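/- **Setting.** All group cohomology $\mathcal H^n(G,A^\chi)$ is that of Borel measurable inhomogeneous cochains (all cochains if $G$ is discrete), with $G$ acting on $A=\mathbb Z$ or $A=\mathrm U(1)=\mathbb R/\mathbb Z$ through a continuous sign character $\chi$. Let $P$ (the point group) be a discrete group with a representation $\rho:P\to O(d)$. Let $\mathbb Z^{\rm or}$ be $\mathbb Z$ twisted by $\det\rho$. For a topological group $G$ with continuous homomorphisms $\pi:G\to P$ and $\sigma:G\to\{\pm1\}$ ($\sigma=-1$ on anti-unitary elements), $\mathrm U(1)$ is twisted by $\sigma$ and $\mathrm U(1)^{\rm or}$ by $\sigma\cdot\det(\rho\circ\pi)$. *Euler class.* $e(P)=e(\rho)\in\mathcal H^d(P,\mathbb Z^{\rm or})$ is the class of the cocycle which counts, with signs, the zeros over the $d$-simplices of $BP$ of a generic piecewise affine section of the bundle $EP\times_P\mathbb R^d$ that is nowhere zero over the $(d-1)$-skeleton. (Sections are taken at the level of chains of affine simplices.) *LSM anomaly.* Take a finite $P$-invariant decomposition of $\mathbb R^d$ into open simplicial cones with tip $0$. Let $C_k(\mathbb R^d,A)$ be its oriented cellular (Borel–Moore)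 chains, and let $H^G_{r}(\mathbb R^d,\mathrm U(1))$ be the homology of $\bigoplus_k\mathcal C^{k-r}(G,C_k(\mathbb R^d,\mathrm U(1)))$ under $D=\partial+(-1)^r\delta$. A projective class $\omega\in\mathcal H^2(G,\mathrm U(1))$ at the origin defines the class $[\omega\cdot[0]]\in H_{-2}^G(\mathbb R^d,\mathrm U(1))$. Its LSM anomaly is the class $y\in\mathcal H^{d+2}(G,\mathrm U(1)^{\rm or})$ with $[y\cdot[\mathbb R^d]]=[\omega\cdot[0]]$. **Statement.** 1. Generic sections exist, their zero counts are cocycles, and all of them represent the same class $e(\rho)$. If $P$ is finite, $P$-invariant cone decompositions exist. 2. For every such decomposition, $y\mapsto y\cdot[\mathbb R^d]$ induces an isomorphism $\mathcal H^{d+2}(G,\mathrm U(1)^{\rm or})\cong H^G_{-2}(\mathbb R^d,\mathrm U(1))$, and the LSM anomaly of $\omega$ is $\pi^*e(P)\cup\omega$. In particular, for $G=G_{\rm int}\times P$ with $\sigma$ and $\alpha\in\mathcal H^2(G_{\rm int},\mathrm U(1))$ coming from $G_{\rm int}$, the LSM anomaly of $\alpha$ at the origin is $$e(P)\cup\alpha\in\mathcal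 H^{d+2}(G_{\rm int}\times P,\mathrm U(1)^{\rm or}).$$ 3. If some $x\neq0$ in $\mathbb R^d$ is fixed by all of $P$, then $e(P)=0$ and $e(P)\cup\alpha=0$ for all $\alpha$. 4. If $d$ is odd, then $2e(P)=0$, hence $2(e(P)\cup\alpha)=e(P)\cup 2\alpha=0$ for all $\alpha$. 5. Let $n\ge1$. Write $d\alpha(g,h)=\alpha(h)-\alpha(gh)+\alpha(g)$ for integer-valued functions $\alpha$. Let $D_n$ be generated by the rotation $R$ of the plane by $2\pi/n$ and a reflection $F$; for $g=R^aF^b$ ($0\le a<n$, $b\in\{0,1\}$) put $\alpha(g)=a$ and $r(g)=b$. For $C_n=\langle R\rangle$ use $\alpha(R^a)=a$. Then * $d=1$: $e(D_1)=r\in\mathcal H^1(D_1,\mathbb Z^r)$, where $D_1=\mathbb Z_2$ acts by $-1$ and $r$ is $1$ on its generator and $0$ on the identity; * $d=2$: $e(C_n)=\frac{d\alpha}{n}$ and $e(D_n)=\frac{d\alpha-2r\cup\alpha}{n}\in\mathcal H^2(D_n,\mathbb Z^r)$; * $d=3$, with $\mathbb R^3$ = plane $\oplus$ axis, where the sign by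 which the group acts on the axis is given in brackets: $p1$: $C_n$ [$+1$], $e=0$; $p11g$: $C_{2n}$ [$(-1)^\alpha$], $e=\bar\alpha\cup\frac{d\alpha}{2n}$; $p11m$: $C_n\times D_1$ with $D_1$ trivial on the plane [$(-1)^r$, $r$ the generator for $D_1$], $e=r\cup\frac{d\alpha}{n}$; $p1m1$: $D_n$ [$+1$], $e=0$; $p211$: $D_n$ [$(-1)^r$], $e=r\cup\frac{d\alpha-2r\cup\alpha}{n}$; $p2mg$: $D_{2n}$ [$(-1)^\alpha$], $e=\bar\alpha\cup\frac{d\alpha-2r\cup\alpha}{2n}$; $p2mm$: $D_1\times D_n$ with $D_1$ trivial on the plane [$(-1)^{\tilde r}$, $\tilde r$ the generator for $D_1$], $e=\tilde r\cup\frac{d\alpha-2r\cup\alpha}{n}$; here $\bar\alpha\in\{0,1\}$ is $\alpha$ mod $2$, the class lies in $\mathcal H^3$ with coefficients $\mathbb Z$ twisted by the determinant of the $3$-dimensional representation, and the outer cup product is the one of twisted coefficients, $(a\cup c)(g_1,g_2,g_3)=a(g_1)\,\epsilon(g_1)\,c(g_2,g_3)$ with $\epsilon$ the determinant on the plane. 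-/

import Mathlib

namespace PointGroupLSM

set_option linter.unusedSectionVars false

noncomputable section

/-! ### Measurable group cohomology with sign-twisted coefficients -/

/-- The coboundary of inhomogeneous cochains, for a `G`-action `act` on the coefficients `M`. -/
def coboundary {G M : Type*} [Mul G] [AddCommGroup M] (act : G → M →+ M) (n : ℕ) :
    ((Fin n → G) → M) →+ ((Fin (n + 1) → G) → M) where
  toFun f := fun g => act (g 0) (f fun i => g i.succ) +
    ∑ j : Fin (n + 1), (-1 : ℤ) ^ ((j : ℕ) + 1) • f (Fin.contractNth j (· * ·) g)
  map_zero' := by funext g; simp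
  map_add' f f' := by
    funext g
    simp only [Pi.add_apply, map_add, smul_add, Finset.sum_add_distrib]
    abel

section

variable {G : Type*} [Group G] [TopologicalSpace G]

/-- The action of `G` on an abelian group `A` through a sign character `χ`. -/
def twist (A : Type*) [AddCommGroup A] (χ : G →ₜ* ℤˣ) : G → A →+ A :=
  fun g => smulAddHom ℤ A ((χ g : ℤˣ) : ℤ)

variable (A : Type*) [AddCommGroup A] [TopologicalSpace A] [IsTopologicalAddGroup A]
  [SecondCountableTopology A]

/-- Borel measurable `n`-cochains of `G` with values in `A`
(all cochains, when `G` is discrete). -/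
def measurableCochains (G : Type*) [TopologicalSpace G] (A : Type*) [AddCommGroup A]
    [TopologicalSpace A] [IsTopologicalAddGroup A] [SecondCountableTopology A] (n : ℕ) :
    AddSubgroup ((Fin n → G) → A) where
  carrier := {f | @Measurable _ _ (borel _) (borel _) f}
  zero_mem' := @measurable_const _ _ (borel _) (borel _) 0
  add_mem' {f f'} hf hf' := by
    let _ : MeasurableSpace A := borel A
    have _ : BorelSpace A := ⟨rfl⟩
    let _ : MeasurableSpace (Fin n → G) := borel _
    exact Measurable.add hf hf'
  neg_mem' {f} hf := by
    let _ : MeasurableSpace A := borel A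
    have _ : BorelSpace A := ⟨rfl⟩
    let _ : MeasurableSpace (Fin n → G) := borel _
    exact Measurable.neg hf

/-- Measurable `n`-cocycles of `G` with values in `A`, twisted by `χ`. -/
def cocycles (χ : G →ₜ* ℤˣ) (n : ℕ) : AddSubgroup ((Fin n → G) → A) :=
  measurableCochains G A n ⊓ (coboundary (twist A χ) n).ker

/-- Coboundaries of measurable cochains. -/
def coboundaries (χ : G →ₜ* ℤˣ) : (n : ℕ) → AddSubgroup ((Fin n → G) → A)
  | 0 => ⊥
  | n + 1 => (measurableCochains G A n).map (coboundary (twist A χ) n)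

/-- The group cohomology `ℋⁿ(G, A^χ)` of measurable cochains, where `g : G` acts on the
coefficients `A` by the sign `χ g`. -/
abbrev Cohomology (χ : G →ₜ* ℤˣ) (n : ℕ) : Type _ :=
  cocycles A χ n ⧸ (coboundaries A χ n).addSubgroupOf (cocycles A χ n)

variable {A}

/-- The class `x` is represented by the cochain `f` (in particular `f` is a cocycle). -/
def Represents {χ : G →ₜ* ℤˣ} {n : ℕ} (x : Cohomology A χ n) (f : (Fin n → G) → A) : Prop :=
  ∃ h : f ∈ cocycles A χ n, x = QuotientAddGroup.mk ⟨f, h⟩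

/-- The cup product of an integral cochain with an `A^ψ`-valued cochain. -/
def cupCochain (ψ : G →ₜ* ℤˣ) {p q : ℕ} (a : (Fin p → G) → ℤ) (b : (Fin q → G) → A) :
    (Fin (p + q) → G) → A := fun g =>
  a (fun i => g (Fin.castAdd q i)) •
    ((∏ i : Fin p, ψ (g (Fin.castAdd q i)) : ℤˣ) : ℤ) • b (fun j => g (Fin.natAdd p j))

theorem cupCochain_measurable (ψ : G →ₜ* ℤˣ) {p q : ℕ} {a : (Fin p → G) → ℤ}
    {b : (Fin q → G) → A} (ha : a ∈ measurableCochains G ℤ p)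
    (hb : b ∈ measurableCochains G A q) :
    cupCochain ψ a b ∈ measurableCochains G A (p + q) := by
  let _ : MeasurableSpace A := borel A
  have _ : BorelSpace A := ⟨rfl⟩
  let _ : MeasurableSpace (Fin p → G) := borel _
  have _ : BorelSpace (Fin p → G) := ⟨rfl⟩
  let _ : MeasurableSpace (Fin q → G) := borel _
  have _ : BorelSpace (Fin q → G) := ⟨rfl⟩
  let _ : MeasurableSpace (Fin (p + q) → G) := borel _
  have _ : BorelSpace (Fin (p + q) → G) := ⟨rfl⟩
  have ha' : Measurable a := by
    have h : @Measurable _ _ (borel _) (borel ℤ) a := ha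
    rwa [(borel_eq_top_of_discrete : borel ℤ = ⊤)] at h
  have hb' : Measurable b := hb
  have h1 : Measurable fun g : Fin (p + q) → G => a fun i => g (Fin.castAdd q i) :=
    ha'.comp (by fun_prop : Continuous fun (g : Fin (p + q) → G) (i : Fin p) =>
      g (Fin.castAdd q i)).measurable
  have h2 : Measurable fun g : Fin (p + q) → G => b fun j => g (Fin.natAdd p j) :=
    hb'.comp (by fun_prop : Continuous fun (g : Fin (p + q) → G) (j : Fin q) =>
      g (Fin.natAdd p j)).measurable
  have h3 : Measurable fun g : Fin (p + q) → G =>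
      ((∏ i : Fin p, ψ (g (Fin.castAdd q i)) : ℤˣ) : ℤ) := by
    refine Continuous.measurable (Units.continuous_val.comp ?_)
    exact continuous_finsetProd _ fun i _ => (map_continuous ψ).comp (continuous_apply _)
  exact h1.smul (h3.smul h2)

/-- The Leibniz rule for the cup product. -/
theorem coboundary_cupCochain (χ ψ : G →ₜ* ℤˣ) {p q : ℕ} (a : (Fin p → G) → ℤ)
    (b : (Fin q → G) → A) (g : Fin (p + q + 1) → G) :
    coboundary (twist A (χ * ψ)) (p + q) (cupCochain ψ a b) g =
      cupCochain ψ (coboundary (twist ℤ χ) p a) b (g ∘ Fin.cast (by omega)) +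
      (-1 : ℤ) ^ p • cupCochain ψ a (coboundary (twist A ψ) q b) g := by
  have hc1 : ∀ j : Fin p, (fun i : Fin p =>
      Fin.contractNth (Fin.castAdd (q + 1) j : Fin (p + (q + 1))) (· * ·) g (Fin.castAdd q i)) =
      Fin.contractNth j.castSucc (· * ·)
        (fun i : Fin (p + 1) => (g ∘ Fin.cast (by omega)) (Fin.castAdd q i)) := by
    intro j
    funext i
    rcases lt_trichotomy (i : ℕ) j with h | h | h
    · rw [Fin.contractNth_apply_of_lt _ _ _ _ (by simpa using h),
        Fin.contractNth_apply_of_lt _ _ _ _ (by simpa using h)]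
      rfl
    · rw [Fin.contractNth_apply_of_eq _ _ _ _ (by simpa using h),
        Fin.contractNth_apply_of_eq _ _ _ _ (by simpa using h)]
      rfl
    · rw [Fin.contractNth_apply_of_gt _ _ _ _ (by simpa using h),
        Fin.contractNth_apply_of_gt _ _ _ _ (by simpa using h)]
      rfl
  have hc2 : ∀ j : Fin p, (fun i : Fin q =>
      Fin.contractNth (Fin.castAdd (q + 1) j : Fin (p + (q + 1))) (· * ·) g (Fin.natAdd p i)) =
      fun i => g (Fin.natAdd p i).succ := by
    intro j
    funext i
    rw [Fin.contractNth_apply_of_gt _ _ _ _ (by simp; omega)]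
  have hc3 : ∀ j : Fin (q + 1), (fun i : Fin p =>
      Fin.contractNth (Fin.natAdd p j : Fin (p + (q + 1))) (· * ·) g (Fin.castAdd q i)) =
      fun i => g (Fin.castAdd q i).castSucc := by
    intro j
    funext i
    rw [Fin.contractNth_apply_of_lt _ _ _ _ (by simp; omega)]
  have hc4 : ∀ j : Fin (q + 1), (fun i : Fin q =>
      Fin.contractNth (Fin.natAdd p j : Fin (p + (q + 1))) (· * ·) g (Fin.natAdd p i)) =
      Fin.contractNth j (· * ·) (fun i : Fin (q + 1) => g (Fin.natAdd p i)) := by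
    intro j
    funext i
    rcases lt_trichotomy (i : ℕ) j with h | h | h
    · rw [Fin.contractNth_apply_of_lt _ _ _ _ (by simpa using h),
        Fin.contractNth_apply_of_lt _ _ _ _ (by simpa using h)]
      rfl
    · rw [Fin.contractNth_apply_of_eq _ _ _ _ (by simpa using h),
        Fin.contractNth_apply_of_eq _ _ _ _ (by simpa using h)]
      rfl
    · rw [Fin.contractNth_apply_of_gt _ _ _ _ (by simpa using h),
        Fin.contractNth_apply_of_gt _ _ _ _ (by simpa using h)]
      rfl
  have hp : ∀ j : Fin p, (∏ i : Fin p, ψ (Fin.contractNth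
      (Fin.castAdd (q + 1) j : Fin (p + (q + 1))) (· * ·) g (Fin.castAdd q i))) =
      ∏ i : Fin (p + 1), ψ ((g ∘ Fin.cast (by omega)) (Fin.castAdd q i)) := by
    intro j
    have key : ∀ (n : ℕ) (k : Fin n) (u : Fin (n + 1) → G),
        (∏ i : Fin n, ψ (Fin.contractNth k.castSucc (· * ·) u i)) = ∏ i, ψ (u i) := by
      intro n
      induction n with
      | zero => intro k; exact k.elim0
      | succ n ih =>
        intro k u
        rw [Fin.prod_univ_succ (n := n + 1)]
        refine Fin.cases ?_ (fun k => ?_) k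
        · rw [Fin.prod_univ_succ, Fin.contractNth_apply_of_eq _ _ _ _ (by simp),
            Fin.prod_univ_succ (n := n), map_mul, mul_assoc]
          congr 1
        · rw [Fin.prod_univ_succ, Fin.contractNth_apply_of_lt _ _ _ _ (by simp),
            ← ih k fun i => u i.succ]
          congr 1
          refine Finset.prod_congr rfl fun i _ => congrArg ψ ?_
          simp only [Fin.contractNth, Fin.val_succ, Fin.val_castSucc]
          simp
    rw [← key p j]
    exact Finset.prod_congr rfl fun i _ => congrArg ψ (congrFun (hc1 j) i)
  have hlast : Fin.contractNth (Fin.last p) (· * ·)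
      (fun i : Fin (p + 1) => (g ∘ Fin.cast (by omega)) (Fin.castAdd q i)) =
      fun i => g (Fin.castAdd q i).castSucc := by
    funext i
    rw [Fin.contractNth_apply_of_lt _ _ _ _ (by simp)]
    rfl
  have hP0 : (∏ i : Fin (p + 1), ψ ((g ∘ Fin.cast (by omega)) (Fin.castAdd q i))) =
      ψ (g 0) * ∏ i : Fin p, ψ (g (Fin.castAdd q i).succ) := by
    rw [Fin.prod_univ_succ]
    rfl
  have hP1 : (∏ i : Fin (p + 1), ψ ((g ∘ Fin.cast (by omega)) (Fin.castAdd q i))) =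
      (∏ i : Fin p, ψ (g (Fin.castAdd q i).castSucc)) * ψ (g (Fin.natAdd p (0 : Fin (q + 1)))) := by
    rw [Fin.prod_univ_castSucc]
    rfl
  have e1 : coboundary (twist A (χ * ψ)) (p + q) (cupCochain ψ a b) g =
      (((χ (g 0) : ℤˣ) : ℤ) * ((ψ (g 0) : ℤˣ) : ℤ)) • cupCochain ψ a b (fun i => g i.succ) +
      (∑ j : Fin p, (-1 : ℤ) ^ ((j : ℕ) + 1) • cupCochain ψ a b
        (Fin.contractNth (Fin.castAdd (q + 1) j : Fin (p + (q + 1))) (· * ·) g) +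
      ∑ j : Fin (q + 1), (-1 : ℤ) ^ (p + (j : ℕ) + 1) • cupCochain ψ a b
        (Fin.contractNth (Fin.natAdd p j : Fin (p + (q + 1))) (· * ·) g)) := by
    have := Fin.sum_univ_add (a := p) (b := q + 1) (fun j : Fin (p + (q + 1)) =>
      (-1 : ℤ) ^ ((j : ℕ) + 1) • cupCochain ψ a b (Fin.contractNth j (· * ·) g))
    simp only [Fin.val_castAdd, Fin.val_natAdd] at this
    rw [← this]
    simp only [coboundary, twist, AddMonoidHom.coe_mk, ZeroHom.coe_mk, smulAddHom_apply,
      ContinuousMonoidHom.mul_apply, Units.val_mul]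
    rfl
  have hb : (fun j : Fin q => (g ∘ Fin.cast (by omega) : Fin (p + 1 + q) → G)
      (Fin.natAdd (p + 1) j)) = fun j => g (Fin.natAdd p j).succ := by
    funext j
    refine congrArg g (Fin.ext ?_)
    simp
    omega
  have e2 : cupCochain ψ (coboundary (twist ℤ χ) p a) b (g ∘ Fin.cast (by omega)) =
      (((χ (g 0) : ℤˣ) : ℤ) * a (fun i => g (Fin.castAdd q i).succ) +
        (∑ j : Fin p, (-1 : ℤ) ^ ((j : ℕ) + 1) * a (Fin.contractNth j.castSucc (· * ·)
          (fun i : Fin (p + 1) => (g ∘ Fin.cast (by omega)) (Fin.castAdd q i))) +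
          (-1 : ℤ) ^ (p + 1) * a (fun i => g (Fin.castAdd q i).castSucc))) •
      ((∏ i : Fin (p + 1), ψ ((g ∘ Fin.cast (by omega)) (Fin.castAdd q i)) : ℤˣ) : ℤ) •
        b (fun j => g (Fin.natAdd p j).succ) := by
    rw [← hb, ← hlast]
    simp only [cupCochain, coboundary, twist, AddMonoidHom.coe_mk, ZeroHom.coe_mk,
      smulAddHom_apply, Fin.sum_univ_castSucc, Fin.val_castSucc, Fin.val_last, smul_eq_mul]
    rfl
  have e3 : cupCochain ψ a (coboundary (twist A ψ) q b) g =
      a (fun i => g (Fin.castAdd q i).castSucc) •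
      ((∏ i : Fin p, ψ (g (Fin.castAdd q i).castSucc) : ℤˣ) : ℤ) •
      (((ψ (g (Fin.natAdd p (0 : Fin (q + 1)))) : ℤˣ) : ℤ) • b (fun j => g (Fin.natAdd p j).succ) +
        ∑ j : Fin (q + 1), (-1 : ℤ) ^ ((j : ℕ) + 1) •
          b (Fin.contractNth j (· * ·) (fun i : Fin (q + 1) => g (Fin.natAdd p i)))) := rfl
  have f1 : ∀ j : Fin p, cupCochain ψ a b
        (Fin.contractNth (Fin.castAdd (q + 1) j : Fin (p + (q + 1))) (· * ·) g) =
      a (Fin.contractNth j.castSucc (· * ·)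
          (fun i : Fin (p + 1) => (g ∘ Fin.cast (by omega)) (Fin.castAdd q i))) •
      ((∏ i : Fin (p + 1), ψ ((g ∘ Fin.cast (by omega)) (Fin.castAdd q i)) : ℤˣ) : ℤ) •
        b (fun j => g (Fin.natAdd p j).succ) := by
    intro j
    rw [← hp j, ← hc1 j, ← hc2 j]
    rfl
  have f2 : ∀ j : Fin (q + 1), cupCochain ψ a b
        (Fin.contractNth (Fin.natAdd p j : Fin (p + (q + 1))) (· * ·) g) =
      a (fun i => g (Fin.castAdd q i).castSucc) •
      ((∏ i : Fin p, ψ (g (Fin.castAdd q i).castSucc) : ℤˣ) : ℤ) •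
        b (Fin.contractNth j (· * ·) (fun i : Fin (q + 1) => g (Fin.natAdd p i))) := by
    intro j
    rw [← hc4 j, ← hc3 j]
    simp only [cupCochain]
    congr 4
    funext i
    exact congrArg ψ (congrFun (hc3 j) i)
  have f0 : cupCochain ψ a b (fun i => g i.succ) = a (fun i => g (Fin.castAdd q i).succ) •
      ((∏ i : Fin p, ψ (g (Fin.castAdd q i).succ) : ℤˣ) : ℤ) •
        b (fun j => g (Fin.natAdd p j).succ) := rfl
  rw [e1, e2, e3, f0]
  simp only [f1, f2]
  generalize b (fun j => g (Fin.natAdd p j).succ) = b₀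
  generalize hu : a (fun i => g (Fin.castAdd q i).castSucc) = u
  have k1 : ((∏ i : Fin (p + 1), ψ ((g ∘ Fin.cast (by omega)) (Fin.castAdd q i)) : ℤˣ) : ℤ) =
      ((ψ (g 0) : ℤˣ) : ℤ) * ((∏ i : Fin p, ψ (g (Fin.castAdd q i).succ) : ℤˣ) : ℤ) := by
    rw [hP0, Units.val_mul]
  have k2 : ((∏ i : Fin (p + 1), ψ ((g ∘ Fin.cast (by omega)) (Fin.castAdd q i)) : ℤˣ) : ℤ) =
      ((∏ i : Fin p, ψ (g (Fin.castAdd q i).castSucc) : ℤˣ) : ℤ) *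
        ((ψ (g (Fin.natAdd p (0 : Fin (q + 1)))) : ℤˣ) : ℤ) := by
    rw [hP1, Units.val_mul]
  generalize ((∏ i : Fin (p + 1), ψ ((g ∘ Fin.cast (by omega)) (Fin.castAdd q i)) : ℤˣ) : ℤ) =
    P at k1 k2 ⊢
  generalize ((∏ i : Fin p, ψ (g (Fin.castAdd q i).succ) : ℤˣ) : ℤ) = Q at k1 ⊢
  generalize ((∏ i : Fin p, ψ (g (Fin.castAdd q i).castSucc) : ℤˣ) : ℤ) = R at k2 ⊢
  generalize ((ψ (g (Fin.natAdd p (0 : Fin (q + 1)))) : ℤˣ) : ℤ) = S at k2 ⊢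
  have k3 : ((-1 : ℤ) ^ p • u • R • (S • b₀ + ∑ j : Fin (q + 1), (-1 : ℤ) ^ ((j : ℕ) + 1) •
          b (Fin.contractNth j (· * ·) (fun i : Fin (q + 1) => g (Fin.natAdd p i))))) =
      ((-1 : ℤ) ^ p * u * P) • b₀ + ∑ j : Fin (q + 1), (-1 : ℤ) ^ (p + (j : ℕ) + 1) • u • R •
          b (Fin.contractNth j (· * ·) (fun i : Fin (q + 1) => g (Fin.natAdd p i))) := by
    simp only [smul_add, Finset.smul_sum, smul_smul, k2]
    congr 1
    · congr 1
      ring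
    · refine Finset.sum_congr rfl fun j _ => ?_
      congr 1
      ring
  rw [k3, add_smul, add_smul, Finset.sum_smul]
  simp only [smul_smul]
  have k4 : ((-1 : ℤ) ^ (p + 1) * u * P) • b₀ = -(((-1 : ℤ) ^ p * u * P) • b₀) := by
    rw [← neg_smul]
    congr 1
    ring
  have k5 : (((χ (g 0) : ℤˣ) : ℤ) * ((ψ (g 0) : ℤˣ) : ℤ) *
      (a (fun i => g (Fin.castAdd q i).succ) * Q)) • b₀ =
      (((χ (g 0) : ℤˣ) : ℤ) * a (fun i => g (Fin.castAdd q i).succ) * P) • b₀ := by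
    rw [k1]
    congr 1
    ring
  rw [k5, k4]
  simp only [mul_assoc]
  abel

theorem cupCochain_sub_left (ψ : G →ₜ* ℤˣ) {p q : ℕ} (a a' : (Fin p → G) → ℤ)
    (b : (Fin q → G) → A) :
    cupCochain ψ (a - a') b = cupCochain ψ a b - cupCochain ψ a' b := by
  funext g
  simp [cupCochain, sub_smul]

theorem cupCochain_sub_right (ψ : G →ₜ* ℤˣ) {p q : ℕ} (a : (Fin p → G) → ℤ)
    (b b' : (Fin q → G) → A) :
    cupCochain ψ a (b - b') = cupCochain ψ a b - cupCochain ψ a b' := by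
  funext g
  simp [cupCochain, smul_sub]

theorem cupCochain_zero_left (ψ : G →ₜ* ℤˣ) {p q : ℕ} (b : (Fin q → G) → A) :
    cupCochain ψ (0 : (Fin p → G) → ℤ) b = 0 := by
  funext g
  simp [cupCochain]

theorem cupCochain_zero_right (ψ : G →ₜ* ℤˣ) {p q : ℕ} (a : (Fin p → G) → ℤ) :
    cupCochain ψ a (0 : (Fin q → G) → A) = 0 := by
  funext g
  simp [cupCochain]

theorem cupCochain_mem_cocycles (χ ψ : G →ₜ* ℤˣ) {p q : ℕ} {a : (Fin p → G) → ℤ}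
    {b : (Fin q → G) → A} (ha : a ∈ cocycles ℤ χ p) (hb : b ∈ cocycles A ψ q) :
    cupCochain ψ a b ∈ cocycles A (χ * ψ) (p + q) := by
  refine ⟨cupCochain_measurable ψ ha.1 hb.1, ?_⟩
  have ha2 : coboundary (twist ℤ χ) p a = 0 := ha.2
  have hb2 : coboundary (twist A ψ) q b = 0 := hb.2
  change coboundary (twist A (χ * ψ)) (p + q) (cupCochain ψ a b) = 0
  funext g
  rw [coboundary_cupCochain, ha2, hb2, cupCochain_zero_left, cupCochain_zero_right]
  simp

theorem coboundaries_cast (χ : G →ₜ* ℤˣ) {m n : ℕ} (h : m = n) (f : (Fin m → G) → A)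
    (hf : f ∈ coboundaries A χ m) :
    (fun g : Fin n → G => f (g ∘ Fin.cast h)) ∈ coboundaries A χ n := by
  subst h
  exact hf

theorem cupCochain_mem_left (χ ψ : G →ₜ* ℤˣ) {p q : ℕ} {a : (Fin p → G) → ℤ}
    {b : (Fin q → G) → A} (ha : a ∈ coboundaries ℤ χ p) (hb : b ∈ cocycles A ψ q) :
    cupCochain ψ a b ∈ coboundaries A (χ * ψ) (p + q) := by
  cases p with
  | zero =>
    have h : a = 0 := ha
    rw [h, cupCochain_zero_left]
    exact zero_mem _
  | succ p =>
    obtain ⟨c, hc, rfl⟩ := ha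
    have hb2 : coboundary (twist A ψ) q b = 0 := hb.2
    have h : coboundary (twist A (χ * ψ)) (p + q) (cupCochain ψ c b) ∈
        coboundaries A (χ * ψ) (p + q + 1) := ⟨_, cupCochain_measurable ψ hc hb.1, rfl⟩
    have h' := coboundaries_cast (χ * ψ) (by omega : p + q + 1 = p + 1 + q) _ h
    convert h' using 1
    funext g
    rw [coboundary_cupCochain, hb2, cupCochain_zero_right]
    simp only [Pi.zero_apply, smul_zero, add_zero]
    rfl

theorem cupCochain_mem_right (χ ψ : G →ₜ* ℤˣ) {p q : ℕ} {a : (Fin p → G) → ℤ}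
    {b : (Fin q → G) → A} (ha : a ∈ cocycles ℤ χ p) (hb : b ∈ coboundaries A ψ q) :
    cupCochain ψ a b ∈ coboundaries A (χ * ψ) (p + q) := by
  cases q with
  | zero =>
    have h : b = 0 := hb
    rw [h, cupCochain_zero_right]
    exact zero_mem _
  | succ q =>
    obtain ⟨c, hc, rfl⟩ := hb
    have ha2 : coboundary (twist ℤ χ) p a = 0 := ha.2
    refine ⟨(-1 : ℤ) ^ p • cupCochain ψ a c,
      AddSubgroup.zsmul_mem _ (cupCochain_measurable ψ ha.1 hc) _, ?_⟩
    funext g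
    have h := coboundary_cupCochain χ ψ a c g
    rw [ha2, cupCochain_zero_left, Pi.zero_apply, zero_add] at h
    rw [map_zsmul]
    refine (congrArg ((-1 : ℤ) ^ p • ·) h).trans ?_
    simp only [smul_smul, ← pow_add, Even.neg_one_pow ⟨p, rfl⟩, one_smul]

/-- The cup product `ℋᵖ(G, ℤ^χ) × ℋ^q(G, A^ψ) → ℋ^{p+q}(G, A^{χψ})`. -/
def cup {χ ψ : G →ₜ* ℤˣ} {p q : ℕ} (x : Cohomology ℤ χ p) (y : Cohomology A ψ q) :
    Cohomology A (χ * ψ) (p + q) :=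
  Quotient.liftOn₂' x y
    (fun a b => QuotientAddGroup.mk
      ⟨cupCochain ψ a.1 b.1, cupCochain_mem_cocycles χ ψ a.2 b.2⟩) <| by
    intro a b a' b' ha hb
    rw [QuotientAddGroup.leftRel_apply, AddSubgroup.mem_addSubgroupOf] at ha hb
    refine QuotientAddGroup.eq.2 ?_
    rw [AddSubgroup.mem_addSubgroupOf]
    have h1 := cupCochain_mem_left χ ψ ha b.2
    have h2 := cupCochain_mem_right χ ψ a'.2 hb
    have h3 : cupCochain ψ (-a.1 + a'.1) b.1 + cupCochain ψ a'.1 (-b.1 + b'.1) ∈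
        coboundaries A (χ * ψ) (p + q) := add_mem h1 h2
    have e : -cupCochain ψ a.1 b.1 + cupCochain ψ a'.1 b'.1 =
        cupCochain ψ (-a.1 + a'.1) b.1 + cupCochain ψ a'.1 (-b.1 + b'.1) := by
      simp only [neg_add_eq_sub, cupCochain_sub_left, cupCochain_sub_right]
      abel
    rw [← e] at h3
    exact h3

theorem coboundary_pullback {K : Type*} [Group K] [TopologicalSpace K] (φ : K →ₜ* G)
    (χ : G →ₜ* ℤˣ) (n : ℕ) (f : (Fin n → G) → A) :
    coboundary (twist A (χ.comp φ)) n (fun g => f (φ ∘ g)) =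
      fun g => coboundary (twist A χ) n f (φ ∘ g) := by
  funext g
  simp only [coboundary, twist, AddMonoidHom.coe_mk, ZeroHom.coe_mk, Function.comp_apply,
    ContinuousMonoidHom.comp_toFun]
  congr 1
  refine Finset.sum_congr rfl fun j _ => ?_
  rw [Fin.comp_contractNth (· * ·) (· * ·) (fun a b => map_mul φ a b) j g]

theorem measurable_pullback {K : Type*} [Group K] [TopologicalSpace K] (φ : K →ₜ* G) {n : ℕ}
    {f : (Fin n → G) → A} (hf : f ∈ measurableCochains G A n) :
    (fun g : Fin n → K => f (φ ∘ g)) ∈ measurableCochains K A n := by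
  let _ : MeasurableSpace A := borel A
  let _ : MeasurableSpace (Fin n → G) := borel _
  have _ : BorelSpace (Fin n → G) := ⟨rfl⟩
  let _ : MeasurableSpace (Fin n → K) := borel _
  have _ : BorelSpace (Fin n → K) := ⟨rfl⟩
  have h : Measurable f := hf
  refine h.comp (Continuous.measurable (continuous_pi fun i => ?_))
  exact (map_continuous φ).comp (continuous_apply i)

/-- Pullback of cohomology classes along a continuous homomorphism. -/
def pullback {K : Type*} [Group K] [TopologicalSpace K] (φ : K →ₜ* G) {χ : G →ₜ* ℤˣ} {n : ℕ} :
    Cohomology A χ n →+ Cohomology A (χ.comp φ) n :=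
  QuotientAddGroup.map _ _
    { toFun := fun f => ⟨fun g => f.1 (φ ∘ g), measurable_pullback φ f.2.1, by
        have h : coboundary (twist A χ) n f.1 = 0 := f.2.2
        change coboundary (twist A (χ.comp φ)) n (fun g => f.1 (φ ∘ g)) = 0
        rw [coboundary_pullback, h]
        rfl⟩
      map_zero' := rfl
      map_add' := fun _ _ => rfl } <| by
    intro f hf
    rw [AddSubgroup.mem_comap, AddSubgroup.mem_addSubgroupOf]
    rw [AddSubgroup.mem_addSubgroupOf] at hf
    change (fun g => f.1 (φ ∘ g)) ∈ coboundaries A (χ.comp φ) n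
    generalize f.1 = f at hf
    cases n with
    | zero =>
      have h : f = 0 := hf
      rw [h]
      exact zero_mem _
    | succ n =>
      obtain ⟨c, hc, rfl⟩ := hf
      exact ⟨_, measurable_pullback φ hc, coboundary_pullback φ χ n c⟩

end

/-- `U(1) = ℝ/ℤ`, written additively. -/
abbrev U1 : Type := UnitAddCircle

/-! ### Linear representations and orientation characters -/

/-- The space `ℝ^d`. -/
abbrev Vec (d : ℕ) : Type := Fin d → ℝ

/-- The orthogonal group `O(d)`. -/
abbrev O (d : ℕ) : Type := Matrix.orthogonalGroup (Fin d) ℝ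

theorem det_cases {d : ℕ} (M : O d) : M.1.det = 1 ∨ M.1.det = -1 := by
  have h := (Matrix.mem_orthogonalGroup_iff (Fin d) ℝ).1 M.2
  have h' := congrArg Matrix.det h
  rw [Matrix.det_mul, Matrix.det_transpose, Matrix.det_one] at h'
  exact mul_self_eq_one_iff.1 h'

open Matrix in
/-- The orientation character `g ↦ det ρ(g) ∈ {1, -1}` of a representation `ρ : P → O(d)` of a
discrete group. `Cohomology ℤ (orientation ρ) n` is `ℋⁿ(P, ℤ^or)`. -/
def orientation {d : ℕ} {P : Type*} [Group P] [TopologicalSpace P] [DiscreteTopology P]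
    (ρ : P →* O d) : P →ₜ* ℤˣ where
  toFun g := if 0 < (ρ g).1.det then 1 else -1
  map_one' := by simp
  map_mul' g h := by
    rw [map_mul, Submonoid.coe_mul, Matrix.det_mul]
    rcases det_cases (ρ g) with hg | hg <;> rcases det_cases (ρ h) with hh | hh <;>
      rw [hg, hh] <;> norm_num
  continuous_toFun := continuous_of_discreteTopology

/-! ### The Euler class, as the obstruction to a nowhere vanishing section

A representation `ρ : P → O(d)` defines a vector bundle over `BP`; a section of it is a
`P`-equivariant map `EP → ℝ^d`, where the `k`-simplices of `EP` are the tuples `(g₀, …, g_k)` of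
elements of `P`. We use piecewise affine sections and record on each simplex of `EP` the chain of
oriented affine simplices of `ℝ^d` which it is mapped to. A `q`-tuple of vectors stands for the
affine simplex with these `q` vertices. -/

/-- Integral chains of affine simplices with `q` vertices in `ℝ^d`. -/
abbrev AffineChain (d q : ℕ) : Type := (Fin q → Vec d) →₀ ℤ

/-- The simplicial boundary `[v₀, …, v_q] ↦ ∑ᵢ (-1)ⁱ [v₀, …, v̂ᵢ, …, v_q]`
(with `[v₀] ↦ []`, the augmentation). -/
def affineBoundary {d q : ℕ} (c : AffineChain d (q + 1)) : AffineChain d q :=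
  c.sum fun v n => ∑ i : Fin (q + 1), Finsupp.single (fun j => v (i.succAbove j))
    ((-1 : ℤ) ^ (i : ℕ) * n)

/-- An affine simplex in `ℝ^d` is generic if its faces of dimension less than `d` avoid the
origin. -/
def IsGeneric {d q : ℕ} (v : Fin q → Vec d) : Prop :=
  ∀ s : Finset (Fin q), s.card ≤ d → (0 : Vec d) ∉ convexHull ℝ (v '' (s : Set (Fin q)))

open Classical Matrix in
/-- The number of zeros of an affine `d`-simplex in `ℝ^d`, counted with the sign of the
determinant of its linear part. -/
def zeroSign {d : ℕ} (v : Fin (d + 1) → Vec d) : ℤ :=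
  if (0 : Vec d) ∈ convexHull ℝ (Set.range v) then
    ((SignType.sign (Matrix.of fun i : Fin d => v i.succ - v 0).det : SignType) : ℤ) else 0

section

variable {d : ℕ} {P : Type*} [Group P]

open Matrix in
/-- A generic piecewise affine section over the `d`-skeleton: the simplex `(g₀, …, g_{q-1})` of
`EP` is sent to the chain `chain q ![g₀, …, g_{q-1}]` with simplices of dimension `q - 1`;
it is nowhere zero over the `(d-1)`-skeleton, and over the `d`-simplices all zeros are in the
interior of affine `d`-simplices. -/
structure GenericSection (ρ : P →* O d) where
  chain : (q : ℕ) → (Fin q → P) → AffineChain d q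
  generic : ∀ q ≤ d + 1, ∀ g : Fin q → P, ∀ v ∈ (chain q g).support, IsGeneric v
  equivariant : ∀ q ≤ d + 1, ∀ (h : P) (g : Fin q → P),
    chain q (fun i => h * g i) = (chain q g).mapDomain fun v i => (ρ h).1 *ᵥ v i
  chain_zero : ∀ g : Fin 0 → P, chain 0 g = Finsupp.single Fin.elim0 1
  boundary : ∀ q ≤ d, ∀ g : Fin (q + 1) → P, affineBoundary (chain (q + 1) g) =
    ∑ i : Fin (q + 1), (-1 : ℤ) ^ (i : ℕ) • chain q fun j => g (i.succAbove j)

/-- The signed number of zeros of a section over the `d`-simplex `[g₁, …, g_d]` of `BP`, which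
lifts to the simplex `(1, g₁, g₁g₂, …)` of `EP`. -/
def GenericSection.zeroCount {ρ : P →* O d} (S : GenericSection ρ) : (Fin d → P) → ℤ :=
  fun g => (S.chain (d + 1) (Fin.partialProd g)).sum fun v n => n * zeroSign v

open Classical in
/-- The Euler class `e(ρ) ∈ ℋ^d(P, ℤ^or)`: the class of the zero count of a generic section.
(The fallback value `0` is never used: generic sections exist, their zero counts are cocycles
and have the same class.) -/
def eulerClass [TopologicalSpace P] [DiscreteTopology P] (ρ : P →* O d) :
    Cohomology ℤ (orientation ρ) d :=
  if h : ∃ S : GenericSection ρ, S.zeroCount ∈ cocycles ℤ (orientation ρ) d then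
    QuotientAddGroup.mk ⟨h.choose.zeroCount, h.choose_spec⟩ else 0

end

/-! ### Cell decompositions of `ℝ^d` into open cones, and equivariant homology -/

/-- The open simplicial cone spanned by `s` (for `s = ∅` it is the origin). -/
def openCone {d : ℕ} (s : Finset (Vec d)) : Set (Vec d) :=
  {x | ∃ c : Vec d → ℝ, (∀ v ∈ s, 0 < c v) ∧ x = ∑ v ∈ s, c v • v}

/-- A finite cell decomposition of `ℝ^d` into open simplicial cones with their tip at the origin.
A cone is given by the finite set of its ray generators. -/
structure ConeComplex (d : ℕ) where
  cones : Finset (Finset (Vec d))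
  face_mem : ∀ s ∈ cones, ∀ t ⊆ s, t ∈ cones
  linearIndepOn : ∀ s ∈ cones, LinearIndepOn ℝ id (s : Set (Vec d))
  existsUnique_mem : ∀ x : Vec d, ∃! s, s ∈ cones ∧ x ∈ openCone s

namespace ConeComplex

variable {d : ℕ} (F : ConeComplex d)

open Matrix Classical in
/-- The cell decomposition is invariant under the action of `P` on `ℝ^d`. -/
def Invariant {P : Type*} [Group P] (ρ : P →* O d) : Prop :=
  ∀ (g : P), ∀ s ∈ F.cones, s.image (fun v => (ρ g).1 *ᵥ v) ∈ F.cones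

open Classical in
/-- The ray generators. -/
def rays : Finset (Vec d) := F.cones.biUnion id

variable (A : Type*) [AddCommGroup A]

open Classical in
/-- The group `C_q(ℝ^d, A)` of (Borel–Moore) cellular `q`-chains: `c w` is the coefficient of the
open cone spanned by `w₀, …, w_{q-1}`, oriented by this basis of its linear span. -/
def chains (q : ℕ) : AddSubgroup ((Fin q → Vec d) → A) where
  carrier := {c | (∀ w, c w ≠ 0 → Function.Injective w ∧ Finset.univ.image w ∈ F.cones) ∧
    ∀ (e : Equiv.Perm (Fin q)) (w), c (w ∘ e) = ((Equiv.Perm.sign e : ℤˣ) : ℤ) • c w}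
  zero_mem' := ⟨fun w h => absurd rfl h, fun e w => by simp⟩
  add_mem' {c c'} hc hc' := by
    refine ⟨fun w h => ?_, fun e w => ?_⟩
    · by_cases h0 : c w = 0
      · refine hc'.1 w fun h1 => h ?_
        rw [Pi.add_apply, h0, h1, add_zero]
      · exact hc.1 w h0
    · rw [Pi.add_apply, Pi.add_apply, hc.2, hc'.2, smul_add]
  neg_mem' {c} hc := by
    refine ⟨fun w h => hc.1 w fun h0 => h ?_, fun e w => ?_⟩
    · rw [Pi.neg_apply, h0, neg_zero]
    · rw [Pi.neg_apply, Pi.neg_apply, hc.2, smul_neg]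

/-- The cellular boundary operator. The cone `w` lies in the boundary of the cone `(x, w)`; as `-x`
points out of the latter, the orientation of `w` induced by `(x, w)` is `-w`. -/
def boundary (q : ℕ) : ((Fin (q + 1) → Vec d) → A) →+ ((Fin q → Vec d) → A) where
  toFun c := fun w => -∑ x ∈ F.rays, c (Fin.cons x w)
  map_zero' := by funext w; simp
  map_add' c c' := by
    funext w
    simp only [Pi.add_apply, Finset.sum_add_distrib]
    abel

open Classical in
/-- The fundamental chain `[ℝ^d]`: the sum of all `d`-dimensional cones, with the standard
orientation of `ℝ^d`. -/
def fundamentalChain : (Fin d → Vec d) → ℤ := fun w =>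
  if Finset.univ.image w ∈ F.cones then ((SignType.sign (Matrix.of w).det : SignType) : ℤ) else 0

end ConeComplex

section

variable {d : ℕ} {G : Type*} [Group G] [TopologicalSpace G] (A : Type*) [AddCommGroup A]

open Matrix in
/-- The action of `G` on chains in `ℝ^d` with coefficients in `A^σ`, where `G` acts on `ℝ^d`
through `τ`. -/
def chainAction (τ : G →* O d) (σ : G →ₜ* ℤˣ) (q : ℕ) :
    G → ((Fin q → Vec d) → A) →+ ((Fin q → Vec d) → A) := fun g =>
  { toFun := fun c w => ((σ g : ℤˣ) : ℤ) • c fun i => (τ g⁻¹).1 *ᵥ w i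
    map_zero' := by funext w; simp
    map_add' := fun c c' => by funext w; simp }

/-- Families `(β_k)_k`, where `β_k` is a function of `k + m` elements of `G` with values in
functions of `k` vectors. -/
abbrev ChainFamily (d : ℕ) (G A : Type*) (m : ℕ) : Type _ :=
  (k : ℕ) → (Fin (k + m) → G) → (Fin k → Vec d) → A

variable [TopologicalSpace A] [IsTopologicalAddGroup A] [SecondCountableTopology A]

/-- The equivariant `(-m)`-chains `⨁_k 𝒞^{k+m}(G, C_k(ℝ^d, A))`, with measurable cochains
(there are no cones of dimension `k > d`). -/
def equivariantChains (F : ConeComplex d) (G : Type*) [TopologicalSpace G] (A : Type*)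
    [AddCommGroup A] [TopologicalSpace A] [IsTopologicalAddGroup A] [SecondCountableTopology A]
    (m : ℕ) : AddSubgroup (ChainFamily d G A m) where
  carrier := {β | ∀ k, (∀ g, β k g ∈ F.chains A k) ∧
    ∀ w, (fun g => β k g w) ∈ measurableCochains G A (k + m)}
  zero_mem' := fun _ => ⟨fun _ => zero_mem _, fun _ => zero_mem _⟩
  add_mem' hβ hβ' := fun k => ⟨fun g => add_mem ((hβ k).1 g) ((hβ' k).1 g),
    fun w => add_mem ((hβ k).2 w) ((hβ' k).2 w)⟩
  neg_mem' hβ := fun k => ⟨fun g => neg_mem ((hβ k).1 g), fun w => neg_mem ((hβ k).2 w)⟩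

/-- The total boundary `D = ∂ + (-1)^r δ` on equivariant `r`-chains, `r = -m`. -/
def totalBoundary (F : ConeComplex d) (τ : G →* O d) (σ : G →ₜ* ℤˣ) (m : ℕ) :
    ChainFamily d G A m →+ ChainFamily d G A (m + 1) where
  toFun β := fun k g => F.boundary A k (β (k + 1) (g ∘ Fin.cast (by omega))) +
    (-1 : ℤ) ^ m • coboundary (chainAction A τ σ k) (k + m) (β k) g
  map_zero' := by
    funext k g
    simp
  map_add' β β' := by
    funext k g
    simp only [Pi.add_apply, map_add, smul_add]
    abel

/-- Equivariant `(-m)`-cycles. -/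
def equivariantCycles (F : ConeComplex d) (τ : G →* O d) (σ : G →ₜ* ℤˣ) (m : ℕ) :
    AddSubgroup (ChainFamily d G A m) :=
  equivariantChains F G A m ⊓ (totalBoundary A F τ σ m).ker

/-- The equivariant homology `H_{-(m+1)}^G(ℝ^d, A)`, where `G` acts on `ℝ^d` through `τ` and on
`A` through `σ`. -/
abbrev EquivariantHomology (F : ConeComplex d) (τ : G →* O d) (σ : G →ₜ* ℤˣ) (m : ℕ) : Type _ :=
  equivariantCycles A F τ σ (m + 1) ⧸
    ((equivariantChains F G A m).map (totalBoundary A F τ σ m)).addSubgroupOf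
      (equivariantCycles A F τ σ (m + 1))

variable {A}

/-- The equivariant homology class `x` is represented by `β` (in particular `β` is a cycle). -/
def HomologyRepresents {F : ConeComplex d} {τ : G →* O d} {σ : G →ₜ* ℤˣ} {m : ℕ}
    (x : EquivariantHomology A F τ σ m) (β : ChainFamily d G A (m + 1)) : Prop :=
  ∃ h : β ∈ equivariantCycles A F τ σ (m + 1), x = QuotientAddGroup.mk ⟨β, h⟩

/-- The equivariant `(-2)`-chain `a · [0]` with `a` placed at the origin. -/
def atOrigin (a : (Fin 2 → G) → A) : ChainFamily d G A 2 := fun k g _ =>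
  if h : k = 0 then a (g ∘ Fin.cast (by omega)) else 0

/-- The equivariant `(-2)`-chain `c · [ℝ^d]`. -/
def timesFundamentalChain (F : ConeComplex d) (c : (Fin (d + 2) → G) → A) :
    ChainFamily d G A 2 := fun k g w =>
  if h : k = d then F.fundamentalChain (w ∘ Fin.cast h.symm) • c (g ∘ Fin.cast (by omega)) else 0

variable {P : Type*} [Group P] [TopologicalSpace P] [DiscreteTopology P]

/-- The coefficient twist of `U(1)^or`: spatially orientation-reversing elements and anti-unitary
elements (those with `σ g = -1`) act by inversion. -/
abbrev orTwist (ρ : P →* O d) (π : G →ₜ* P) (σ : G →ₜ* ℤˣ) : G →ₜ* ℤˣ :=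
  (orientation ρ).comp π * σ

/-- `y ∈ ℋ^{d+2}(G, U(1)^or)` is the LSM anomaly of the anomalous texture at the origin with
projective class `ω ∈ ℋ²(G, U(1))`: the classes of `ω · [0]` and of `y · [ℝ^d]` in
`H_{-2}^G(ℝ^d, U(1))` agree. Here `G` acts on `ℝ^d` through `π : G → P` and `ρ : P → O(d)`. -/
def IsLSMAnomaly (F : ConeComplex d) (ρ : P →* O d) (π : G →ₜ* P) (σ : G →ₜ* ℤˣ)
    (ω : Cohomology U1 σ 2) (y : Cohomology U1 (orTwist ρ π σ) (d + 2)) : Prop :=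
  ∃ (x : EquivariantHomology U1 F (ρ.comp π.toMonoidHom) σ 1) (a : (Fin 2 → G) → U1)
    (c : (Fin (d + 2) → G) → U1), Represents ω a ∧ Represents y c ∧
      HomologyRepresents x (atOrigin a) ∧ HomologyRepresents x (timesFundamentalChain F c)

end

/-- For `G = G_int × P`, where only `G_int` acts projectively, with class `α`, and contains the
anti-unitary elements: the class `e(P) ∪ α ∈ ℋ^{d+2}(G_int × P, U(1)^or)`. -/
def eulerCup {d : ℕ} {P : Type*} [Group P] [TopologicalSpace P] [DiscreteTopology P]
    (ρ : P →* O d) {Gint : Type*} [Group Gint] [TopologicalSpace Gint] {σ : Gint →ₜ* ℤˣ}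
    (α : Cohomology U1 σ 2) :
    Cohomology U1 (orTwist ρ (ContinuousMonoidHom.snd Gint P)
      (σ.comp (ContinuousMonoidHom.fst Gint P))) (d + 2) :=
  cup (pullback (ContinuousMonoidHom.snd Gint P) (eulerClass ρ))
    (pullback (ContinuousMonoidHom.fst Gint P) α)

/-! ### Point groups in dimensions 1, 2 and 3 -/

instance (n : ℕ) : TopologicalSpace (DihedralGroup n) := ⊥

instance (n : ℕ) : DiscreteTopology (DihedralGroup n) := ⟨rfl⟩

/-- The cyclic group `ℤ_n`, written multiplicatively. -/
abbrev Cyc (n : ℕ) : Type := Multiplicative (ZMod n)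

/-- The generator of `ℤ_n`. -/
def gen (n : ℕ) : Cyc n := Multiplicative.ofAdd 1

/-- The lift to `[0, n)` of the tautological generator of `ℋ¹(ℤ_n, ℤ_n)`. -/
def cycLift (n : ℕ) (g : Cyc n) : ℤ := ((Multiplicative.toAdd g).val : ℤ)

/-- The lift to `[0, n)` of the generator of `ℋ¹(D_n, ℤ_n^r)`: the exponent `i` of the rotation
in `g = r^i` or `g = r^i s`. (In `DihedralGroup n` the element `sr i` is `s r^i = r^{-i} s`.) -/
def dihLift (n : ℕ) : DihedralGroup n → ℤ
  | .r i => (i.val : ℤ)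
  | .sr i => ((-i).val : ℤ)

/-- The class in `ℋ¹(D_n, ℤ_2)` corresponding to reflections, lifted to `{0, 1}`. -/
def dihRefl (n : ℕ) : DihedralGroup n → ℤ
  | .r _ => 0
  | .sr _ => 1

/-- The 1-cochain given by a function on the group. -/
def cochain1 {G : Type*} (a : G → ℤ) : (Fin 1 → G) → ℤ := fun g => a (g 0)

/-- The 2-cochain `(dα - 2 r ∪ α) / n`. -/
def twistedBockstein {G : Type*} [Group G] (n : ℕ) (r α : G → ℤ) : (Fin 2 → G) → ℤ := fun g =>
  ((α (g 1) - α (g 0 * g 1) + α (g 0)) - 2 * (r (g 0) * α (g 1))) / n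

/-- Rotation of the plane by the angle `2π/n`. -/
def rotationMatrix (n : ℕ) : Matrix (Fin 2) (Fin 2) ℝ :=
  !![Real.cos (2 * Real.pi / n), -Real.sin (2 * Real.pi / n);
    Real.sin (2 * Real.pi / n), Real.cos (2 * Real.pi / n)]

/-- Reflection of the plane. -/
def mirrorMatrix : Matrix (Fin 2) (Fin 2) ℝ := !![1, 0; 0, -1]

/-- The orthogonal map of `ℝ³ = ℝ² ⊕ ℝ` which acts by `M` on the plane and by `ε` on the axis. -/
def axial (M : Matrix (Fin 2) (Fin 2) ℝ) (ε : ℝ) : Matrix (Fin 3) (Fin 3) ℝ :=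
  !![M 0 0, M 0 1, 0; M 1 0, M 1 1, 0; 0, 0, ε]

end

end PointGroupLSM

open PointGroupLSM
open scoped Matrix

universe u v

/-! Everything rests on one fact about polyhedra: a segment cut out of an orthant by linear
equations in general position has two end points, of opposite sign (`sum_sign_vertices_eq_zero`).
Applied to a generic (d+1)-simplex, it says that the zeros over its boundary cancel. Applied to an
affine simplex and a simplicial cone, it is the Leibniz rule for intersection numbers
(`faceSum_crossing`).

Euler class. Almost every apex is generic, so any cycle of generic simplices can be coned off; hence
such a cycle has no zeros in total (`countZeros_eq_zero`). Coning off inductively over normalised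
simplices and transporting by the group yields a section, and in the same way a homotopy between two
sections. Zero counts are therefore cocycles, and their differences are coboundaries. The argument
is carried out for simplices up to reordering (`OrientedSection`), because the generators of a cone
have no invariant order. In practice the class is read off from any section over the (d-1)-skeleton
with chosen fillings (`represents_eulerClass_of_filling`). A constant invariant vector is a section
without zeros, and negating a section in odd dimension reverses the sign of every zero.

LSM anomaly. The dual chains of a cone complex detect the coefficients of cellular chains
(`pairChain_dual`). Coning the dual chains to a generic point contracts the cellular complex below
dimension d and shows that the top cycles are the multiples of [ℝ^d]. Solving for the components of
an equivariant chain one dimension at a time then gives the isomorphism `fundamentalHom_bijective`.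

The same contraction produces equivariant chains of cones η_q, the cone version of a section: their
links form a section over the (d-1)-skeleton, and the boundary over a d-simplex is the Euler number
times [ℝ^d] (`represents_eulerClass`). The products η_k ∪ ω telescope under D, leaving ω·[0] at one
end and ± (e ∪ ω)·[ℝ^d] at the other (`atOrigin_eq`). The sign (-1)^d is harmless, since 2e = 0 for
odd d.

Invariant decompositions come from barycentrically subdividing the arrangement of all translates of
the coordinate hyperplanes.

Examples. In the plane the section runs along a regular 4n-gon, and its winding number is the
integer by which α fails to be a twisted homomorphism, divided by n. In space this section is
suspended between the two poles of the axis, which multiplies its zero count by the character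
exchanging the poles. -/

namespace PointGroupLSM

noncomputable section

/-! ### Alternating sums over faces -/

section FaceSum

variable {α M : Type*} [AddCommGroup M]

/-- The alternating sum of the values of `f` on the faces of a tuple. -/
def faceSum {n : ℕ} (f : (Fin n → α) → M) (v : Fin (n + 1) → α) : M :=
  ∑ i : Fin (n + 1), (-1 : ℤ) ^ (i : ℕ) • f fun j => v (i.succAbove j)

/-- Every pair of entries is deleted in two orders, and the two terms carry opposite signs; the
involution exchanges the orders. -/
theorem faceSum_faceSum {n : ℕ} (f : (Fin n → α) → M) (v : Fin (n + 2) → α) :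
    faceSum (faceSum f) v = 0 := by
  simp only [faceSum, Finset.smul_sum, smul_smul, ← pow_add]
  rw [← Finset.sum_product']
  refine Finset.sum_involution (fun p _ => (p.1.succAbove p.2, p.2.predAbove p.1)) ?_ ?_
    (fun _ _ => Finset.mem_product.2 ⟨Finset.mem_univ _, Finset.mem_univ _⟩) ?_
  · rintro ⟨i, j⟩ _
    simp only [Fin.succAbove_succAbove_succAbove_predAbove, Fin.neg_one_pow_succAbove_add_predAbove,
      neg_smul, add_neg_cancel]
  · rintro ⟨i, j⟩ _ _ h
    exact Fin.succAbove_ne i j (congrArg Prod.fst h)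
  · rintro ⟨i, j⟩ _
    simp only [Fin.succAbove_succAbove_predAbove, Fin.predAbove_predAbove_succAbove]

theorem faceSum_sub {n : ℕ} (f f' : (Fin n → α) → M) (v : Fin (n + 1) → α) :
    faceSum (f - f') v = faceSum f v - faceSum f' v := by
  simp [faceSum, smul_sub, Finset.sum_sub_distrib]

theorem map_faceSum {M' : Type*} [AddCommGroup M'] (φ : M →+ M') {n : ℕ} (f : (Fin n → α) → M)
    (v : Fin (n + 1) → α) : φ (faceSum f v) = faceSum (fun w => φ (f w)) v := by
  simp [faceSum, map_sum, map_zsmul]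

theorem faceSum_mem {T : AddSubgroup M} {n : ℕ} {f : (Fin n → α) → M} {v : Fin (n + 1) → α}
    (h : ∀ i : Fin (n + 1), f (fun j => v (i.succAbove j)) ∈ T) : faceSum f v ∈ T :=
  sum_mem fun i _ => zsmul_mem (h i) _

theorem faceSum_comp {β : Type*} (φ : α → β) {n : ℕ} (f : (Fin n → β) → M)
    (v : Fin (n + 1) → α) : faceSum (fun w => f fun i => φ (w i)) v = faceSum f fun i => φ (v i) :=
  rfl

/-- The face opposite `x` is `v`; all other faces keep `x` and are shifted by one position. This is
the combinatorial source of the boundary formula for cones and of the Leibniz rule for suspensions.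
-/
theorem faceSum_cons {n : ℕ} (f : (Fin (n + 1) → α) → M) (x : α) (v : Fin (n + 1) → α) :
    faceSum f (Fin.cons x v : Fin (n + 2) → α) =
      f v - faceSum (fun w => f (Fin.cons x w : Fin (n + 1) → α)) v := by
  rw [faceSum, Fin.sum_univ_succ, faceSum, sub_eq_add_neg, ← Finset.sum_neg_distrib]
  congr 1
  · simp
  · refine Finset.sum_congr rfl fun i _ => ?_
    rw [Fin.val_succ, pow_succ, mul_neg_one, neg_smul]
    congr 3
    funext j
    refine Fin.cases ?_ (fun j => ?_) j
    · simp
    · simp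

theorem faceSum_cons_zero (f : (Fin 0 → α) → M) (x : α) (v : Fin 0 → α) :
    faceSum f (Fin.cons x v : Fin 1 → α) = f v := by
  have h : (fun j => (Fin.cons x v : Fin 1 → α) ((0 : Fin 1).succAbove j)) = v :=
    Subsingleton.elim _ _
  rw [faceSum, Fin.sum_univ_one, h, Fin.val_zero, pow_zero, one_smul]

/-- The faces of the path (1, g₁, g₁g₂, …) are again such paths, except for the zeroth, which starts
at g₁ and is a translate by g₁; equivariance turns that translation into the action. This passes
from `EP` to inhomogeneous cochains. -/
theorem coboundary_partialProd {G : Type*} [Group G] (act : G → M →+ M) {n : ℕ}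
    (F : (Fin (n + 1) → G) → M) (hF : ∀ (h : G) g, F (fun i => h * g i) = act h (F g))
    (g : Fin (n + 1) → G) :
    coboundary act n (fun g => F (Fin.partialProd g)) g = faceSum F (Fin.partialProd g) := by
  rw [faceSum, Fin.sum_univ_succ]
  simp only [coboundary, AddMonoidHom.coe_mk, ZeroHom.coe_mk]
  congr 1
  · rw [← hF, Fin.val_zero, pow_zero, one_smul]
    congr 1
    funext j
    exact (Fin.partialProd_succ' g j).symm
  · refine Finset.sum_congr rfl fun j _ => ?_
    rw [Fin.partialProd_contractNth]
    rfl

/-- The homogeneous cochain corresponding to an inhomogeneous one. -/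
def homogeneous {G : Type*} [Group G] (act : G → M →+ M) {n : ℕ} (f : (Fin n → G) → M) :
    (Fin (n + 1) → G) → M :=
  fun g => act (g 0) (f fun i => (g i.castSucc)⁻¹ * g i.succ)

theorem homogeneous_partialProd {G : Type*} [Group G] (act : G → M →+ M)
    (h1 : ∀ m, act 1 m = m) {n : ℕ} (f : (Fin n → G) → M) (g : Fin n → G) :
    homogeneous act f (Fin.partialProd g) = f g := by
  simp only [homogeneous, Fin.partialProd_zero, h1, Fin.partialProd_right_inv]

theorem homogeneous_mul {G : Type*} [Group G] (act : G → M →+ M)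
    (hm : ∀ g h m, act (g * h) m = act g (act h m)) {n : ℕ} (f : (Fin n → G) → M) (h : G)
    (g : Fin (n + 1) → G) : homogeneous act f (fun i => h * g i) = act h (homogeneous act f g) := by
  simp only [homogeneous, hm, mul_inv_rev]
  congr 3
  funext i
  group

theorem coboundary_eq_faceSum {G : Type*} [Group G] (act : G → M →+ M)
    (h1 : ∀ m, act 1 m = m) (hm : ∀ g h m, act (g * h) m = act g (act h m)) {n : ℕ}
    (f : (Fin n → G) → M) (g : Fin (n + 1) → G) :
    coboundary act n f g = faceSum (homogeneous act f) (Fin.partialProd g) := by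
  rw [← coboundary_partialProd act _ (homogeneous_mul act hm f)]
  simp only [homogeneous_partialProd act h1]

/-- In homogeneous form the coboundary is the face sum, so this reduces to `faceSum_faceSum`. -/
theorem coboundary_coboundary {G : Type*} [Group G] (act : G → M →+ M)
    (h1 : ∀ m, act 1 m = m) (hm : ∀ g h m, act (g * h) m = act g (act h m)) {n : ℕ}
    (f : (Fin n → G) → M) : coboundary act (n + 1) (coboundary act n f) = 0 := by
  funext g
  have e : coboundary act n f = fun g => faceSum (homogeneous act f) (Fin.partialProd g) :=
    funext fun g => coboundary_eq_faceSum act h1 hm f g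
  rw [e, coboundary_partialProd act (faceSum (homogeneous act f)), faceSum_faceSum]
  · rfl
  · intro h g
    rw [map_faceSum]
    simp only [← homogeneous_mul act hm f]
    rfl

end FaceSum

/-! ### Chains of affine simplices -/

section AffineChains

variable {d : ℕ} {B B' : Type*} [AddCommGroup B] [AddCommGroup B']

/-- The additive extension of a function of affine simplices to chains. -/
def chainLift {q : ℕ} (f : (Fin q → Vec d) → B) : AffineChain d q →+ B :=
  Finsupp.liftAddHom fun v => zmultiplesHom B (f v)

theorem chainLift_apply {q : ℕ} (f : (Fin q → Vec d) → B) (c : AffineChain d q) :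
    chainLift f c = c.sum fun v n => n • f v := rfl

@[simp]
theorem chainLift_single {q : ℕ} (f : (Fin q → Vec d) → B) (v : Fin q → Vec d) (n : ℤ) :
    chainLift f (Finsupp.single v n) = n • f v := by
  simp [chainLift]

theorem chain_hom_ext {q : ℕ} {φ φ' : AffineChain d q →+ B}
    (h : ∀ v, φ (Finsupp.single v 1) = φ' (Finsupp.single v 1)) : φ = φ' := by
  refine Finsupp.addHom_ext fun v n => ?_
  have e : Finsupp.single v n = n • Finsupp.single v (1 : ℤ) := by simp
  rw [e, map_zsmul, map_zsmul, h]

theorem map_chainLift {q : ℕ} (φ : B →+ B') (f : (Fin q → Vec d) → B) (c : AffineChain d q) :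
    φ (chainLift f c) = chainLift (fun v => φ (f v)) c :=
  DFunLike.congr_fun (chain_hom_ext (φ := φ.comp (chainLift f))
    (φ' := chainLift fun v => φ (f v)) fun v => by simp) c

/-- The chains whose simplices belong to `S`. -/
def chainsIn {q : ℕ} (S : Set (Fin q → Vec d)) : AddSubgroup (AffineChain d q) where
  carrier := {c | ∀ v ∈ c.support, v ∈ S}
  zero_mem' := by simp
  add_mem' {c c'} hc hc' v hv := by
    classical
    rcases Finset.mem_union.1 (Finsupp.support_add hv) with h | h
    exacts [hc v h, hc' v h]
  neg_mem' {c} hc v hv := hc v (by rwa [Finsupp.support_neg] at hv)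

theorem single_mem_chainsIn {q : ℕ} {S : Set (Fin q → Vec d)} {v : Fin q → Vec d} (hv : v ∈ S)
    (n : ℤ) : Finsupp.single v n ∈ chainsIn S := by
  intro w hw
  rw [Finset.mem_singleton.1 (Finsupp.support_single_subset hw)]
  exact hv

theorem chainLift_mem {q : ℕ} {S : Set (Fin q → Vec d)} {T : AddSubgroup B}
    {f : (Fin q → Vec d) → B} {c : AffineChain d q} (hc : c ∈ chainsIn S)
    (h : ∀ v ∈ S, f v ∈ T) : chainLift f c ∈ T :=
  sum_mem fun v hv => zsmul_mem (h v (hc v hv)) _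

theorem chainLift_congr {q : ℕ} {S : Set (Fin q → Vec d)} {f f' : (Fin q → Vec d) → B}
    {c : AffineChain d q} (hc : c ∈ chainsIn S) (h : ∀ v ∈ S, f v = f' v) :
    chainLift f c = chainLift f' c :=
  Finset.sum_congr rfl fun v hv => congrArg (c v • ·) (h v (hc v hv))

/-- An affine simplex, as a chain. -/
abbrev simplex {q : ℕ} (v : Fin q → Vec d) : AffineChain d q := Finsupp.single v 1

/-- `affineBoundary` as a homomorphism. -/
def bdry {q : ℕ} : AffineChain d (q + 1) →+ AffineChain d q := chainLift (faceSum simplex)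

theorem affineBoundary_eq {q : ℕ} (c : AffineChain d (q + 1)) : affineBoundary c = bdry c := by
  rw [affineBoundary, bdry, chainLift_apply]
  refine Finsupp.sum_congr fun v _ => ?_
  simp only [faceSum, Finset.smul_sum, Finsupp.smul_single, smul_eq_mul, mul_one]
  exact Finset.sum_congr rfl fun i _ => by rw [mul_comm]

@[simp]
theorem bdry_simplex {q : ℕ} (v : Fin (q + 1) → Vec d) : bdry (simplex v) = faceSum simplex v := by
  simp [bdry]

/-- The cone over a chain. -/
def cone {q : ℕ} (x : Vec d) : AffineChain d q →+ AffineChain d (q + 1) :=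
  chainLift fun v => simplex (Fin.cons x v)

@[simp]
theorem cone_simplex {q : ℕ} (x : Vec d) (v : Fin q → Vec d) :
    cone x (simplex v) = simplex (Fin.cons x v) := by
  simp [cone]

theorem bdry_cone {q : ℕ} (x : Vec d) (c : AffineChain d (q + 1)) :
    bdry (cone x c) = c - cone x (bdry c) := by
  have h : (bdry.comp (cone x) : AffineChain d (q + 1) →+ _) =
      AddMonoidHom.id _ - (cone x).comp bdry := chain_hom_ext fun v => by
    simp only [AddMonoidHom.comp_apply, bdry_simplex, cone_simplex, AddMonoidHom.sub_apply,
      AddMonoidHom.id_apply, map_faceSum]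
    exact faceSum_cons _ _ _
  exact DFunLike.congr_fun h c

/-- The empty simplex has no boundary, so the correction term of `bdry_cone` is absent. This is the
start of the inductions over skeleta. -/
theorem bdry_cone_zero (x : Vec d) (c : AffineChain d 0) : bdry (cone x c) = c := by
  have h : (bdry.comp (cone x) : AffineChain d 0 →+ _) = AddMonoidHom.id _ :=
    chain_hom_ext fun v => by
      simp only [AddMonoidHom.comp_apply, bdry_simplex, cone_simplex, AddMonoidHom.id_apply]
      exact faceSum_cons_zero _ _ _
  exact DFunLike.congr_fun h c

/-- The image of a chain under a linear map. -/
def act {q : ℕ} (M : Matrix (Fin d) (Fin d) ℝ) : AffineChain d q →+ AffineChain d q :=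
  chainLift fun v => simplex fun i => M *ᵥ v i

@[simp]
theorem act_simplex {q : ℕ} (M : Matrix (Fin d) (Fin d) ℝ) (v : Fin q → Vec d) :
    act M (simplex v) = simplex fun i => M *ᵥ v i := by
  simp [act]

theorem mapDomain_eq_act {q : ℕ} (M : Matrix (Fin d) (Fin d) ℝ) (c : AffineChain d q) :
    (c.mapDomain fun v i => M *ᵥ v i) = act M c := by
  rw [act, chainLift_apply, Finsupp.mapDomain]
  exact Finsupp.sum_congr fun v _ => by simp

theorem act_one {q : ℕ} (c : AffineChain d q) : act 1 c = c := by
  have h : (act 1 : AffineChain d q →+ _) = AddMonoidHom.id _ := chain_hom_ext fun v => by simp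
  exact DFunLike.congr_fun h c

theorem act_mul {q : ℕ} (M M' : Matrix (Fin d) (Fin d) ℝ) (c : AffineChain d q) :
    act (M * M') c = act M (act M' c) := by
  have h : (act (M * M') : AffineChain d q →+ _) = (act M).comp (act M') :=
    chain_hom_ext fun v => by simp
  exact DFunLike.congr_fun h c

theorem bdry_act {q : ℕ} (M : Matrix (Fin d) (Fin d) ℝ) (c : AffineChain d (q + 1)) :
    bdry (act M c) = act M (bdry c) := by
  have h : (bdry.comp (act M) : AffineChain d (q + 1) →+ _) = (act M).comp bdry :=
    chain_hom_ext fun v => by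
      simp only [AddMonoidHom.comp_apply, bdry_simplex, act_simplex, map_faceSum]
      rfl
  exact DFunLike.congr_fun h c

theorem act_cone {q : ℕ} (M : Matrix (Fin d) (Fin d) ℝ) (x : Vec d) (c : AffineChain d q) :
    act M (cone x c) = cone (M *ᵥ x) (act M c) := by
  have h : ((act M).comp (cone x) : AffineChain d q →+ _) = (cone (M *ᵥ x)).comp (act M) :=
    chain_hom_ext fun v => by
      simp only [AddMonoidHom.comp_apply, cone_simplex, act_simplex]
      congr 1
      funext i
      refine Fin.cases ?_ (fun j => ?_) i <;> simp
  exact DFunLike.congr_fun h c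

/-! Oriented simplices: ordered simplices up to even permutations of their vertices. -/

/-- The subgroup of chains which vanish as chains of oriented simplices. -/
def altRel (d q : ℕ) : AddSubgroup (AffineChain d q) :=
  AddSubgroup.closure {c | ∃ (v : Fin q → Vec d) (e : Equiv.Perm (Fin q)),
    c = simplex (v ∘ e) - ((Equiv.Perm.sign e : ℤˣ) : ℤ) • simplex v}

theorem map_mem_of_mem_altRel {q : ℕ} {φ : AffineChain d q →+ B} {T : AddSubgroup B}
    (h : ∀ (v : Fin q → Vec d) (e : Equiv.Perm (Fin q)),
      φ (simplex (v ∘ e)) - ((Equiv.Perm.sign e : ℤˣ) : ℤ) • φ (simplex v) ∈ T)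
    {c : AffineChain d q} (hc : c ∈ altRel d q) : φ c ∈ T := by
  refine (AddSubgroup.closure_le (K := T.comap φ)).2 ?_ hc
  rintro _ ⟨v, e, rfl⟩
  have := h v e
  rwa [← map_zsmul, ← map_sub] at this

theorem act_mem_altRel {q : ℕ} (M : Matrix (Fin d) (Fin d) ℝ) {c : AffineChain d q}
    (hc : c ∈ altRel d q) : act M c ∈ altRel d q := by
  refine map_mem_of_mem_altRel (fun v e => AddSubgroup.subset_closure ?_) hc
  rw [act_simplex, act_simplex]
  exact ⟨_, e, rfl⟩

/-- A permutation of the old vertices extends by fixing the apex, with the same sign. -/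
theorem cone_mem_altRel {q : ℕ} (x : Vec d) {c : AffineChain d q}
    (hc : c ∈ altRel d q) : cone x c ∈ altRel d (q + 1) := by
  refine map_mem_of_mem_altRel (fun v e => AddSubgroup.subset_closure ?_) hc
  rw [cone_simplex, cone_simplex]
  refine ⟨Fin.cons x v, Equiv.Perm.decomposeFin.symm (0, e), ?_⟩
  rw [Equiv.Perm.decomposeFin.symm_sign, if_pos rfl, one_mul]
  congr 2
  funext i
  refine Fin.cases ?_ (fun j => ?_) i <;> simp

end AffineChains

end

end PointGroupLSM

namespace PointGroupLSM

noncomputable section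

/-! ### Vertices of one-dimensional polyhedra -/

section Polyhedra

open Classical in
-- Start at a feasible point and move along the kernel direction `y`: the first coordinate to reach
-- zero is the one minimising `x i / -y i`. As the feasible set lies on a line, there is only one
-- exit point, and `gen` allows only one coordinate to vanish there.
theorem existsUnique_exit {n : ℕ} {E : Type*} [AddCommGroup E] [Module ℝ E] (u : Fin n → E) (b : E)
    (gen : ∀ x : Fin n → ℝ, (∀ i, 0 ≤ x i) → ∑ i, x i • u i = b → ∀ i j, i ≠ j → x i = 0 → x j ≠ 0)
    (y : Fin n → ℝ) (hy : ∑ i, y i • u i = 0)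
    (hker : ∀ z : Fin n → ℝ, ∑ i, z i • u i = 0 → ∃ s : ℝ, z = s • y) (hneg : ∃ i, y i < 0)
    (x : Fin n → ℝ) (hx : ∀ i, 0 ≤ x i) (hb : ∑ i, x i • u i = b) :
    ∃! i, y i < 0 ∧ ∃ x' : Fin n → ℝ, (∀ i, 0 ≤ x' i) ∧ ∑ i, x' i • u i = b ∧ x' i = 0 := by
  have hne : (Finset.univ.filter fun i => y i < 0).Nonempty := by
    obtain ⟨i, hi⟩ := hneg
    exact ⟨i, by simpa using hi⟩
  obtain ⟨i, hi, hmin⟩ := Finset.exists_min_image _ (fun i => x i / -y i) hne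
  have hi : y i < 0 := by simpa using hi
  obtain ⟨x', h0', hb', hz'⟩ : ∃ x' : Fin n → ℝ, (∀ i, 0 ≤ x' i) ∧ ∑ i, x' i • u i = b ∧
      x' i = 0 := by
    refine ⟨fun j => x j + (x i / -y i) * y j, fun j => ?_, ?_, ?_⟩
    · by_cases hj : y j < 0
      · have h := hmin j (by simpa using hj)
        rw [le_div_iff₀ (by linarith)] at h
        linarith
      · have h1 := hx j
        have h2 : 0 ≤ x i / -y i := div_nonneg (hx i) (by linarith)
        have := mul_nonneg h2 (not_lt.1 hj)
        linarith
    · simp only [add_smul, Finset.sum_add_distrib, mul_smul, ← Finset.smul_sum, hy, hb, smul_zero,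
        add_zero]
    · have : y i ≠ 0 := hi.ne
      field_simp
      ring
  refine ⟨i, ⟨hi, x', h0', hb', hz'⟩, ?_⟩
  rintro i' ⟨hi', x'', h0'', hb'', hz''⟩
  obtain ⟨s, hs⟩ := hker (x'' - x') (by simp [sub_smul, Finset.sum_sub_distrib, hb', hb''])
  have e : ∀ j, x'' j = x' j + s * y j := fun j => by
    have := congrFun hs j
    simp only [Pi.sub_apply, Pi.smul_apply, smul_eq_mul] at this
    linarith
  have e1 := e i'
  have e2 := e i
  have p1 := h0' i'
  have p2 := h0'' i
  rw [hz''] at e1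
  rw [hz'] at e2
  -- At `i'` the point `x''` has just reached zero while `x'` has not passed it, and conversely at
  -- `i`; as `y` is negative at both, the two exit points coincide.
  have s1 : 0 ≤ s := by nlinarith
  have s2 : s ≤ 0 := by nlinarith
  have s0 : s = 0 := le_antisymm s2 s1
  by_contra hne
  refine gen x' h0' hb' i i' (fun h => hne h.symm) hz' ?_
  rw [s0] at e1
  linarith

/-- For each coordinate `k`, expand along the first column a determinant in which column `k` occurs
twice. -/
theorem sum_det_smul_eq_zero {N : ℕ} (u : Fin (N + 1) → Fin N → ℝ) :
    ∑ i : Fin (N + 1), ((-1) ^ (i : ℕ) * (Matrix.of fun j => u (i.succAbove j)).det) • u i = 0 := by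
  funext k
  have h := Matrix.det_succ_column_zero (Matrix.of fun i => (Fin.cons (u i k) (u i) : Fin (N + 1) → ℝ))
  have h0 : (Matrix.of fun i => (Fin.cons (u i k) (u i) : Fin (N + 1) → ℝ)).det = 0 :=
    Matrix.det_zero_of_column_eq (i := 0) (j := k.succ) (Fin.succ_ne_zero k).symm fun i => by simp
  rw [h0] at h
  rw [Finset.sum_apply, Pi.zero_apply, h]
  refine Finset.sum_congr rfl fun i _ => ?_
  simp only [Pi.smul_apply, smul_eq_mul, Matrix.of_apply, Fin.cons_zero]
  have : ((Matrix.of fun i => (Fin.cons (u i k) (u i) : Fin (N + 1) → ℝ)).submatrix i.succAbove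
      Fin.succ) = Matrix.of fun j => u (i.succAbove j) := by
    ext a b
    simp
  rw [this]
  ring

open Classical in
/-- The two end points of a segment, cut out of an orthant by linear equations, have opposite
signs. -/
theorem sum_sign_vertices_eq_zero {N : ℕ} (u : Fin (N + 1) → Fin N → ℝ) (b : Fin N → ℝ)
    (pos : ∀ x : Fin (N + 1) → ℝ, (∀ i, 0 ≤ x i) → ∑ i, x i • u i = 0 → x = 0)
    (gen : ∀ x : Fin (N + 1) → ℝ, (∀ i, 0 ≤ x i) → ∑ i, x i • u i = b →
      ∀ i j, i ≠ j → x i = 0 → x j ≠ 0) :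
    ∑ i : Fin (N + 1), (-1 : ℤ) ^ (i : ℕ) •
      (if ∃ x : Fin N → ℝ, (∀ j, 0 ≤ x j) ∧ ∑ j, x j • u (i.succAbove j) = b then
        ((SignType.sign (Matrix.of fun j => u (i.succAbove j)).det : SignType) : ℤ) else 0) = 0 := by
  set y : Fin (N + 1) → ℝ := fun i =>
    (-1) ^ (i : ℕ) * (Matrix.of fun j => u (i.succAbove j)).det with hydef
  have hy : ∑ i, y i • u i = 0 := sum_det_smul_eq_zero u
  let S : Fin (N + 1) → Prop := fun i => ∃ x : Fin (N + 1) → ℝ, (∀ i, 0 ≤ x i) ∧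
    ∑ i, x i • u i = b ∧ x i = 0
  have hS : ∀ i : Fin (N + 1), (∃ x : Fin N → ℝ, (∀ j, 0 ≤ x j) ∧
      ∑ j, x j • u (i.succAbove j) = b) ↔ S i := by
    intro i
    constructor
    · rintro ⟨x, hx, hb⟩
      refine ⟨i.insertNth 0 x, fun j => ?_, ?_, by simp⟩
      · refine Fin.succAboveCases i ?_ (fun j => ?_) j
        · simp
        · simpa using hx j
      · rw [Fin.sum_univ_succAbove _ i]
        simpa using hb
    · rintro ⟨x, hx, hb, h0⟩
      refine ⟨fun j => x (i.succAbove j), fun j => hx _, ?_⟩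
      rw [Fin.sum_univ_succAbove _ i, h0, zero_smul, zero_add] at hb
      exact hb
  have hterm : ∀ i : Fin (N + 1), (-1 : ℤ) ^ (i : ℕ) •
      (if ∃ x : Fin N → ℝ, (∀ j, 0 ≤ x j) ∧ ∑ j, x j • u (i.succAbove j) = b then
        ((SignType.sign (Matrix.of fun j => u (i.succAbove j)).det : SignType) : ℤ) else 0) =
      if S i then ((SignType.sign (y i) : SignType) : ℤ) else 0 := by
    intro i
    simp only [hS]
    split_ifs
    · rw [hydef, sign_mul, smul_eq_mul, SignType.coe_mul]
      congr 1
      rcases Nat.even_or_odd (i : ℕ) with ho | ho <;> simp [ho.neg_one_pow]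
    · simp
  simp only [hterm]
  by_cases hex : ∃ x : Fin (N + 1) → ℝ, (∀ i, 0 ≤ x i) ∧ ∑ i, x i • u i = b
  swap
  · exact Finset.sum_eq_zero fun i _ => if_neg fun ⟨x, hx, hb, _⟩ => hex ⟨x, hx, hb⟩
  -- If all maximal minors vanish, every term has sign zero. Otherwise `y` spans the space of
  -- relations, since the vectors other than `u i₀` are independent.
  by_cases hy0 : y = 0
  · refine Finset.sum_eq_zero fun i _ => ?_
    rw [hy0]
    simp
  obtain ⟨x, hx, hb⟩ := hex
  obtain ⟨i₀, hi₀⟩ := Function.ne_iff.1 hy0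
  have hdet : (Matrix.of fun j => u (i₀.succAbove j)).det ≠ 0 := fun h => hi₀ (by simp [hydef, h])
  have hli := Matrix.linearIndependent_rows_of_det_ne_zero hdet
  have hker : ∀ z : Fin (N + 1) → ℝ, ∑ i, z i • u i = 0 → ∃ s : ℝ, z = s • y := by
    intro z hz
    refine ⟨z i₀ / y i₀, ?_⟩
    have h1 : ∑ i, (z i - z i₀ / y i₀ * y i) • u i = 0 := by
      simp only [sub_smul, Finset.sum_sub_distrib, mul_smul, ← Finset.smul_sum, hy, hz, smul_zero,
        sub_zero]
    have h0 : z i₀ - z i₀ / y i₀ * y i₀ = 0 := by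
      rw [div_mul_cancel₀ _ hi₀, sub_self]
    rw [Fin.sum_univ_succAbove _ i₀, h0, zero_smul, zero_add] at h1
    have h2 := Fintype.linearIndependent_iff.1 hli _ h1
    funext i
    refine Fin.succAboveCases i₀ ?_ (fun j => ?_) i
    · simpa [sub_eq_zero] using h0
    · simpa [sub_eq_zero] using h2 j
  -- `pos` forbids nonzero relations of a constant sign, so the feasible set is bounded in both
  -- directions and has an exit along `y` and one along `-y`.
  have hneg : ∃ i, y i < 0 := by
    by_contra h
    push Not at h
    exact hy0 (pos y h hy)
  have hpos : ∃ i, (-y) i < 0 := by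
    by_contra h
    push Not at h
    exact hy0 (neg_eq_zero.1 (pos (-y) h (by simp [hy])))
  obtain ⟨i, ⟨hi, hi'⟩, hiu⟩ := existsUnique_exit u b gen y hy hker hneg x hx hb
  obtain ⟨j, ⟨hj, hj'⟩, hju⟩ := existsUnique_exit u b gen (-y) (by simp [hy])
    (fun z hz => (hker z hz).imp' Neg.neg fun s hs => by simp [hs]) hpos x hx hb
  have hj : 0 < y j := by simpa using hj
  -- The exit along `y` contributes -1, the exit along `-y` contributes +1, and no other index
  -- contributes.
  have key : ∀ k, (if S k then ((SignType.sign (y k) : SignType) : ℤ) else 0) =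
      (if k = j then 1 else 0) - if k = i then 1 else 0 := by
    intro k
    rcases lt_trichotomy (y k) 0 with h | h | h
    · have hkj : k ≠ j := fun e => by rw [e] at h; linarith
      rw [if_neg hkj]
      by_cases hk : S k
      · rw [if_pos hk, hiu k ⟨h, hk⟩, sign_neg hi]
        simp
      · have : k ≠ i := fun e => hk (e ▸ hi')
        rw [if_neg hk, if_neg this]
        simp
    · have hkj : k ≠ j := fun e => by rw [e] at h; linarith
      have hki : k ≠ i := fun e => by rw [e] at h; linarith
      rw [h, if_neg hkj, if_neg hki]
      simp
    · have hki : k ≠ i := fun e => by rw [e] at h; linarith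
      rw [if_neg hki]
      by_cases hk : S k
      · rw [if_pos hk, hju k ⟨by simpa using h, hk⟩, sign_pos hj]
        simp
      · have : k ≠ j := fun e => hk (e ▸ hj')
        rw [if_neg hk, if_neg this]
        simp
  simp only [key, Finset.sum_sub_distrib, Finset.sum_ite_eq', Finset.mem_univ, if_true, sub_self]

end Polyhedra

/-! ### Crossing numbers of affine simplices and cones -/

section Crossing

variable {d : ℕ}

/-- The point `v` of `ℝ^d` in homogeneous coordinates. -/
def hpt (v : Vec d) : Fin (d + 1) → ℝ := Fin.cons 1 v

/-- The opposite of the direction `w` in homogeneous coordinates. -/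
def hdir (w : Vec d) : Fin (d + 1) → ℝ := Fin.cons 0 (-w)

theorem hcomb_eq {ι κ : Type*} (s : Finset ι) (t : Finset κ) (a : ι → ℝ) (c : κ → ℝ)
    (v : ι → Vec d) (w : κ → Vec d) :
    ∑ i ∈ s, a i • hpt (v i) + ∑ j ∈ t, c j • hdir (w j) =
      Fin.cons (∑ i ∈ s, a i) (∑ i ∈ s, a i • v i - ∑ j ∈ t, c j • w j) := by
  funext k
  refine Fin.cases ?_ (fun k => ?_) k
  · simp [hpt, hdir, Finset.sum_apply]
  · simp [hpt, hdir, Finset.sum_apply, sub_eq_add_neg]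

theorem cons_eq_cons_iff {x y : ℝ} {v w : Vec d} :
    (Fin.cons x v : Fin (d + 1) → ℝ) = Fin.cons y w ↔ x = y ∧ v = w :=
  Fin.cons_inj

/-- The origin of `ℝ^d` in homogeneous coordinates lies in the cone spanned by `t`. -/
def ContainsOrigin {n : ℕ} (t : Fin n → Fin (d + 1) → ℝ) : Prop :=
  ∃ x : Fin n → ℝ, (∀ i, 0 ≤ x i) ∧ ∑ i, x i • t i = hpt 0

open Classical in
/-- The sign with which the simplicial cone spanned by `t` contains the origin. -/
def originSign {n : ℕ} (t : Fin n → Fin (d + 1) → ℝ) : ℤ :=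
  if h : n = d + 1 then if ContainsOrigin t then
    ((SignType.sign (Matrix.of fun i => t (Fin.cast h.symm i)).det : SignType) : ℤ) else 0 else 0

theorem originSign_cast {n n' : ℕ} (h : n = n') {t : Fin n → Fin (d + 1) → ℝ}
    {t' : Fin n' → Fin (d + 1) → ℝ} (ht : ∀ k, t (Fin.cast h.symm k) = t' k) :
    originSign t = originSign t' := by
  subst h
  exact congrArg originSign (funext ht)

theorem originSign_eq_zero {n : ℕ} {t : Fin n → Fin (d + 1) → ℝ} (h : ¬ContainsOrigin t) :
    originSign t = 0 := by
  rw [originSign]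
  split_ifs
  · rfl
  · rfl

theorem originSign_perm {n : ℕ} (t : Fin n → Fin (d + 1) → ℝ) (e : Equiv.Perm (Fin n)) :
    originSign (t ∘ e) = ((Equiv.Perm.sign e : ℤˣ) : ℤ) * originSign t := by
  have hc : ContainsOrigin (t ∘ e) ↔ ContainsOrigin t := by
    constructor
    · rintro ⟨x, hx, hs⟩
      refine ⟨x ∘ e.symm, fun i => hx _, ?_⟩
      rw [← hs, ← Equiv.sum_comp e]
      simp
    · rintro ⟨x, hx, hs⟩
      refine ⟨x ∘ e, fun i => hx _, ?_⟩
      rw [← hs]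
      exact Equiv.sum_comp e fun i => x i • t i
  by_cases h : n = d + 1
  · subst h
    simp only [originSign, dif_pos]
    by_cases h : ContainsOrigin t
    · rw [if_pos h, if_pos (hc.2 h)]
      have := Matrix.det_permute e (Matrix.of t)
      have e1 : (Matrix.of fun i => (t ∘ e) (Fin.cast rfl i)) = (Matrix.of t).submatrix e id := rfl
      rw [e1, this]
      rcases Int.units_eq_one_or (Equiv.Perm.sign e) with h | h <;> rw [h] <;> simp [Left.sign_neg]
    · rw [if_neg h, if_neg fun h' => h (hc.1 h'), mul_zero]
  · simp [originSign, h]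

/-- If `n = d + 1`, the nonnegative representations of the origin form a segment and the faces
containing the origin are its end points. For any other `n` the faces have the wrong number of
generators and count zero by definition. -/
theorem faceSum_originSign {n : ℕ} (u : Fin (n + 1) → Fin (d + 1) → ℝ)
    (pos : ∀ x : Fin (n + 1) → ℝ, (∀ i, 0 ≤ x i) → ∑ i, x i • u i = 0 → x = 0)
    (gen : n = d + 1 → ∀ x : Fin (n + 1) → ℝ, (∀ i, 0 ≤ x i) → ∑ i, x i • u i = hpt 0 →
      ∀ i j, i ≠ j → x i = 0 → x j ≠ 0) :
    faceSum originSign u = 0 := by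
  by_cases h : n = d + 1
  · subst h
    rw [← sum_sign_vertices_eq_zero u (hpt 0) pos (gen rfl)]
    rw [faceSum]
    refine Finset.sum_congr rfl fun i _ => ?_
    rw [originSign, dif_pos rfl]
    rfl
  · refine Finset.sum_eq_zero fun i _ => ?_
    rw [originSign, dif_neg h, smul_zero]

/-- The number of points, counted with signs, in which the affine simplex `v` meets the cone
spanned by `w`. -/
def crossing {p m : ℕ} (v : Fin p → Vec d) (w : Fin m → Vec d) : ℤ :=
  originSign (Fin.append (fun i => hpt (v i)) fun j => hdir (w j))

theorem sum_append {p m : ℕ} (x : Fin (p + m) → ℝ) (v : Fin p → Vec d) (w : Fin m → Vec d) :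
    ∑ k, x k • (Fin.append (fun i => hpt (v i)) fun j => hdir (w j)) k =
      Fin.cons (∑ i, x (Fin.castAdd m i))
        (∑ i, x (Fin.castAdd m i) • v i - ∑ j, x (Fin.natAdd p j) • w j) := by
  rw [Fin.sum_univ_add, ← hcomb_eq]
  simp

theorem crossing_eq_zero {p m : ℕ} {v : Fin p → Vec d} {w : Fin m → Vec d}
    (h : ∀ (a : Fin p → ℝ) (c : Fin m → ℝ), (∀ i, 0 ≤ a i) → ∑ i, a i = 1 → (∀ j, 0 ≤ c j) →
      ∑ i, a i • v i ≠ ∑ j, c j • w j) : crossing v w = 0 := by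
  refine originSign_eq_zero ?_
  rintro ⟨x, hx, hs⟩
  rw [sum_append, hpt, cons_eq_cons_iff, sub_eq_zero] at hs
  exact h _ _ (fun i => hx _) hs.1 (fun j => hx _) hs.2

theorem crossing_perm_right {p m : ℕ} (v : Fin p → Vec d) (w : Fin m → Vec d)
    (e : Equiv.Perm (Fin m)) :
    crossing v (w ∘ e) = ((Equiv.Perm.sign e : ℤˣ) : ℤ) * crossing v w := by
  have h := originSign_perm (Fin.append (fun i => hpt (v i)) fun j => hdir (w j))
    (finSumFinEquiv.permCongr (Equiv.Perm.sumCongr (1 : Equiv.Perm (Fin p)) e))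
  rw [Equiv.Perm.sign_permCongr, Equiv.Perm.sign_sumCongr, Equiv.Perm.sign_one, one_mul] at h
  rw [crossing, crossing, ← h]
  congr 1
  funext k
  refine Fin.addCases (fun i => ?_) (fun j => ?_) k
  · simp [Equiv.permCongr_apply]
  · simp [Equiv.permCongr_apply]

theorem originSign_hpt_perm {p : ℕ} (v : Fin p → Vec d) (e : Equiv.Perm (Fin p)) :
    originSign (fun i => hpt ((v ∘ e) i)) =
      ((Equiv.Perm.sign e : ℤˣ) : ℤ) * originSign fun i => hpt (v i) :=
  originSign_perm (fun i => hpt (v i)) e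

theorem crossing_nil {p : ℕ} (v : Fin p → Vec d) (w : Fin 0 → Vec d) :
    crossing v w = originSign fun i => hpt (v i) :=
  originSign_cast rfl fun k => Fin.append_left _ _ k

/-- An affine simplex is in general position with respect to the cones spanned by the members of
`𝒮`: it meets them only in the dimensions in which it has to. -/
def Transverse (𝒮 : Set (Finset (Vec d))) {q : ℕ} (v : Fin q → Vec d) : Prop :=
  ∀ s ∈ 𝒮, ∀ u : Finset (Fin q), u.card + s.card ≤ d → ∀ (a : Fin q → ℝ) (c : Vec d → ℝ),
    (∀ i ∈ u, 0 ≤ a i) → ∑ i ∈ u, a i = 1 → (∀ x ∈ s, 0 ≤ c x) →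
    ∑ i ∈ u, a i • v i ≠ ∑ x ∈ s, c x • x

open Classical in
-- If two coefficients vanished, at most `d` would remain. The face of the simplex and the face of
-- the cone which they span would then meet in too small a total dimension, against transversality.
theorem general_position {𝒮 : Set (Finset (Vec d))} {p m : ℕ} {v : Fin p → Vec d}
    {w : Fin m → Vec d} (hv : Transverse 𝒮 v) (hw : ∀ t : Finset (Fin m), t.image w ∈ 𝒮)
    (hli : LinearIndependent ℝ w) (hpm : p + m = d + 2) (x : Fin (p + m) → ℝ)
    (hx : ∀ i, 0 ≤ x i)
    (hs : ∑ k, x k • (Fin.append (fun i => hpt (v i)) fun j => hdir (w j)) k = hpt 0)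
    (i j : Fin (p + m)) (hij : i ≠ j) (hi : x i = 0) : x j ≠ 0 := by
  intro hj
  rw [sum_append, hpt, cons_eq_cons_iff, sub_eq_zero] at hs
  set a : Fin p → ℝ := fun i => x (Fin.castAdd m i)
  set c : Fin m → ℝ := fun j => x (Fin.natAdd p j)
  set U := Finset.univ.filter fun i => a i ≠ 0 with hU
  set T := Finset.univ.filter fun j => c j ≠ 0 with hT
  have hcard : U.card + T.card = (Finset.univ.filter fun k => x k ≠ 0).card := by
    simp only [hU, hT, Finset.card_filter]
    rw [Fin.sum_univ_add]
  have hle : (Finset.univ.filter fun k => x k ≠ 0).card ≤ d := by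
    have hsub : (Finset.univ.filter fun k => x k ≠ 0) ⊆ Finset.univ \ {i, j} := by
      intro k hk
      rw [Finset.mem_filter] at hk
      simp only [Finset.mem_sdiff, Finset.mem_univ, true_and, Finset.mem_insert,
        Finset.mem_singleton, not_or]
      exact ⟨fun e => hk.2 (e ▸ hi), fun e => hk.2 (e ▸ hj)⟩
    have := Finset.card_le_card hsub
    rw [Finset.card_sdiff_of_subset (Finset.subset_univ _), Finset.card_pair hij, Finset.card_univ,
      Fintype.card_fin] at this
    omega
  have hinj := hli.injective
  have s1 : ∑ i ∈ U, a i = 1 := by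
    rw [← hs.1]
    exact Finset.sum_filter_ne_zero _
  have s2 : ∑ i ∈ U, a i • v i = ∑ i, a i • v i := by
    refine Finset.sum_filter_of_ne fun i _ h h0 => h (by rw [h0, zero_smul])
  have s3 : ∑ y ∈ T.image w, (Function.extend w c 0) y • y = ∑ j, c j • w j := by
    rw [Finset.sum_image fun _ _ _ _ h => hinj h]
    simp only [hinj.extend_apply]
    exact Finset.sum_filter_of_ne fun i _ h h0 => h (by rw [h0, zero_smul])
  refine hv (T.image w) (hw T) U ?_ a (Function.extend w c 0) (fun i _ => hx _) s1 ?_ ?_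
  · rw [Finset.card_image_of_injective _ hinj]
    omega
  · intro y hy
    obtain ⟨j, _, rfl⟩ := Finset.mem_image.1 hy
    rw [hinj.extend_apply]
    exact hx _
  · rw [s2, s3]
    exact hs.2

/-- The first homogeneous coordinate is the sum of the weights of the simplex, so these vanish; the
weights of the cone then vanish by linear independence. -/
theorem positive_kernel {p m : ℕ} (v : Fin p → Vec d) {w : Fin m → Vec d}
    (hli : LinearIndependent ℝ w) (x : Fin (p + m) → ℝ) (hx : ∀ i, 0 ≤ x i)
    (hs : ∑ k, x k • (Fin.append (fun i => hpt (v i)) fun j => hdir (w j)) k = 0) : x = 0 := by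
  have hz : (0 : Fin (d + 1) → ℝ) = Fin.cons 0 (0 : Vec d) := by
    funext k
    refine Fin.cases ?_ (fun k => ?_) k <;> simp
  rw [sum_append, hz, cons_eq_cons_iff] at hs
  have h1 := (Finset.sum_eq_zero_iff_of_nonneg fun i _ => hx _).1 hs.1
  have h2 := hs.2
  rw [Finset.sum_eq_zero fun i hi => by rw [h1 i hi, zero_smul], zero_sub, neg_eq_zero] at h2
  have h3 := Fintype.linearIndependent_iff.1 hli _ h2
  funext k
  exact Fin.addCases (fun i => h1 i (Finset.mem_univ _)) (fun j => h3 j) k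

theorem castAdd_succAbove_castAdd {p m : ℕ} (h : p + (m + 1) = p + 1 + m) (i : Fin (p + 1))
    (a : Fin p) : (Fin.castAdd (m + 1) i : Fin (p + 1 + m + 1)).succAbove
      (Fin.cast h (Fin.castAdd (m + 1) a)) = Fin.castAdd (m + 1) (i.succAbove a) := by
  ext
  simp [Fin.succAbove, Fin.lt_def, apply_ite]

theorem castAdd_succAbove_natAdd {p m : ℕ} (h : p + (m + 1) = p + 1 + m) (i : Fin (p + 1))
    (b : Fin (m + 1)) : (Fin.castAdd (m + 1) i : Fin (p + 1 + m + 1)).succAbove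
      (Fin.cast h (Fin.natAdd p b)) = Fin.natAdd (p + 1) b := by
  ext
  have := i.2
  simp only [Fin.succAbove, Fin.lt_def, Fin.val_castSucc, Fin.val_cast, Fin.val_natAdd,
    Fin.val_castAdd]
  split_ifs
  · omega
  · simp
    omega

theorem natAdd_succAbove_castAdd {p m : ℕ} (j : Fin (m + 1)) (a : Fin (p + 1)) :
    (Fin.natAdd (p + 1) j : Fin (p + 1 + m + 1)).succAbove (Fin.castAdd m a) =
      Fin.castAdd (m + 1) a := by
  ext
  have := a.2
  simp only [Fin.succAbove, Fin.lt_def, Fin.val_castSucc, Fin.val_natAdd, Fin.val_castAdd]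
  split_ifs
  · simp
  · omega

theorem natAdd_succAbove_natAdd {p m : ℕ} (j : Fin (m + 1)) (b : Fin m) :
    (Fin.natAdd (p + 1) j : Fin (p + 1 + m + 1)).succAbove (Fin.natAdd (p + 1) b) =
      Fin.natAdd (p + 1) (j.succAbove b) := by
  ext
  simp only [Fin.succAbove, Fin.lt_def, Fin.val_castSucc, Fin.val_natAdd]
  split_ifs <;> simp <;> omega

/-- The simplex meets the cone in a segment when `p + m = d`; its ends lie on faces of the simplex
or on faces of the cone. Splitting the face sum of the joint family into these two kinds gives both
sides, and the sign is the offset `p + 1` of the second block. -/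
theorem faceSum_crossing {𝒮 : Set (Finset (Vec d))} {p m : ℕ} {v : Fin (p + 1) → Vec d}
    {w : Fin (m + 1) → Vec d} (hv : Transverse 𝒮 v)
    (hw : ∀ t : Finset (Fin (m + 1)), open Classical in t.image w ∈ 𝒮)
    (hli : LinearIndependent ℝ w) :
    faceSum (fun v' => crossing v' w) v = (-1) ^ p * faceSum (fun w' => crossing v w') w := by
  let u : Fin (p + 1 + (m + 1)) → Fin (d + 1) → ℝ :=
    Fin.append (fun i => hpt (v i)) fun j => hdir (w j)
  have h := faceSum_originSign (n := p + 1 + m) u (positive_kernel v hli)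
    (fun hn => general_position hv hw hli (by omega))
  have e : faceSum (n := p + 1 + m) originSign u = faceSum (fun v' => crossing v' w) v +
      (-1) ^ (p + 1) * faceSum (fun w' => crossing v w') w := by
    simp only [faceSum]
    refine (Fin.sum_univ_add (a := p + 1) (b := m + 1) _).trans ?_
    rw [Finset.mul_sum]
    congr 1
    · refine Finset.sum_congr rfl fun i _ => ?_
      rw [Fin.val_castAdd]
      congr 1
      refine originSign_cast (by omega) fun k => ?_
      refine Fin.addCases (fun a => ?_) (fun b => ?_) k
      · rw [Fin.append_left]
        exact (congrArg u (castAdd_succAbove_castAdd _ i a)).trans (Fin.append_left _ _ _)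
      · rw [Fin.append_right]
        exact (congrArg u (castAdd_succAbove_natAdd _ i b)).trans (Fin.append_right _ _ _)
    · refine Finset.sum_congr rfl fun j _ => ?_
      rw [Fin.val_natAdd, smul_eq_mul, smul_eq_mul, pow_add, mul_assoc]
      congr 2
      refine originSign_cast rfl fun k => ?_
      refine Fin.addCases (fun a => ?_) (fun b => ?_) k
      · rw [Fin.append_left]
        exact (congrArg u (natAdd_succAbove_castAdd j a)).trans (Fin.append_left _ _ _)
      · rw [Fin.append_right]
        exact (congrArg u (natAdd_succAbove_natAdd j b)).trans (Fin.append_right _ _ _)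
  rw [e] at h
  rw [pow_succ] at h
  linarith

/-- For the zero-dimensional cone there are no faces on the second side, so only the faces of the
simplex remain. -/
theorem faceSum_crossing_nil {𝒮 : Set (Finset (Vec d))} (h𝒮 : ∅ ∈ 𝒮) {p : ℕ}
    {v : Fin (p + 1) → Vec d} (hv : Transverse 𝒮 v) :
    faceSum (fun v' => originSign fun i => hpt (v' i)) v = 0 := by
  have hw : ∀ t : Finset (Fin 0), (open Classical in t.image (Fin.elim0 : Fin 0 → Vec d)) ∈ 𝒮 := by
    intro t
    rw [Finset.eq_empty_of_isEmpty t, Finset.image_empty]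
    exact h𝒮
  have hli : LinearIndependent ℝ (Fin.elim0 : Fin 0 → Vec d) := linearIndependent_empty_type
  have e : (Fin.append (fun i => hpt (v i)) fun j => hdir ((Fin.elim0 : Fin 0 → Vec d) j) :
      Fin (p + 1 + 0) → Fin (d + 1) → ℝ) = fun i => hpt (v i) := by
    funext k
    exact Fin.append_left _ _ k
  have h1 := fun x hx hs => positive_kernel v hli x hx hs
  have h2 := fun hn x hx hs => general_position hv hw hli (show p + 1 + 0 = d + 2 by omega) x hx hs
  rw [e] at h1
  have := faceSum_originSign (fun i => hpt (v i)) h1 (fun hn => by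
    have := h2
    rw [e] at this
    exact this (by omega))
  exact this

end Crossing

end

end PointGroupLSM

namespace PointGroupLSM

noncomputable section

/-! ### Generic vertices and the sign of a zero -/

section GeneralPosition

variable {d : ℕ}

open MeasureTheory Classical in
-- A bad new vertex lies in the linear span of fewer than `d` vectors, taken from the old vertices
-- and the generators of one cone. Each such span is a null set, and there are finitely many of
-- them.
theorem ae_transverse_cons {𝒮 : Set (Finset (Vec d))} (h𝒮 : 𝒮.Finite) {q : ℕ}
    {v : Fin q → Vec d} (hv : Transverse 𝒮 v) :
    ∀ᵐ x : Vec d, Transverse 𝒮 (Fin.cons x v : Fin (q + 1) → Vec d) := by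
  have h1 : ∀ s ∈ 𝒮, ∀ u : Finset (Fin q), ∀ᵐ x : Vec d, u.card + 1 + s.card ≤ d →
      x ∉ Submodule.span ℝ ((u.image v ∪ s : Finset (Vec d)) : Set (Vec d)) := by
    intro s _ u
    by_cases h : u.card + 1 + s.card ≤ d
    · have hne : Submodule.span ℝ ((u.image v ∪ s : Finset (Vec d)) : Set (Vec d)) ≠ ⊤ := by
        intro ht
        have h2 := finrank_span_finset_le_card (R := ℝ) (u.image v ∪ s)
        rw [Set.finrank, ht, finrank_top, Module.finrank_fin_fun] at h2
        have h3 := Finset.card_union_le (u.image v) s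
        have h4 := Finset.card_image_le (s := u) (f := v)
        omega
      have := Measure.addHaar_submodule (volume : Measure (Vec d)) _ hne
      rw [measure_eq_zero_iff_ae_notMem] at this
      filter_upwards [this] with x hx _ using hx
    · exact Filter.Eventually.of_forall fun x h' => absurd h' h
  have h2 : ∀ᵐ x : Vec d, ∀ s ∈ 𝒮, ∀ u : Finset (Fin q), u.card + 1 + s.card ≤ d →
      x ∉ Submodule.span ℝ ((u.image v ∪ s : Finset (Vec d)) : Set (Vec d)) :=
    (ae_ball_iff h𝒮.countable).2 fun s hs => ae_all_iff.2 fun u => h1 s hs u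
  filter_upwards [h2] with x hx
  intro s hs u hu a c ha ha1 hc he
  set u' : Finset (Fin q) := Finset.univ.filter fun i => i.succ ∈ u with hu'
  have hsum : ∀ {B : Type} [AddCommGroup B] (f : Fin (q + 1) → B), ∑ i ∈ u, f i =
      (if (0 : Fin (q + 1)) ∈ u then f 0 else 0) + ∑ i ∈ u', f i.succ := by
    intro B _ f
    have : ∑ i ∈ u, f i = ∑ i, if i ∈ u then f i else 0 := by
      rw [← Finset.sum_filter, Finset.filter_mem_eq_inter, Finset.univ_inter]
    rw [hu', Finset.sum_filter, this]
    exact Fin.sum_univ_succ _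
  have hcard : u.card = (if (0 : Fin (q + 1)) ∈ u then 1 else 0) + u'.card := by
    have := hsum (B := ℤ) fun _ => 1
    simp only [Finset.sum_const, nsmul_eq_mul, mul_one] at this
    split_ifs at this ⊢ <;> omega
  rw [hsum] at he ha1
  simp only [Fin.cons_zero, Fin.cons_succ] at he
  -- If the new vertex has nonzero weight, the relation can be solved for it, which places it in one
  -- of the excluded spans. Otherwise the relation involves only the old simplex.
  by_cases h0 : (0 : Fin (q + 1)) ∈ u ∧ a 0 ≠ 0
  · rw [if_pos h0.1] at he ha1 hcard
    refine hx s hs u' (by omega) ?_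
    have e : x = (a 0)⁻¹ • (∑ y ∈ s, c y • y - ∑ i ∈ u', a i.succ • v i) := by
      rw [← he, add_sub_cancel_right, smul_smul, inv_mul_cancel₀ h0.2, one_smul]
    rw [e]
    refine Submodule.smul_mem _ _ (Submodule.sub_mem _ (Submodule.sum_mem _ fun y hy => ?_)
      (Submodule.sum_mem _ fun i hi => ?_))
    · exact Submodule.smul_mem _ _ (Submodule.subset_span (by simp [hy]))
    · refine Submodule.smul_mem _ _ (Submodule.subset_span ?_)
      rw [Finset.mem_coe, Finset.mem_union]
      exact Or.inl (Finset.mem_image_of_mem v hi)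
  · have e1 : (if (0 : Fin (q + 1)) ∈ u then a 0 else 0) = 0 := by
      split_ifs with h
      · by_contra h'
        exact h0 ⟨h, h'⟩
      · rfl
    have e2 : (if (0 : Fin (q + 1)) ∈ u then a 0 • x else 0) = 0 := by
      split_ifs with h
      · rw [if_pos h] at e1
        rw [e1, zero_smul]
      · rfl
    rw [e2, zero_add] at he
    rw [e1, zero_add] at ha1
    refine hv s hs u' (by omega) (fun i => a i.succ) c (fun i hi => ha _ ?_) ha1 hc he
    exact (Finset.mem_filter.1 hi).2

theorem mem_convexHull_range_iff {ι E : Type*} [Fintype ι] [AddCommGroup E] [Module ℝ E]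
    (v : ι → E) (x : E) : x ∈ convexHull ℝ (Set.range v) ↔
      ∃ a : ι → ℝ, (∀ i, 0 ≤ a i) ∧ ∑ i, a i = 1 ∧ ∑ i, a i • v i = x := by
  classical
  have h := (Fintype.linearCombination ℝ v).image_convexHull
    (Set.range fun i : ι => (Pi.single i 1 : ι → ℝ))
  rw [convexHull_rangle_single_eq_stdSimplex, ← Set.range_comp] at h
  have e : (Fintype.linearCombination ℝ v ∘ fun i : ι => (Pi.single i 1 : ι → ℝ)) = v := by
    funext i
    simp
  rw [e] at h
  rw [← h]
  simp only [Set.mem_image, stdSimplex, Set.mem_ofPred_eq, Fintype.linearCombination_apply, and_assoc]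

/-- Avoiding the origin is transversality to the single cone with no generators, so the results on
transversality cover genericity as well. -/
theorem isGeneric_iff {q : ℕ} (v : Fin q → Vec d) : IsGeneric v ↔ Transverse {∅} v := by
  have key : ∀ s : Finset (Fin q), (0 : Vec d) ∈ convexHull ℝ (v '' (s : Set (Fin q))) ↔
      ∃ a : Fin q → ℝ, (∀ i ∈ s, 0 ≤ a i) ∧ ∑ i ∈ s, a i = 1 ∧ ∑ i ∈ s, a i • v i = 0 := by
    intro s
    have hr : v '' (s : Set (Fin q)) = Set.range fun i : s => v i := by
      ext x
      simp
    rw [hr, mem_convexHull_range_iff]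
    constructor
    · rintro ⟨a, ha, h1, h0⟩
      refine ⟨fun i => if h : i ∈ s then a ⟨i, h⟩ else 0, fun i hi => ?_, ?_, ?_⟩
      · simp only [dif_pos hi]
        exact ha _
      · rw [← Finset.sum_coe_sort, ← h1]
        simp
      · rw [← Finset.sum_coe_sort, ← h0]
        simp
    · rintro ⟨a, ha, h1, h0⟩
      refine ⟨fun i => a i, fun i => ha i i.2, ?_, ?_⟩
      · rw [← h1]
        exact Finset.sum_coe_sort s a
      · rw [← h0]
        exact Finset.sum_coe_sort s fun i => a i • v i
  simp only [IsGeneric, key, Transverse, Set.mem_singleton_iff, forall_eq, Finset.card_empty,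
    add_zero, Finset.sum_empty, not_exists, not_and, Finset.notMem_empty, false_imp_iff,
    implies_true, true_imp_iff]
  exact ⟨fun h u hu a _ => h u hu a, fun h s hs a => h s hs a 0⟩

theorem ae_isGeneric_cons {q : ℕ} {v : Fin q → Vec d} (hv : IsGeneric v) :
    ∀ᵐ x : Vec d, IsGeneric (Fin.cons x v : Fin (q + 1) → Vec d) := by
  simp only [isGeneric_iff] at hv ⊢
  exact ae_transverse_cons (Set.finite_singleton _) hv

theorem containsOrigin_hpt {q : ℕ} (v : Fin q → Vec d) :
    ContainsOrigin (fun i => hpt (v i)) ↔ (0 : Vec d) ∈ convexHull ℝ (Set.range v) := by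
  rw [mem_convexHull_range_iff]
  refine exists_congr fun a => and_congr_right fun _ => ?_
  have := hcomb_eq Finset.univ (∅ : Finset (Fin 0)) a 0 v Fin.elim0
  rw [Finset.sum_empty, Finset.sum_empty, add_zero, sub_zero] at this
  rw [this, hpt, cons_eq_cons_iff]

/-- Subtract the first row from all others and expand along the first column, which has become (1,
0, …, 0). -/
theorem det_hpt (v : Fin (d + 1) → Vec d) : (Matrix.of fun i => hpt (v i)).det =
    (Matrix.of fun i : Fin d => v i.succ - v 0).det := by
  rw [Matrix.det_eq_of_forall_row_eq_smul_add_const (A := Matrix.of fun i => hpt (v i))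
    (B := Matrix.of (Fin.cons (hpt (v 0)) fun i : Fin d => hpt (v i.succ) - hpt (v 0)))
    (fun i => if i = 0 then 0 else 1) 0 (if_pos rfl)]
  · rw [Matrix.det_succ_column_zero, Fin.sum_univ_succ, Finset.sum_eq_zero]
    · rw [Fin.val_zero, pow_zero, one_mul, add_zero]
      have h : (Matrix.of (Fin.cons (hpt (v 0)) fun i : Fin d => hpt (v i.succ) - hpt (v 0)) :
        Matrix (Fin (d + 1)) (Fin (d + 1)) ℝ) 0 0 = 1 := rfl
      rw [h, one_mul]
      congr 1
    · intro i _
      have h : (Matrix.of (Fin.cons (hpt (v 0)) fun i : Fin d => hpt (v i.succ) - hpt (v 0)) :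
        Matrix (Fin (d + 1)) (Fin (d + 1)) ℝ) i.succ 0 = 0 := sub_self (1 : ℝ)
      rw [h, mul_zero, zero_mul]
  · intro i j
    refine Fin.cases ?_ (fun i => ?_) i
    · simp
    · simp [Fin.succ_ne_zero]

theorem zeroSign_eq (v : Fin (d + 1) → Vec d) : zeroSign v = originSign fun i => hpt (v i) := by
  rw [originSign, dif_pos rfl, zeroSign]
  by_cases h : (0 : Vec d) ∈ convexHull ℝ (Set.range v)
  · rw [if_pos h, if_pos ((containsOrigin_hpt v).2 h), ← det_hpt]
    rfl
  · rw [if_neg h, if_neg fun h' => h ((containsOrigin_hpt v).1 h')]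

theorem zeroSign_perm (v : Fin (d + 1) → Vec d) (e : Equiv.Perm (Fin (d + 1))) :
    zeroSign (v ∘ e) = ((Equiv.Perm.sign e : ℤˣ) : ℤ) * zeroSign v := by
  rw [zeroSign_eq, zeroSign_eq, originSign_hpt_perm]

theorem faceSum_zeroSign {v : Fin (d + 2) → Vec d} (hv : IsGeneric v) : faceSum zeroSign v = 0 := by
  rw [isGeneric_iff] at hv
  have : (zeroSign : (Fin (d + 1) → Vec d) → ℤ) = fun v => originSign fun i => hpt (v i) :=
    funext zeroSign_eq
  rw [this]
  exact faceSum_crossing_nil (Set.mem_singleton _) hv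

theorem zeroSign_mulVec (M : Matrix (Fin d) (Fin d) ℝ) (hM : IsUnit M.det)
    (v : Fin (d + 1) → Vec d) :
    zeroSign (fun i => M *ᵥ v i) = ((SignType.sign M.det : SignType) : ℤ) * zeroSign v := by
  have h1 : (0 : Vec d) ∈ convexHull ℝ (Set.range fun i => M *ᵥ v i) ↔
      (0 : Vec d) ∈ convexHull ℝ (Set.range v) := by
    have e : (Set.range fun i => M *ᵥ v i) = M.mulVecLin '' Set.range v := by
      rw [← Set.range_comp]
      rfl
    rw [e, ← LinearMap.image_convexHull]
    constructor
    · rintro ⟨x, hx, h⟩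
      have hx0 : x = 0 := by
        have := Matrix.mulVec_injective_of_isUnit ((Matrix.isUnit_iff_isUnit_det M).2 hM)
        exact this (h.trans (Matrix.mulVec_zero M).symm)
      rwa [← hx0]
    · exact fun h => ⟨0, h, map_zero _⟩
  have h2 : (Matrix.of fun i : Fin d => M *ᵥ v i.succ - M *ᵥ v 0).det =
      M.det * (Matrix.of fun i : Fin d => v i.succ - v 0).det := by
    rw [mul_comm, ← Matrix.det_transpose M, ← Matrix.det_mul]
    congr 1
    ext i j
    simp only [Matrix.of_apply, ← Matrix.mulVec_sub, Matrix.mul_apply, Matrix.transpose_apply,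
      Matrix.mulVec, dotProduct]
    exact Finset.sum_congr rfl fun _ _ => mul_comm _ _
  by_cases h : (0 : Vec d) ∈ convexHull ℝ (Set.range v)
  · rw [zeroSign, zeroSign, if_pos h, if_pos (h1.2 h), h2, sign_mul, SignType.coe_mul]
  · rw [zeroSign, zeroSign, if_neg h, if_neg fun h' => h (h1.1 h'), mul_zero]

end GeneralPosition

end

end PointGroupLSM

namespace PointGroupLSM

noncomputable section

/-! ### Sections over oriented simplices, and the Euler class -/

section Fillings

variable {d : ℕ}

/-- Chains of generic affine simplices. -/
abbrev genericChains (d q : ℕ) : AddSubgroup (AffineChain d q) := chainsIn {v | IsGeneric v}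

/-- The number of zeros of a chain of affine `d`-simplices. -/
def countZeros (d : ℕ) : AffineChain d (d + 1) →+ ℤ := chainLift zeroSign

@[simp]
theorem countZeros_simplex (v : Fin (d + 1) → Vec d) : countZeros d (simplex v) = zeroSign v := by
  simp [countZeros]

/-- Each of the finitely many simplices excludes only a null set of apices. -/
theorem exists_apex {q : ℕ} (c : AffineChain d q) : ∃ x : Vec d, ∀ v ∈ c.support, IsGeneric v →
    IsGeneric (Fin.cons x v : Fin (q + 1) → Vec d) := by
  have h : ∀ᵐ x : Vec d, ∀ v ∈ c.support, IsGeneric v →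
      IsGeneric (Fin.cons x v : Fin (q + 1) → Vec d) :=
    (MeasureTheory.ae_ball_iff (Finset.countable_toSet c.support)).2 fun v _ => by
      by_cases hv : IsGeneric v
      · filter_upwards [ae_isGeneric_cons hv] with x hx _ using hx
      · exact Filter.Eventually.of_forall fun _ h => absurd h hv
  exact h.exists

/-- The generic cone over a chain. -/
def coneOff {q : ℕ} (c : AffineChain d q) : AffineChain d (q + 1) := cone (exists_apex c).choose c

theorem coneOff_mem {q : ℕ} {c : AffineChain d q} (hc : c ∈ genericChains d q) :
    coneOff c ∈ genericChains d (q + 1) := by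
  have h := (exists_apex c).choose_spec
  refine chainLift_mem (S := {v | v ∈ c.support}) (fun v hv => hv) fun v hv => ?_
  exact single_mem_chainsIn (h v hv (hc v hv)) 1

theorem bdry_coneOff_sub_mem {q : ℕ} {c : AffineChain d (q + 1)} (hc : bdry c ∈ altRel d q) :
    bdry (coneOff c) - c ∈ altRel d (q + 1) := by
  rw [coneOff, bdry_cone, sub_sub_cancel_left]
  exact neg_mem (cone_mem_altRel _ hc)

theorem countZeros_eq_zero_of_mem_altRel {c : AffineChain d (d + 1)} (hc : c ∈ altRel d (d + 1)) :
    countZeros d c = 0 := by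
  rw [← AddSubgroup.mem_bot]
  refine map_mem_of_mem_altRel (fun v e => ?_) hc
  rw [countZeros_simplex, countZeros_simplex, zeroSign_perm, smul_eq_mul, sub_self]
  exact zero_mem _

theorem countZeros_bdry {c : AffineChain d (d + 2)} (hc : c ∈ genericChains d (d + 2)) :
    countZeros d (bdry c) = 0 := by
  have h : ∀ v ∈ {v : Fin (d + 2) → Vec d | IsGeneric v},
      countZeros d (faceSum simplex v) = (0 : (Fin (d + 2) → Vec d) → ℤ) v := fun v hv => by
    rw [map_faceSum]
    simp only [countZeros_simplex]
    exact faceSum_zeroSign hv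
  rw [bdry, map_chainLift, chainLift_congr hc h, chainLift_apply]
  simp

/-- Generic cycles have no zeros in total. -/
theorem countZeros_eq_zero {c : AffineChain d (d + 1)} (hc : c ∈ genericChains d (d + 1))
    (hb : bdry c ∈ altRel d d) : countZeros d c = 0 := by
  -- The boundary of the generic cone over `c` is `c` minus the cone over `bdry c`. The latter
  -- counts zero because it vanishes as a chain of oriented simplices.
  have h1 := countZeros_bdry (coneOff_mem hc)
  have h2 := countZeros_eq_zero_of_mem_altRel (cone_mem_altRel (exists_apex c).choose hb)
  rw [coneOff, bdry_cone, map_sub, h2, sub_zero] at h1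
  exact h1

theorem isGeneric_mulVec {M : Matrix (Fin d) (Fin d) ℝ} (hM : IsUnit M.det) {q : ℕ}
    {v : Fin q → Vec d} (hv : IsGeneric v) : IsGeneric fun i => M *ᵥ v i := by
  rw [isGeneric_iff] at hv ⊢
  intro s hs u hu a c ha ha1 hc h
  refine hv s hs u hu a c ha ha1 hc ?_
  rw [Set.mem_singleton_iff.1 hs, Finset.sum_empty] at h ⊢
  refine Matrix.mulVec_injective_of_isUnit ((Matrix.isUnit_iff_isUnit_det M).2 hM) ?_
  rw [Matrix.mulVec_zero, ← h, ← Matrix.mulVecLin_apply, map_sum]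
  simp

theorem isUnit_det (M : O d) : IsUnit M.1.det := by
  rcases det_cases M with h | h <;> rw [h] <;> simp

theorem act_mem_generic (M : O d) {q : ℕ} {c : AffineChain d q} (hc : c ∈ genericChains d q) :
    act M.1 c ∈ genericChains d q :=
  chainLift_mem hc fun _ hv => single_mem_chainsIn (isGeneric_mulVec (isUnit_det M) hv) 1

theorem countZeros_act (M : O d) (c : AffineChain d (d + 1)) :
    countZeros d (act M.1 c) = ((SignType.sign M.1.det : SignType) : ℤ) * countZeros d c := by
  have h : (countZeros d).comp (act M.1) =
      (AddMonoidHom.mulLeft ((SignType.sign M.1.det : SignType) : ℤ)).comp (countZeros d) :=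
    chain_hom_ext fun v => by
      simp only [AddMonoidHom.comp_apply, act_simplex, countZeros_simplex,
        AddMonoidHom.coe_mulLeft]
      exact zeroSign_mulVec _ (isUnit_det M) v
  exact DFunLike.congr_fun h c

end Fillings

/-! ### Sections, their homotopies and the obstruction class -/

section Sections

variable {d : ℕ} {P : Type*} [Group P]

theorem orientation_coe [TopologicalSpace P] [DiscreteTopology P] (ρ : P →* O d) (g : P) :
    ((orientation ρ g : ℤˣ) : ℤ) = ((SignType.sign (ρ g).1.det : SignType) : ℤ) := by
  change ((if 0 < (ρ g).1.det then 1 else -1 : ℤˣ) : ℤ) = _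
  rcases det_cases (ρ g) with h | h <;> rw [h] <;> norm_num

theorem measurable_of_discrete {P : Type*} [TopologicalSpace P] [DiscreteTopology P] {A : Type*}
    [AddCommGroup A] [TopologicalSpace A] [IsTopologicalAddGroup A] [SecondCountableTopology A]
    {n : ℕ} (f : (Fin n → P) → A) : f ∈ measurableCochains P A n := by
  change @Measurable _ _ (borel _) (borel _) f
  rw [borel_eq_top_of_discrete]
  exact @measurable_from_top _ _ (borel _) f

/-- The translate of a tuple whose first entry is the identity. -/
abbrev normalize {q : ℕ} (g : Fin (q + 1) → P) : Fin (q + 1) → P := fun i => (g 0)⁻¹ * g i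

theorem normalize_mul {q : ℕ} (h : P) (g : Fin (q + 1) → P) :
    normalize (fun i => h * g i) = normalize g := by
  funext i
  simp only [normalize]
  group

theorem act_hom_mul (ρ : P →* O d) {q : ℕ} (g h : P) (c : AffineChain d q) :
    act (ρ (g * h)).1 c = act (ρ g).1 (act (ρ h).1 c) := by
  rw [map_mul, Submonoid.coe_mul, act_mul]

theorem act_hom_one (ρ : P →* O d) {q : ℕ} (c : AffineChain d q) : act (ρ 1).1 c = c := by
  rw [map_one]
  exact act_one c

/-- A generic piecewise affine section, up to reorderings of the vertices of simplices. -/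
structure OrientedSection (ρ : P →* O d) where
  chain : (q : ℕ) → (Fin q → P) → AffineChain d q
  generic : ∀ q ≤ d + 1, ∀ g : Fin q → P, chain q g ∈ genericChains d q
  equivariant : ∀ q ≤ d + 1, ∀ (h : P) (g : Fin q → P),
    chain q (fun i => h * g i) - act (ρ h).1 (chain q g) ∈ altRel d q
  chain_zero : ∀ g : Fin 0 → P, chain 0 g = simplex Fin.elim0
  boundary : ∀ q ≤ d, ∀ g : Fin (q + 1) → P,
    bdry (chain (q + 1) g) - faceSum (chain q) g ∈ altRel d q

/-- A generic section is in particular a section over oriented simplices. -/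
def GenericSection.toOriented {ρ : P →* O d} (S : GenericSection ρ) : OrientedSection ρ where
  chain := S.chain
  generic q hq g v hv := S.generic q hq g v hv
  equivariant q hq h g := by
    rw [S.equivariant q hq h g, mapDomain_eq_act, sub_self]
    exact zero_mem _
  chain_zero := S.chain_zero
  boundary q hq g := by
    rw [← affineBoundary_eq, S.boundary q hq g, faceSum, sub_self]
    exact zero_mem _

namespace OrientedSection

variable {ρ : P →* O d} (S S' : OrientedSection ρ)

/-- The number of zeros over the simplices of `EP`. -/
def count (g : Fin (d + 1) → P) : ℤ := countZeros d (S.chain (d + 1) g)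

theorem count_mul (h : P) (g : Fin (d + 1) → P) :
    S.count (fun i => h * g i) = ((SignType.sign (ρ h).1.det : SignType) : ℤ) * S.count g := by
  have e := countZeros_eq_zero_of_mem_altRel (S.equivariant (d + 1) le_rfl h g)
  rwa [map_sub, countZeros_act, sub_eq_zero] at e

/-- The chains over the faces of a (d+1)-simplex add up to a generic chain whose boundary is trivial
up to reordering, and such a chain has no zeros in total. -/
theorem faceSum_count (g : Fin (d + 2) → P) : faceSum S.count g = 0 := by
  have h : faceSum S.count g = countZeros d (faceSum (S.chain (d + 1)) g) :=
    (map_faceSum _ _ _).symm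
  rw [h]
  refine countZeros_eq_zero (faceSum_mem fun i => S.generic _ le_rfl _) ?_
  rw [map_faceSum]
  have e : faceSum (fun g => bdry (S.chain (d + 1) g) - faceSum (S.chain d) g) g ∈ altRel d d :=
    faceSum_mem fun i => S.boundary d le_rfl _
  have e' := faceSum_sub (fun g => bdry (S.chain (d + 1) g)) (faceSum (S.chain d)) g
  rw [faceSum_faceSum, sub_zero] at e'
  rw [← e']
  exact e

/-- The difference of two sections which is to be filled, given a homotopy in lower dimensions. -/
def difference {q : ℕ} (h : (Fin q → P) → AffineChain d (q + 1)) (g : Fin (q + 1) → P) :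
    AffineChain d (q + 1) :=
  S.chain (q + 1) g - S'.chain (q + 1) g - faceSum h g

/-- A homotopy between two sections. -/
def homotopy : (q : ℕ) → (Fin q → P) → AffineChain d (q + 1)
  | 0 => fun _ => 0
  -- The apex is chosen for tuples starting at the identity and transported by `ρ (g 0)`. Hence the
  -- homotopy is strictly equivariant, although the sections are so only up to reordering.
  | q + 1 => fun g => act (ρ (g 0)).1 (coneOff (difference S S' (homotopy q) (normalize g)))

theorem homotopy_mul (q : ℕ) (h : P) (g : Fin q → P) :
    homotopy S S' q (fun i => h * g i) = act (ρ h).1 (homotopy S S' q g) := by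
  cases q with
  | zero => exact (map_zero _).symm
  | succ q => simp only [homotopy, normalize_mul, act_hom_mul]

theorem difference_generic {q : ℕ} (hq : q ≤ d) {h : (Fin q → P) → AffineChain d (q + 1)}
    (hh : ∀ g, h g ∈ genericChains d (q + 1)) (g : Fin (q + 1) → P) :
    difference S S' h g ∈ genericChains d (q + 1) :=
  sub_mem (sub_mem (S.generic _ (by omega) g) (S'.generic _ (by omega) g))
    (faceSum_mem fun _ => hh _)

theorem homotopy_generic (q : ℕ) (hq : q ≤ d + 1) (g : Fin q → P) :
    homotopy S S' q g ∈ genericChains d (q + 1) := by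
  induction q with
  | zero => exact zero_mem _
  | succ q ih =>
    exact act_mem_generic _ (coneOff_mem (difference_generic S S' (by omega) (ih (by omega)) _))

/-- The homotopy is strictly equivariant, so the only defect comes from the two sections; this is
the price for normalising before coning. -/
theorem difference_normalize {q : ℕ} (hq : q ≤ d) (g : Fin (q + 1) → P) :
    act (ρ (g 0)).1 (difference S S' (homotopy S S' q) (normalize g)) -
      difference S S' (homotopy S S' q) g ∈ altRel d (q + 1) := by
  have e : g = fun i => g 0 * normalize g i := by
    funext i
    simp [normalize]
  have h1 := S.equivariant (q + 1) (by omega) (g 0) (normalize g)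
  have h2 := S'.equivariant (q + 1) (by omega) (g 0) (normalize g)
  have h3 : act (ρ (g 0)).1 (faceSum (homotopy S S' q) (normalize g)) =
      faceSum (homotopy S S' q) g := by
    rw [map_faceSum]
    simp only [← homotopy_mul]
    conv_rhs => rw [e]
    rfl
  rw [← e] at h1 h2
  simp only [difference, map_sub, h3]
  convert sub_mem h2 h1 using 1
  abel

theorem bdry_homotopy {q : ℕ} (hq : q ≤ d) (g : Fin (q + 1) → P)
    (h : bdry (difference S S' (homotopy S S' q) (normalize g)) ∈ altRel d q) :
    bdry (homotopy S S' (q + 1) g) - difference S S' (homotopy S S' q) g ∈ altRel d (q + 1) := by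
  rw [homotopy, bdry_act]
  convert add_mem (act_mem_altRel (ρ (g 0)).1 (bdry_coneOff_sub_mem h))
    (difference_normalize S S' hq g) using 1
  rw [map_sub]
  abel

/-- Induction over the skeleta: the boundary of the lower homotopy is the previous difference, whose
face sum equals that of the two sections because the double face sum of the homotopy vanishes. -/
theorem bdry_difference (q : ℕ) (hq : q ≤ d) (g : Fin (q + 1) → P) :
    bdry (difference S S' (homotopy S S' q) g) ∈ altRel d q := by
  induction q with
  | zero =>
    have h1 := S.boundary 0 hq g
    have h2 := S'.boundary 0 hq g
    have e : faceSum (S.chain 0) g = faceSum (S'.chain 0) g := by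
      simp only [faceSum, S.chain_zero, S'.chain_zero]
    have e0 : faceSum (homotopy S S' 0) g = 0 := by simp [faceSum, homotopy]
    rw [difference, e0, sub_zero, map_sub]
    rw [e] at h1
    convert sub_mem h1 h2 using 1
    abel
  | succ q ih =>
    have h1 := S.boundary (q + 1) hq g
    have h2 := S'.boundary (q + 1) hq g
    have h3 : faceSum (fun g => bdry (homotopy S S' (q + 1) g) -
        difference S S' (homotopy S S' q) g) g ∈ altRel d (q + 1) :=
      faceSum_mem fun i => bdry_homotopy S S' (by omega) _ (ih (by omega) _)
    have e3 := faceSum_sub (fun g => bdry (homotopy S S' (q + 1) g))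
      (difference S S' (homotopy S S' q)) g
    have e4 : faceSum (difference S S' (homotopy S S' q)) g =
        faceSum (S.chain (q + 1)) g - faceSum (S'.chain (q + 1)) g := by
      have := faceSum_sub (S.chain (q + 1) - S'.chain (q + 1)) (faceSum (homotopy S S' q)) g
      rw [faceSum_faceSum, sub_zero] at this
      exact this.trans (faceSum_sub _ _ g)
    have e5 : bdry (faceSum (homotopy S S' (q + 1)) g) =
        faceSum (fun g => bdry (homotopy S S' (q + 1) g)) g := map_faceSum _ _ _
    rw [difference, map_sub, map_sub, e5]
    have h4 := sub_mem (sub_mem h1 h2) h3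
    rw [show faceSum (fun g => bdry (homotopy S S' (q + 1) g) -
      difference S S' (homotopy S S' q) g) g = _ from e3, e4] at h4
    convert h4 using 1
    abel

/-- In the top degree the difference of the sections, corrected by the homotopy, is a generic cycle
and has no zeros. The zeros over the homotopy therefore form the cochain whose coboundary is the
difference. -/
theorem count_sub_count (g : Fin (d + 1) → P) :
    S.count g - S'.count g = faceSum (fun k => countZeros d (homotopy S S' d k)) g := by
  have h := countZeros_eq_zero
    (difference_generic S S' le_rfl (homotopy_generic S S' d (by omega)) g)
    (bdry_difference S S' d le_rfl g)
  rw [difference, map_sub, map_sub, map_faceSum, sub_eq_zero] at h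
  exact h

/-- The number of zeros over the simplices of `BP`. -/
def zeroCount : (Fin d → P) → ℤ := fun g => S.count (Fin.partialProd g)

variable [TopologicalSpace P] [DiscreteTopology P]

theorem zeroCount_mem_cocycles : S.zeroCount ∈ cocycles ℤ (orientation ρ) d := by
  refine ⟨measurable_of_discrete _, ?_⟩
  change coboundary _ _ _ = 0
  funext g
  exact (coboundary_partialProd _ S.count (fun h g => by
    rw [count_mul, ← orientation_coe]
    rfl) g).trans (S.faceSum_count _)

theorem zeroCount_sub_mem_coboundaries :
    S.zeroCount - S'.zeroCount ∈ coboundaries ℤ (orientation ρ) d := by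
  have h := fun g : Fin d → P => count_sub_count S S' (Fin.partialProd g)
  rcases d with _ | n
  -- For `d = 0` the only coboundary is zero, and the homotopy vanishes in degree zero.
  · change S.zeroCount - S'.zeroCount = 0
    funext g
    refine (h g).trans ?_
    simp [faceSum, homotopy]
  · refine ⟨fun g => countZeros (n + 1) (homotopy S S' (n + 1) (Fin.partialProd g)),
      measurable_of_discrete _, ?_⟩
    funext g
    refine (coboundary_partialProd _ (fun k => countZeros (n + 1) (homotopy S S' (n + 1) k))
      (fun k g => ?_) g).trans (h g).symm
    rw [homotopy_mul, countZeros_act, ← orientation_coe]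
    rfl

end OrientedSection

/-- The chains of a generic section. -/
def sectionChain (ρ : P →* O d) : (q : ℕ) → (Fin q → P) → AffineChain d q
  | 0 => fun _ => simplex Fin.elim0
  | q + 1 => fun g => act (ρ (g 0)).1 (coneOff (faceSum (sectionChain ρ q) (normalize g)))

theorem sectionChain_mul (ρ : P →* O d) (q : ℕ) (h : P) (g : Fin q → P) :
    sectionChain ρ q (fun i => h * g i) = act (ρ h).1 (sectionChain ρ q g) := by
  cases q with
  | zero =>
    simp only [sectionChain, act_simplex]
    exact congrArg simplex (Subsingleton.elim _ _)
  | succ q => simp only [sectionChain, normalize_mul, act_hom_mul]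

theorem faceSum_normalize (ρ : P →* O d) {q : ℕ} {f : (Fin q → P) → AffineChain d q}
    (hf : ∀ (h : P) g, f (fun i => h * g i) = act (ρ h).1 (f g)) (g : Fin (q + 1) → P) :
    act (ρ (g 0)).1 (faceSum f (normalize g)) = faceSum f g := by
  rw [map_faceSum]
  simp only [← hf]
  have e : g = fun i => g 0 * normalize g i := by
    funext i
    simp [normalize]
  conv_rhs => rw [e]
  rfl

theorem sectionChain_generic (ρ : P →* O d) (q : ℕ) (g : Fin q → P) :
    sectionChain ρ q g ∈ genericChains d q := by
  induction q with
  | zero =>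
    refine single_mem_chainsIn ?_ 1
    intro s _
    rw [Finset.eq_empty_of_isEmpty s]
    simp
  | succ q ih => exact act_mem_generic _ (coneOff_mem (faceSum_mem fun i => ih _))

/-- The face sum over the boundary is a cycle by induction, so the boundary of its cone is the face
sum itself. All identities are exact here, since `sectionChain` is strictly equivariant. -/
theorem bdry_sectionChain (ρ : P →* O d) (q : ℕ) (g : Fin (q + 1) → P) :
    bdry (sectionChain ρ (q + 1) g) = faceSum (sectionChain ρ q) g := by
  induction q with
  | zero =>
    refine Eq.trans ?_ (faceSum_normalize ρ (sectionChain_mul ρ 0) g)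
    rw [show sectionChain ρ (0 + 1) g = act (ρ (g 0)).1
      (coneOff (faceSum (sectionChain ρ 0) (normalize g))) from rfl, bdry_act, coneOff,
      bdry_cone_zero]
  | succ q ih =>
    rw [sectionChain, bdry_act, coneOff, bdry_cone, map_faceSum]
    simp only [ih]
    rw [show faceSum (fun w => faceSum (sectionChain ρ q) w) (normalize g) = 0 from
      faceSum_faceSum _ _, map_zero, sub_zero,
      faceSum_normalize ρ (sectionChain_mul ρ (q + 1))]

theorem nonempty_genericSection (ρ : P →* O d) : Nonempty (GenericSection ρ) :=
  ⟨{ chain := sectionChain ρ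
     generic := fun q _ g v hv => sectionChain_generic ρ q g v hv
     equivariant := fun q _ h g => by rw [sectionChain_mul, mapDomain_eq_act]
     chain_zero := fun _ => rfl
     boundary := fun q _ g => by
      rw [affineBoundary_eq, bdry_sectionChain]
      rfl }⟩

variable [TopologicalSpace P] [DiscreteTopology P]

theorem represents_mk_iff {G A : Type*} [Group G] [TopologicalSpace G] [AddCommGroup A]
    [TopologicalSpace A] [IsTopologicalAddGroup A] [SecondCountableTopology A] {χ : G →ₜ* ℤˣ}
    {n : ℕ} {f f' : (Fin n → G) → A} (hf : f ∈ cocycles A χ n) (hf' : f' ∈ cocycles A χ n) :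
    Represents (QuotientAddGroup.mk ⟨f, hf⟩ : Cohomology A χ n) f' ↔
      f' - f ∈ coboundaries A χ n := by
  constructor
  · rintro ⟨h, e⟩
    have := QuotientAddGroup.eq.1 e
    rw [AddSubgroup.mem_addSubgroupOf] at this
    rw [sub_eq_neg_add]
    exact this
  · intro h
    refine ⟨hf', QuotientAddGroup.eq.2 ?_⟩
    rw [AddSubgroup.mem_addSubgroupOf]
    rw [sub_eq_neg_add] at h
    exact h

/-- The definition of `eulerClass` picks one generic section; existence makes its fallback void, and
the homotopy compares the picked section with `S`. -/
theorem OrientedSection.represents {ρ : P →* O d} (S : OrientedSection ρ) :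
    Represents (eulerClass ρ) S.zeroCount := by
  have hex : ∃ S : GenericSection ρ, S.zeroCount ∈ cocycles ℤ (orientation ρ) d := by
    obtain ⟨S⟩ := nonempty_genericSection ρ
    exact ⟨S, S.toOriented.zeroCount_mem_cocycles⟩
  rw [eulerClass, dif_pos hex, represents_mk_iff hex.choose_spec S.zeroCount_mem_cocycles]
  exact S.zeroCount_sub_mem_coboundaries hex.choose.toOriented

theorem GenericSection.represents {ρ : P →* O d} (S : GenericSection ρ) :
    Represents (eulerClass ρ) S.zeroCount :=
  S.toOriented.represents

/-- The Euler class is determined by the number of zeros over the `d`-simplices of `BP` of any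
extension of a section over the `(d-1)`-skeleton. -/
theorem represents_eulerClass_of_filling (ρ : P →* O d)
    (chain : (q : ℕ) → (Fin q → P) → AffineChain d q)
    (generic : ∀ q ≤ d, ∀ g : Fin q → P, chain q g ∈ genericChains d q)
    (equivariant : ∀ q ≤ d, ∀ (h : P) (g : Fin q → P),
      chain q (fun i => h * g i) - act (ρ h).1 (chain q g) ∈ altRel d q)
    (chain_zero : ∀ g : Fin 0 → P, chain 0 g = simplex Fin.elim0)
    (boundary : ∀ q < d, ∀ g : Fin (q + 1) → P,
      bdry (chain (q + 1) g) - faceSum (chain q) g ∈ altRel d q)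
    (E : (Fin d → P) → ℤ)
    (filling : ∀ g : Fin d → P, ∃ c ∈ genericChains d (d + 1),
      bdry c - faceSum (chain d) (Fin.partialProd g) ∈ altRel d d ∧ countZeros d c = E g) :
    Represents (eulerClass ρ) E := by
  choose fill fill_gen fill_bdry fill_count using filling
  -- The fillings are given only for simplices starting at the identity; the others are translates.
  let top : (Fin (d + 1) → P) → AffineChain d (d + 1) := fun g =>
    act (ρ (g 0)).1 (fill fun i => (g i.castSucc)⁻¹ * g i.succ)
  let chain' : (q : ℕ) → (Fin q → P) → AffineChain d q := fun q g =>
    if h : q = d + 1 then (by subst h; exact top g) else chain q g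
  have hlow : ∀ q ≤ d, chain' q = chain q := fun q hq => by
    funext g
    exact dif_neg (by omega)
  have htop : chain' (d + 1) = top := by
    funext g
    exact dif_pos rfl
  have hnorm : ∀ g : Fin (d + 1) → P,
      normalize g = Fin.partialProd fun i => (g i.castSucc)⁻¹ * g i.succ := by
    intro g
    have h := Fin.partialProd_left_inv g
    funext i
    have hi := congrFun h i
    rw [Pi.smul_apply, smul_eq_mul] at hi
    rw [normalize, ← hi, inv_mul_cancel_left]
  let S : OrientedSection ρ :=
    { chain := chain'
      generic := fun q hq g => by
        rcases Nat.lt_or_ge d q with h | h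
        · obtain rfl : q = d + 1 := by omega
          rw [htop]
          exact act_mem_generic _ (fill_gen _)
        · rw [hlow q h]
          exact generic q h g
      equivariant := fun q hq h g => by
        rcases Nat.lt_or_ge d q with hq' | hq'
        · obtain rfl : q = d + 1 := by omega
          rw [htop]
          have e : top (fun i => h * g i) = act (ρ h).1 (top g) := by
            simp only [top, act_hom_mul, mul_inv_rev]
            congr 3
            funext i
            group
          rw [e, sub_self]
          exact zero_mem _
        · rw [hlow q hq']
          exact equivariant q hq' h g
      chain_zero := fun g => by
        rw [hlow 0 (Nat.zero_le d)]
        exact chain_zero g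
      boundary := fun q hq g => by
        rcases hq.lt_or_eq with h | rfl
        · rw [hlow q hq, hlow (q + 1) h]
          exact boundary q h g
        · rw [hlow q le_rfl, htop]
          -- Translating the filling makes it bound the translated boundary chain; this differs from
          -- the boundary chain over `g` by the failure of `chain` to be strictly equivariant, which
          -- lies in `altRel`.
          have h1 := act_mem_altRel (ρ (g 0)).1
            (fill_bdry fun i => (g i.castSucc)⁻¹ * g i.succ)
          rw [← hnorm, map_sub, map_faceSum] at h1
          have h2 : faceSum (fun k => chain q (fun i => g 0 * k i) - act (ρ (g 0)).1 (chain q k))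
              (normalize g) ∈ altRel q q := faceSum_mem fun i => equivariant q le_rfl _ _
          have e2 := faceSum_sub (fun k => chain q (fun i => g 0 * k i))
            (fun k => act (ρ (g 0)).1 (chain q k)) (normalize g)
          have e3 : faceSum (fun k => chain q (fun i => g 0 * k i)) (normalize g) =
              faceSum (chain q) g := by
            rw [faceSum_comp (fun x => g 0 * x) (chain q)]
            congr 1
            funext i
            simp [normalize]
          rw [show faceSum (fun k => chain q (fun i => g 0 * k i) - act (ρ (g 0)).1 (chain q k))
            (normalize g) = _ from e2, e3] at h2
          rw [bdry_act]
          convert sub_mem h1 h2 using 1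
          abel }
  have hE : S.zeroCount = E := by
    funext g
    change countZeros d (chain' (d + 1) (Fin.partialProd g)) = E g
    rw [htop]
    simp only [top, Fin.partialProd_zero, Fin.partialProd_right_inv, act_hom_one]
    exact fill_count g
  rw [← hE]
  exact S.represents

/-- The Euler class vanishes if there is an invariant vector. -/
theorem eulerClass_eq_zero (ρ : P →* O d) {x : Vec d} (hx : x ≠ 0)
    (hρ : ∀ g, (ρ g).1 *ᵥ x = x) : eulerClass ρ = 0 := by
  have hull : ∀ {q : ℕ} (s : Set (Fin q)), (0 : Vec d) ∉ convexHull ℝ ((fun _ : Fin q => x) '' s) := by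
    intro q s h
    have h1 : (fun _ : Fin q => x) '' s ⊆ {x} := by
      rintro _ ⟨_, _, rfl⟩
      rfl
    have h2 := convexHull_mono h1 h
    rw [convexHull_singleton, Set.mem_singleton_iff] at h2
    exact hx h2.symm
  -- The constant section with value `x`: all its simplices are degenerate, concentrated at `x`, and
  -- never meet the origin.
  let S : GenericSection ρ :=
    { chain := fun q _ => simplex fun _ => x
      generic := fun q _ g v hv s _ => by
        rw [Finset.mem_singleton.1 (Finsupp.support_single_subset hv)]
        exact hull _
      equivariant := fun q _ h g => by
        rw [mapDomain_eq_act, act_simplex]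
        simp only [hρ]
      chain_zero := fun g => congrArg simplex (Subsingleton.elim _ _)
      boundary := fun q _ g => by
        rw [affineBoundary_eq, bdry_simplex]
        rfl }
  obtain ⟨h, e⟩ := S.represents
  have h0 : S.zeroCount = 0 := by
    funext g
    change countZeros d (simplex fun _ => x) = 0
    rw [countZeros_simplex, zeroSign, if_neg]
    rw [← Set.image_univ]
    exact hull _
  have e' : (⟨S.zeroCount, h⟩ : cocycles ℤ (orientation ρ) d) = 0 := Subtype.ext h0
  rw [e, e']
  exact map_zero (QuotientAddGroup.mk' _)

/-- The Euler class of an odd-dimensional representation has order two. -/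
theorem two_nsmul_eulerClass (ρ : P →* O d) (hd : Odd d) : 2 • eulerClass ρ = 0 := by
  have hdet : (-1 : Matrix (Fin d) (Fin d) ℝ).det = -1 := by
    rw [Matrix.det_neg, Matrix.det_one, Fintype.card_fin, hd.neg_one_pow, mul_one]
  have hu : IsUnit (-1 : Matrix (Fin d) (Fin d) ℝ).det := by rw [hdet]; simp
  obtain ⟨S⟩ := nonempty_genericSection ρ
  let T := S.toOriented
  -- The negative of the section. Negation commutes with the representation and has determinant -1
  -- for odd `d`, so every zero changes sign while the class stays the same.
  let T' : OrientedSection ρ :=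
    { chain := fun q g => act (-1) (T.chain q g)
      generic := fun q hq g => chainLift_mem (T.generic q hq g) fun v hv =>
        single_mem_chainsIn (isGeneric_mulVec hu hv) 1
      equivariant := fun q hq h g => by
        have := act_mem_altRel (-1) (T.equivariant q hq h g)
        have e : act (-1) (act (ρ h).1 (T.chain q g)) = act (ρ h).1 (act (-1) (T.chain q g)) := by
          rw [← act_mul, ← act_mul, neg_one_mul, mul_neg_one]
        rwa [map_sub, e] at this
      chain_zero := fun g => by
        rw [T.chain_zero, act_simplex]
        exact congrArg simplex (Subsingleton.elim _ _)
      boundary := fun q hq g => by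
        have := act_mem_altRel (-1) (T.boundary q hq g)
        rwa [map_sub, map_faceSum, ← bdry_act] at this }
  have hneg : ∀ c, countZeros d (act (-1) c) = -countZeros d c := by
    intro c
    have h : (countZeros d).comp (act (-1)) = -countZeros d := chain_hom_ext fun v => by
      simp only [AddMonoidHom.comp_apply, act_simplex, countZeros_simplex,
        AddMonoidHom.neg_apply]
      rw [zeroSign_mulVec _ hu v, hdet]
      simp
    exact DFunLike.congr_fun h c
  obtain ⟨h, e⟩ := T.represents
  obtain ⟨h', e'⟩ := T'.represents
  have hc : T'.zeroCount = -T.zeroCount := funext fun g => hneg _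
  have e2 : (⟨T'.zeroCount, h'⟩ : cocycles ℤ (orientation ρ) d) = -⟨T.zeroCount, h⟩ :=
    Subtype.ext hc
  have e3 : eulerClass ρ = -eulerClass ρ := by
    conv_lhs => rw [e', e2]
    conv_rhs => rw [e]
    exact map_neg (QuotientAddGroup.mk' _) _
  rw [two_nsmul]
  nth_rewrite 1 [e3]
  exact neg_add_cancel _

end Sections

end

end PointGroupLSM

namespace PointGroupLSM

noncomputable section

/-! ### Chains of cones, and their pairing with affine simplices -/

theorem sign_mul_sign {q : ℕ} (e : Equiv.Perm (Fin q)) :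
    ((Equiv.Perm.sign e : ℤˣ) : ℤ) * ((Equiv.Perm.sign e : ℤˣ) : ℤ) = 1 := by
  rcases Int.units_eq_one_or (Equiv.Perm.sign e) with h | h <;> simp [h]

theorem cons_comp_perm {α : Type*} {q : ℕ} (x : α) (w : Fin q → α) (e : Equiv.Perm (Fin q)) :
    (Fin.cons x (w ∘ e) : Fin (q + 1) → α) =
      (Fin.cons x w : Fin (q + 1) → α) ∘ Equiv.Perm.decomposeFin.symm (0, e) := by
  funext i
  refine Fin.cases ?_ (fun j => ?_) i <;> simp

theorem cons_removeNth_eq {α : Type*} {q : ℕ} (w : Fin (q + 1) → α) (j : Fin (q + 1)) :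
    (Fin.cons (w j) (fun i => w (j.succAbove i)) : Fin (q + 1) → α) = w ∘ j.cycleRange.symm := by
  funext i
  refine Fin.cases ?_ (fun i => ?_) i
  · simp [Fin.cycleRange_symm_zero]
  · simp [Fin.cycleRange_symm_succ]

theorem exists_perm_of_image_eq {α : Type*} [DecidableEq α] {q : ℕ} {w w' : Fin q → α}
    (hw' : Function.Injective w')
    (h : Finset.univ.image w = Finset.univ.image w') : ∃ e : Equiv.Perm (Fin q), w' = w ∘ e := by
  have h1 : ∀ i, ∃ j, w j = w' i := fun i => by
    have : w' i ∈ Finset.univ.image w := by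
      rw [h]
      exact Finset.mem_image_of_mem _ (Finset.mem_univ i)
    simpa using this
  choose f hf using h1
  have hinj : Function.Injective f := fun i j hij => hw' (by rw [← hf, ← hf, hij])
  exact ⟨Equiv.ofBijective f (Finite.injective_iff_bijective.1 hinj), funext fun i => (hf i).symm⟩

theorem image_comp_perm {α : Type*} [DecidableEq α] {q : ℕ} (w : Fin q → α)
    (e : Equiv.Perm (Fin q)) : Finset.univ.image (w ∘ e) = Finset.univ.image w := by
  ext x
  simp only [Finset.mem_image, Finset.mem_univ, true_and, Function.comp_apply]
  exact ⟨fun ⟨i, h⟩ => ⟨e i, h⟩, fun ⟨i, h⟩ => ⟨e.symm i, by simpa using h⟩⟩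

theorem image_cons {α : Type*} [DecidableEq α] {q : ℕ} (x : α) (w : Fin q → α) :
    Finset.univ.image (Fin.cons x w : Fin (q + 1) → α) = insert x (Finset.univ.image w) := by
  ext y
  simp only [Finset.mem_image, Finset.mem_univ, true_and, Finset.mem_insert, Fin.exists_fin_succ,
    Fin.cons_zero, Fin.cons_succ, eq_comm]

namespace ConeComplex

variable {d : ℕ} (F : ConeComplex d)

theorem mem_rays {x : Vec d} : x ∈ F.rays ↔ ∃ s ∈ F.cones, x ∈ s := by
  simp [rays]

/-- The vectors `w` are the distinct generators of one of the cones. -/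
def IsCone {q : ℕ} (w : Fin q → Vec d) : Prop :=
  Function.Injective w ∧ Finset.univ.image w ∈ F.cones

variable {F} in
theorem IsCone.comp_perm {q : ℕ} {w : Fin q → Vec d} (hw : F.IsCone w) (e : Equiv.Perm (Fin q)) :
    F.IsCone (w ∘ e) :=
  ⟨hw.1.comp e.injective, by rw [image_comp_perm]; exact hw.2⟩

theorem isCone_comp_perm {q : ℕ} {w : Fin q → Vec d} (e : Equiv.Perm (Fin q)) :
    F.IsCone (w ∘ e) ↔ F.IsCone w := by
  refine ⟨fun h => ?_, fun h => h.comp_perm e⟩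
  have := h.comp_perm e.symm
  rwa [Function.comp_assoc, Equiv.self_comp_symm, Function.comp_id] at this

theorem isCone_cons {q : ℕ} {x : Vec d} {w : Fin q → Vec d} :
    F.IsCone (Fin.cons x w : Fin (q + 1) → Vec d) ↔
      x ∉ Finset.univ.image w ∧ Function.Injective w ∧
        insert x (Finset.univ.image w) ∈ F.cones := by
  rw [IsCone, image_cons, Fin.cons_injective_iff]
  simp [and_assoc]

variable {F} in
theorem IsCone.of_cons {q : ℕ} {x : Vec d} {w : Fin q → Vec d}
    (h : F.IsCone (Fin.cons x w : Fin (q + 1) → Vec d)) : F.IsCone w ∧ x ∈ F.rays := by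
  obtain ⟨_, h1, h2⟩ := F.isCone_cons.1 h
  exact ⟨⟨h1, F.face_mem _ h2 _ (Finset.subset_insert _ _)⟩,
    F.mem_rays.2 ⟨_, h2, Finset.mem_insert_self _ _⟩⟩

variable {F} in
theorem IsCone.linearIndependent {q : ℕ} {w : Fin q → Vec d} (h : F.IsCone w) :
    LinearIndependent ℝ w := by
  have h1 := F.linearIndepOn _ h.2
  rw [Finset.coe_image, Finset.coe_univ, Set.image_univ] at h1
  exact (linearIndepOn_id_range_iff h.1).1 h1

variable {F} in
theorem IsCone.card_image {q : ℕ} {w : Fin q → Vec d} (h : F.IsCone w) :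
    (Finset.univ.image w).card = q := by
  rw [Finset.card_image_of_injective _ h.1, Finset.card_univ, Fintype.card_fin]

variable {F} in
theorem IsCone.le {q : ℕ} {w : Fin q → Vec d} (h : F.IsCone w) : q ≤ d := by
  have := h.linearIndependent.fintype_card_le_finrank
  simpa using this

variable {F} in
theorem IsCone.image_mem {q : ℕ} {w : Fin q → Vec d} (h : F.IsCone w) (t : Finset (Fin q)) :
    t.image w ∈ F.cones :=
  F.face_mem _ h.2 _ (Finset.image_subset_image (Finset.subset_univ _))

open Classical in
/-- An enumeration of the generators of a cone. -/
def enum (m : ℕ) (s : Finset (Vec d)) : Fin m → Vec d :=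
  if h : s.card = m then fun i => s.equivFin.symm (Fin.cast h.symm i) else 0

theorem enum_injective {m : ℕ} {s : Finset (Vec d)} (h : s.card = m) :
    Function.Injective (enum m s) := by
  intro i j hij
  simpa [enum, h] using hij

theorem image_enum {m : ℕ} {s : Finset (Vec d)} (h : s.card = m) :
    Finset.univ.image (enum m s) = s := by
  ext x
  simp only [Finset.mem_image, Finset.mem_univ, true_and, enum, dif_pos h]
  constructor
  · rintro ⟨i, rfl⟩
    exact Subtype.coe_prop _
  · intro hx
    exact ⟨Fin.cast h (s.equivFin ⟨x, hx⟩), by simp⟩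

/-- The cones of dimension `m`. -/
def conesOf (m : ℕ) : Finset (Finset (Vec d)) := F.cones.filter fun s => s.card = m

variable {F} in
theorem isCone_enum {m : ℕ} {s : Finset (Vec d)} (hs : s ∈ F.conesOf m) : F.IsCone (enum m s) := by
  obtain ⟨h1, h2⟩ := Finset.mem_filter.1 hs
  exact ⟨enum_injective h2, by rw [image_enum h2]; exact h1⟩

variable {F} in
theorem IsCone.mem_conesOf {m : ℕ} {w : Fin m → Vec d} (h : F.IsCone w) :
    Finset.univ.image w ∈ F.conesOf m :=
  Finset.mem_filter.2 ⟨h.2, h.card_image⟩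

variable {F} in
theorem IsCone.exists_perm {m : ℕ} {w : Fin m → Vec d} (h : F.IsCone w) :
    ∃ e : Equiv.Perm (Fin m), w = enum m (Finset.univ.image w) ∘ e :=
  exists_perm_of_image_eq h.1 (image_enum h.card_image)

/-- Double counting of flags: a cone with a distinguished generator is a facet with an added ray.
The symmetry of `H` makes the choice of enumerations irrelevant. -/
theorem sum_conesOf_succ {B : Type*} [AddCommGroup B] {m : ℕ}
    (H : Vec d → (Fin m → Vec d) → B) (hsymm : ∀ x w (e : Equiv.Perm (Fin m)), H x (w ∘ e) = H x w)
    (h0 : ∀ x w, ¬F.IsCone (Fin.cons x w : Fin (m + 1) → Vec d) → H x w = 0) :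
    ∑ s ∈ F.conesOf (m + 1), ∑ j : Fin (m + 1),
      H (enum (m + 1) s j) (fun i => enum (m + 1) s (j.succAbove i)) =
    ∑ s ∈ F.conesOf m, ∑ x ∈ F.rays, H x (enum m s) := by
  have h1 : ∀ s ∈ F.conesOf (m + 1), ∑ j : Fin (m + 1),
      H (enum (m + 1) s j) (fun i => enum (m + 1) s (j.succAbove i)) =
      ∑ x ∈ s, H x (enum m (s.erase x)) := by
    intro s hs
    have hc := (Finset.mem_filter.1 hs).2
    have hinj := enum_injective hc
    have hs' : ∀ x, x ∈ s ↔ ∃ i, enum (m + 1) s i = x := fun x => by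
      have h := congrArg (x ∈ ·) (image_enum hc)
      simpa using h.symm
    have hsum : ∀ φ : Vec d → B, ∑ x ∈ s, φ x = ∑ j, φ (enum (m + 1) s j) := fun φ => by
      refine (Finset.sum_bij (fun j _ => enum (m + 1) s j) (fun j _ => (hs' _).2 ⟨j, rfl⟩)
        (fun _ _ _ _ h => hinj h) (fun x hx => ?_) fun _ _ => rfl).symm
      obtain ⟨j, rfl⟩ := (hs' x).1 hx
      exact ⟨j, Finset.mem_univ _, rfl⟩
    rw [hsum]
    refine Finset.sum_congr rfl fun j _ => ?_
    have hmem : enum (m + 1) s j ∈ s := (hs' _).2 ⟨j, rfl⟩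
    have hce : (s.erase (enum (m + 1) s j)).card = m := by
      rw [Finset.card_erase_of_mem hmem, hc, Nat.add_sub_cancel]
    obtain ⟨e, he⟩ := exists_perm_of_image_eq (w := enum m (s.erase (enum (m + 1) s j)))
      (w' := fun i => enum (m + 1) s (j.succAbove i))
      (fun a b h => Fin.succAbove_right_injective (hinj h)) (by
        rw [image_enum hce]
        ext x
        rw [Finset.mem_erase, hs']
        simp only [Finset.mem_image, Finset.mem_univ, true_and]
        constructor
        · rintro ⟨hne, i, rfl⟩
          have : i ≠ j := fun h => hne (by rw [h])
          obtain ⟨k, rfl⟩ := Fin.exists_succAbove_eq this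
          exact ⟨k, rfl⟩
        · rintro ⟨k, rfl⟩
          exact ⟨fun h => Fin.succAbove_ne j k (hinj h), _, rfl⟩)
    rw [he, hsymm]
  rw [Finset.sum_congr rfl h1, Finset.sum_sigma', Finset.sum_sigma']
  refine Finset.sum_bij_ne_zero (fun p _ _ => ⟨p.1.erase p.2, p.2⟩) ?_ ?_ ?_ ?_
  · rintro ⟨s, x⟩ hp _
    rw [Finset.mem_sigma] at hp ⊢
    obtain ⟨hs, hx⟩ := hp
    obtain ⟨hs1, hs2⟩ := Finset.mem_filter.1 hs
    exact ⟨Finset.mem_filter.2 ⟨F.face_mem s hs1 _ (Finset.erase_subset _ _), by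
      rw [Finset.card_erase_of_mem hx, hs2, Nat.add_sub_cancel]⟩, F.mem_rays.2 ⟨s, hs1, hx⟩⟩
  · rintro ⟨s, x⟩ hp _ ⟨s', x'⟩ hp' _ h
    rw [Finset.mem_sigma] at hp hp'
    simp only [Sigma.mk.injEq, heq_eq_eq] at h
    obtain ⟨h1, rfl⟩ := h
    have h2 : insert x (s.erase x) = insert x (s'.erase x) := by rw [h1]
    rw [Finset.insert_erase hp.2, Finset.insert_erase hp'.2] at h2
    subst h2
    rfl
  · rintro ⟨s, x⟩ hp hne
    rw [Finset.mem_sigma] at hp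
    have hc : F.IsCone (Fin.cons x (enum m s) : Fin (m + 1) → Vec d) := by
      by_contra h
      exact hne (h0 _ _ h)
    have hcs := (Finset.mem_filter.1 hp.1).2
    obtain ⟨hx, _, hi⟩ := F.isCone_cons.1 hc
    rw [image_enum hcs] at hx hi
    refine ⟨⟨insert x s, x⟩, ?_, ?_, ?_⟩
    · rw [Finset.mem_sigma]
      exact ⟨Finset.mem_filter.2 ⟨hi, by rw [Finset.card_insert_of_notMem hx, hcs]⟩,
        Finset.mem_insert_self _ _⟩
    · rw [Finset.erase_insert hx]
      exact hne
    · simp only [Finset.erase_insert hx]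
  · rintro ⟨s, x⟩ _ _
    rfl

variable {A B C : Type*} [AddCommGroup A] [AddCommGroup B] [AddCommGroup C]

variable {F} in
theorem chains_eq_zero {m : ℕ} {c : (Fin m → Vec d) → A} (hc : c ∈ F.chains A m)
    {w : Fin m → Vec d} (hw : ¬F.IsCone w) : c w = 0 := by
  by_contra h
  exact hw (hc.1 w h)

variable {F} in
theorem chains_perm {m : ℕ} {c : (Fin m → Vec d) → A} (hc : c ∈ F.chains A m)
    (w : Fin m → Vec d) (e : Equiv.Perm (Fin m)) :
    c (w ∘ e) = ((Equiv.Perm.sign e : ℤˣ) : ℤ) • c w := hc.2 e w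

variable {F} in
theorem chains_cons_perm {m : ℕ} {c : (Fin (m + 1) → Vec d) → A} (hc : c ∈ F.chains A (m + 1))
    (x : Vec d) (w : Fin m → Vec d) (e : Equiv.Perm (Fin m)) :
    c (Fin.cons x (w ∘ e)) = ((Equiv.Perm.sign e : ℤˣ) : ℤ) • c (Fin.cons x w) := by
  rw [cons_comp_perm, chains_perm hc, Equiv.Perm.decomposeFin.symm_sign, if_pos rfl, one_mul]

variable {F} in
theorem boundary_mem {m : ℕ} {c : (Fin (m + 1) → Vec d) → A} (hc : c ∈ F.chains A (m + 1)) :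
    F.boundary A m c ∈ F.chains A m := by
  refine ⟨fun w h => ?_, fun e w => ?_⟩
  · by_contra hw
    refine h ?_
    change -∑ x ∈ F.rays, c (Fin.cons x w) = 0
    rw [Finset.sum_eq_zero fun x _ => ?_, neg_zero]
    exact chains_eq_zero hc fun h' => hw h'.of_cons.1
  · change -∑ x ∈ F.rays, c (Fin.cons x (w ∘ e)) = _ • -∑ x ∈ F.rays, c (Fin.cons x w)
    simp only [chains_cons_perm hc, smul_neg, Finset.smul_sum]

/-- The pairing of a cellular chain with an alternating function. -/
def sumCones (β : A →+ B →+ C) {m : ℕ} (c : (Fin m → Vec d) → A) (φ : (Fin m → Vec d) → B) : C :=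
  ∑ s ∈ F.conesOf m, β (c (enum m s)) (φ (enum m s))

/-- Stokes' theorem for chains of cones. Moving the omitted generator to the front costs the sign of
a cycle, which cancels the sign in the face sum; the minus comes from the convention for `boundary`.
-/
theorem sumCones_faceSum (β : A →+ B →+ C) {m : ℕ} {c : (Fin (m + 1) → Vec d) → A}
    (hc : c ∈ F.chains A (m + 1)) {φ : (Fin m → Vec d) → B}
    (hφ : ∀ w (e : Equiv.Perm (Fin m)), φ (w ∘ e) = ((Equiv.Perm.sign e : ℤˣ) : ℤ) • φ w) :
    F.sumCones β c (faceSum φ) = -F.sumCones β (F.boundary A m c) φ := by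
  have h := F.sum_conesOf_succ (fun x w => β (c (Fin.cons x w)) (φ w))
    (fun x w e => by
      simp only [chains_cons_perm hc, hφ, map_zsmul, AddMonoidHom.coe_smul, Pi.smul_apply,
        smul_smul, sign_mul_sign, one_smul])
    (fun x w h => by rw [chains_eq_zero hc h, map_zero, AddMonoidHom.zero_apply])
  simp only [sumCones]
  have e1 : ∀ s ∈ F.conesOf (m + 1), β (c (enum (m + 1) s)) (faceSum φ (enum (m + 1) s)) =
      ∑ j : Fin (m + 1), β (c (Fin.cons (enum (m + 1) s j)
        fun i => enum (m + 1) s (j.succAbove i))) (φ fun i => enum (m + 1) s (j.succAbove i)) := by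
    intro s _
    simp only [faceSum, map_sum, map_zsmul]
    refine Finset.sum_congr rfl fun j _ => ?_
    rw [cons_removeNth_eq, chains_perm hc, Equiv.Perm.sign_symm, Fin.sign_cycleRange, map_zsmul]
    simp
  rw [Finset.sum_congr rfl e1, h, ← Finset.sum_neg_distrib]
  refine Finset.sum_congr rfl fun s _ => ?_
  change _ = -β (-∑ x ∈ F.rays, c (Fin.cons x (enum m s))) (φ (enum m s))
  simp only [map_neg, map_sum, AddMonoidHom.neg_apply, neg_neg, AddMonoidHom.finsetSum_apply]

/-- The total crossing number of an affine simplex and a chain of cones. -/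
def pairing {p m : ℕ} (v : Fin p → Vec d) (c : (Fin m → Vec d) → A) : A :=
  F.sumCones (smulAddHom ℤ A).flip c (crossing v)

theorem pairing_eq {p m : ℕ} (v : Fin p → Vec d) (c : (Fin m → Vec d) → A) :
    F.pairing v c = ∑ s ∈ F.conesOf m, crossing v (enum m s) • c (enum m s) := rfl

theorem empty_mem : ∅ ∈ F.cones := by
  obtain ⟨s, hs, _⟩ := F.existsUnique_mem 0
  exact F.face_mem s hs.1 ∅ (Finset.empty_subset s)

/-- Move the faces from the simplex to each cone by `faceSum_crossing`, then from the cones to the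
chain by Stokes. -/
theorem faceSum_pairing {p m : ℕ} {v : Fin (p + 1) → Vec d} (hv : Transverse F.cones v)
    {c : (Fin (m + 1) → Vec d) → A} (hc : c ∈ F.chains A (m + 1)) :
    faceSum (fun v' => F.pairing v' c) v = (-1 : ℤ) ^ (p + 1) • F.pairing v (F.boundary A m c) := by
  have h := F.sumCones_faceSum (smulAddHom ℤ A).flip hc (φ := crossing v)
    (fun w e => by rw [crossing_perm_right, smul_eq_mul])
  rw [pow_succ, mul_neg_one, neg_smul, ← smul_neg, pairing, ← h]
  simp only [faceSum, pairing_eq, sumCones, Finset.smul_sum]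
  rw [Finset.sum_comm]
  refine Finset.sum_congr rfl fun s hs => ?_
  have hcr := faceSum_crossing hv (fun t => (isCone_enum hs).image_mem t)
    (isCone_enum hs).linearIndependent
  simp only [smul_smul, ← Finset.sum_smul, AddMonoidHom.flip_apply, smulAddHom_apply]
  congr 1

theorem faceSum_pairing_zero {p : ℕ} {v : Fin (p + 1) → Vec d} (hv : Transverse F.cones v)
    (c : (Fin 0 → Vec d) → A) : faceSum (fun v' => F.pairing v' c) v = 0 := by
  simp only [faceSum, pairing_eq, Finset.smul_sum]
  rw [Finset.sum_comm]
  refine Finset.sum_eq_zero fun s _ => ?_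
  have hcr := faceSum_crossing_nil (𝒮 := (F.cones : Set (Finset (Vec d))))
    (Finset.mem_coe.2 F.empty_mem) hv
  simp only [smul_smul, ← Finset.sum_smul, crossing_nil]
  simp only [faceSum, smul_eq_mul] at hcr
  simp only [hcr, zero_smul]

/-- The pairing of chains of affine simplices with chains of cones. -/
def pairChain {p m : ℕ} (z : AffineChain d p) (c : (Fin m → Vec d) → A) : A :=
  chainLift (fun v => F.pairing v c) z

/-- Linear extension of `faceSum_pairing`: intersection numbers make the two boundary operators
adjoint up to sign. Transversality of every simplex in the chain is essential. -/
theorem pairChain_bdry {p m : ℕ} {z : AffineChain d (p + 1)}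
    (hz : z ∈ chainsIn {v | Transverse F.cones v})
    {c : (Fin (m + 1) → Vec d) → A} (hc : c ∈ F.chains A (m + 1)) :
    F.pairChain (bdry z) c = (-1 : ℤ) ^ (p + 1) • F.pairChain z (F.boundary A m c) := by
  have h1 : F.pairChain (bdry z) c =
      chainLift (fun v => chainLift (fun v => F.pairing v c) (faceSum simplex v)) z :=
    map_chainLift (chainLift fun v => F.pairing v c) _ z
  have h2 : (-1 : ℤ) ^ (p + 1) • F.pairChain z (F.boundary A m c) =
      chainLift (fun v => (-1 : ℤ) ^ (p + 1) • F.pairing v (F.boundary A m c)) z :=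
    map_chainLift (zsmulAddGroupHom (α := A) ((-1 : ℤ) ^ (p + 1))) _ z
  rw [h1, h2]
  refine chainLift_congr hz fun v hv => ?_
  rw [← F.faceSum_pairing hv hc, map_faceSum]
  simp only [chainLift_single, one_smul]

theorem pairChain_bdry_zero {p : ℕ} {z : AffineChain d (p + 1)}
    (hz : z ∈ chainsIn {v | Transverse F.cones v}) (c : (Fin 0 → Vec d) → A) :
    F.pairChain (bdry z) c = 0 := by
  have h1 : F.pairChain (bdry z) c =
      chainLift (fun v => chainLift (fun v => F.pairing v c) (faceSum simplex v)) z :=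
    map_chainLift (chainLift fun v => F.pairing v c) _ z
  have h2 : (0 : A) = chainLift (fun _ => 0) z := by rw [chainLift_apply]; simp
  rw [h1, h2]
  refine chainLift_congr hz fun v hv => ?_
  rw [← F.faceSum_pairing_zero hv c, map_faceSum]
  simp only [chainLift_single, one_smul]

/-- The cellular chain of a single oriented cone. -/
def elementary {m : ℕ} (w : Fin m → Vec d) : (Fin m → Vec d) → ℤ := fun w' =>
  ∑ e : Equiv.Perm (Fin m), if w' = w ∘ e then ((Equiv.Perm.sign e : ℤˣ) : ℤ) else 0

theorem elementary_perm {m : ℕ} (w w' : Fin m → Vec d) (e : Equiv.Perm (Fin m)) :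
    elementary w (w' ∘ e) = ((Equiv.Perm.sign e : ℤˣ) : ℤ) * elementary w w' := by
  simp only [elementary, Finset.mul_sum]
  rw [← Equiv.sum_comp (Equiv.mulRight e)]
  refine Finset.sum_congr rfl fun f _ => ?_
  have h : w' ∘ e = w ∘ (Equiv.mulRight e f : Equiv.Perm (Fin m)) ↔ w' = w ∘ f := by
    rw [Equiv.coe_mulRight, Equiv.Perm.coe_mul, ← Function.comp_assoc]
    exact e.surjective.injective_comp_right.eq_iff
  by_cases h' : w' = w ∘ f
  · rw [if_pos (h.2 h'), if_pos h', Equiv.coe_mulRight, Equiv.Perm.sign_mul, Units.val_mul, mul_comm]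
  · rw [if_neg (mt h.1 h'), if_neg h', mul_zero]

theorem exists_of_elementary_ne_zero {m : ℕ} {w w' : Fin m → Vec d} (h : elementary w w' ≠ 0) :
    ∃ e : Equiv.Perm (Fin m), w' = w ∘ e := by
  obtain ⟨e, _, he⟩ := Finset.exists_ne_zero_of_sum_ne_zero h
  refine ⟨e, ?_⟩
  by_contra h'
  exact he (if_neg h')

variable {F} in
theorem elementary_mem {m : ℕ} {w : Fin m → Vec d} (hw : F.IsCone w) :
    elementary w ∈ F.chains ℤ m := by
  refine ⟨fun w' h => ?_, fun e w' => ?_⟩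
  · obtain ⟨e, rfl⟩ := exists_of_elementary_ne_zero h
    exact hw.comp_perm e
  · rw [elementary_perm, smul_eq_mul]

theorem elementary_self {m : ℕ} {w : Fin m → Vec d} (hw : Function.Injective w) :
    elementary w w = 1 := by
  rw [elementary, Finset.sum_eq_single 1]
  · simp
  · intro e _ he
    refine if_neg fun h => he (Equiv.ext fun i => hw ?_)
    exact (congrFun h i).symm
  · simp

end ConeComplex

end

end PointGroupLSM

namespace PointGroupLSM

noncomputable section

/-! ### Geometry of cone complexes -/

/-- The closed simplicial cone spanned by `s`. -/
def closedCone {d : ℕ} (s : Finset (Vec d)) : Set (Vec d) :=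
  {x | ∃ c : Vec d → ℝ, (∀ v ∈ s, 0 ≤ c v) ∧ x = ∑ v ∈ s, c v • v}

theorem openCone_subset_closedCone {d : ℕ} (s : Finset (Vec d)) : openCone s ⊆ closedCone s :=
  fun _ ⟨c, hc, h⟩ => ⟨c, fun v hv => (hc v hv).le, h⟩

theorem exists_openCone_of_mem_closedCone {d : ℕ} {s : Finset (Vec d)} {x : Vec d}
    (h : x ∈ closedCone s) : ∃ t ⊆ s, x ∈ openCone t := by
  classical
  obtain ⟨c, hc, rfl⟩ := h
  refine ⟨s.filter (0 < c ·), Finset.filter_subset _ _, c, fun v hv => (Finset.mem_filter.1 hv).2, ?_⟩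
  rw [Finset.sum_filter]
  refine Finset.sum_congr rfl fun v hv => ?_
  split_ifs with h
  · rfl
  · rw [le_antisymm (not_lt.1 h) (hc v hv), zero_smul]

theorem isClosed_closedCone {d : ℕ} {s : Finset (Vec d)}
    (h : LinearIndepOn ℝ id (s : Set (Vec d))) : IsClosed (closedCone s) := by
  classical
  have hinj : LinearMap.ker (Fintype.linearCombination ℝ fun i : s => (i : Vec d)) = ⊥ := by
    rw [LinearMap.ker_eq_bot]
    exact LinearIndependent.fintypeLinearCombination_injective h
  have hcl : IsClosed {c : s → ℝ | ∀ i, 0 ≤ c i} := by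
    simp only [Set.ofPred_forall]
    exact isClosed_iInter fun i => isClosed_le continuous_const (continuous_apply i)
  have h2 := (LinearMap.isClosedEmbedding_of_injective hinj).isClosedMap _ hcl
  convert h2 using 1
  ext x
  constructor
  · rintro ⟨c, hc, rfl⟩
    refine ⟨fun i => c i, fun i => hc _ i.2, ?_⟩
    rw [Fintype.linearCombination_apply]
    exact Finset.sum_coe_sort s fun v => c v • v
  · rintro ⟨c, hc, rfl⟩
    refine ⟨fun v => if hv : v ∈ s then c ⟨v, hv⟩ else 0, fun v hv => ?_, ?_⟩
    · simp only [dif_pos hv]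
      exact hc _
    · rw [Fintype.linearCombination_apply, ← Finset.sum_coe_sort s]
      exact Finset.sum_congr rfl fun i _ => by simp only [dif_pos i.2, Subtype.coe_eta]

/-- An interior point of the cone spanned by `s`. -/
def center {d : ℕ} (s : Finset (Vec d)) : Vec d := ∑ v ∈ s, v

theorem center_mem {d : ℕ} (s : Finset (Vec d)) : center s ∈ openCone s :=
  ⟨fun _ => 1, fun _ _ => one_pos, by simp [center]⟩

namespace ConeComplex

variable {d : ℕ} (F : ConeComplex d)

variable {F} in
theorem cone_unique {s t : Finset (Vec d)} {x : Vec d} (hs : s ∈ F.cones) (ht : t ∈ F.cones)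
    (h : x ∈ openCone s) (h' : x ∈ openCone t) : s = t :=
  (F.existsUnique_mem x).unique ⟨hs, h⟩ ⟨ht, h'⟩

/-- The open star of a cone. -/
def star (s : Finset (Vec d)) : Set (Vec d) := {z | ∃ t ∈ F.cones, s ⊆ t ∧ z ∈ openCone t}

theorem star_mono {s t : Finset (Vec d)} (h : s ⊆ t) : F.star t ⊆ F.star s :=
  fun _ ⟨r, hr, hr', hz⟩ => ⟨r, hr, h.trans hr', hz⟩

variable {F} in
theorem center_mem_star {s : Finset (Vec d)} (hs : s ∈ F.cones) : center s ∈ F.star s :=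
  ⟨s, hs, subset_rfl, center_mem s⟩

variable {F} in
-- The point lies in exactly one open cone. That cone contains `s` because the point is in the star,
-- and it is a face of `t` because the point is in the closure of `t`.
theorem subset_of_mem_star {s t : Finset (Vec d)} {z : Vec d} (ht : t ∈ F.cones) (hz : z ∈ F.star s)
    (h : z ∈ closedCone t) : s ⊆ t := by
  obtain ⟨r, hr, hsr, hz⟩ := hz
  obtain ⟨t', ht', hz'⟩ := exists_openCone_of_mem_closedCone h
  rw [cone_unique hr (F.face_mem t ht t' ht') hz hz'] at hsr
  exact hsr.trans ht'

/-- The complement is the union of the finitely many closed cones that do not have `s` as a face. -/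
theorem isOpen_star (s : Finset (Vec d)) : IsOpen (F.star s) := by
  rw [← isClosed_compl_iff]
  have h : (F.star s)ᶜ = ⋃ t ∈ {t | t ∈ F.cones ∧ ¬s ⊆ t}, closedCone t := by
    ext z
    simp only [Set.mem_compl_iff, Set.mem_iUnion, exists_prop, Set.mem_ofPred_eq]
    constructor
    · intro hz
      obtain ⟨t, ⟨ht, hzt⟩, _⟩ := F.existsUnique_mem z
      exact ⟨t, ⟨ht, fun hst => hz ⟨t, ht, hst, hzt⟩⟩, openCone_subset_closedCone t hzt⟩
    · rintro ⟨t, ⟨ht, hst⟩, hz⟩ h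
      exact hst (subset_of_mem_star ht h hz)
  rw [h]
  refine Set.Finite.isClosed_biUnion (F.cones.finite_toSet.subset fun t ht => ht.1) fun t ht => ?_
  exact isClosed_closedCone (F.linearIndepOn t ht.1)

variable {F} in
-- Adding a multiple of the center only increases coefficients of generators that are already
-- present. So the star is star-shaped about the center of `s`.
theorem add_mem_star {s : Finset (Vec d)} {z : Vec d} (hz : z ∈ F.star s) {a b : ℝ} (ha : 0 ≤ a)
    (hb : 0 < b) : a • center s + b • z ∈ F.star s := by
  classical
  obtain ⟨t, ht, hst, c, hc, rfl⟩ := hz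
  refine ⟨t, ht, hst, fun v => (if v ∈ s then a else 0) + b * c v, fun v hv => ?_, ?_⟩
  · have := mul_pos hb (hc v hv)
    dsimp only
    split_ifs <;> linarith
  · simp only [add_smul, Finset.sum_add_distrib, ite_smul, zero_smul, Finset.sum_ite_mem,
      Finset.inter_eq_right.2 hst, center, Finset.smul_sum, mul_smul]

variable {F} in
theorem card_le {s : Finset (Vec d)} (hs : s ∈ F.cones) : s.card ≤ d := by
  have := (F.linearIndepOn s hs).encard_le_toENat_rank
  simpa using this

variable {F} in
/-- Every small displacement from the center of a cone leads into a coface. -/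
theorem exists_displacement {s : Finset (Vec d)} (hs : s ∈ F.cones) (ν : Vec d) :
    ∃ t : ℝ, 0 < t ∧ center s + t • ν ∈ F.star s := by
  have h : Filter.Tendsto (fun t : ℝ => center s + t • ν) (nhds 0) (nhds (center s)) := by
    have : Continuous fun t : ℝ => center s + t • ν := by fun_prop
    simpa using this.tendsto 0
  have h1 := h.eventually ((F.isOpen_star s).mem_nhds (center_mem_star hs))
  obtain ⟨t, ht, h0⟩ := ((h1.filter_mono nhdsWithin_le_nhds).and
    (self_mem_nhdsWithin (a := (0 : ℝ)) (s := Set.Ioi 0))).exists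
  exact ⟨t, h0, ht⟩

variable {F} in
-- A small displacement of the center out of the span of the cone stays in the open star but leaves
-- the cone, so it lands in a larger cone.
theorem exists_coface {m : ℕ} {w : Fin m → Vec d} (hw : F.IsCone w) (hm : m < d) :
    ∃ x, F.IsCone (Fin.cons x w : Fin (m + 1) → Vec d) := by
  classical
  set s := Finset.univ.image w with hs
  have hspan : Submodule.span ℝ (s : Set (Vec d)) ≠ ⊤ := by
    intro h
    have h1 := finrank_span_finset_le_card (R := ℝ) s
    rw [Set.finrank, h, finrank_top, hw.card_image] at h1
    simp at h1
    omega
  obtain ⟨ν, hν⟩ : ∃ ν, ν ∉ Submodule.span ℝ (s : Set (Vec d)) := by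
    by_contra! h
    exact hspan (eq_top_iff.2 fun x _ => h x)
  obtain ⟨t, ht, r, hr, hsr, hz⟩ := exists_displacement hw.2 ν
  have hne : r ≠ s := by
    rintro rfl
    obtain ⟨c, _, hc⟩ := hz
    have h1 : t • ν = ∑ v ∈ s, c v • v - center s := by rw [← hc]; abel
    have h2 : t • ν ∈ Submodule.span ℝ (s : Set (Vec d)) := by
      rw [h1]
      exact sub_mem (sum_mem fun v hv => Submodule.smul_mem _ _ (Submodule.subset_span hv))
        (sum_mem fun v hv => Submodule.subset_span hv)
    exact hν ((Submodule.smul_mem_iff _ ht.ne').1 h2)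
  obtain ⟨x, hx, hxs⟩ := Finset.exists_of_ssubset (hsr.ssubset_of_ne hne.symm)
  refine ⟨x, F.isCone_cons.2 ⟨hxs, hw.1, F.face_mem r hr _ ?_⟩⟩
  exact Finset.insert_subset hx hsr

open Classical in
variable {F} in
/-- A cone of codimension one has exactly one coface on each side. -/
theorem existsUnique_coface {s : Finset (Vec d)} (hs : s ∈ F.cones) (hcard : s.card + 1 = d)
    (l : Vec d →ₗ[ℝ] ℝ) (hl : l ≠ 0) (hls : ∀ v ∈ s, l v = 0)
    (hker : ∀ z, l z = 0 → z ∈ Submodule.span ℝ (s : Set (Vec d))) :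
    ∃! x, insert x s ∈ F.cones ∧ 0 < l x := by
  have hl0 : ∀ c : Vec d → ℝ, l (∑ v ∈ s, c v • v) = 0 := fun c => by
    rw [map_sum]
    exact Finset.sum_eq_zero fun v hv => by rw [map_smul, hls v hv, smul_zero]
  have hns : ∀ x, 0 < l x → x ∉ s := fun x hx h => hx.ne' (hls x h)
  obtain ⟨ν, hν⟩ : ∃ ν, 0 < l ν := by
    obtain ⟨ν, hν⟩ : ∃ ν, l ν ≠ 0 := by
      by_contra! h
      exact hl (LinearMap.ext h)
    rcases lt_or_gt_of_ne hν with h | h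
    · exact ⟨-ν, by simpa using h⟩
    · exact ⟨ν, h⟩
  obtain ⟨t, ht, r, hr, hsr, c, hc, hz⟩ := exists_displacement hs ν
  have hlz : l (∑ v ∈ r, c v • v) = t * l ν := by
    rw [← hz, map_add, map_smul, smul_eq_mul]
    have := hl0 fun _ => 1
    simp only [one_smul] at this
    rw [center, this, zero_add]
  obtain ⟨x, hx, hxs⟩ : ∃ x ∈ r, x ∉ s := by
    by_contra! h
    rw [Finset.Subset.antisymm h hsr, hl0] at hlz
    exact (mul_pos ht hν).ne hlz
  have hrs : insert x s = r := by
    refine Finset.eq_of_subset_of_card_le (Finset.insert_subset hx hsr) ?_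
    rw [Finset.card_insert_of_notMem hxs, hcard]
    exact card_le hr
  refine ⟨x, ⟨by rw [hrs]; exact hr, ?_⟩, ?_⟩
  · rw [← hrs, Finset.sum_insert hxs, map_add, hl0, map_smul, smul_eq_mul, add_zero] at hlz
    have h1 : 0 < c x * l x := hlz ▸ mul_pos ht hν
    exact pos_of_mul_pos_right h1 (hc x hx).le
  · rintro x' ⟨hx', hlx'⟩
    have hlx : 0 < l x := by
      rw [← hrs, Finset.sum_insert hxs, map_add, hl0, map_smul, smul_eq_mul, add_zero] at hlz
      have h1 : 0 < c x * l x := hlz ▸ mul_pos ht hν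
      exact pos_of_mul_pos_right h1 (hc x hx).le
    have h1 : x' - (l x' / l x) • x ∈ Submodule.span ℝ (s : Set (Vec d)) := by
      refine hker _ ?_
      rw [map_sub, map_smul, smul_eq_mul, div_mul_cancel₀ _ hlx.ne', sub_self]
    obtain ⟨b, hb⟩ := Submodule.mem_span_finset'.1 h1
    set b' : Vec d → ℝ := fun v => if hv : v ∈ s then b ⟨v, hv⟩ else 0 with hb'
    have hbs : ∑ v ∈ s, b' v • v = x' - (l x' / l x) • x := by
      rw [← hb, ← Finset.sum_coe_sort s]
      exact Finset.sum_congr rfl fun i _ => by rw [hb']; simp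
    -- Modulo the span of `s` the vector `x'` is a positive multiple of `x`. Adding a large multiple
    -- of the center makes all coefficients positive, so one point lies in both open cones, and
    -- these must be equal.
    obtain ⟨M, hM0, hM⟩ : ∃ M : ℝ, 0 < M ∧ ∀ v ∈ s, 0 < M + b' v := by
      refine ⟨1 + ∑ v ∈ s, |b' v|, by positivity, fun v hv => ?_⟩
      have h2 := Finset.single_le_sum (f := fun v => |b' v|) (fun _ _ => abs_nonneg _) hv
      have h3 := neg_abs_le (b' v)
      linarith
    have hxs' := hns x' hlx'
    have hrc : insert x s ∈ F.cones := by rw [hrs]; exact hr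
    have key : insert x' s = insert x s := by
      refine cone_unique (x := x' + M • center s) hx' hrc
        ⟨fun v => if v ∈ s then M else 1, fun v _ => by dsimp only; split_ifs <;> linarith, ?_⟩
        ⟨fun v => if v ∈ s then M + b' v else l x' / l x, fun v _ => ?_, ?_⟩
      · rw [Finset.sum_insert hxs', center, Finset.smul_sum]
        simp only [if_neg hxs', one_smul]
        congr 1
        exact Finset.sum_congr rfl fun v hv => by rw [if_pos hv]
      · dsimp only
        split_ifs with hv
        · exact hM v hv
        · exact div_pos hlx' hlx
      · rw [Finset.sum_insert hxs]
        simp only [if_neg hxs]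
        have : ∑ v ∈ s, (if v ∈ s then M + b' v else l x' / l x) • v =
            M • center s + (x' - (l x' / l x) • x) := by
          rw [← hbs, center, Finset.smul_sum, ← Finset.sum_add_distrib]
          exact Finset.sum_congr rfl fun v hv => by rw [if_pos hv, add_smul]
        rw [this]
        abel
    have : x' ∈ insert x s := key ▸ Finset.mem_insert_self x' s
    exact (Finset.mem_insert.1 this).resolve_right hxs'

open Classical in
variable {F} in
-- A cone of codimension one has exactly two cofaces, on opposite sides, and the standard
-- orientation of `ℝ^d` gives them opposite signs.
theorem sum_fundamentalChain_cons {m : ℕ} {w : Fin m → Vec (m + 1)} {F : ConeComplex (m + 1)}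
    (hw : F.IsCone w) :
    ∑ x ∈ F.rays, F.fundamentalChain (Fin.cons x w : Fin (m + 1) → Vec (m + 1)) = 0 := by
  set s := Finset.univ.image w with hs
  have e : ∀ z : Vec (m + 1), (Matrix.of (Fin.cons 0 w : Fin (m + 1) → Vec (m + 1))).updateRow 0 z
      = Matrix.of (Fin.cons z w) := fun z => by
    ext i j
    refine Fin.cases ?_ (fun i => ?_) i <;> simp [Matrix.updateRow_apply]
  -- The determinant as a function of its first row: its kernel is the span of the facet, and its
  -- sign on the new generator is both the side and the coefficient in the fundamental chain.
  let l : Vec (m + 1) →ₗ[ℝ] ℝ :=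
    { toFun := fun x => (Matrix.of (Fin.cons x w : Fin (m + 1) → Vec (m + 1))).det
      map_add' := fun x y => by
        rw [← e (x + y), Matrix.det_updateRow_add, e, e]
      map_smul' := fun a y => by
        rw [← e (a • y), Matrix.det_updateRow_smul, e]
        rfl }
  have hl : ∀ x, l x = (Matrix.of (Fin.cons x w : Fin (m + 1) → Vec (m + 1))).det := fun _ => rfl
  have hrange : Set.range w = (s : Set (Vec (m + 1))) := by simp [hs]
  have hls : ∀ v ∈ s, l v = 0 := by
    intro v hv
    obtain ⟨i, _, rfl⟩ := Finset.mem_image.1 hv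
    rw [hl]
    exact Matrix.det_zero_of_row_eq (i := 0) (j := i.succ) (Fin.succ_ne_zero i).symm (by
      funext k; simp)
  have hli : ∀ z, l z ≠ 0 ↔ LinearIndependent ℝ (Fin.cons z w : Fin (m + 1) → Vec (m + 1)) := by
    intro z
    rw [hl, ← isUnit_iff_ne_zero, ← Matrix.isUnit_iff_isUnit_det,
      ← Matrix.linearIndependent_rows_iff_isUnit]
    rfl
  have hker : ∀ z, l z = 0 → z ∈ Submodule.span ℝ (s : Set (Vec (m + 1))) := by
    intro z hz
    by_contra h
    refine (hli z).2 (linearIndependent_finCons.2 ⟨hw.linearIndependent, ?_⟩) hz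
    rwa [hrange]
  have hl0 : l ≠ 0 := by
    obtain ⟨x, hx⟩ := exists_coface hw (Nat.lt_succ_self m)
    intro h
    exact (hli x).2 hx.linearIndependent (by rw [h]; rfl)
  have hcard : s.card + 1 = m + 1 := by rw [hs, hw.card_image]
  have h1 := existsUnique_coface hw.2 hcard l hl0 hls hker
  have h2 := existsUnique_coface hw.2 hcard (-l) (neg_ne_zero.2 hl0)
    (fun v hv => by rw [LinearMap.neg_apply, hls v hv, neg_zero])
    (fun z hz => hker z (by simpa using hz))
  have h3 : ∀ x, F.fundamentalChain (Fin.cons x w : Fin (m + 1) → Vec (m + 1)) =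
      (if insert x s ∈ F.cones ∧ 0 < l x then 1 else 0) -
      (if insert x s ∈ F.cones ∧ 0 < (-l) x then 1 else 0) := by
    intro x
    rw [fundamentalChain, image_cons, ← hl, ← hs]
    simp only [LinearMap.neg_apply, Left.neg_pos_iff]
    by_cases hc : insert x s ∈ F.cones
    · simp only [hc, true_and, if_true]
      rcases lt_trichotomy (l x) 0 with h | h | h
      · simp [h, not_lt.2 h.le]
      · simp [h]
      · simp [h, not_lt.2 h.le]
    · simp [hc]
  have h4 : ∀ l' : Vec (m + 1) →ₗ[ℝ] ℝ, (∃! x, insert x s ∈ F.cones ∧ 0 < l' x) →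
      ∑ x ∈ F.rays, (if insert x s ∈ F.cones ∧ 0 < l' x then (1 : ℤ) else 0) = 1 := by
    rintro l' ⟨x, hx, hux⟩
    rw [Finset.sum_eq_single x]
    · rw [if_pos hx]
    · exact fun y _ hy => if_neg fun h => hy (hux y h)
    · exact fun h => absurd (F.mem_rays.2 ⟨_, hx.1, Finset.mem_insert_self _ _⟩) h
  rw [Finset.sum_congr rfl fun x _ => h3 x, Finset.sum_sub_distrib]
  rw [Finset.sum_congr rfl fun x _ => rfl, h4 l h1]
  rw [h4 (-l) h2, sub_self]

theorem det_ne_zero_of_isCone {w : Fin d → Vec d} (hw : F.IsCone w) : (Matrix.of w).det ≠ 0 := by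
  rw [← isUnit_iff_ne_zero, ← Matrix.isUnit_iff_isUnit_det,
    ← Matrix.linearIndependent_rows_iff_isUnit]
  exact hw.linearIndependent

open Classical in
theorem fundamentalChain_mem : F.fundamentalChain ∈ F.chains ℤ d := by
  refine ⟨fun w h => ?_, fun e w => ?_⟩
  · rw [fundamentalChain] at h
    refine ⟨fun i j hij => ?_, ?_⟩
    · by_contra hne
      refine h ?_
      rw [Matrix.det_zero_of_row_eq hne (by exact hij)]
      simp
    · by_contra hne
      exact h (if_neg (by convert hne))
  · rw [fundamentalChain, fundamentalChain]
    have e1 : Finset.univ.image (w ∘ e) = Finset.univ.image w := image_comp_perm w e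
    have e2 : (Matrix.of (w ∘ e)).det = ((Equiv.Perm.sign e : ℤˣ) : ℤ) * (Matrix.of w).det :=
      Matrix.det_permute e (Matrix.of w)
    rw [e2]
    have hi : Finset.univ.image (w ∘ e) ∈ F.cones ↔ Finset.univ.image w ∈ F.cones := by rw [e1]
    by_cases hc : Finset.univ.image w ∈ F.cones
    · rw [if_pos (hi.2 hc), if_pos hc]
      rcases Int.units_eq_one_or (Equiv.Perm.sign e) with h | h <;> rw [h] <;> simp [Left.sign_neg]
    · rw [if_neg (mt hi.1 hc), if_neg hc, smul_zero]

theorem boundary_fundamentalChain {m : ℕ} (F : ConeComplex (m + 1)) :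
    F.boundary ℤ m F.fundamentalChain = 0 := by
  funext w
  by_cases hw : F.IsCone w
  · change -∑ x ∈ F.rays, _ = 0
    rw [sum_fundamentalChain_cons hw, neg_zero]
  · exact chains_eq_zero (boundary_mem F.fundamentalChain_mem) hw

end ConeComplex

end

end PointGroupLSM

namespace PointGroupLSM

noncomputable section

/-! ### Dual chains and the contraction of the cellular complex -/

namespace ConeComplex

variable {d : ℕ} (F : ConeComplex d)

/-- Affine simplices in general position to all cones, contained in the star of `s`. -/
def starSimplices (s : Finset (Vec d)) (q : ℕ) : Set (Fin q → Vec d) :=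
  {v | Transverse F.cones v ∧ ∀ a ∈ stdSimplex ℝ (Fin q), ∑ i, a i • v i ∈ F.star s}

/-- Two requirements are met at once: staying in the star holds for all apices near the center, by
openness and compactness, and transversality holds for almost all apices, hence for a dense set. -/
theorem exists_apex_star {s : Finset (Vec d)} (hs : s ∈ F.cones) {q : ℕ} (c : AffineChain d q) :
    ∃ y, ∀ v ∈ c.support, v ∈ F.starSimplices s q →
      (Fin.cons y v : Fin (q + 1) → Vec d) ∈ F.starSimplices s (q + 1) := by
  have h1 : ∀ v ∈ c.support, ∀ᶠ y in nhds (center s), v ∈ F.starSimplices s q →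
      ∀ a ∈ stdSimplex ℝ (Fin (q + 1)),
        ∑ i, a i • (Fin.cons y v : Fin (q + 1) → Vec d) i ∈ F.star s := by
    intro v _
    by_cases hv : v ∈ F.starSimplices s q
    swap
    · exact Filter.Eventually.of_forall fun _ h => absurd h hv
    refine Filter.Eventually.mono ?_ fun _ h _ => h
    refine (isCompact_stdSimplex ℝ (Fin (q + 1))).eventually_forall_of_forall_eventually
      fun a ha => ?_
    have hcont : Continuous fun z : Vec d × (Fin (q + 1) → ℝ) =>
        ∑ i, z.2 i • (Fin.cons z.1 v : Fin (q + 1) → Vec d) i := by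
      simp only [Fin.sum_univ_succ, Fin.cons_zero, Fin.cons_succ]
      fun_prop
    -- It suffices to treat the apex `center s`: a point of the join is either the center itself or
    -- a positive multiple of a star point plus a nonnegative multiple of the center.
    refine hcont.continuousAt.eventually ((F.isOpen_star s).mem_nhds ?_)
    simp only [Fin.sum_univ_succ, Fin.cons_zero, Fin.cons_succ]
    obtain ⟨ha0, ha1⟩ := ha
    rw [Fin.sum_univ_succ] at ha1
    have hnn : 0 ≤ ∑ i : Fin q, a i.succ := Finset.sum_nonneg fun i _ => ha0 _
    rcases hnn.eq_or_lt with h0 | h0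
    · have h2 : ∀ i : Fin q, a i.succ = 0 := fun i =>
        (Finset.sum_eq_zero_iff_of_nonneg fun i _ => ha0 _).1 h0.symm i (Finset.mem_univ i)
      rw [← h0, add_zero] at ha1
      simp only [h2, zero_smul, Finset.sum_const_zero, add_zero, ha1, one_smul]
      exact center_mem_star hs
    · set b := ∑ i : Fin q, a i.succ with hb
      have h3 := hv.2 (fun i => a i.succ / b) ⟨fun i => div_nonneg (ha0 _) h0.le, by
        rw [← Finset.sum_div, div_self h0.ne']⟩
      have h4 := add_mem_star h3 (ha0 0) h0
      rw [Finset.smul_sum] at h4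
      simpa only [smul_smul, mul_div_cancel₀ _ h0.ne'] using h4
  have h2 := (Filter.eventually_all_finset c.support).2 h1
  have h3 : ∀ᵐ y : Vec d, ∀ v ∈ c.support, v ∈ F.starSimplices s q →
      Transverse F.cones (Fin.cons y v : Fin (q + 1) → Vec d) := by
    rw [Filter.eventually_all_finset]
    intro v _
    by_cases hv : v ∈ F.starSimplices s q
    · filter_upwards [ae_transverse_cons F.cones.finite_toSet hv.1] with y hy _ using hy
    · exact Filter.Eventually.of_forall fun _ h => absurd h hv
  obtain ⟨y, hy, hy'⟩ := (MeasureTheory.Measure.dense_of_ae h3).inter_nhds_nonempty h2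
  exact ⟨y, fun v hv hvs => ⟨hy v hv hvs, hy' v hv hvs⟩⟩

/-- A closed cone through the center of `s` has `s` as a face, and a cone with fewer than `d`
generators cannot. -/
theorem transverse_center {s : Finset (Vec d)} (hs : s ∈ F.cones) (hcard : s.card = d) :
    ![center s] ∈ F.starSimplices s 1 := by
  refine ⟨fun t ht u hu a c ha ha1 hc h => ?_, fun a ha => ?_⟩
  · have hu1 : u = Finset.univ := by
      refine Finset.eq_univ_of_forall fun i => ?_
      by_contra hi
      have : u = ∅ := Finset.eq_empty_of_forall_notMem fun j hj => hi (Subsingleton.elim j i ▸ hj)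
      rw [this] at ha1
      simp at ha1
    subst hu1
    simp only [Finset.univ_unique, Finset.sum_singleton, Matrix.cons_val_fin_one,
      Finset.card_singleton] at h hu ha1
    rw [ha1, one_smul] at h
    have h1 := subset_of_mem_star ht (center_mem_star hs) ⟨c, hc, h⟩
    have := Finset.card_le_card h1
    omega
  · have h1 := ha.2
    simp only [Finset.univ_unique, Finset.sum_singleton, Matrix.cons_val_fin_one] at h1 ⊢
    rw [h1, one_smul]
    exact center_mem_star hs

/-- The matrix is block triangular with blocks 1 and `-w`, which accounts for the factor (-1)^d. -/
theorem crossing_vertex {x : Vec d} {w : Fin d → Vec d} {a : Fin d → ℝ} (ha : ∀ i, 0 ≤ a i)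
    (hx : x = ∑ i, a i • w i) :
    crossing ![x] w = (-1) ^ d * ((SignType.sign (Matrix.of w).det : SignType) : ℤ) := by
  have h1 : crossing ![x] w =
      originSign (Fin.cons (hpt x) fun j => hdir (w j) : Fin (d + 1) → Fin (d + 1) → ℝ) := by
    refine originSign_cast (add_comm 1 d) fun k => ?_
    refine Fin.cases ?_ (fun k => ?_) k
    · have : (Fin.cast (add_comm 1 d).symm 0 : Fin (1 + d)) = Fin.castAdd d 0 := rfl
      rw [this, Fin.append_left]
      simp
    · have : (Fin.cast (add_comm 1 d).symm k.succ : Fin (1 + d)) = Fin.natAdd 1 k :=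
        Fin.ext (by simp [add_comm])
      rw [this, Fin.append_right]
      simp
  rw [h1, originSign, dif_pos rfl, if_pos]
  · have h2 : (Matrix.of fun i : Fin (d + 1) =>
        (Fin.cons (hpt x) fun j => hdir (w j) : Fin (d + 1) → Fin (d + 1) → ℝ) (Fin.cast rfl i)).det =
        (-1) ^ d * (Matrix.of w).det := by
      rw [Matrix.det_succ_column_zero, Fin.sum_univ_succ]
      rw [Finset.sum_eq_zero fun i _ => ?_, add_zero]
      · have h3 : (Matrix.of fun i : Fin (d + 1) =>
          (Fin.cons (hpt x) fun j => hdir (w j) : Fin (d + 1) → Fin (d + 1) → ℝ)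
            (Fin.cast rfl i)).submatrix (Fin.succAbove 0) Fin.succ = -Matrix.of w := by
          ext i j
          simp [hdir]
        rw [h3, Matrix.det_neg]
        simp [hpt]
      · simp [hdir]
    rw [h2]
    rcases Nat.even_or_odd d with h | h
    · simp [h.neg_one_pow]
    · simp [h.neg_one_pow, Left.sign_neg]
  · refine ⟨Fin.cons 1 a, fun i => Fin.cases zero_le_one (fun i => by simpa using ha i) i, ?_⟩
    have := hcomb_eq (Finset.univ : Finset (Fin 1)) (Finset.univ : Finset (Fin d)) (fun _ => 1) a
      (fun _ => x) w
    rw [Fin.sum_univ_succ]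
    simp only [Fin.cons_zero, Fin.cons_succ]
    simp only [Finset.univ_unique, Finset.sum_singleton, ← hx, one_smul, sub_self] at this
    rw [one_smul]
    exact this

theorem crossing_center {w : Fin d → Vec d} (hw : Function.Injective w) :
    crossing ![center (Finset.univ.image w)] w =
      (-1) ^ d * ((SignType.sign (Matrix.of w).det : SignType) : ℤ) := by
  refine crossing_vertex (a := fun _ => 1) (fun _ => zero_le_one) ?_
  rw [center, Finset.sum_image fun i _ j _ h => hw h]
  simp

/-- The sum of the values of `D` on the cofaces of `w`. -/
def cofaceSum {B : Type*} [AddCommGroup B] {m : ℕ} (D : (Fin (m + 1) → Vec d) → B)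
    (w : Fin m → Vec d) : B :=
  ∑ x ∈ F.rays, D (Fin.cons x w)

open Classical in
/-- The dual chain of the cone `w`: it meets `w` once, and no other cone of this dimension. -/
def dual : (n : ℕ) → {m : ℕ} → (Fin m → Vec d) → AffineChain d (n + 1)
  | 0, _, w => if F.IsCone w then
      crossing ![center (Finset.univ.image w)] w • simplex ![center (Finset.univ.image w)] else 0
  | n + 1, m, w => if F.IsCone w then
      (-1 : ℤ) ^ (n + 1) • cone
        -- The apex is selected from the set of generators and its fixed enumeration, not from the
        -- tuple `w`. Reordering `w` therefore changes the dual chain only by a sign.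
        (Classical.epsilon fun y => ∀ v ∈
          (F.cofaceSum (dual n) (enum m (Finset.univ.image w))).support,
            v ∈ F.starSimplices (Finset.univ.image w) (n + 1) →
            (Fin.cons y v : Fin (n + 2) → Vec d) ∈
              F.starSimplices (Finset.univ.image w) (n + 2))
        (F.cofaceSum (dual n) w) else 0

theorem dual_eq_zero (n : ℕ) {m : ℕ} {w : Fin m → Vec d} (hw : ¬F.IsCone w) : F.dual n w = 0 := by
  cases n <;> rw [dual, if_neg hw]

theorem dual_perm (n : ℕ) {m : ℕ} (w : Fin m → Vec d) (e : Equiv.Perm (Fin m)) :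
    F.dual n (w ∘ e) = ((Equiv.Perm.sign e : ℤˣ) : ℤ) • F.dual n w := by
  classical
  induction n generalizing m with
  | zero =>
    by_cases hw : F.IsCone w
    · rw [dual, dual, if_pos hw, if_pos (hw.comp_perm e), image_comp_perm, crossing_perm_right,
        mul_smul]
    · rw [dual_eq_zero F 0 hw, dual_eq_zero F 0 (mt (F.isCone_comp_perm e).1 hw), smul_zero]
  | succ n ih =>
    by_cases hw : F.IsCone w
    · rw [dual, dual, if_pos hw, if_pos (hw.comp_perm e), image_comp_perm]
      have : F.cofaceSum (F.dual n) (w ∘ e) =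
          ((Equiv.Perm.sign e : ℤˣ) : ℤ) • F.cofaceSum (F.dual n) w := by
        simp only [cofaceSum, Finset.smul_sum]
        refine Finset.sum_congr rfl fun x _ => ?_
        rw [cons_comp_perm, ih, Equiv.Perm.decomposeFin.symm_sign, if_pos rfl, one_mul]
      rw [this, map_zsmul, smul_comm]
    · rw [dual_eq_zero F _ hw, dual_eq_zero F _ (mt (F.isCone_comp_perm e).1 hw), smul_zero]

theorem starSimplices_mono {s t : Finset (Vec d)} (h : s ⊆ t) (q : ℕ) :
    F.starSimplices t q ⊆ F.starSimplices s q :=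
  fun _ hv => ⟨hv.1, fun a ha => F.star_mono h (hv.2 a ha)⟩

theorem chainsIn_mono {q : ℕ} {S T : Set (Fin q → Vec d)} (h : S ⊆ T) {c : AffineChain d q}
    (hc : c ∈ chainsIn S) : c ∈ chainsIn T := fun v hv => h (hc v hv)

open Classical in
-- The dual chains of the cofaces lie in smaller stars, so an apex for the star of `w` is available
-- at every stage.
theorem dual_mem (n : ℕ) {m : ℕ} (hmn : m + n = d) {w : Fin m → Vec d} (hw : F.IsCone w) :
    F.dual n w ∈ chainsIn (F.starSimplices (Finset.univ.image w) (n + 1)) := by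
  induction n generalizing m with
  | zero =>
    rw [dual, if_pos hw]
    refine AddSubgroup.zsmul_mem _ (single_mem_chainsIn (F.transverse_center hw.2 ?_) 1) _
    rw [hw.card_image]
    exact hmn
  | succ n ih =>
    rw [dual, if_pos hw]
    have hZ : ∀ w' : Fin m → Vec d, F.cofaceSum (F.dual n) w' ∈
        chainsIn (F.starSimplices (Finset.univ.image w') (n + 1)) := fun w' => by
      refine sum_mem fun x _ => ?_
      by_cases hx : F.IsCone (Fin.cons x w' : Fin (m + 1) → Vec d)
      · refine chainsIn_mono (F.starSimplices_mono ?_ _) (ih (by omega) hx)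
        rw [image_cons]
        exact Finset.subset_insert _ _
      · rw [F.dual_eq_zero n hx]
        exact zero_mem _
    have hap := Classical.epsilon_spec (F.exists_apex_star hw.2
      (F.cofaceSum (F.dual n) (enum m (Finset.univ.image w))))
    set y := Classical.epsilon fun y => ∀ v ∈
          (F.cofaceSum (F.dual n) (enum m (Finset.univ.image w))).support,
            v ∈ F.starSimplices (Finset.univ.image w) (n + 1) →
            (Fin.cons y v : Fin (n + 2) → Vec d) ∈
              F.starSimplices (Finset.univ.image w) (n + 2)
    refine AddSubgroup.zsmul_mem _ ?_ _
    obtain ⟨e, he⟩ := hw.exists_perm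
    have h1 : F.cofaceSum (F.dual n) w = ((Equiv.Perm.sign e : ℤˣ) : ℤ) •
        F.cofaceSum (F.dual n) (enum m (Finset.univ.image w)) := by
      conv_lhs => rw [he]
      simp only [cofaceSum, Finset.smul_sum]
      refine Finset.sum_congr rfl fun x _ => ?_
      rw [cons_comp_perm, dual_perm, Equiv.Perm.decomposeFin.symm_sign, if_pos rfl, one_mul]
    have hZ' := hZ (enum m (Finset.univ.image w))
    rw [image_enum hw.card_image] at hZ'
    rw [h1, map_zsmul]
    refine AddSubgroup.zsmul_mem _ ?_ _
    have h2 : F.cofaceSum (F.dual n) (enum m (Finset.univ.image w)) ∈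
        chainsIn {v | (Fin.cons y v : Fin (n + 2) → Vec d) ∈
          F.starSimplices (Finset.univ.image w) (n + 2)} := fun v hv => hap v hv (hZ' v hv)
    exact chainLift_mem h2 fun v hv => single_mem_chainsIn (S := F.starSimplices _ (n + 2)) hv 1

/-- Exchanging the two added generators reverses the sign, and repeated generators contribute
nothing. The same computation gives ∂² = 0 for cellular chains. -/
theorem sum_cofaceSum_eq_zero {B : Type*} [AddCommGroup B] {m : ℕ} {D : (Fin (m + 2) → Vec d) → B}
    (hD : ∀ w (e : Equiv.Perm (Fin (m + 2))), D (w ∘ e) = ((Equiv.Perm.sign e : ℤˣ) : ℤ) • D w)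
    (h0 : ∀ w, ¬Function.Injective w → D w = 0) (w : Fin m → Vec d) :
    F.cofaceSum (F.cofaceSum D) w = 0 := by
  have hs : ∀ x y, D (Fin.cons x (Fin.cons y w)) = -D (Fin.cons y (Fin.cons x w)) := by
    intro x y
    have h := hD (Fin.cons y (Fin.cons x w)) (Equiv.swap 0 1)
    rw [Equiv.Perm.sign_swap (by simp)] at h
    simp only [Units.val_neg, Units.val_one, neg_smul, one_smul] at h
    rw [← h]
    congr 1
    funext i
    refine Fin.cases ?_ (fun i => Fin.cases ?_ (fun i => ?_) i) i
    · simp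
    · simp
    · rw [Function.comp_apply, Equiv.swap_apply_of_ne_of_ne]
      · simp
      · exact Fin.succ_ne_zero _
      · intro h
        have := congrArg Fin.val h
        simp at this
  simp only [cofaceSum]
  rw [← Finset.sum_product']
  refine Finset.sum_involution (fun p _ => (p.2, p.1)) ?_ ?_ ?_ ?_
  · rintro ⟨x, y⟩ _
    simp only
    rw [hs y x, neg_add_cancel]
  · rintro ⟨x, y⟩ _ hne h
    simp only [Prod.mk.injEq] at h
    refine hne (h0 _ fun hinj => ?_)
    have := @hinj 0 1 (by simp [h.1])
    simp at this
  · rintro ⟨x, y⟩ h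
    rw [Finset.mem_product] at h ⊢
    exact ⟨h.2, h.1⟩
  · rintro ⟨x, y⟩ _
    rfl

/-- A dual chain is a cone over the sum of the dual chains of the cofaces, so the point is that this
sum is a cycle. For points this is the cancellation of orientations across a facet; above that, it
is the vanishing of the double coface sum. -/
theorem bdry_dual (n : ℕ) {m : ℕ} (hmn : m + (n + 1) = d) {w : Fin m → Vec d} (hw : F.IsCone w) :
    bdry (F.dual (n + 1) w) = (-1 : ℤ) ^ (n + 1) • F.cofaceSum (F.dual n) w := by
  induction n generalizing m with
  | zero =>
    subst hmn
    rw [dual, if_pos hw, map_zsmul, bdry_cone]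
    have : bdry (F.cofaceSum (F.dual 0) w) = 0 := by
      have h1 : bdry (F.cofaceSum (F.dual 0) w) = ((-1 : ℤ) ^ (m + 1) *
          ∑ x ∈ F.rays, F.fundamentalChain (Fin.cons x w : Fin (m + 1) → Vec (m + 1))) •
            simplex Fin.elim0 := by
        rw [cofaceSum, map_sum, Finset.mul_sum, Finset.sum_smul]
        refine Finset.sum_congr rfl fun x _ => ?_
        by_cases hx : F.IsCone (Fin.cons x w : Fin (m + 1) → Vec (m + 1))
        · have h2 : F.fundamentalChain (Fin.cons x w : Fin (m + 1) → Vec (m + 1)) =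
              ((SignType.sign (Matrix.of (Fin.cons x w : Fin (m + 1) → Vec (m + 1))).det :
                SignType) : ℤ) := if_pos (by convert hx.2)
          rw [dual, if_pos hx, map_zsmul, bdry_simplex, crossing_center hx.1, h2]
          congr 1
          rw [faceSum, Fin.sum_univ_one]
          simp only [Fin.val_zero, pow_zero, one_smul]
          congr 1
        · rw [F.dual_eq_zero 0 hx, map_zero, chains_eq_zero F.fundamentalChain_mem hx, mul_zero,
            zero_smul]
      rw [h1, sum_fundamentalChain_cons hw, mul_zero, zero_smul]
    rw [this, map_zero, sub_zero]
  | succ n ih =>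
    rw [dual, if_pos hw, map_zsmul, bdry_cone]
    have : bdry (F.cofaceSum (F.dual (n + 1)) w) = 0 := by
      have h1 : bdry (F.cofaceSum (F.dual (n + 1)) w) =
          (-1 : ℤ) ^ (n + 1) • F.cofaceSum (F.cofaceSum (F.dual n)) w := by
        conv_lhs => rw [cofaceSum, map_sum]
        conv_rhs => rw [cofaceSum, Finset.smul_sum]
        refine Finset.sum_congr rfl fun x _ => ?_
        by_cases hx : F.IsCone (Fin.cons x w : Fin (m + 1) → Vec d)
        · exact ih (by omega) hx
        · rw [F.dual_eq_zero _ hx, map_zero, cofaceSum, Finset.sum_eq_zero, smul_zero]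
          exact fun y _ => F.dual_eq_zero _ fun h => hx h.of_cons.1
      rw [h1, F.sum_cofaceSum_eq_zero (F.dual_perm n)
        (fun w hw => F.dual_eq_zero n fun h => hw h.1), smul_zero]
    rw [this, map_zero, sub_zero]

/-- The dual chain stays in the open star of `w`, and `w` is the only cone of its dimension that
meets this star. -/
theorem pairChain_dual_eq_smul {A : Type*} [AddCommGroup A] {n m : ℕ} (hmn : m + n = d)
    {w : Fin m → Vec d} (hw : F.IsCone w) {c : (Fin m → Vec d) → A} (hc : c ∈ F.chains A m) :
    F.pairChain (F.dual n w) c = chainLift (fun v => crossing v w) (F.dual n w) • c w := by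
  classical
  have h1 : chainLift (fun v => crossing v w) (F.dual n w) • c w =
      chainLift (fun v => crossing v w • c w) (F.dual n w) :=
    map_chainLift ((smulAddHom ℤ A).flip (c w)) _ _
  rw [h1]
  refine chainLift_congr (F.dual_mem n hmn hw) fun v hv => ?_
  rw [pairing_eq, Finset.sum_eq_single (Finset.univ.image w)]
  · obtain ⟨e, he⟩ := hw.exists_perm
    have h2 := crossing_perm_right v (enum m (Finset.univ.image w)) e
    have h3 := chains_perm hc (enum m (Finset.univ.image w)) e
    rw [← he] at h2 h3
    rw [h2, h3, smul_smul, mul_right_comm, sign_mul_sign, one_mul]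
  · intro s hs hne
    rw [crossing_eq_zero, zero_smul]
    intro a b ha ha1 hb h
    have hs2 := (Finset.mem_filter.1 hs)
    have h2 := hv.2 a ⟨ha, ha1⟩
    rw [h] at h2
    refine hne ?_
    have h3 : ∑ j, b j • enum m s j ∈ closedCone s := by
      obtain ⟨b', hb'⟩ : ∃ b' : Vec d → ℝ, ∀ j, b' (enum m s j) = b j :=
        ⟨Function.extend (enum m s) b 0, fun j => (enum_injective hs2.2).extend_apply _ _ j⟩
      refine ⟨b', fun x hx => ?_, ?_⟩
      · rw [← image_enum hs2.2] at hx
        obtain ⟨j, _, rfl⟩ := Finset.mem_image.1 hx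
        rw [hb']
        exact hb j
      · conv_rhs => rw [← image_enum hs2.2]
        rw [Finset.sum_image fun i _ j _ h => enum_injective hs2.2 h]
        simp only [hb']
    exact (Finset.eq_of_subset_of_card_le (subset_of_mem_star hs2.1 h2 h3)
      (by rw [hs2.2, hw.card_image])).symm
  · exact fun h => absurd hw.mem_conesOf h

/-- Induction on the codimension: pair the dual chain with the boundary of a single coface `(x, w)`.
Adjointness moves the boundary onto the dual chain, where only the dual of that coface contributes,
and it contributes 1. -/
theorem crossing_dual {n m : ℕ} (hmn : m + n = d) {w : Fin m → Vec d} (hw : F.IsCone w) :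
    chainLift (fun v => crossing v w) (F.dual n w) = 1 := by
  classical
  induction n generalizing m with
  | zero =>
    obtain rfl : m = d := hmn
    rw [dual, if_pos hw, map_zsmul, chainLift_single, crossing_center hw.1, one_smul, smul_eq_mul]
    rw [mul_mul_mul_comm, ← pow_add, Even.neg_one_pow ⟨m, rfl⟩, one_mul]
    rcases (F.det_ne_zero_of_isCone hw).lt_or_gt with h | h <;> simp [h]
  | succ n ih =>
    obtain ⟨x, hx⟩ := exists_coface hw (by omega)
    have hE := elementary_mem hx
    have h1 : ∀ y, elementary (Fin.cons x w : Fin (m + 1) → Vec d) (Fin.cons y w) =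
        if y = x then 1 else 0 := by
      intro y
      split_ifs with h
      · rw [h, elementary_self hx.1]
      · by_contra h2
        obtain ⟨e, he⟩ := exists_of_elementary_ne_zero h2
        have h3 := congrArg (fun u => Finset.univ.image u) he
        simp only [image_comp_perm, image_cons] at h3
        have h4 : y ∈ insert x (Finset.univ.image w) := h3 ▸ Finset.mem_insert_self _ _
        have h5 := (Finset.mem_insert.1 h4).resolve_left h
        rw [Finset.insert_eq_of_mem h5] at h3
        exact (F.isCone_cons.1 hx).1 (h3 ▸ Finset.mem_insert_self _ _)
    have hxr : x ∈ F.rays := hx.of_cons.2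
    have h2 : F.boundary ℤ m (elementary (Fin.cons x w)) w = -1 := by
      change -∑ y ∈ F.rays, elementary (Fin.cons x w : Fin (m + 1) → Vec d) (Fin.cons y w) = -1
      simp only [h1, Finset.sum_ite_eq', hxr, if_true]
    have h3 := F.pairChain_bdry (chainsIn_mono (fun v hv => hv.1) (F.dual_mem (n + 1) hmn hw)) hE
    rw [F.pairChain_dual_eq_smul hmn hw (boundary_mem hE), h2, F.bdry_dual n hmn hw] at h3
    have h4 : F.pairChain (F.cofaceSum (F.dual n) w) (elementary (Fin.cons x w)) = 1 := by
      rw [cofaceSum, pairChain, map_sum, Finset.sum_eq_single x]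
      · change F.pairChain (F.dual n (Fin.cons x w : Fin (m + 1) → Vec d)) _ = 1
        rw [F.pairChain_dual_eq_smul (by omega) hx hE, ih (by omega) hx, elementary_self hx.1, one_smul]
      · intro y _ hyx
        by_cases hy : F.IsCone (Fin.cons y w : Fin (m + 1) → Vec d)
        · change F.pairChain (F.dual n (Fin.cons y w : Fin (m + 1) → Vec d)) _ = 0
          rw [F.pairChain_dual_eq_smul (by omega) hy hE, h1, if_neg hyx, smul_zero]
        · rw [F.dual_eq_zero n hy, map_zero]
      · exact fun h => absurd hxr h
    rw [pairChain, map_zsmul] at h3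
    change (-1 : ℤ) ^ (n + 1) • F.pairChain _ _ = _ at h3
    rw [h4, pow_succ (-1 : ℤ) (n + 1)] at h3
    simp only [smul_eq_mul, mul_one, mul_neg, neg_mul, neg_neg] at h3
    have h5 : ((-1 : ℤ) ^ (n + 1)) ≠ 0 := pow_ne_zero _ (by norm_num)
    exact (mul_left_cancel₀ h5 (by rw [mul_one]; exact h3)).symm

/-- The coefficients of a chain are its intersection numbers with the dual chains. -/
theorem pairChain_dual {A : Type*} [AddCommGroup A] {n m : ℕ} (hmn : m + n = d)
    {w : Fin m → Vec d} (hw : F.IsCone w) {c : (Fin m → Vec d) → A} (hc : c ∈ F.chains A m) :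
    F.pairChain (F.dual n w) c = c w := by
  rw [F.pairChain_dual_eq_smul hmn hw hc, F.crossing_dual hmn hw, one_smul]

theorem exists_contractionApex : ∃ x : Vec d, ∀ m ∈ Finset.range (d + 1), ∀ s ∈ F.conesOf m,
    ∀ v ∈ (F.dual (d - m) (enum m s)).support, Transverse F.cones v →
      Transverse F.cones (Fin.cons x v : Fin (d - m + 2) → Vec d) := by
  suffices h : ∀ᵐ x : Vec d, ∀ m ∈ Finset.range (d + 1), ∀ s ∈ F.conesOf m,
      ∀ v ∈ (F.dual (d - m) (enum m s)).support, Transverse F.cones v →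
      Transverse F.cones (Fin.cons x v : Fin (d - m + 2) → Vec d) from h.exists
  simp only [Filter.eventually_all_finset]
  intro m _ s _ v _
  by_cases hv : Transverse F.cones v
  · filter_upwards [ae_transverse_cons F.cones.finite_toSet hv] with x hx _ using hx
  · exact Filter.Eventually.of_forall fun _ h => absurd h hv

/-- A point in general position. -/
def contractionApex : Vec d := F.exists_contractionApex.choose

theorem cone_dual_mem {n m : ℕ} (hmn : m + n = d) {w : Fin m → Vec d} (hw : F.IsCone w) :
    cone F.contractionApex (F.dual n w) ∈ chainsIn {v | Transverse F.cones v} := by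
  classical
  obtain rfl : n = d - m := by omega
  obtain ⟨e, he⟩ := hw.exists_perm
  have h1 := F.dual_mem (d - m) hmn (isCone_enum hw.mem_conesOf)
  have h2 : F.dual (d - m) (enum m (Finset.univ.image w)) ∈
      chainsIn {v | Transverse F.cones (Fin.cons F.contractionApex v : Fin (d - m + 2) → Vec d)} :=
    fun v hv => F.exists_contractionApex.choose_spec m (Finset.mem_range.2 (by omega)) _
      hw.mem_conesOf v hv (h1 v hv).1
  rw [he, dual_perm, map_zsmul]
  refine AddSubgroup.zsmul_mem _ ?_ _
  refine chainLift_mem h2 fun v hv => ?_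
  have hv' : Transverse F.cones (Fin.cons F.contractionApex v : Fin (d - m + 2) → Vec d) := hv
  exact single_mem_chainsIn (Set.mem_ofPred.2 hv') 1

section Contraction

variable {A : Type*} [AddCommGroup A]

/-- The contracting homotopy of the cellular chain complex. -/
def contraction (m : ℕ) : ((Fin m → Vec d) → A) →+ ((Fin (m + 1) → Vec d) → A) where
  -- The exponent is the codimension of `w`. The sign compensates those in `bdry_dual` and in
  -- `boundary`.
  toFun c := fun w => (-1 : ℤ) ^ (d - (m + 1)) •
    F.pairChain (cone F.contractionApex (F.dual (d - (m + 1)) w)) c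
  map_zero' := by
    funext w
    simp [pairChain, pairing_eq, chainLift_apply]
  map_add' c c' := by
    funext w
    simp only [pairChain, pairing_eq, chainLift_apply, Pi.add_apply, smul_add,
      Finset.sum_add_distrib, Finsupp.sum_add]

/-- The chain `c` is a cycle. -/
def IsCycle : {m : ℕ} → ((Fin m → Vec d) → A) → Prop
  | 0, _ => True
  | m + 1, c => F.boundary A m c = 0

theorem contraction_apply {m : ℕ} (c : (Fin m → Vec d) → A) (w : Fin (m + 1) → Vec d) :
    F.contraction m c w = (-1 : ℤ) ^ (d - (m + 1)) •
      F.pairChain (cone F.contractionApex (F.dual (d - (m + 1)) w)) c := rfl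

theorem contraction_mem {m : ℕ} (c : (Fin m → Vec d) → A) :
    F.contraction m c ∈ F.chains A (m + 1) := by
  refine ⟨fun w hw => ?_, fun e w => ?_⟩
  · by_contra h
    rw [contraction_apply, F.dual_eq_zero _ h, map_zero, pairChain, map_zero, smul_zero] at hw
    exact hw rfl
  · rw [contraction_apply, contraction_apply, dual_perm, map_zsmul, pairChain, map_zsmul, smul_comm]
    rfl

/-- Adjointness, with the convention that every chain of dimension zero is a cycle. -/
theorem pairChain_bdry_eq_zero {p m : ℕ} {z : AffineChain d (p + 1)}
    (hz : z ∈ chainsIn {v | Transverse F.cones v}) {c : (Fin m → Vec d) → A}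
    (hc : c ∈ F.chains A m) (hcycle : F.IsCycle c) : F.pairChain (bdry z) c = 0 := by
  cases m with
  | zero => exact F.pairChain_bdry_zero hz c
  | succ m =>
    have h : F.boundary A m c = 0 := hcycle
    rw [F.pairChain_bdry hz hc, h]
    simp [pairChain, pairing_eq, chainLift_apply]

/-- Pair `c` with the boundary of the cone over the dual chain of `w`. A cycle pairs to zero with a
boundary, so the coefficient `c w`, which is the pairing with the dual chain, equals the pairing
with the cone over its boundary, and that is what the left-hand side computes. -/
theorem boundary_contraction {m : ℕ} (hm : m < d) {c : (Fin m → Vec d) → A}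
    (hc : c ∈ F.chains A m) (hcycle : F.IsCycle c) :
    F.boundary A m (F.contraction m c) = c := by
  funext w
  by_cases hw : F.IsCone w
  swap
  · rw [chains_eq_zero hc hw, chains_eq_zero (boundary_mem (F.contraction_mem c)) hw]
  obtain ⟨n, rfl⟩ : ∃ n, d = m + (n + 1) := ⟨d - (m + 1), by omega⟩
  have hn : m + (n + 1) - (m + 1) = n := by omega
  have h1 : F.boundary A m (F.contraction m c) w =
      F.pairChain (cone F.contractionApex (bdry (F.dual (n + 1) w))) c := by
    rw [F.bdry_dual n rfl hw, map_zsmul, pairChain, map_zsmul, cofaceSum, map_sum, map_sum]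
    change -∑ x ∈ F.rays, F.contraction m c (Fin.cons x w) = _
    rw [Finset.smul_sum, ← Finset.sum_neg_distrib]
    refine Finset.sum_congr rfl fun x _ => ?_
    rw [contraction_apply, hn, ← neg_smul, pow_succ, mul_neg_one]
    rfl
  have h2 := bdry_cone F.contractionApex (F.dual (n + 1) w)
  have h3 := F.pairChain_bdry_eq_zero (F.cone_dual_mem rfl hw) hc hcycle
  have h4 := F.pairChain_dual rfl hw hc
  rw [h2, pairChain, map_sub] at h3
  rw [h1, ← h4]
  exact (sub_eq_zero.1 h3).symm

/-- In top dimension the dual chain is a signed point, and coning it moves that point to the common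
apex. All coefficients thus agree up to orientation with the intersection number at the apex. -/
theorem cycle_eq_smul_fundamentalChain {c : (Fin d → Vec d) → A} (hc : c ∈ F.chains A d)
    (hcycle : F.IsCycle c) (w : Fin d → Vec d) :
    c w = F.fundamentalChain w • ((-1 : ℤ) ^ d • F.pairing ![F.contractionApex] c) := by
  classical
  by_cases hw : F.IsCone w
  swap
  · rw [chains_eq_zero hc hw, chains_eq_zero F.fundamentalChain_mem hw, zero_smul]
  have h4 := F.pairChain_dual (add_zero d) hw hc
  have hm := F.cone_dual_mem (add_zero d) hw
  have hf : F.fundamentalChain w = ((SignType.sign (Matrix.of w).det : SignType) : ℤ) :=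
    if_pos (by convert hw.2)
  have h3 := F.pairChain_bdry_eq_zero hm hc hcycle
  rw [bdry_cone, pairChain, map_sub, sub_eq_zero] at h3
  have h5 : cone F.contractionApex (bdry (F.dual 0 w)) =
      ((-1) ^ d * ((SignType.sign (Matrix.of w).det : SignType) : ℤ)) •
        simplex ![F.contractionApex] := by
    rw [dual, if_pos hw, map_zsmul, map_zsmul, crossing_center hw.1, bdry_simplex]
    congr 1
    rw [faceSum, Fin.sum_univ_one]
    simp only [Fin.val_zero, pow_zero, one_smul, cone_simplex]
    congr 1
  rw [h5, map_zsmul, chainLift_single, one_smul] at h3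
  rw [← h4, pairChain, h3, hf, smul_smul, mul_comm]

end Contraction

end ConeComplex

end

end PointGroupLSM

namespace PointGroupLSM

noncomputable section

set_option linter.unusedSectionVars false

/-! ### Equivariant homology of a cone complex -/

section Measurability

variable {G : Type*} [Group G] [TopologicalSpace G]
  {A : Type*} [AddCommGroup A] [TopologicalSpace A] [IsTopologicalAddGroup A]
  [SecondCountableTopology A]

theorem smul_mem_measurable {n : ℕ} {f : (Fin n → G) → ℤ} (hf : Continuous f)
    {b : (Fin n → G) → A} (hb : b ∈ measurableCochains G A n) :
    (fun g => f g • b g) ∈ measurableCochains G A n := by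
  let _ : MeasurableSpace A := borel A
  have _ : BorelSpace A := ⟨rfl⟩
  let _ : MeasurableSpace (Fin n → G) := borel _
  have _ : BorelSpace (Fin n → G) := ⟨rfl⟩
  have hb' : Measurable b := hb
  exact hf.measurable.smul hb'

theorem comp_mem_measurable {n n' : ℕ} {φ : (Fin n → G) → Fin n' → G} (hφ : Continuous φ)
    {b : (Fin n' → G) → A} (hb : b ∈ measurableCochains G A n') :
    (fun g => b (φ g)) ∈ measurableCochains G A n := by
  let _ : MeasurableSpace A := borel A
  let _ : MeasurableSpace (Fin n → G) := borel _
  have _ : BorelSpace (Fin n → G) := ⟨rfl⟩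
  let _ : MeasurableSpace (Fin n' → G) := borel _
  have _ : BorelSpace (Fin n' → G) := ⟨rfl⟩
  have hb' : Measurable b := hb
  exact hb'.comp hφ.measurable

theorem continuous_contractNth [ContinuousMul G] {n : ℕ} (j : Fin (n + 1)) :
    Continuous fun g : Fin (n + 1) → G => Fin.contractNth j (· * ·) g := by
  refine continuous_pi fun i => ?_
  rcases lt_trichotomy (i : ℕ) j with h | h | h
  · simp only [Fin.contractNth_apply_of_lt _ _ _ _ h]
    fun_prop
  · simp only [Fin.contractNth_apply_of_eq _ _ _ _ h]
    fun_prop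
  · simp only [Fin.contractNth_apply_of_gt _ _ _ _ h]
    fun_prop

end Measurability

theorem coboundary_cast {G M : Type*} [Mul G] [AddCommGroup M] (act : G → M →+ M) {n n' : ℕ}
    (h : n = n') (f : (Fin n → G) → M) (g : Fin (n' + 1) → G) :
    coboundary act n' (fun g' => f (g' ∘ Fin.cast h)) g =
      coboundary act n f (g ∘ Fin.cast (by rw [h])) := by
  subst h
  rfl

theorem map_coboundary {G M M' : Type*} [Mul G] [AddCommGroup M] [AddCommGroup M']
    (act : G → M →+ M) (act' : G → M' →+ M') (φ : M →+ M') {n : ℕ} (f : (Fin n → G) → M)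
    (h : ∀ (g : G) (g' : Fin n → G), φ (act g (f g')) = act' g (φ (f g'))) (g : Fin (n + 1) → G) :
    φ (coboundary act n f g) = coboundary act' n (fun g' => φ (f g')) g := by
  simp only [coboundary, AddMonoidHom.coe_mk, ZeroHom.coe_mk, map_add, map_sum, map_zsmul, h]

namespace ConeComplex

variable {d : ℕ} {G : Type*} [Group G] [TopologicalSpace G] (F : ConeComplex d)

section Action

variable {A : Type*} [AddCommGroup A] (τ : G →* O d) (σ : G →ₜ* ℤˣ)

theorem chainAction_apply {q : ℕ} (g : G) (c : (Fin q → Vec d) → A) (w : Fin q → Vec d) :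
    chainAction A τ σ q g c w = ((σ g : ℤˣ) : ℤ) • c fun i => (τ g⁻¹).1 *ᵥ w i := rfl

theorem mulVec_mulVec_inv (g : G) (x : Vec d) : (τ g).1 *ᵥ ((τ g⁻¹).1 *ᵥ x) = x := by
  rw [Matrix.mulVec_mulVec, ← Submonoid.coe_mul, ← map_mul, mul_inv_cancel, map_one,
    Submonoid.coe_one, Matrix.one_mulVec]

theorem mulVec_inv_mulVec (g : G) (x : Vec d) : (τ g⁻¹).1 *ᵥ ((τ g).1 *ᵥ x) = x := by
  have := mulVec_mulVec_inv τ g⁻¹ x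
  rwa [inv_inv] at this

theorem mulVec_injective (g : G) : Function.Injective fun x : Vec d => (τ g).1 *ᵥ x :=
  fun x y h => by
    rw [← mulVec_inv_mulVec τ g x, ← mulVec_inv_mulVec τ g y]
    exact congrArg _ h

theorem chainAction_one {q : ℕ} (c : (Fin q → Vec d) → A) : chainAction A τ σ q 1 c = c := by
  funext w
  rw [chainAction_apply]
  simp

theorem chainAction_mul {q : ℕ} (g h : G) (c : (Fin q → Vec d) → A) :
    chainAction A τ σ q (g * h) c = chainAction A τ σ q g (chainAction A τ σ q h c) := by
  funext w
  simp only [chainAction_apply, map_mul, Units.val_mul, mul_smul, mul_inv_rev, Submonoid.coe_mul,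
    Matrix.mulVec_mulVec]

variable {F τ} (hF : F.Invariant τ)
include hF

theorem isCone_mulVec {q : ℕ} {w : Fin q → Vec d} (g : G) (hw : F.IsCone w) :
    F.IsCone fun i => (τ g).1 *ᵥ w i := by
  classical
  refine ⟨(mulVec_injective τ g).comp hw.1, ?_⟩
  have h := hF g _ hw.2
  rw [Finset.image_image, Function.comp_def] at h
  convert h

theorem mulVec_mem_rays (g : G) {x : Vec d} (hx : x ∈ F.rays) : (τ g).1 *ᵥ x ∈ F.rays := by
  classical
  obtain ⟨s, hs, hxs⟩ := F.mem_rays.1 hx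
  exact F.mem_rays.2 ⟨_, hF g s hs, by convert Finset.mem_image_of_mem _ hxs⟩

theorem sum_rays_mulVec {B : Type*} [AddCommMonoid B] (g : G) (φ : Vec d → B) :
    ∑ x ∈ F.rays, φ ((τ g).1 *ᵥ x) = ∑ x ∈ F.rays, φ x :=
  Finset.sum_nbij' (fun x => (τ g).1 *ᵥ x) (fun x => (τ g⁻¹).1 *ᵥ x)
    (fun _ hx => mulVec_mem_rays hF g hx) (fun _ hx => mulVec_mem_rays hF g⁻¹ hx)
    (fun x _ => mulVec_inv_mulVec τ g x) (fun x _ => mulVec_mulVec_inv τ g x) (fun _ _ => rfl)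

theorem chainAction_mem {q : ℕ} (g : G) {c : (Fin q → Vec d) → A} (hc : c ∈ F.chains A q) :
    chainAction A τ σ q g c ∈ F.chains A q := by
  refine ⟨fun w hw => ?_, fun e w => ?_⟩
  · by_contra h
    rw [chainAction_apply, chains_eq_zero hc, smul_zero] at hw
    · exact hw rfl
    · intro h'
      have := isCone_mulVec hF g h'
      simp only [mulVec_mulVec_inv] at this
      exact h this
  · rw [chainAction_apply, chainAction_apply, smul_comm, ← chains_perm hc]
    rfl

theorem boundary_chainAction {q : ℕ} (g : G) (c : (Fin (q + 1) → Vec d) → A) :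
    F.boundary A q (chainAction A τ σ (q + 1) g c) =
      chainAction A τ σ q g (F.boundary A q c) := by
  funext w
  change -∑ x ∈ F.rays, chainAction A τ σ (q + 1) g c (Fin.cons x w) =
    ((σ g : ℤˣ) : ℤ) • -∑ x ∈ F.rays, c (Fin.cons x fun i => (τ g⁻¹).1 *ᵥ w i)
  rw [← sum_rays_mulVec hF g⁻¹ fun x => c (Fin.cons x fun i => (τ g⁻¹).1 *ᵥ w i), smul_neg,
    Finset.smul_sum]
  congr 1
  refine Finset.sum_congr rfl fun x _ => ?_
  rw [chainAction_apply]
  congr 2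
  funext i
  refine Fin.cases rfl (fun i => rfl) i

theorem boundary_coboundary {q n : ℕ} (f : (Fin n → G) → (Fin (q + 1) → Vec d) → A)
    (g : Fin (n + 1) → G) :
    F.boundary A q (coboundary (chainAction A τ σ (q + 1)) n f g) =
      coboundary (chainAction A τ σ q) n (fun g' => F.boundary A q (f g')) g :=
  map_coboundary _ _ (F.boundary A q) f (fun g _ => boundary_chainAction σ hF g _) g

theorem coboundary_mem_chains {q n : ℕ} {f : (Fin n → G) → (Fin q → Vec d) → A}
    (hf : ∀ g, f g ∈ F.chains A q) (g : Fin (n + 1) → G) :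
    coboundary (chainAction A τ σ q) n f g ∈ F.chains A q :=
  add_mem (chainAction_mem σ hF _ (hf _))
    (sum_mem fun _ _ => AddSubgroup.zsmul_mem _ (hf _) _)

end Action

section BoundarySq

variable {A : Type*} [AddCommGroup A]

theorem boundary_eq_neg_cofaceSum {q : ℕ} (c : (Fin (q + 1) → Vec d) → A) :
    F.boundary A q c = -F.cofaceSum c := rfl

theorem boundary_boundary {q : ℕ} {c : (Fin (q + 2) → Vec d) → A} (hc : c ∈ F.chains A (q + 2)) :
    F.boundary A q (F.boundary A (q + 1) c) = 0 := by
  rw [boundary_eq_neg_cofaceSum F c, map_neg, boundary_eq_neg_cofaceSum, neg_neg]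
  funext w
  exact F.sum_cofaceSum_eq_zero (chains_perm hc)
    (fun w hw => chains_eq_zero hc fun h => hw h.1) w

end BoundarySq

section Homology

variable {A : Type*} [AddCommGroup A] [TopologicalSpace A] [IsTopologicalAddGroup A]
  [SecondCountableTopology A]

/-- Measurable cochains with values in cellular chains. -/
def cellCochains (G A : Type*) [TopologicalSpace G] [AddCommGroup A] [TopologicalSpace A]
    [IsTopologicalAddGroup A] [SecondCountableTopology A] (n k : ℕ) :
    AddSubgroup ((Fin n → G) → (Fin k → Vec d) → A) where
  carrier := {f | (∀ g, f g ∈ F.chains A k) ∧ ∀ w, (fun g => f g w) ∈ measurableCochains G A n}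
  zero_mem' := ⟨fun _ => zero_mem _, fun _ => zero_mem _⟩
  add_mem' hf hf' := ⟨fun g => add_mem (hf.1 g) (hf'.1 g), fun w => add_mem (hf.2 w) (hf'.2 w)⟩
  neg_mem' hf := ⟨fun g => neg_mem (hf.1 g), fun w => neg_mem (hf.2 w)⟩

variable {F}

theorem comp_mem_cellCochains {n n' k : ℕ} {φ : (Fin n → G) → Fin n' → G} (hφ : Continuous φ)
    {f : (Fin n' → G) → (Fin k → Vec d) → A} (hf : f ∈ F.cellCochains G A n' k) :
    (fun g => f (φ g)) ∈ F.cellCochains G A n k :=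
  ⟨fun _ => hf.1 _, fun w => comp_mem_measurable hφ (hf.2 w)⟩

theorem boundary_mem_cellCochains {n k : ℕ} {f : (Fin n → G) → (Fin (k + 1) → Vec d) → A}
    (hf : f ∈ F.cellCochains G A n (k + 1)) :
    (fun g => F.boundary A k (f g)) ∈ F.cellCochains G A n k := by
  refine ⟨fun g => boundary_mem (hf.1 g), fun w => ?_⟩
  have h := neg_mem (sum_mem (t := F.rays) fun x _ => hf.2 (Fin.cons x w))
  convert h using 1
  funext g
  change -∑ x ∈ F.rays, f g (Fin.cons x w) = _
  rw [Pi.neg_apply, Finset.sum_apply]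

theorem pairing_mem_measurable {n p k : ℕ} (v : Fin p → Vec d)
    {f : (Fin n → G) → (Fin k → Vec d) → A} (hf : f ∈ F.cellCochains G A n k) :
    (fun g => F.pairing v (f g)) ∈ measurableCochains G A n := by
  have h := sum_mem (t := F.conesOf k) fun s _ =>
    AddSubgroup.zsmul_mem _ (hf.2 (enum k s)) (crossing v (enum k s))
  convert h using 1
  funext g
  rw [pairing_eq, Finset.sum_apply]
  rfl

theorem contraction_mem_cellCochains {n k : ℕ} {f : (Fin n → G) → (Fin k → Vec d) → A}
    (hf : f ∈ F.cellCochains G A n k) :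
    (fun g => F.contraction k (f g)) ∈ F.cellCochains G A n (k + 1) := by
  refine ⟨fun g => F.contraction_mem _, fun w => ?_⟩
  have h : ∀ z : AffineChain d (d - (k + 1) + 2),
      (fun g => F.pairChain z (f g)) ∈ measurableCochains G A n := fun z => by
    have h := sum_mem (t := z.support) fun v _ =>
      AddSubgroup.zsmul_mem _ (pairing_mem_measurable v hf) (z v)
    convert h using 1
    funext g
    rw [pairChain, chainLift_apply, Finsupp.sum, Finset.sum_apply]
    rfl
  exact AddSubgroup.zsmul_mem _ (h _) _

variable {τ : G →* O d} (σ : G →ₜ* ℤˣ)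

/-- Only measurability of the first term needs an argument, because there the group element also
moves the arguments of the chain. -/
theorem coboundary_mem_cellCochains [ContinuousMul G] (hF : F.Invariant τ)
    (hτ : ∀ x y : Vec d, IsClopen {g | (τ g⁻¹).1 *ᵥ x = y}) {n k : ℕ}
    {f : (Fin n → G) → (Fin k → Vec d) → A} (hf : f ∈ F.cellCochains G A n k) :
    coboundary (chainAction A τ σ k) n f ∈ F.cellCochains G A (n + 1) k := by
  classical
  refine ⟨coboundary_mem_chains σ hF hf.1, fun w => ?_⟩
  -- The translated tuple of vectors takes only finitely many values on which the chain can be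
  -- nonzero, each on a clopen set of group elements; so the term is a finite sum of clopen
  -- indicators times measurable functions.
  have h1 : (fun g : Fin (n + 1) → G => ((σ (g 0) : ℤˣ) : ℤ) •
      ∑ w' ∈ Fintype.piFinset fun _ : Fin k => F.rays,
        (if ∀ i, (τ (g 0)⁻¹).1 *ᵥ w i = w' i then (1 : ℤ) else 0) • f (fun i => g i.succ) w') ∈
      measurableCochains G A (n + 1) := by
    refine smul_mem_measurable
      (Units.continuous_val.comp ((map_continuous σ).comp (continuous_apply 0))) ?_
    have h : ∀ w' : Fin k → Vec d, (fun g : Fin (n + 1) → G =>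
        (if ∀ i, (τ (g 0)⁻¹).1 *ᵥ w i = w' i then (1 : ℤ) else 0) • f (fun i => g i.succ) w') ∈
        measurableCochains G A (n + 1) := fun w' => by
      refine smul_mem_measurable ?_
        (comp_mem_measurable (φ := fun g i => g i.succ) (by fun_prop) (hf.2 w'))
      have hc : IsClopen {g : Fin (n + 1) → G | ∀ i, (τ (g 0)⁻¹).1 *ᵥ w i = w' i} := by
        have e : {g : Fin (n + 1) → G | ∀ i, (τ (g 0)⁻¹).1 *ᵥ w i = w' i} =
            ⋂ i, (fun g : Fin (n + 1) → G => g 0) ⁻¹' {g | (τ g⁻¹).1 *ᵥ w i = w' i} := by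
          ext g
          simp
        rw [e]
        exact isClopen_iInter_of_finite fun i => (hτ _ _).preimage (continuous_apply 0)
      refine continuous_const.if (fun g hg => ?_) continuous_const
      rw [hc.frontier_eq] at hg
      exact absurd hg (Set.notMem_empty _)
    have h' := sum_mem (t := Fintype.piFinset fun _ : Fin k => F.rays) fun w' _ => h w'
    convert h' using 1
    funext g
    rw [Finset.sum_apply]
  have h2 : ∀ j : Fin (n + 1), (fun g : Fin (n + 1) → G => (-1 : ℤ) ^ ((j : ℕ) + 1) •
      f (Fin.contractNth j (· * ·) g) w) ∈ measurableCochains G A (n + 1) := fun j =>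
    AddSubgroup.zsmul_mem _ (comp_mem_measurable (continuous_contractNth j) (hf.2 w)) _
  have h3 := add_mem h1 (sum_mem (t := Finset.univ) fun j _ => h2 j)
  convert h3 using 1
  funext g
  have e1 : ∑ w' ∈ Fintype.piFinset fun _ : Fin k => F.rays,
      (if ∀ i, (τ (g 0)⁻¹).1 *ᵥ w i = w' i then (1 : ℤ) else 0) • f (fun i => g i.succ) w' =
      f (fun i => g i.succ) fun i => (τ (g 0)⁻¹).1 *ᵥ w i := by
    have e2 : ∀ w' : Fin k → Vec d, (∀ i, (τ (g 0)⁻¹).1 *ᵥ w i = w' i) ↔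
        (fun i => (τ (g 0)⁻¹).1 *ᵥ w i) = w' := fun w' => funext_iff.symm
    simp only [e2, ite_smul, one_smul, zero_smul, Finset.sum_ite_eq]
    refine ite_eq_left_iff.2 fun h => ?_
    by_contra h0
    have hc := (hf.1 _).1 _ (Ne.symm h0)
    refine h (Fintype.mem_piFinset.2 fun i => F.mem_rays.2 ⟨_, hc.2, ?_⟩)
    exact Finset.mem_image_of_mem _ (Finset.mem_univ i)
  simp only [Pi.add_apply, Finset.sum_apply, e1]
  simp [coboundary, chainAction_apply]

theorem totalBoundary_apply {m : ℕ} (β : ChainFamily d G A m) (k : ℕ) (g : Fin (k + m + 1) → G) :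
    totalBoundary A F τ σ m β k g = F.boundary A k (β (k + 1) (g ∘ Fin.cast (by omega))) +
      (-1 : ℤ) ^ m • coboundary (chainAction A τ σ k) (k + m) (β k) g := rfl

theorem totalBoundary_mem [ContinuousMul G] (hF : F.Invariant τ)
    (hτ : ∀ x y : Vec d, IsClopen {g | (τ g⁻¹).1 *ᵥ x = y}) {m : ℕ} {β : ChainFamily d G A m}
    (hβ : β ∈ equivariantChains F G A m) :
    totalBoundary A F τ σ m β ∈ equivariantChains F G A (m + 1) := by
  intro k
  exact add_mem (comp_mem_cellCochains (φ := fun g : Fin (k + (m + 1)) → G => g ∘ Fin.cast (by omega))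
    (by fun_prop) (boundary_mem_cellCochains (hβ (k + 1))))
    (AddSubgroup.zsmul_mem _ (coboundary_mem_cellCochains σ hF hτ (hβ k)) _)

/-- ∂² and δ² vanish, ∂ and δ commute, and the signs (-1)^m and (-1)^(m+1) of consecutive degrees
cancel the mixed terms. -/
theorem totalBoundary_totalBoundary (hF : F.Invariant τ) {m : ℕ} {β : ChainFamily d G A m}
    (hβ : β ∈ equivariantChains F G A m) :
    totalBoundary A F τ σ (m + 1) (totalBoundary A F τ σ m β) = 0 := by
  funext k g
  have h1 : F.boundary A k (totalBoundary A F τ σ m β (k + 1) (g ∘ Fin.cast (by omega))) =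
      (-1 : ℤ) ^ m • coboundary (chainAction A τ σ k) (k + 1 + m)
        (fun g' => F.boundary A k (β (k + 1) g')) (g ∘ Fin.cast (by omega)) := by
    rw [totalBoundary_apply, map_add, F.boundary_boundary ((hβ (k + 2)).1 _), zero_add, map_zsmul,
      boundary_coboundary σ hF]
  have h2 : coboundary (chainAction A τ σ k) (k + (m + 1)) (totalBoundary A F τ σ m β k) g =
      coboundary (chainAction A τ σ k) (k + 1 + m)
        (fun g' => F.boundary A k (β (k + 1) g')) (g ∘ Fin.cast (by omega)) := by
    have h3 : totalBoundary A F τ σ m β k =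
        (fun g' => (fun g' => F.boundary A k (β (k + 1) g')) (g' ∘ Fin.cast (by omega))) +
        (-1 : ℤ) ^ m • coboundary (chainAction A τ σ k) (k + m) (β k) := rfl
    rw [h3, map_add, map_zsmul]
    have h4 := coboundary_coboundary (chainAction A τ σ k) (chainAction_one τ σ)
      (chainAction_mul τ σ) (β k)
    have h5 : coboundary (chainAction A τ σ k) (k + (m + 1))
        (coboundary (chainAction A τ σ k) (k + m) (β k)) = 0 := h4
    rw [h5, smul_zero, add_zero]
    exact coboundary_cast (chainAction A τ σ k) (n := k + 1 + m) (n' := k + (m + 1)) (by omega)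
      (fun g' => F.boundary A k (β (k + 1) g')) g
  rw [totalBoundary_apply, h1, h2, ← add_smul, pow_succ, mul_neg_one, add_neg_cancel, zero_smul]
  rfl

/-- The components of a primitive of an equivariant chain. -/
def primitive (F : ConeComplex d) (τ : G →* O d) (σ : G →ₜ* ℤˣ) {m : ℕ}
    (β : ChainFamily d G A (m + 1)) : ChainFamily d G A m
  | 0 => 0
  | k + 1 => fun g => F.contraction k (β k (g ∘ Fin.cast (by omega)) - (-1 : ℤ) ^ m •
      coboundary (chainAction A τ σ k) (k + m) (primitive F τ σ β k) (g ∘ Fin.cast (by omega)))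

theorem primitive_mem [ContinuousMul G] (hF : F.Invariant τ)
    (hτ : ∀ x y : Vec d, IsClopen {g | (τ g⁻¹).1 *ᵥ x = y}) {m : ℕ}
    {β : ChainFamily d G A (m + 1)} (hβ : β ∈ equivariantChains F G A (m + 1)) :
    primitive F τ σ β ∈ equivariantChains F G A m := by
  intro k
  induction k with
  | zero => exact zero_mem (F.cellCochains G A _ _)
  | succ k ih =>
    refine contraction_mem_cellCochains (sub_mem (comp_mem_cellCochains (by fun_prop) (hβ k)) ?_)
    exact AddSubgroup.zsmul_mem _ (comp_mem_cellCochains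
      (φ := fun g : Fin (k + 1 + m) → G => (g ∘ Fin.cast (by omega) : Fin (k + m + 1) → G))
      (by fun_prop) (coboundary_mem_cellCochains σ hF hτ ih)) _

/-- Solve D ε = β one dimension at a time: once ε_k is known, β_k minus its δ-part is a cellular
cycle, and ε_{k+1} is its contraction. The procedure can only fail in dimension `d`, where the
contraction is no longer available. -/
theorem totalBoundary_primitive (hF : F.Invariant τ) {m : ℕ}
    {β : ChainFamily d G A (m + 1)} (hβ : ∀ k g, β k g ∈ F.chains A k)
    (h : ∀ k < d, totalBoundary A F τ σ (m + 1) β k = 0) (k : ℕ) (hk : k < d) :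
    totalBoundary A F τ σ m (primitive F τ σ β) k = β k := by
  have hε : ∀ k g, primitive F τ σ β k g ∈ F.chains A k := by
    intro k
    cases k with
    | zero => exact fun _ => zero_mem _
    | succ k => exact fun _ => F.contraction_mem _
  have hz : ∀ k (g : Fin (k + m + 1) → G), β k g - (-1 : ℤ) ^ m •
      coboundary (chainAction A τ σ k) (k + m) (primitive F τ σ β k) g ∈ F.chains A k :=
    fun k g => sub_mem (hβ k g) (AddSubgroup.zsmul_mem _ (coboundary_mem_chains σ hF (hε k) g) _)
  -- The remainder is a cycle because D β vanishes one dimension lower, where δ of the equation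
  -- already solved gives δ β since δ² = 0.
  have hc : ∀ k ≤ d, ∀ g : Fin (k + m + 1) → G, F.IsCycle (β k g - (-1 : ℤ) ^ m •
      coboundary (chainAction A τ σ k) (k + m) (primitive F τ σ β k) g) := by
    intro k
    induction k with
    | zero => exact fun _ _ => trivial
    | succ k ih =>
      intro hk g
      change F.boundary A k _ = 0
      have h1 : (fun g' => F.boundary A k (primitive F τ σ β (k + 1) g')) =
          fun g' : Fin (k + 1 + m) → G => (β k - (-1 : ℤ) ^ m • coboundary (chainAction A τ σ k)
            (k + m) (primitive F τ σ β k)) (g' ∘ Fin.cast (by omega)) :=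
        funext fun g' => F.boundary_contraction hk (hz k _) (ih (by omega) _)
      have h2 := congrFun (h k hk) (g ∘ Fin.cast (by omega))
      rw [totalBoundary_apply] at h2
      have h3 := coboundary_cast (chainAction A τ σ k) (n := k + (m + 1)) (n' := k + 1 + m)
        (by omega) (β k - (-1 : ℤ) ^ m • coboundary (chainAction A τ σ k)
            (k + m) (primitive F τ σ β k)) g
      have h4 := coboundary_coboundary (chainAction A τ σ k) (chainAction_one τ σ)
        (chainAction_mul τ σ) (primitive F τ σ β k)
      have h5 : coboundary (chainAction A τ σ k) (k + (m + 1))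
        (coboundary (chainAction A τ σ k) (k + m) (primitive F τ σ β k)) = 0 := h4
      rw [map_sub, map_zsmul, h5, smul_zero, sub_zero] at h3
      rw [map_sub, map_zsmul, boundary_coboundary σ hF, h1, h3]
      rw [pow_succ, mul_neg_one, neg_smul, ← sub_eq_add_neg] at h2
      exact h2
  funext g
  have h1 := F.boundary_contraction hk (hz k g) (hc k hk.le g)
  rw [totalBoundary_apply]
  exact (congrArg (· + _) h1).trans (sub_add_cancel _ _)

end Homology

end ConeComplex

end

end PointGroupLSM

namespace PointGroupLSM

noncomputable section

set_option linter.unusedSectionVars false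

/-! ### The isomorphism given by multiples of the fundamental chain -/

namespace ConeComplex

variable {d : ℕ} {G : Type*} [Group G] [TopologicalSpace G] (F : ConeComplex d)

theorem exists_isCone (m : ℕ) (hm : m ≤ d) : ∃ w : Fin m → Vec d, F.IsCone w := by
  induction m with
  | zero => exact ⟨0, Function.injective_of_subsingleton _, by simpa using F.empty_mem⟩
  | succ m ih =>
    obtain ⟨w, hw⟩ := ih (by omega)
    obtain ⟨x, hx⟩ := exists_coface hw (by omega)
    exact ⟨_, hx⟩

variable {A : Type*} [AddCommGroup A]

theorem eq_zero_of_fundamentalChain_smul {a : A} (h : ∀ w, F.fundamentalChain w • a = 0) : a = 0 := by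
  classical
  obtain ⟨w, hw⟩ := F.exists_isCone d le_rfl
  have h1 := h w
  have h2 : F.fundamentalChain w = ((SignType.sign (Matrix.of w).det : SignType) : ℤ) :=
    if_pos (by convert hw.2)
  rw [h2] at h1
  rcases (F.det_ne_zero_of_isCone hw).lt_or_gt with h | h <;> simpa [h] using h1

/-- The multiples of an integral chain. -/
def smulChain {q : ℕ} (f : (Fin q → Vec d) → ℤ) : A →+ ((Fin q → Vec d) → A) where
  toFun a := fun w => f w • a
  map_zero' := by funext w; simp
  map_add' a b := by funext w; simp

variable {F} in
theorem smulChain_mem {q : ℕ} {f : (Fin q → Vec d) → ℤ} (hf : f ∈ F.chains ℤ q) (a : A) :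
    smulChain f a ∈ F.chains A q := by
  refine ⟨fun w hw => hf.1 w fun h => hw ?_, fun e w => ?_⟩
  · change f w • a = 0
    rw [h, zero_smul]
  · change f (w ∘ e) • a = _ • f w • a
    rw [chains_perm hf, smul_assoc]

theorem boundary_smulChain {q : ℕ} (f : (Fin (q + 1) → Vec d) → ℤ) (a : A) :
    F.boundary A q (smulChain f a) = smulChain (F.boundary ℤ q f) a := by
  funext w
  change -∑ x ∈ F.rays, f (Fin.cons x w) • a = (-∑ x ∈ F.rays, f (Fin.cons x w)) • a
  rw [neg_smul, Finset.sum_smul]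

theorem boundary_smul_fundamentalChain {q : ℕ} (F : ConeComplex (q + 1)) (a : A) :
    F.boundary A q (smulChain F.fundamentalChain a) = 0 := by
  rw [boundary_smulChain, boundary_fundamentalChain]
  funext w
  exact zero_smul ℤ a

variable {F} in
-- Invariance permutes the top cones, so only the orientation changes; an orthogonal matrix and its
-- inverse have the same determinant ±1. This is why the coefficients are twisted by the
-- determinant.
theorem fundamentalChain_mulVec {τ : G →* O d} (hF : F.Invariant τ) (g : G) (w : Fin d → Vec d) :
    F.fundamentalChain (fun i => (τ g⁻¹).1 *ᵥ w i) =
      ((SignType.sign (τ g).1.det : SignType) : ℤ) * F.fundamentalChain w := by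
  classical
  by_cases hw : F.IsCone w
  · have hw' := isCone_mulVec hF g⁻¹ hw
    have h1 : F.fundamentalChain w = ((SignType.sign (Matrix.of w).det : SignType) : ℤ) :=
      if_pos (by convert hw.2)
    have h2 : F.fundamentalChain (fun i => (τ g⁻¹).1 *ᵥ w i) =
        ((SignType.sign (Matrix.of fun i => (τ g⁻¹).1 *ᵥ w i).det : SignType) : ℤ) :=
      if_pos (by convert hw'.2)
    have h3 : (Matrix.of fun i => (τ g⁻¹).1 *ᵥ w i) = Matrix.of w * (τ g⁻¹).1ᵀ := by
      ext i j
      simp [Matrix.mul_apply, Matrix.mulVec, dotProduct, mul_comm]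
    have h4 : (τ g⁻¹).1.det * (τ g).1.det = 1 := by
      rw [← Matrix.det_mul, ← Submonoid.coe_mul, ← map_mul, inv_mul_cancel, map_one,
        Submonoid.coe_one, Matrix.det_one]
    rw [h1, h2, h3, Matrix.det_mul, Matrix.det_transpose]
    rcases det_cases (τ g) with h | h
    · rw [h, mul_one] at h4
      rw [h, h4]
      simp
    · rw [h] at h4
      have : (τ g⁻¹).1.det = -1 := by linarith
      rw [h, this]
      simp [Left.sign_neg]
  · rw [chains_eq_zero F.fundamentalChain_mem hw, chains_eq_zero F.fundamentalChain_mem, mul_zero]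
    intro h
    have := isCone_mulVec hF g h
    simp only [mulVec_mulVec_inv] at this
    exact hw this

/-- The equivariant chain `c · [ℝ^d]`. -/
def timesFundamental (m : ℕ) (c : (Fin (d + m) → G) → A) : ChainFamily d G A m := fun k g w =>
  if h : k = d then F.fundamentalChain (w ∘ Fin.cast h.symm) • c (g ∘ Fin.cast (by omega)) else 0

theorem timesFundamental_self (m : ℕ) (c : (Fin (d + m) → G) → A) :
    F.timesFundamental m c d = fun g => smulChain F.fundamentalChain (c g) := by
  funext g w
  exact dif_pos rfl

theorem timesFundamental_of_ne (m : ℕ) (c : (Fin (d + m) → G) → A) {k : ℕ} (hk : k ≠ d) :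
    F.timesFundamental m c k = 0 := by
  funext g w
  exact dif_neg hk

theorem timesFundamental_injective (m : ℕ) :
    Function.Injective (F.timesFundamental (G := G) (A := A) m) := by
  intro c c' h
  funext g
  refine sub_eq_zero.1 (F.eq_zero_of_fundamentalChain_smul fun w => ?_)
  have h1 := congrFun (congrFun (congrFun h d) g) w
  rw [timesFundamental_self, timesFundamental_self] at h1
  rw [smul_sub]
  exact sub_eq_zero.2 h1

variable {F} {τ : G →* O d} {σ χ : G →ₜ* ℤˣ}

variable [TopologicalSpace A] [IsTopologicalAddGroup A] [SecondCountableTopology A]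

/-- The cellular boundary of [ℝ^d] vanishes, and by `hχ` the action on [ℝ^d] turns the coefficient
twist σ into χ. -/
theorem totalBoundary_timesFundamental (hF : F.Invariant τ)
    (hχ : ∀ g, ((χ g : ℤˣ) : ℤ) = ((SignType.sign (τ g).1.det : SignType) : ℤ) * ((σ g : ℤˣ) : ℤ))
    (m : ℕ) (c : (Fin (d + m) → G) → A) :
    totalBoundary A F τ σ m (F.timesFundamental m c) =
      F.timesFundamental (m + 1) ((-1 : ℤ) ^ m • coboundary (twist A χ) (d + m) c) := by
  have h0 : ∀ k, coboundary (chainAction A τ σ k) (k + m)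
      (0 : (Fin (k + m) → G) → (Fin k → Vec d) → A) = 0 :=
    fun k => map_zero _
  funext k g
  rw [totalBoundary_apply]
  rcases eq_or_ne k d with rfl | hk
  · rw [timesFundamental_self, timesFundamental_self, timesFundamental_of_ne F m c (by omega),
      Pi.zero_apply, map_zero, zero_add]
    have h1 := map_coboundary (twist A χ) (chainAction A τ σ k)
      (smulChain (A := A) F.fundamentalChain) c (fun g' g'' => by
        funext w
        rw [chainAction_apply]
        change F.fundamentalChain w • ((χ g' : ℤˣ) : ℤ) • c g'' =
          ((σ g' : ℤˣ) : ℤ) • F.fundamentalChain (fun i => (τ g'⁻¹).1 *ᵥ w i) • c g''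
        rw [fundamentalChain_mulVec hF, hχ, smul_smul, smul_smul]
        congr 1
        ring) g
    rw [← h1, ← map_zsmul]
    rfl
  · rw [F.timesFundamental_of_ne (m + 1) _ hk, F.timesFundamental_of_ne m c hk, h0]
    simp only [Pi.zero_apply, smul_zero, add_zero]
    rcases eq_or_ne (k + 1) d with rfl | hk1
    · rw [timesFundamental_self, boundary_smul_fundamentalChain]
    · rw [F.timesFundamental_of_ne m c hk1, Pi.zero_apply, map_zero]

theorem timesFundamental_mem (m : ℕ) {c : (Fin (d + m) → G) → A}
    (hc : c ∈ measurableCochains G A (d + m)) :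
    F.timesFundamental m c ∈ equivariantChains F G A m := by
  intro k
  rcases eq_or_ne k d with rfl | hk
  · rw [timesFundamental_self]
    exact ⟨fun g => smulChain_mem F.fundamentalChain_mem _, fun w => AddSubgroup.zsmul_mem _ hc _⟩
  · rw [F.timesFundamental_of_ne m c hk]
    exact zero_mem (F.cellCochains G A (k + m) k)

/-- After subtracting D of the primitive only the component in dimension `d` is left; it is
cycle-valued, hence a multiple of [ℝ^d]. The multiplicity is measurable, being an intersection
number with a fixed point. The hypothesis concerns only dimensions below `d`, so that chains whose
total boundary is a multiple of [ℝ^d] are also covered. -/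
theorem exists_eq_totalBoundary_add [ContinuousMul G] (hF : F.Invariant τ)
    (hτ : ∀ x y : Vec d, IsClopen {g | (τ g⁻¹).1 *ᵥ x = y}) {m : ℕ}
    {β : ChainFamily d G A (m + 1)} (hβ : β ∈ equivariantChains F G A (m + 1))
    (h : ∀ k < d, totalBoundary A F τ σ (m + 1) β k = 0) :
    ∃ ε ∈ equivariantChains F G A m, ∃ b ∈ measurableCochains G A (d + (m + 1)),
      β = totalBoundary A F τ σ m ε + F.timesFundamental (m + 1) b := by
  have hε := primitive_mem σ hF hτ hβ
  have hmem := sub_mem hβ (totalBoundary_mem σ hF hτ hε)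
  have h0 : ∀ k < d, (β - totalBoundary A F τ σ m (primitive F τ σ β)) k = 0 := fun k hk =>
    sub_eq_zero.2 (totalBoundary_primitive σ hF (fun k => (hβ k).1) h k hk).symm
  set β' := β - totalBoundary A F τ σ m (primitive F τ σ β) with hβ'
  have hD : ∀ k < d, totalBoundary A F τ σ (m + 1) β' k = 0 := by
    intro k hk
    rw [hβ', map_sub, totalBoundary_totalBoundary σ hF hε, sub_zero]
    exact h k hk
  have hcyc : ∀ g, F.IsCycle (β' d g) := by
    intro g
    cases d with
    | zero => trivial
    | succ k =>
      have h1 := congrFun (hD k (by omega)) (g ∘ Fin.cast (by omega))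
      rw [totalBoundary_apply, h0 k (by omega), map_zero, Pi.zero_apply, smul_zero, add_zero] at h1
      exact h1
  refine ⟨_, hε, fun g => (-1 : ℤ) ^ d • F.pairing ![F.contractionApex] (β' d g),
    AddSubgroup.zsmul_mem _ (pairing_mem_measurable _ (hmem d)) _, ?_⟩
  rw [← sub_eq_iff_eq_add', ← hβ']
  funext k g w
  rcases lt_trichotomy k d with hk | rfl | hk
  · rw [h0 k hk, timesFundamental_of_ne F _ _ hk.ne]
  · rw [timesFundamental_self]
    exact F.cycle_eq_smul_fundamentalChain ((hmem k).1 g) (hcyc g) w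
  · rw [timesFundamental_of_ne F _ _ hk.ne']
    exact chains_eq_zero ((hmem k).1 g) fun hw => by have := hw.le; omega

theorem timesFundamental_mem_cycles (hF : F.Invariant τ)
    (hχ : ∀ g, ((χ g : ℤˣ) : ℤ) = ((SignType.sign (τ g).1.det : SignType) : ℤ) * ((σ g : ℤˣ) : ℤ))
    {m : ℕ} {c : (Fin (d + m) → G) → A} (hc : c ∈ cocycles A χ (d + m)) :
    F.timesFundamental m c ∈ equivariantCycles A F τ σ m := by
  refine ⟨timesFundamental_mem m hc.1, ?_⟩
  change totalBoundary A F τ σ m _ = 0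
  have h : coboundary (twist A χ) (d + m) c = 0 := hc.2
  rw [totalBoundary_timesFundamental hF hχ, h, smul_zero]
  funext k g w
  simp only [timesFundamental]
  split_ifs <;> simp

/-- The homomorphism induced by `c ↦ c · [ℝ^d]`. -/
def fundamentalHom (hF : F.Invariant τ)
    (hχ : ∀ g, ((χ g : ℤˣ) : ℤ) = ((SignType.sign (τ g).1.det : SignType) : ℤ) * ((σ g : ℤˣ) : ℤ)) :
    Cohomology A χ (d + 2) →+ EquivariantHomology A F τ σ 1 :=
  QuotientAddGroup.map _ _
    { toFun := fun c => ⟨F.timesFundamental 2 c.1, timesFundamental_mem_cycles hF hχ c.2⟩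
      map_zero' := Subtype.ext <| by
        funext k g w
        simp [timesFundamental]
      map_add' := fun c c' => Subtype.ext <| by
        funext k g w
        simp only [timesFundamental, AddSubgroup.coe_add, Pi.add_apply]
        split_ifs <;> simp } <| by
    rintro ⟨c, hc⟩ h
    rw [AddSubgroup.mem_comap, AddSubgroup.mem_addSubgroupOf]
    rw [AddSubgroup.mem_addSubgroupOf] at h
    obtain ⟨b, hb, rfl⟩ := h
    refine ⟨F.timesFundamental 1 (-b), timesFundamental_mem 1 (neg_mem hb), ?_⟩
    rw [totalBoundary_timesFundamental hF hχ, map_neg, pow_one, neg_smul, one_smul, neg_neg]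
    rfl

/-- For surjectivity decompose a cycle; its top coefficient is then a cocycle. For injectivity
decompose the chain that bounds `c · [ℝ^d]`; its top coefficient bounds `c` up to sign. Both use
that a multiple of [ℝ^d] determines its coefficient. -/
theorem fundamentalHom_bijective [ContinuousMul G] (hF : F.Invariant τ)
    (hτ : ∀ x y : Vec d, IsClopen {g | (τ g⁻¹).1 *ᵥ x = y})
    (hχ : ∀ g, ((χ g : ℤˣ) : ℤ) = ((SignType.sign (τ g).1.det : SignType) : ℤ) * ((σ g : ℤˣ) : ℤ)) :
    Function.Bijective (fundamentalHom (A := A) hF hχ) := by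
  constructor
  · rw [injective_iff_map_eq_zero]
    intro y hy
    induction y using QuotientAddGroup.induction_on with | H c => ?_
    obtain ⟨c, hc⟩ := c
    obtain ⟨ε, hε, h⟩ := (AddSubgroup.mem_addSubgroupOf).1 ((QuotientAddGroup.eq_zero_iff _).1 hy)
    have h' : totalBoundary A F τ σ 1 ε = F.timesFundamental 2 c := h
    obtain ⟨ε', hε', b, hb, rfl⟩ := exists_eq_totalBoundary_add (m := 0) (σ := σ) hF hτ hε fun k hk => by
      change totalBoundary A F τ σ 1 ε k = 0
      rw [h', timesFundamental_of_ne F _ _ hk.ne]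
    rw [map_add] at h'
    have h0 : totalBoundary A F τ σ 1 (totalBoundary A F τ σ 0 ε') = 0 :=
      totalBoundary_totalBoundary σ hF hε'
    have h1 := totalBoundary_timesFundamental (A := A) hF hχ 1 b
    have h2 : F.timesFundamental 2 c =
        F.timesFundamental 2 ((-1 : ℤ) ^ 1 • coboundary (twist A χ) (d + 1) b) := by
      rw [← h']
      exact (congrArg (· + _) h0).trans ((zero_add _).trans h1)
    have h3 := F.timesFundamental_injective 2 h2
    rw [QuotientAddGroup.eq_zero_iff, AddSubgroup.mem_addSubgroupOf]
    refine ⟨(-1 : ℤ) ^ 1 • b, AddSubgroup.zsmul_mem _ hb _, ?_⟩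
    rw [map_zsmul]
    exact h3.symm
  · intro x
    induction x using QuotientAddGroup.induction_on with | H β => ?_
    obtain ⟨β, hβ⟩ := β
    have hβ2 : totalBoundary A F τ σ 2 β = 0 := hβ.2
    obtain ⟨ε, hε, b, hb, h⟩ := exists_eq_totalBoundary_add (m := 1) (σ := σ) hF hτ hβ.1 fun k _ => by
      change totalBoundary A F τ σ 2 β k = 0
      rw [hβ2]
      rfl
    have hbc : b ∈ cocycles A χ (d + 2) := by
      refine ⟨hb, ?_⟩
      change coboundary (twist A χ) (d + 2) b = 0
      have h1 := totalBoundary_timesFundamental (A := A) hF hχ 2 b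
      rw [h, map_add] at hβ2
      have h0 : totalBoundary A F τ σ 2 (totalBoundary A F τ σ 1 ε) = 0 :=
        totalBoundary_totalBoundary σ hF hε
      have h2 : F.timesFundamental 3 ((-1 : ℤ) ^ 2 • coboundary (twist A χ) (d + 2) b) =
          F.timesFundamental 3 0 := by
        rw [← h1]
        have h3 : totalBoundary A F τ σ 2 (F.timesFundamental 2 b) = 0 := by
          rw [← hβ2]
          exact ((congrArg (· + _) h0).trans (zero_add _)).symm
        rw [h3]
        funext k g w
        simp [timesFundamental]
      have h4 := F.timesFundamental_injective 3 h2
      simpa using h4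
    refine ⟨QuotientAddGroup.mk ⟨b, hbc⟩, ?_⟩
    refine QuotientAddGroup.eq.2 ?_
    rw [AddSubgroup.mem_addSubgroupOf]
    refine ⟨ε, hε, ?_⟩
    change totalBoundary A F τ σ 1 ε = -F.timesFundamental 2 b + β
    rw [h]
    exact (neg_add_cancel_comm_assoc _ _).symm

end ConeComplex

end

end PointGroupLSM

namespace PointGroupLSM

noncomputable section

set_option linter.unusedSectionVars false

/-! ### The Euler class from an invariant cone complex -/

theorem isGeneric_of_forall {d q : ℕ} {v : Fin q → Vec d}
    (h : ∀ u : Finset (Fin q), u.card ≤ d → ∀ a : Fin q → ℝ, (∀ i ∈ u, 0 ≤ a i) →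
      ∑ i ∈ u, a i = 1 → ∑ i ∈ u, a i • v i ≠ 0) : IsGeneric v := by
  rw [isGeneric_iff]
  rintro s hs u hu a c ha ha1 _
  obtain rfl : s = ∅ := hs
  rw [Finset.sum_empty]
  exact h u (by simpa using hu) a ha ha1

theorem isGeneric_of_linearIndependent {d q : ℕ} {v : Fin q → Vec d}
    (h : LinearIndependent ℝ v) : IsGeneric v := by
  refine isGeneric_of_forall fun u _ a _ ha1 h0 => ?_
  have := linearIndependent_iff'.1 h u a h0
  rw [Finset.sum_congr rfl this, Finset.sum_const_zero] at ha1
  exact zero_ne_one ha1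

/-- The barycenter is the origin. The edge vectors are `w` multiplied by the identity plus the
all-ones matrix, whose determinant `1 + d` is positive. -/
theorem zeroSign_cons_neg_sum {d : ℕ} (w : Fin d → Vec d) :
    zeroSign (Fin.cons (-∑ j, w j) w : Fin (d + 1) → Vec d) =
      ((SignType.sign (Matrix.of w).det : SignType) : ℤ) := by
  rw [zeroSign, if_pos]
  · have h : (Matrix.of fun i : Fin d => (Fin.cons (-∑ j, w j) w : Fin (d + 1) → Vec d) i.succ -
        (Fin.cons (-∑ j, w j) w : Fin (d + 1) → Vec d) 0) =
        ((1 : Matrix (Fin d) (Fin d) ℝ) + Matrix.replicateCol Unit (fun _ : Fin d => (1 : ℝ)) *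
          Matrix.replicateRow Unit fun _ : Fin d => (1 : ℝ)) * Matrix.of w := by
      ext i j
      simp [Matrix.mul_apply, Matrix.one_apply, add_mul, Finset.sum_add_distrib]
    rw [h, Matrix.det_mul, Matrix.det_one_add_replicateCol_mul_replicateRow]
    have : (0 : ℝ) < 1 + (fun _ : Fin d => (1 : ℝ)) ⬝ᵥ fun _ => 1 := by
      simp [dotProduct]
      positivity
    rw [sign_mul, sign_pos this, one_mul]
  · rw [mem_convexHull_range_iff]
    refine ⟨fun _ => ((d : ℝ) + 1)⁻¹, fun _ => by positivity, ?_, ?_⟩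
    · rw [Finset.sum_const, Finset.card_univ, Fintype.card_fin, nsmul_eq_mul, Nat.cast_add_one]
      exact mul_inv_cancel₀ (by positivity)
    · rw [← Finset.smul_sum, Fin.sum_univ_succ]
      simp

namespace ConeComplex

variable {d : ℕ} (F : ConeComplex d)

theorem enum_mem {m : ℕ} {s : Finset (Vec d)} (h : s.card = m) (j : Fin m) : enum m s j ∈ s := by
  classical
  have := Finset.mem_image_of_mem (enum m s) (Finset.mem_univ j)
  rwa [image_enum h] at this

theorem sum_enum {B : Type*} [AddCommMonoid B] {m : ℕ} {s : Finset (Vec d)} (h : s.card = m)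
    (φ : Vec d → B) : ∑ j, φ (enum m s j) = ∑ x ∈ s, φ x := by
  classical
  have : ∑ x ∈ Finset.univ.image (enum m s), φ x = ∑ x ∈ s, φ x := by rw [image_enum h]
  rw [← this, Finset.sum_image fun i _ j _ h' => enum_injective h h']

theorem sum_mem_closedCone {m : ℕ} {s t : Finset (Vec d)} (h : s.card = m) (ht : t ⊆ s)
    {b : Fin m → ℝ} (hb : ∀ i, 0 ≤ b i) (h0 : ∀ i, enum m s i ∉ t → b i = 0) :
    ∑ i, b i • enum m s i ∈ closedCone t := by
  obtain ⟨b', hb'⟩ : ∃ b' : Vec d → ℝ, ∀ i, b' (enum m s i) = b i :=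
    ⟨Function.extend (enum m s) b 0, fun i => (enum_injective h).extend_apply _ _ i⟩
  have himg : ∀ x ∈ s, ∃ i, enum m s i = x := fun x hx => by
    classical
    rw [← image_enum h] at hx
    obtain ⟨i, _, hi⟩ := Finset.mem_image.1 hx
    exact ⟨i, hi⟩
  refine ⟨b', fun x hx => ?_, ?_⟩
  · obtain ⟨i, rfl⟩ := himg x (ht hx)
    rw [hb']
    exact hb i
  · rw [Finset.sum_subset ht, ← sum_enum h fun x => b' x • x]
    · simp only [hb']
    · intro x hx hxt
      obtain ⟨i, rfl⟩ := himg x hx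
      rw [hb', h0 i hxt, zero_smul]

/-! ### The link of the origin -/

section Link

/-- The chain of affine simplices spanned by the generators of the cones. -/
def link {q : ℕ} : ((Fin q → Vec d) → ℤ) →+ AffineChain d q where
  toFun c := ∑ s ∈ F.conesOf q, c (enum q s) • simplex (enum q s)
  map_zero' := by simp
  map_add' c c' := by simp only [Pi.add_apply, add_smul, Finset.sum_add_distrib]

theorem link_apply {q : ℕ} (c : (Fin q → Vec d) → ℤ) :
    F.link c = ∑ s ∈ F.conesOf q, c (enum q s) • simplex (enum q s) := rfl

theorem link_mem {q : ℕ} (c : (Fin q → Vec d) → ℤ) : F.link c ∈ genericChains d q :=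
  sum_mem fun _ hs => AddSubgroup.zsmul_mem _
    (single_mem_chainsIn (isGeneric_of_linearIndependent (isCone_enum hs).linearIndependent) 1) _

theorem mk_simplex_comp_perm {q : ℕ} (w : Fin q → Vec d) (e : Equiv.Perm (Fin q)) :
    (QuotientAddGroup.mk (simplex (w ∘ e)) : AffineChain d q ⧸ altRel d q) =
      ((Equiv.Perm.sign e : ℤˣ) : ℤ) • (QuotientAddGroup.mk (simplex w) : AffineChain d q ⧸ altRel d q) := by
  rw [← QuotientAddGroup.mk_zsmul, ← sub_eq_zero, ← QuotientAddGroup.mk_sub,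
    QuotientAddGroup.eq_zero_iff]
  exact AddSubgroup.subset_closure ⟨w, e, rfl⟩

theorem mk_link {q : ℕ} (c : (Fin q → Vec d) → ℤ) :
    (QuotientAddGroup.mk (F.link c) : AffineChain d q ⧸ altRel d q) =
      F.sumCones (smulAddHom ℤ (AffineChain d q ⧸ altRel d q)) c
        fun w => QuotientAddGroup.mk (simplex w) := by
  rw [link_apply, sumCones]
  exact map_sum (QuotientAddGroup.mk' (altRel d q)) _ _

/-- Modulo reordering, a simplex is an alternating function of its vertices, so Stokes' theorem
`sumCones_faceSum` applies. The sign is the one built into `boundary`. -/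
theorem bdry_link_add_mem {q : ℕ} {c : (Fin (q + 1) → Vec d) → ℤ} (hc : c ∈ F.chains ℤ (q + 1)) :
    bdry (F.link c) + F.link (F.boundary ℤ q c) ∈ altRel d q := by
  have h := F.sumCones_faceSum (smulAddHom ℤ (AffineChain d q ⧸ altRel d q)) hc
    (φ := fun w => (QuotientAddGroup.mk (simplex w) : AffineChain d q ⧸ altRel d q))
    mk_simplex_comp_perm
  have e : (QuotientAddGroup.mk (bdry (F.link c)) : AffineChain d q ⧸ altRel d q) =
      F.sumCones (smulAddHom ℤ (AffineChain d q ⧸ altRel d q)) c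
        (faceSum fun w => QuotientAddGroup.mk (simplex w)) := by
    rw [link_apply, map_sum]
    refine (map_sum (QuotientAddGroup.mk' (altRel d q)) _ _).trans ?_
    refine Finset.sum_congr rfl fun s _ => ?_
    rw [map_zsmul, bdry_simplex, map_zsmul, map_faceSum]
    rfl
  rw [← QuotientAddGroup.eq_zero_iff, QuotientAddGroup.mk_add, mk_link, e, h, neg_add_cancel]

/-- The group permutes the cones but does not respect their chosen enumerations, so equivariance
holds only up to reordering of vertices. -/
theorem link_chainAction_sub_mem {G : Type*} [Group G] [TopologicalSpace G] {τ : G →* O d}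
    (hF : F.Invariant τ) {q : ℕ} (g : G) {c : (Fin q → Vec d) → ℤ} (hc : c ∈ F.chains ℤ q) :
    F.link (chainAction ℤ τ 1 q g c) - act (τ g).1 (F.link c) ∈ altRel d q := by
  classical
  rw [← QuotientAddGroup.eq_zero_iff, QuotientAddGroup.mk_sub, sub_eq_zero, mk_link, link_apply,
    map_sum, sumCones]
  refine Eq.trans ?_ (map_sum (QuotientAddGroup.mk' (altRel d q)) _ _).symm
  have hinv : ∀ g s, s ∈ F.conesOf q → s.image (fun x => (τ g).1 *ᵥ x) ∈ F.conesOf q := by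
    intro g s hs
    obtain ⟨h1, h2⟩ := Finset.mem_filter.1 hs
    refine Finset.mem_filter.2 ⟨by convert hF g s h1, ?_⟩
    rw [Finset.card_image_of_injective _ (mulVec_injective τ g), h2]
  have hinv2 : ∀ g (s : Finset (Vec d)),
      (s.image (fun x => (τ g⁻¹).1 *ᵥ x)).image (fun x => (τ g).1 *ᵥ x) = s := by
    intro g s
    rw [Finset.image_image]
    have : ((fun x => (τ g).1 *ᵥ x) ∘ fun x => (τ g⁻¹).1 *ᵥ x) = id :=
      funext fun x => mulVec_mulVec_inv τ g x
    rw [this, Finset.image_id]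
  refine (Finset.sum_nbij' (fun s => s.image fun x => (τ g).1 *ᵥ x)
    (fun s => s.image fun x => (τ g⁻¹).1 *ᵥ x) (hinv g) (hinv g⁻¹)
    (fun s _ => by simpa using hinv2 g⁻¹ s) (fun s _ => hinv2 g s) ?_).symm
  intro s hs
  have h1 := isCone_mulVec hF g (isCone_enum hs)
  obtain ⟨e, he⟩ := h1.exists_perm
  have h2 : Finset.univ.image (fun i => (τ g).1 *ᵥ enum q s i) =
      s.image fun x => (τ g).1 *ᵥ x := by
    conv_rhs => rw [← image_enum (Finset.mem_filter.1 hs).2]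
    rw [Finset.image_image]
    rfl
  rw [h2] at he
  set t := s.image fun x => (τ g).1 *ᵥ x
  have h3 : c (enum q s) = ((Equiv.Perm.sign e : ℤˣ) : ℤ) • chainAction ℤ τ 1 q g c (enum q t) := by
    rw [← chains_perm (chainAction_mem 1 hF g hc), ← he, chainAction_apply]
    simp only [mulVec_inv_mulVec]
    simp
  rw [map_zsmul, act_simplex, he, map_zsmul, h3]
  change _ • (QuotientAddGroup.mk (simplex (enum q t ∘ e)) : AffineChain d q ⧸ altRel d q) = _
  rw [mk_simplex_comp_perm, smul_smul, smul_eq_mul, mul_right_comm, sign_mul_sign, one_mul]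
  rfl

theorem bdry_link_fundamentalChain {q : ℕ} (F : ConeComplex (q + 1)) :
    bdry (F.link F.fundamentalChain) ∈ altRel (q + 1) q := by
  have h := F.bdry_link_add_mem F.fundamentalChain_mem
  rwa [boundary_fundamentalChain, map_zero, add_zero] at h

/-- The link of the origin is a sphere which surrounds it once. -/
theorem exists_filling_link : ∃ c ∈ genericChains d (d + 1),
    bdry c - F.link F.fundamentalChain ∈ altRel d d ∧ countZeros d c = 1 := by
  classical
  obtain ⟨w₀, hw₀⟩ := F.exists_isCone d le_rfl
  set s₀ := Finset.univ.image w₀ with hs₀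
  have hs₀m : s₀ ∈ F.conesOf d := hw₀.mem_conesOf
  have hs₀c := (Finset.mem_filter.1 hs₀m).2
  -- A proper face through the origin either gives a relation among the generators of `s` or puts
  -- the center of `s₀` into a proper closed face of `s`. The latter would have to contain all `d`
  -- generators of `s₀`.
  have hgen : ∀ s ∈ F.conesOf d,
      IsGeneric (Fin.cons (-center s₀) (enum d s) : Fin (d + 1) → Vec d) := by
    intro s hs
    refine isGeneric_of_forall fun u hu a ha ha1 h0 => ?_
    obtain ⟨hs1, hs2⟩ := Finset.mem_filter.1 hs
    have hli := (isCone_enum hs).linearIndependent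
    set b : Fin (d + 1) → ℝ := fun i => if i ∈ u then a i else 0 with hb
    have hb0 : ∀ i, 0 ≤ b i := fun i => by
      rw [hb]
      dsimp only
      split_ifs with h
      · exact ha i h
      · exact le_rfl
    have hb1 : ∑ i, b i = 1 := by
      rw [← ha1, hb, Finset.sum_ite_mem, Finset.univ_inter]
    have hbs : ∑ i, b i • (Fin.cons (-center s₀) (enum d s) : Fin (d + 1) → Vec d) i = 0 := by
      rw [← h0, hb]
      simp only [ite_smul, zero_smul, Finset.sum_ite_mem, Finset.univ_inter]
    rw [Fin.sum_univ_succ] at hb1 hbs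
    simp only [Fin.cons_zero, Fin.cons_succ] at hbs
    rcases (hb0 0).eq_or_lt with h | h
    · rw [← h, zero_smul, zero_add] at hbs
      have := Fintype.linearIndependent_iff.1 hli (fun i => b i.succ) hbs
      rw [← h, zero_add, Finset.sum_congr rfl fun i _ => this i, Finset.sum_const_zero] at hb1
      exact zero_ne_one hb1
    · have hj : ∃ j : Fin d, b j.succ = 0 := by
        by_contra! hne
        have : u = Finset.univ := by
          refine Finset.eq_univ_of_forall fun i => ?_
          by_contra hi
          have hbi : b i = 0 := if_neg hi
          refine Fin.cases (fun h' => h.ne' h') (fun j h' => hne j h') i hbi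
        rw [this, Finset.card_univ, Fintype.card_fin] at hu
        omega
      obtain ⟨j, hj⟩ := hj
      have hcen : center s₀ ∈ closedCone (s.erase (enum d s j)) := by
        have e1 : center s₀ = ∑ i, (b i.succ / b 0) • enum d s i := by
          rw [smul_neg, neg_add_eq_zero] at hbs
          have : center s₀ = (b 0)⁻¹ • b 0 • center s₀ := by
            rw [smul_smul, inv_mul_cancel₀ h.ne', one_smul]
          rw [this, hbs, Finset.smul_sum]
          refine Finset.sum_congr rfl fun i _ => ?_
          rw [smul_smul, div_eq_inv_mul]
        rw [e1]
        refine sum_mem_closedCone hs2 (Finset.erase_subset _ _)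
          (fun i => div_nonneg (hb0 _) h.le) fun i hi => ?_
        have : enum d s i = enum d s j := by
          by_contra hne
          exact hi (Finset.mem_erase.2 ⟨hne, enum_mem hs2 i⟩)
        rw [enum_injective hs2 this, hj, zero_div]
      have h4 := subset_of_mem_star (F.face_mem s hs1 _ (Finset.erase_subset _ _))
        (center_mem_star (Finset.mem_filter.1 hs₀m).1) hcen
      have h5 := Finset.card_le_card h4
      have h6 : enum d s j ∈ s := enum_mem hs2 j
      rw [Finset.card_erase_of_mem h6, hs₀c, hs2] at h5
      have := j.2
      omega
  -- Cone off the link from a point opposite to the center of one top cone `s₀`. The ray from the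
  -- apex through the origin leaves through `s₀` only, so exactly one simplex contains the origin.
  refine ⟨cone (-center s₀) (F.link F.fundamentalChain), ?_, ?_, ?_⟩
  · rw [link_apply, map_sum]
    refine sum_mem fun s hs => ?_
    rw [map_zsmul, cone_simplex]
    exact AddSubgroup.zsmul_mem _ (single_mem_chainsIn (hgen s hs) 1) _
  · cases d with
    | zero =>
      rw [bdry_cone_zero, sub_self]
      exact zero_mem _
    | succ q =>
      rw [bdry_cone, sub_sub_cancel_left]
      exact neg_mem (cone_mem_altRel _ F.bdry_link_fundamentalChain)
  · rw [link_apply, map_sum, map_sum, Finset.sum_eq_single s₀]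
    · have h1 := isCone_enum hs₀m
      have h2 : center s₀ = ∑ j, enum d s₀ j := by
        exact (sum_enum hs₀c fun x => x).symm
      rw [map_zsmul, map_zsmul, cone_simplex, countZeros_simplex, h2, zeroSign_cons_neg_sum]
      have hf : F.fundamentalChain (enum d s₀) =
          ((SignType.sign (Matrix.of (enum d s₀)).det : SignType) : ℤ) :=
        if_pos (by convert h1.2)
      rw [hf]
      rcases (F.det_ne_zero_of_isCone h1).lt_or_gt with h | h <;> simp [h]
    · intro s hs hne
      obtain ⟨hs1, hs2⟩ := Finset.mem_filter.1 hs
      rw [map_zsmul, map_zsmul, cone_simplex, countZeros_simplex, zeroSign, if_neg, smul_zero]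
      rw [mem_convexHull_range_iff]
      rintro ⟨b, hb0, hb1, hbs⟩
      rw [Fin.sum_univ_succ] at hb1 hbs
      simp only [Fin.cons_zero, Fin.cons_succ] at hbs
      rcases (hb0 0).eq_or_lt with h | h
      · rw [← h, zero_smul, zero_add] at hbs
        have := Fintype.linearIndependent_iff.1 (isCone_enum hs).linearIndependent
          (fun i => b i.succ) hbs
        rw [← h, zero_add, Finset.sum_congr rfl fun i _ => this i, Finset.sum_const_zero] at hb1
        exact zero_ne_one hb1
      · have hcen : center s₀ ∈ closedCone s := by
          have e1 : center s₀ = ∑ i, (b i.succ / b 0) • enum d s i := by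
            rw [smul_neg, neg_add_eq_zero] at hbs
            have : center s₀ = (b 0)⁻¹ • b 0 • center s₀ := by
              rw [smul_smul, inv_mul_cancel₀ h.ne', one_smul]
            rw [this, hbs, Finset.smul_sum]
            refine Finset.sum_congr rfl fun i _ => ?_
            rw [smul_smul, div_eq_inv_mul]
          rw [e1]
          exact sum_mem_closedCone hs2 subset_rfl (fun i => div_nonneg (hb0 _) h.le)
            fun i hi => absurd (enum_mem hs2 i) hi
        have h4 := subset_of_mem_star hs1 (center_mem_star (Finset.mem_filter.1 hs₀m).1) hcen
        exact hne (Finset.eq_of_subset_of_card_le h4 (by rw [hs₀c, hs2])).symm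
    · exact fun h => absurd hs₀m h

end Link

/-! ### Sections with values in chains of cones -/

section Euler

variable {P : Type*} [Group P] [TopologicalSpace P] [DiscreteTopology P]

/-- Equivariant chains of cones, with the sign convention `∂ η_{q+1} = -∑ᵢ (-1)ⁱ η_q(…, ĝᵢ, …)`. -/
def sectionCones (ρ : P →* O d) : (q : ℕ) → (Fin q → P) → (Fin q → Vec d) → ℤ
  | 0 => fun _ _ => 1
  -- The contraction is not equivariant, so it is applied to normalised simplices and the result is
  -- transported.
  | q + 1 => fun g => chainAction ℤ ρ 1 (q + 1) (g 0)
      (F.contraction q (-faceSum (sectionCones ρ q) (normalize g)))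

variable {F} {ρ : P →* O d}

theorem sectionCones_mul (q : ℕ) (h : P) (g : Fin q → P) :
    F.sectionCones ρ q (fun i => h * g i) = chainAction ℤ ρ 1 q h (F.sectionCones ρ q g) := by
  cases q with
  | zero =>
    funext w
    rw [chainAction_apply]
    simp [sectionCones]
  | succ q => simp only [sectionCones, normalize_mul, chainAction_mul]

theorem faceSum_sectionCones_normalize (q : ℕ) (g : Fin (q + 1) → P) :
    chainAction ℤ ρ 1 q (g 0) (faceSum (F.sectionCones ρ q) (normalize g)) =
      faceSum (F.sectionCones ρ q) g := by
  rw [map_faceSum]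
  simp only [← sectionCones_mul]
  have e : g = fun i => g 0 * normalize g i := by
    funext i
    simp [normalize]
  conv_rhs => rw [e]
  rfl

/-- The degree of the boundary of an equivariant chain of cones over a `d`-simplex of `EP`. -/
def eulerDegree (F : ConeComplex d) (ρ : P →* O d) (g : Fin (d + 1) → P) : ℤ :=
  (-1 : ℤ) ^ d • F.pairing ![F.contractionApex] (faceSum (F.sectionCones ρ d) g)

variable (hF : F.Invariant ρ)
include hF

theorem sectionCones_mem (q : ℕ) (g : Fin q → P) : F.sectionCones ρ q g ∈ F.chains ℤ q := by
  cases q with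
  | zero =>
    refine ⟨fun w _ => ⟨Function.injective_of_subsingleton _, by simpa using F.empty_mem⟩,
      fun e w => ?_⟩
    rw [Subsingleton.elim e 1]
    simp [sectionCones]
  | succ q => exact chainAction_mem 1 hF _ (F.contraction_mem _)

theorem faceSum_sectionCones_mem (q : ℕ) (g : Fin (q + 1) → P) :
    faceSum (F.sectionCones ρ q) g ∈ F.chains ℤ q :=
  faceSum_mem fun _ => sectionCones_mem hF q _

theorem boundary_sectionCones_of_isCycle (q : ℕ) (hq : q < d) (g : Fin (q + 1) → P)
    (h : F.IsCycle (faceSum (F.sectionCones ρ q) (normalize g))) :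
    F.boundary ℤ q (F.sectionCones ρ (q + 1) g) = -faceSum (F.sectionCones ρ q) g := by
  have h' : F.IsCycle (-faceSum (F.sectionCones ρ q) (normalize g)) := by
    cases q with
    | zero => trivial
    | succ q =>
      change F.boundary ℤ q _ = 0
      rw [map_neg, neg_eq_zero]
      exact h
  rw [sectionCones, boundary_chainAction 1 hF,
    F.boundary_contraction hq (neg_mem (faceSum_sectionCones_mem hF q _)) h', map_neg,
    faceSum_sectionCones_normalize]

/-- By induction the boundaries of the lower chains are, up to sign, face sums, whose alternating
sum vanishes. This makes the next contraction legitimate. -/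
theorem isCycle_faceSum_sectionCones (q : ℕ) (hq : q ≤ d) (g : Fin (q + 1) → P) :
    F.IsCycle (faceSum (F.sectionCones ρ q) g) := by
  induction q with
  | zero => trivial
  | succ q ih =>
    change F.boundary ℤ q _ = 0
    rw [map_faceSum]
    simp only [boundary_sectionCones_of_isCycle hF q hq _ (ih (by omega) _)]
    have : (fun w => -faceSum (F.sectionCones ρ q) w) = fun w =>
        (-AddMonoidHom.id _) (faceSum (F.sectionCones ρ q) w) := rfl
    rw [this, ← map_faceSum]
    have h := faceSum_faceSum (F.sectionCones ρ q) g
    rw [h, map_zero]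

theorem boundary_sectionCones (q : ℕ) (hq : q < d) (g : Fin (q + 1) → P) :
    F.boundary ℤ q (F.sectionCones ρ (q + 1) g) = -faceSum (F.sectionCones ρ q) g :=
  boundary_sectionCones_of_isCycle hF q hq g (isCycle_faceSum_sectionCones hF q hq.le _)

/-- In dimension `d` the contraction stops: the cycle over the boundary of a simplex need not bound,
and the obstruction is its multiplicity along [ℝ^d]. -/
theorem faceSum_sectionCones (g : Fin (d + 1) → P) :
    faceSum (F.sectionCones ρ d) g = smulChain F.fundamentalChain (F.eulerDegree ρ g) :=
  funext fun w => F.cycle_eq_smul_fundamentalChain (faceSum_sectionCones_mem hF d g)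
    (isCycle_faceSum_sectionCones hF d le_rfl g) w

/-- Replacing cones by the simplices on their generators turns the chains of cones into a section
over the (d-1)-skeleton; the signs in `boundary` and in `sectionCones` cancel. This is the bridge
between the zero count and the cellular complex. -/
theorem represents_eulerClass :
    Represents (eulerClass ρ) fun g : Fin d → P => F.eulerDegree ρ (Fin.partialProd g) := by
  refine represents_eulerClass_of_filling ρ (fun q g => F.link (F.sectionCones ρ q g))
    (fun q _ g => F.link_mem _) (fun q _ h g => ?_) (fun g => ?_) (fun q hq g => ?_) _ fun g => ?_
  · rw [sectionCones_mul]
    exact F.link_chainAction_sub_mem hF h (sectionCones_mem hF q g)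
  · have h0 : F.conesOf 0 = {∅} := by
      ext s
      rw [conesOf, Finset.mem_filter, Finset.card_eq_zero, Finset.mem_singleton]
      exact ⟨fun h => h.2, fun h => ⟨h ▸ F.empty_mem, h⟩⟩
    rw [link_apply, h0, Finset.sum_singleton]
    simp only [sectionCones, one_smul]
    congr 1
    exact Subsingleton.elim _ _
  · have h := F.bdry_link_add_mem (sectionCones_mem hF (q + 1) g)
    rw [boundary_sectionCones hF q hq, map_neg, ← sub_eq_add_neg, map_faceSum] at h
    exact h
  -- The boundary of a d-simplex goes to `eulerDegree` times the link of the origin, which is filled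
  -- by the same multiple of a chain with one zero.
  · obtain ⟨c, hc, hb, h1⟩ := F.exists_filling_link
    refine ⟨F.eulerDegree ρ (Fin.partialProd g) • c, AddSubgroup.zsmul_mem _ hc _, ?_, ?_⟩
    · have h2 : faceSum (fun g => F.link (F.sectionCones ρ d g)) (Fin.partialProd g) =
          F.eulerDegree ρ (Fin.partialProd g) • F.link F.fundamentalChain := by
        rw [← map_faceSum, ← map_zsmul]
        congr 1
        refine (faceSum_sectionCones hF _).trans ?_
        funext w
        exact mul_comm _ _
      rw [h2, map_zsmul, ← smul_sub]
      exact AddSubgroup.zsmul_mem _ hb _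
    · rw [map_zsmul, h1, smul_eq_mul, mul_one]

end Euler

end ConeComplex

end

end PointGroupLSM

namespace PointGroupLSM

noncomputable section

set_option linter.unusedSectionVars false

/-! ### The LSM anomaly -/

/-- Leibniz rule for a front face times a back face sharing the vertex in position `j`. Faces up to
`j` act on `f` and the last three act on `b`; the cocycle condition trades the latter for the single
missing face of `f`. -/
theorem faceSum_cup {α A : Type*} [AddCommGroup A] (j : ℕ) (f : (Fin (j + 1) → α) → ℤ)
    (b : (Fin 3 → α) → A) (hb : ∀ u : Fin 4 → α, faceSum b u = 0) (g : Fin (j + 4) → α) :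
    faceSum (fun g' : Fin (j + 3) → α =>
      f (fun i => g' (Fin.castAdd 2 i)) • b (fun i => g' (Fin.natAdd j i))) g =
      faceSum f (fun i : Fin (j + 2) => g (Fin.castAdd 2 i)) •
        b (fun i => g (Fin.natAdd (j + 1) i)) := by
  have hc1 : ∀ (i : Fin (j + 1)) (l : Fin (j + 1)),
      (Fin.castAdd 3 i : Fin (j + 4)).succAbove (Fin.castAdd 2 l : Fin (j + 3)) =
        Fin.castAdd 2 (i.castSucc.succAbove l : Fin (j + 2)) := by
    intro i l
    ext
    simp only [Fin.succAbove, Fin.lt_def, Fin.val_castSucc, Fin.val_castAdd]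
    split_ifs <;> simp
  have hc2 : ∀ (i : Fin (j + 1)) (l : Fin 3),
      (Fin.castAdd 3 i : Fin (j + 4)).succAbove (Fin.natAdd j l : Fin (j + 3)) =
        Fin.natAdd (j + 1) l := by
    intro i l
    ext
    have := i.2
    simp only [Fin.succAbove, Fin.lt_def, Fin.val_castSucc, Fin.val_castAdd, Fin.val_natAdd]
    rw [if_neg (by omega)]
    simp only [Fin.val_succ, Fin.val_natAdd]
    omega
  have hc3 : ∀ (i : Fin 3) (l : Fin (j + 1)),
      (Fin.natAdd (j + 1) i : Fin (j + 4)).succAbove (Fin.castAdd 2 l : Fin (j + 3)) =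
        Fin.castAdd 2 (l.castSucc : Fin (j + 2)) := by
    intro i l
    ext
    have := l.2
    simp only [Fin.succAbove, Fin.lt_def, Fin.val_castSucc, Fin.val_castAdd, Fin.val_natAdd]
    rw [if_pos (by omega)]
    simp
  have hc4 : ∀ (i : Fin 3) (l : Fin 3),
      (Fin.natAdd (j + 1) i : Fin (j + 4)).succAbove (Fin.natAdd j l : Fin (j + 3)) =
        Fin.natAdd j (i.succ.succAbove l : Fin 4) := by
    intro i l
    ext
    simp only [Fin.succAbove, Fin.lt_def, Fin.val_castSucc, Fin.val_natAdd, Fin.val_succ]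
    split_ifs <;> simp <;> omega
  have h1 := Fin.sum_univ_add (a := j + 1) (b := 3) fun i : Fin (j + 4) => (-1 : ℤ) ^ (i : ℕ) •
    (f (fun l => g (i.succAbove (Fin.castAdd 2 l : Fin (j + 3)))) •
      b fun l => g (i.succAbove (Fin.natAdd j l : Fin (j + 3))))
  simp only [hc1, hc2, hc3, hc4, Fin.val_castAdd, Fin.val_natAdd] at h1
  have h2 := hb fun l : Fin 4 => g (Fin.natAdd j l)
  rw [faceSum, Fin.sum_univ_succ] at h2
  have h3 : (fun l : Fin 3 => g (Fin.natAdd j ((0 : Fin 4).succAbove l))) =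
      fun l => g (Fin.natAdd (j + 1) l) := by
    funext l
    congr 1
    ext
    simp
    omega
  rw [h3] at h2
  simp only [Fin.val_zero, pow_zero, one_smul, Fin.val_succ] at h2
  have h4 : faceSum f (fun i : Fin (j + 2) => g (Fin.castAdd 2 i)) =
      ∑ i : Fin (j + 1), (-1 : ℤ) ^ (i : ℕ) *
        f (fun l => g (Fin.castAdd 2 (i.castSucc.succAbove l : Fin (j + 2)))) +
      (-1 : ℤ) ^ (j + 1) * f (fun l => g (Fin.castAdd 2 (l.castSucc : Fin (j + 2)))) := by
    rw [faceSum, Fin.sum_univ_castSucc]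
    simp only [Fin.val_castSucc, Fin.val_last, Fin.succAbove_last, smul_eq_mul]
  refine Eq.trans h1 ?_
  rw [h4, add_smul, Finset.sum_smul]
  simp only [smul_smul]
  refine congrArg₂ (· + ·) rfl ?_
  -- The back face starting at position `j + 1` is minus the sum of the other three faces of `b`.
  rw [eq_neg_of_add_eq_zero_left h2, smul_neg, Finset.smul_sum, ← Finset.sum_neg_distrib]
  refine Finset.sum_congr rfl fun i _ => ?_
  rw [smul_smul, ← neg_smul]
  congr 1
  ring

theorem faceSum_homogeneous_eq_zero {G A : Type*} [Group G] [AddCommGroup A] (act : G → A →+ A)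
    (h1 : ∀ m, act 1 m = m) (hm : ∀ g h m, act (g * h) m = act g (act h m)) {n : ℕ}
    {f : (Fin n → G) → A} (hf : coboundary act n f = 0) (u : Fin (n + 2) → G) :
    faceSum (homogeneous act f) u = 0 := by
  have h2 := coboundary_eq_faceSum act h1 hm f fun i => (u i.castSucc)⁻¹ * u i.succ
  rw [hf, Pi.zero_apply] at h2
  have h3 : u = fun i => u 0 * Fin.partialProd (fun i => (u i.castSucc)⁻¹ * u i.succ) i :=
    (Fin.partialProd_left_inv u).symm
  have h4 : faceSum (homogeneous act f) u = act (u 0) (faceSum (homogeneous act f)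
      (Fin.partialProd fun i => (u i.castSucc)⁻¹ * u i.succ)) := by
    rw [map_faceSum]
    simp only [← homogeneous_mul act hm f]
    conv_lhs => rw [h3]
    rfl
  rw [h4, ← h2, map_zero]

theorem partialProd_castAdd {G : Type*} [Group G] {n : ℕ} (g : Fin (n + 2) → G) (i : Fin (n + 1)) :
    Fin.partialProd g (Fin.castAdd 2 i) = Fin.partialProd (fun i : Fin n => g (Fin.castAdd 2 i)) i := by
  induction i using Fin.induction with
  | zero =>
    rw [Fin.partialProd_zero]
    exact Fin.partialProd_zero g
  | succ i ih =>
    rw [Fin.partialProd_succ, ← ih]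
    exact Fin.partialProd_succ g (Fin.castAdd 2 i)

theorem map_partialProd {G H : Type*} [Group G] [Group H] (φ : G →* H) {n : ℕ} (g : Fin n → G)
    (i : Fin (n + 1)) : φ (Fin.partialProd g i) = Fin.partialProd (fun i => φ (g i)) i := by
  induction i using Fin.induction with
  | zero => simp
  | succ i ih => rw [Fin.partialProd_succ, Fin.partialProd_succ, map_mul, ih]

theorem partialProd_last {M : Type*} [CommMonoid M] {n : ℕ} (g : Fin n → M) :
    Fin.partialProd g (Fin.last n) = ∏ i, g i := by
  rw [Fin.partialProd, ← List.prod_ofFn]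
  congr 1
  exact List.take_of_length_le (by simp)

theorem continuous_partialProd {G : Type*} [Group G] [TopologicalSpace G] [ContinuousMul G] {n : ℕ}
    (i : Fin (n + 1)) : Continuous fun g : Fin n → G => Fin.partialProd g i := by
  induction i using Fin.induction with
  | zero => simpa using continuous_const
  | succ i ih =>
    simp only [Fin.partialProd_succ]
    exact ih.mul (continuous_apply i)

namespace ConeComplex

variable {d : ℕ} {G : Type*} [Group G] [TopologicalSpace G] (F : ConeComplex d)
  {P : Type*} [Group P] [TopologicalSpace P] [DiscreteTopology P] (ρ : P →* O d) (π : G →ₜ* P)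
  (σ : G →ₜ* ℤˣ) {A : Type*} [AddCommGroup A] (a : (Fin 2 → G) → A)

/-- The products of the equivariant chains of cones with the cochain `a`. -/
def cupCones : (k : ℕ) → (Fin (k + 2) → G) → (Fin k → Vec d) → A
  -- In dimension zero the front face would be empty and could not share a vertex with the three
  -- points on which `a` is evaluated.
  | 0 => 0
  | j + 1 => fun g => smulChain (F.sectionCones ρ (j + 1) fun i => π (g (Fin.castAdd 2 i)))
      (homogeneous (twist A σ) a fun i => g (Fin.natAdd j i))

/-- The products of the boundaries of the equivariant chains of cones with the cochain `a`. -/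
def cupConesBoundary (k : ℕ) (g : Fin (k + 3) → G) : (Fin k → Vec d) → A :=
  smulChain (faceSum (F.sectionCones ρ k) fun i : Fin (k + 1) => π (g (Fin.castAdd 2 i)))
    (homogeneous (twist A σ) a fun i => g (Fin.natAdd k i))

theorem twist_one (x : A) : twist A σ 1 x = x := by simp [twist]

theorem twist_mul (g h : G) (x : A) : twist A σ (g * h) x = twist A σ g (twist A σ h x) := by
  simp [twist, mul_smul]

theorem cupCones_mul (k : ℕ) (h : G) (g : Fin (k + 2) → G) :
    F.cupCones ρ π σ a k (fun i => h * g i) =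
      chainAction A (ρ.comp π.toMonoidHom) σ k h (F.cupCones ρ π σ a k g) := by
  cases k with
  | zero => exact (map_zero _).symm
  | succ j =>
    funext w
    rw [chainAction_apply]
    have h1 := homogeneous_mul (twist A σ) (twist_mul σ) a h fun i => g (Fin.natAdd j i)
    have h2 := congrFun (sectionCones_mul (F := F) (ρ := ρ) (j + 1) (π h)
      fun i => π (g (Fin.castAdd 2 i))) w
    simp only [← map_mul] at h2
    change F.sectionCones ρ (j + 1) (fun i => π (h * g (Fin.castAdd 2 i))) w • homogeneous
      (twist A σ) a (fun i => h * g (Fin.natAdd j i)) = _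
    rw [h1, h2, chainAction_apply]
    change _ = _ • F.sectionCones ρ (j + 1) (fun i => π (g (Fin.castAdd 2 i)))
      (fun i => (ρ (π h⁻¹)).1 *ᵥ w i) • homogeneous (twist A σ) a fun i => g (Fin.natAdd j i)
    have h3 : π h⁻¹ = (π h)⁻¹ := map_inv π h
    rw [h3]
    refine (smul_comm _ _ _).trans (congrArg (((σ h : ℤˣ) : ℤ) • ·) (congrArg (fun n : ℤ =>
      n • homogeneous (twist A σ) a fun i => g (Fin.natAdd j i)) ?_))
    exact one_smul ℤ _

variable {a} [TopologicalSpace A] [IsTopologicalAddGroup A] [SecondCountableTopology A]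

theorem faceSum_cupCones (ha : a ∈ cocycles A σ 2) (j : ℕ) (g : Fin (j + 4) → G) :
    faceSum (F.cupCones ρ π σ a (j + 1)) g = F.cupConesBoundary ρ π σ a (j + 1) g := by
  funext w
  have h1 := map_faceSum (Pi.evalAddMonoidHom (fun _ : Fin (j + 1) → Vec d => A) w)
    (F.cupCones ρ π σ a (j + 1)) g
  refine h1.trans ?_
  have h2 := map_faceSum (Pi.evalAddMonoidHom (fun _ : Fin (j + 1) → Vec d => ℤ) w)
    (F.sectionCones ρ (j + 1)) fun i : Fin (j + 2) => π (g (Fin.castAdd 2 i))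
  have h3 := faceSum_cup j (fun u => F.sectionCones ρ (j + 1) (fun i => π (u i)) w)
    (homogeneous (twist A σ) a)
    (faceSum_homogeneous_eq_zero _ (twist_one σ) (twist_mul σ) ha.2) g
  refine h3.trans ?_
  rw [faceSum_comp π fun u => F.sectionCones ρ (j + 1) u w]
  exact congrArg (· • homogeneous (twist A σ) a fun i => g (Fin.natAdd (j + 1) i)) h2.symm

/-- Over a vertex the face sum is the value 1 of the empty cone, so the lowest product is `a`
itself. This is the end of the telescope at the origin. -/
theorem cupConesBoundary_zero (g : Fin 2 → G) (w : Fin 0 → Vec d) :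
    F.cupConesBoundary ρ π σ a 0 (Fin.partialProd g) w = a g := by
  have h1 := homogeneous_partialProd (twist A σ) (twist_one σ) a g
  change faceSum (F.sectionCones ρ 0) _ w • homogeneous (twist A σ) a _ = _
  have h2 : (fun i : Fin 3 => Fin.partialProd g (Fin.natAdd 0 i)) = Fin.partialProd g := by
    funext i
    congr 1
    ext
    simp
  rw [h2, h1, faceSum, Fin.sum_univ_one]
  simp [sectionCones]

variable {F ρ} (hF : F.Invariant ρ)
include hF

theorem boundary_cupCones (k : ℕ) (hk : k < d) (g : Fin (k + 3) → G) :
    F.boundary A k (F.cupCones ρ π σ a (k + 1) g) = -F.cupConesBoundary ρ π σ a k g := by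
  change F.boundary A k (smulChain _ _) = _
  rw [boundary_smulChain, boundary_sectionCones hF k hk]
  funext w
  exact neg_smul _ _

theorem cupCones_mem (k : ℕ) (g : Fin (k + 2) → G) : F.cupCones ρ π σ a k g ∈ F.chains A k := by
  cases k with
  | zero => exact zero_mem _
  | succ j => exact smulChain_mem (sectionCones_mem hF _ _) _

theorem cupCones_eq_zero (k : ℕ) (hk : d < k) (g : Fin (k + 2) → G) :
    F.cupCones ρ π σ a k g = 0 := by
  funext w
  exact chains_eq_zero (cupCones_mem π σ hF k g) fun h => by have := h.le; omega

/-- The face sum becomes the Euler number times [ℝ^d]. Evaluating `a` from the vertex g₁⋯g_d on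
produces the sign σ(g₁⋯g_d), which is the twist in `cupCochain`. -/
theorem cupConesBoundary_top (g : Fin (d + 2) → G) :
    F.cupConesBoundary ρ π σ a d (Fin.partialProd g) = smulChain F.fundamentalChain
      (cupCochain σ (fun g => F.eulerDegree ρ (Fin.partialProd fun i => π (g i))) a g) := by
  have h1 : (fun i : Fin (d + 1) => π (Fin.partialProd g (Fin.castAdd 2 i))) =
      Fin.partialProd fun i : Fin d => π (g (Fin.castAdd 2 i)) := by
    funext i
    rw [partialProd_castAdd]
    exact map_partialProd π.toMonoidHom _ i
  have h2 : homogeneous (twist A σ) a (fun i => Fin.partialProd g (Fin.natAdd d i)) =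
      ((∏ i : Fin d, σ (g (Fin.castAdd 2 i)) : ℤˣ) : ℤ) • a fun j => g (Fin.natAdd d j) := by
    have h3 : σ (Fin.partialProd g (Fin.natAdd d (0 : Fin 3))) = ∏ i : Fin d, σ (g (Fin.castAdd 2 i)) := by
      have : (Fin.natAdd d (0 : Fin 3) : Fin (d + 3)) = Fin.castAdd 2 (Fin.last d) := rfl
      rw [this, partialProd_castAdd, ← partialProd_last]
      exact map_partialProd σ.toMonoidHom _ _
    rw [homogeneous, ← h3]
    refine congrArg (twist A σ _) (congrArg a (funext fun i => ?_))
    exact Fin.partialProd_right_inv g (Fin.natAdd d i)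
  rw [cupConesBoundary, h1, faceSum_sectionCones hF, h2]
  funext w
  exact smul_assoc (F.fundamentalChain w)
    (F.eulerDegree ρ (Fin.partialProd fun i : Fin d => π (g (Fin.castAdd 2 i)))) _

/-- The equivariant chain which moves the class at the origin to the top dimension. -/
def transport (F : ConeComplex d) (ρ : P →* O d) (π : G →ₜ* P) (σ : G →ₜ* ℤˣ) (a : (Fin 2 → G) → A) :
    ChainFamily d G A 1 :=
  fun k g => (-1 : ℤ) ^ k • F.cupCones ρ π σ a k (Fin.partialProd g)

theorem transport_mem [IsTopologicalGroup G] (ha : a ∈ cocycles A σ 2) :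
    transport F ρ π σ a ∈ equivariantChains F G A 1 := by
  intro k
  refine AddSubgroup.zsmul_mem (F.cellCochains G A (k + 1) k) ?_ _
  refine ⟨fun g => cupCones_mem π σ hF k _, fun w => ?_⟩
  cases k with
  | zero => exact zero_mem _
  | succ j =>
    have hp := fun i : Fin (j + 3) => continuous_partialProd (G := G) (n := j + 2) i
    refine smul_mem_measurable (f := fun g : Fin (j + 2) → G => F.sectionCones ρ (j + 1)
      (fun i => π (Fin.partialProd g (Fin.castAdd 2 i : Fin (j + 3)))) w) ?_ ?_
    · exact (continuous_of_discreteTopology (f := fun u : Fin (j + 1) → P =>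
        F.sectionCones ρ (j + 1) u w)).comp
        (continuous_pi fun i => (map_continuous π).comp (hp _))
    · refine smul_mem_measurable (f := fun g : Fin (j + 2) → G =>
        ((σ (Fin.partialProd g (Fin.natAdd j (0 : Fin 3) : Fin (j + 3))) : ℤˣ) : ℤ)) ?_ ?_
      · exact Units.continuous_val.comp ((map_continuous σ).comp (hp _))
      · exact comp_mem_measurable (φ := fun (g : Fin (j + 2) → G) (i : Fin 2) =>
          (Fin.partialProd g (Fin.natAdd j i.castSucc : Fin (j + 3)))⁻¹ *
            Fin.partialProd g (Fin.natAdd j i.succ : Fin (j + 3)))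
          (continuous_pi fun i => (hp _).inv.mul (hp _)) ha.1

/-- ∂ of the component in dimension `k + 1` and δ of the component in dimension `k` give the same
product with opposite signs. Only the ends survive: at `k = 0` there is no δ-term, and at `k = d` no
∂-term. -/
theorem totalBoundary_transport (ha : a ∈ cocycles A σ 2) (k : ℕ) (g : Fin (k + 2) → G) :
    totalBoundary A F (ρ.comp π.toMonoidHom) σ 1 (transport F ρ π σ a) k g =
      (if k < d then (-1 : ℤ) ^ k • F.cupConesBoundary ρ π σ a k (Fin.partialProd g) else 0) -
      (if 0 < k ∧ k ≤ d then (-1 : ℤ) ^ k • F.cupConesBoundary ρ π σ a k (Fin.partialProd g) else 0) := by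
  have h1 : F.boundary A k (transport F ρ π σ a (k + 1) (g ∘ Fin.cast (by omega))) =
      if k < d then (-1 : ℤ) ^ k • F.cupConesBoundary ρ π σ a k (Fin.partialProd g) else 0 := by
    change F.boundary A k ((-1 : ℤ) ^ (k + 1) • F.cupCones ρ π σ a (k + 1) (Fin.partialProd g)) = _
    rw [map_zsmul]
    split_ifs with hk
    · rw [boundary_cupCones π σ hF k hk, pow_succ, mul_neg_one, neg_smul, smul_neg, neg_neg]
    · rw [cupCones_eq_zero π σ hF (k + 1) (by omega), map_zero, smul_zero]
  have h2 : coboundary (chainAction A (ρ.comp π.toMonoidHom) σ k) (k + 1)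
      (transport F ρ π σ a k) g = (-1 : ℤ) ^ k • faceSum (F.cupCones ρ π σ a k) (Fin.partialProd g) := by
    have h3 := coboundary_partialProd (chainAction A (ρ.comp π.toMonoidHom) σ k)
      (F.cupCones ρ π σ a k) (F.cupCones_mul ρ π σ a k) g
    rw [← h3]
    have : transport F ρ π σ a k = (-1 : ℤ) ^ k • fun g => F.cupCones ρ π σ a k (Fin.partialProd g) := rfl
    rw [this, map_zsmul]
    rfl
  rw [totalBoundary_apply, h1, h2, pow_one, neg_smul, one_smul, ← sub_eq_add_neg]
  congr 1
  cases k with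
  | zero =>
    rw [if_neg (by omega)]
    simp [faceSum, cupCones]
  | succ j =>
    split_ifs with hk
    · rw [F.faceSum_cupCones ρ π σ ha j]
    · rw [faceSum, Finset.sum_eq_zero, smul_zero]
      intro i _
      rw [cupCones_eq_zero π σ hF (j + 1) (by omega), smul_zero]

/-- The two surviving ends of the telescope are `a · [0]` and the Euler cochain times `a` on [ℝ^d].
For `d = 0` they coincide and the transport contributes nothing. -/
theorem atOrigin_eq (ha : a ∈ cocycles A σ 2) :
    atOrigin a = totalBoundary A F (ρ.comp π.toMonoidHom) σ 1 (transport F ρ π σ a) +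
      (-1 : ℤ) ^ d • F.timesFundamental 2
        (cupCochain σ (fun g => F.eulerDegree ρ (Fin.partialProd fun i => π (g i))) a) := by
  funext k g w
  have h0 : ∀ (k : ℕ), k ≠ 0 → ∀ g w, (atOrigin a : ChainFamily d G A 2) k g w = 0 :=
    fun k hk g w => dif_neg hk
  have h1 : ∀ g w, (atOrigin a : ChainFamily d G A 2) 0 g w =
      F.cupConesBoundary ρ π σ a 0 (Fin.partialProd g) w := fun g w =>
    (F.cupConesBoundary_zero ρ π σ g w).symm
  have h2 : ((-1 : ℤ) ^ d • F.timesFundamental 2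
      (cupCochain σ (fun g => F.eulerDegree ρ (Fin.partialProd fun i => π (g i))) a)) k g w =
      if k = d then (-1 : ℤ) ^ k • F.cupConesBoundary ρ π σ a k (Fin.partialProd g) w else 0 := by
    split_ifs with hk
    · subst hk
      rw [cupConesBoundary_top π σ hF]
      exact congrArg (fun x : A => (-1 : ℤ) ^ k • x)
        (congrFun (congrFun (timesFundamental_self F 2 _) g) w)
    · exact (congrArg (fun x : A => (-1 : ℤ) ^ d • x) (congrFun (congrFun (timesFundamental_of_ne F 2 _ hk) g)
        w)).trans (smul_zero _)
  have h3 := congrFun (totalBoundary_transport π σ hF ha k g) w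
  change _ = totalBoundary A F (ρ.comp π.toMonoidHom) σ 1 (transport F ρ π σ a) k g w + _
  rw [h2, h3, Pi.sub_apply]
  rcases Nat.eq_zero_or_pos k with rfl | hk0
  · rw [h1]
    rcases Nat.eq_zero_or_pos d with hd | hd
    · simp [hd]
    · simp [hd, hd.ne]
  · rw [h0 k hk0.ne']
    rcases lt_trichotomy k d with hk | hk | hk
    · simp [hk, hk0, hk.le, hk.ne]
    · simp [hk, hk ▸ hk0]
    · simp [hk.not_gt, hk.not_ge, hk.ne']

end ConeComplex

end

end PointGroupLSM

namespace PointGroupLSM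

noncomputable section

set_option linter.unusedSectionVars false

/-! ### Bilinearity of the cup product, and the LSM anomaly -/

section

variable {G : Type*} [Group G] [TopologicalSpace G] {A : Type*} [AddCommGroup A]
  [TopologicalSpace A] [IsTopologicalAddGroup A] [SecondCountableTopology A] {χ ψ : G →ₜ* ℤˣ}
  {p q : ℕ}

theorem cup_add_left (x x' : Cohomology ℤ χ p) (y : Cohomology A ψ q) :
    cup (x + x') y = cup x y + cup x' y := by
  induction x using QuotientAddGroup.induction_on with | H a => ?_
  induction x' using QuotientAddGroup.induction_on with | H a' => ?_
  induction y using QuotientAddGroup.induction_on with | H b => ?_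
  refine congrArg QuotientAddGroup.mk (Subtype.ext ?_)
  funext g
  exact add_smul (a.1 _) (a'.1 _) _

theorem cup_add_right (x : Cohomology ℤ χ p) (y y' : Cohomology A ψ q) :
    cup x (y + y') = cup x y + cup x y' := by
  induction x using QuotientAddGroup.induction_on with | H a => ?_
  induction y using QuotientAddGroup.induction_on with | H b => ?_
  induction y' using QuotientAddGroup.induction_on with | H b' => ?_
  refine congrArg QuotientAddGroup.mk (Subtype.ext ?_)
  funext g
  exact (congrArg (a.1 _ • ·) (smul_add _ _ _)).trans (smul_add _ _ _)

theorem cup_zero_left (y : Cohomology A ψ q) : cup (0 : Cohomology ℤ χ p) y = 0 := by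
  have h := cup_add_left (0 : Cohomology ℤ χ p) 0 y
  rwa [add_zero, left_eq_add] at h

theorem Represents.cup {x : Cohomology ℤ χ p} {y : Cohomology A ψ q} {a : (Fin p → G) → ℤ}
    {b : (Fin q → G) → A} (hx : Represents x a) (hy : Represents y b) :
    Represents (PointGroupLSM.cup x y) (cupCochain ψ a b) := by
  obtain ⟨ha, rfl⟩ := hx
  obtain ⟨hb, rfl⟩ := hy
  exact ⟨cupCochain_mem_cocycles χ ψ ha hb, rfl⟩

theorem Represents.pullback {K : Type*} [Group K] [TopologicalSpace K] (φ : K →ₜ* G)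
    {x : Cohomology A χ p} {a : (Fin p → G) → A} (hx : Represents x a) :
    Represents (PointGroupLSM.pullback φ x) fun g => a (φ ∘ g) := by
  obtain ⟨ha, rfl⟩ := hx
  exact ⟨_, rfl⟩

theorem exists_represents (x : Cohomology A χ p) : ∃ a, Represents x a := by
  induction x using QuotientAddGroup.induction_on with | H a => ?_
  exact ⟨a.1, a.2, rfl⟩

end

section

variable {d : ℕ} {P : Type*} [Group P] [TopologicalSpace P] [DiscreteTopology P] {ρ : P →* O d}
  {G : Type*} [Group G] [TopologicalSpace G] {F : ConeComplex d} (π : G →ₜ* P) (σ : G →ₜ* ℤˣ)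

theorem invariant_comp (hF : F.Invariant ρ) : F.Invariant (ρ.comp π.toMonoidHom) :=
  fun g => hF (π g)

theorem isClopen_mulVec_eq (x y : Vec d) :
    IsClopen {g | ((ρ.comp π.toMonoidHom) g⁻¹).1 *ᵥ x = y} := by
  have h : {g | ((ρ.comp π.toMonoidHom) g⁻¹).1 *ᵥ x = y} = π ⁻¹' {p | (ρ p⁻¹).1 *ᵥ x = y} := by
    ext g
    change (ρ (π g⁻¹)).1 *ᵥ x = y ↔ (ρ (π g)⁻¹).1 *ᵥ x = y
    rw [show π g⁻¹ = (π g)⁻¹ from map_inv π g]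
  rw [h]
  exact (isClopen_discrete _).preimage (map_continuous π)

theorem orTwist_coe (g : G) : ((orTwist ρ π σ g : ℤˣ) : ℤ) =
    ((SignType.sign ((ρ.comp π.toMonoidHom) g).1.det : SignType) : ℤ) * ((σ g : ℤˣ) : ℤ) := by
  change (((orientation ρ (π g)) * σ g : ℤˣ) : ℤ) = _
  rw [Units.val_mul, orientation_coe]
  rfl

/-- In even dimension there is no sign; in odd dimension the Euler class is 2-torsion, so the sign
does not matter. -/
theorem neg_one_pow_smul_cup_eulerClass (ω : Cohomology U1 σ 2) :
    (-1 : ℤ) ^ d • cup (pullback π (eulerClass ρ)) ω = cup (pullback π (eulerClass ρ)) ω := by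
  rcases Nat.even_or_odd d with hd | hd
  · rw [hd.neg_one_pow, one_smul]
  · have h : cup (pullback π (eulerClass ρ)) ω + cup (pullback π (eulerClass ρ)) ω = 0 := by
      rw [← cup_add_left, ← map_add, ← two_nsmul, two_nsmul_eulerClass ρ hd, map_zero, cup_zero_left]
    rw [hd.neg_one_pow, neg_one_smul]
    exact (eq_neg_of_add_eq_zero_left h).symm

variable {π σ}

theorem fundamentalHom_represents (hF : F.Invariant ρ) {y : Cohomology U1 (orTwist ρ π σ) (d + 2)}
    {c : (Fin (d + 2) → G) → U1} (hy : Represents y c) :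
    HomologyRepresents (ConeComplex.fundamentalHom (invariant_comp π hF) (orTwist_coe π σ) y)
      (timesFundamentalChain F c) := by
  obtain ⟨hc, rfl⟩ := hy
  exact ⟨ConeComplex.timesFundamental_mem_cycles (invariant_comp π hF) (orTwist_coe π σ) hc, rfl⟩

theorem HomologyRepresents.unique {A : Type*} [AddCommGroup A] [TopologicalSpace A]
    [IsTopologicalAddGroup A] [SecondCountableTopology A] {τ : G →* O d} {m : ℕ}
    {x x' : EquivariantHomology A F τ σ m} {β : ChainFamily d G A (m + 1)}
    (h : HomologyRepresents x β) (h' : HomologyRepresents x' β) : x = x' := by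
  obtain ⟨_, rfl⟩ := h
  obtain ⟨_, rfl⟩ := h'
  rfl

/-- `atOrigin_eq` exhibits the two cycles as homologous up to the sign (-1)^d, which the previous
torsion argument absorbs. -/
theorem fundamentalHom_cup_represents [IsTopologicalGroup G] (hF : F.Invariant ρ)
    {ω : Cohomology U1 σ 2} {a : (Fin 2 → G) → U1} (ha : Represents ω a) :
    HomologyRepresents (ConeComplex.fundamentalHom (invariant_comp π hF) (orTwist_coe π σ)
      (cup (pullback π (eulerClass ρ)) ω)) (atOrigin a) := by
  set b := cupCochain σ (fun g => F.eulerDegree ρ (Fin.partialProd fun i => π (g i))) a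
  have hb : Represents (cup (pullback π (eulerClass ρ)) ω) b :=
    ((ConeComplex.represents_eulerClass hF).pullback π).cup ha
  have hat := ConeComplex.atOrigin_eq π σ hF ha.1
  have hT := ConeComplex.transport_mem π σ hF ha.1
  rw [← neg_one_pow_smul_cup_eulerClass π σ ω, map_zsmul]
  obtain ⟨hc, hx⟩ := fundamentalHom_represents hF hb
  have hdd : totalBoundary U1 F (ρ.comp π.toMonoidHom) σ 1
      (ConeComplex.transport F ρ π σ a) ∈ equivariantCycles U1 F (ρ.comp π.toMonoidHom) σ 2 :=
    ⟨ConeComplex.totalBoundary_mem σ (invariant_comp π hF) (isClopen_mulVec_eq π) hT,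
      ConeComplex.totalBoundary_totalBoundary σ (invariant_comp π hF) hT⟩
  have hmem : atOrigin a ∈ equivariantCycles U1 F (ρ.comp π.toMonoidHom) σ 2 := by
    rw [hat]
    exact add_mem hdd (AddSubgroup.zsmul_mem _ hc _)
  refine ⟨hmem, ?_⟩
  rw [hx]
  refine QuotientAddGroup.eq.2 ?_
  rw [AddSubgroup.mem_addSubgroupOf]
  refine ⟨_, hT, ?_⟩
  change _ = -((-1 : ℤ) ^ d • F.timesFundamental 2 b) + atOrigin a
  rw [hat]
  abel

theorem isLSMAnomaly_iff [IsTopologicalGroup G] (hF : F.Invariant ρ) (ω : Cohomology U1 σ 2)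
    (y : Cohomology U1 (orTwist ρ π σ) (d + 2)) :
    IsLSMAnomaly F ρ π σ ω y ↔ y = cup (pullback π (eulerClass ρ)) ω := by
  constructor
  · rintro ⟨x, a, c, ha, hc, hx, hx'⟩
    refine (ConeComplex.fundamentalHom_bijective (A := U1) (invariant_comp π hF)
      (isClopen_mulVec_eq π) (orTwist_coe π σ)).1 ?_
    rw [← hx'.unique (fundamentalHom_represents hF hc), hx.unique (fundamentalHom_cup_represents hF ha)]
  · rintro rfl
    obtain ⟨a, ha⟩ := exists_represents ω
    obtain ⟨c, hc⟩ := exists_represents (cup (pullback π (eulerClass ρ)) ω)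
    exact ⟨_, a, c, ha, hc, fundamentalHom_cup_represents hF ha, fundamentalHom_represents hF hc⟩

theorem exists_fundamental_addEquiv [IsTopologicalGroup G] (hF : F.Invariant ρ) :
    ∃ Φ : Cohomology U1 (orTwist ρ π σ) (d + 2) ≃+
        EquivariantHomology U1 F (ρ.comp π.toMonoidHom) σ 1,
      ∀ y c, Represents y c → HomologyRepresents (Φ y) (timesFundamentalChain F c) :=
  ⟨AddEquiv.ofBijective _ (ConeComplex.fundamentalHom_bijective (invariant_comp π hF)
    (isClopen_mulVec_eq π) (orTwist_coe π σ)), fun _ _ h => fundamentalHom_represents hF h⟩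

end

section

variable {d : ℕ} {P : Type*} [Group P] [TopologicalSpace P] [DiscreteTopology P] {ρ : P →* O d}
  {Gint : Type*} [Group Gint] [TopologicalSpace Gint] {σ : Gint →ₜ* ℤˣ} (α : Cohomology U1 σ 2)

theorem eulerCup_eq_zero (h : eulerClass ρ = 0) : eulerCup ρ α = 0 := by
  rw [eulerCup, h, map_zero, cup_zero_left]

theorem two_nsmul_eulerCup (hd : Odd d) : 2 • eulerCup ρ α = 0 := by
  rw [eulerCup, two_nsmul, ← cup_add_left, ← map_add, ← two_nsmul, two_nsmul_eulerClass ρ hd,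
    map_zero, cup_zero_left]

theorem eulerCup_two_nsmul : eulerCup ρ (2 • α) = 2 • eulerCup ρ α := by
  rw [eulerCup, two_nsmul, map_add, cup_add_right, two_nsmul]
  rfl

end

end

end PointGroupLSM

namespace PointGroupLSM

noncomputable section

set_option linter.unusedSectionVars false

/-! ### Invariant decompositions into cones -/

section

variable {d : ℕ} {I : Type*} (l : I → Vec d →ₗ[ℝ] ℝ)

/-- The signs of the functionals `l` at a point, which determine its face in the arrangement of
their kernels. -/
def signVector (x : Vec d) : I → SignType := fun i => SignType.sign (l i x)

/-- `FaceLE l x y` means that the face of `x` is contained in the closure of the face of `y`. -/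
def FaceLE (x y : Vec d) : Prop :=
  ∀ i, signVector l x i ≠ 0 → signVector l y i = signVector l x i

variable {l}

theorem FaceLE.trans {x y z : Vec d} (h : FaceLE l x y) (h' : FaceLE l y z) : FaceLE l x z :=
  fun i hi => by
    have h1 := h i hi
    rw [h' i (by rwa [h1]), h1]

theorem FaceLE.of_eq {x y : Vec d} (h : signVector l x = signVector l y) : FaceLE l x y :=
  fun i _ => by rw [h]

theorem FaceLE.antisymm {x y : Vec d} (h : FaceLE l x y) (h' : FaceLE l y x) :
    signVector l x = signVector l y := by
  funext i
  by_cases hi : signVector l x i = 0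
  · by_contra hne
    exact hne (h' i fun h0 => hne (hi.trans h0.symm))
  · exact (h i hi).symm

theorem signVector_eq_zero {x : Vec d} {i : I} : signVector l x i = 0 ↔ l i x = 0 := sign_eq_zero_iff

theorem exists_of_not_faceLE {x y : Vec d} (h : FaceLE l x y) (h' : ¬FaceLE l y x) :
    ∃ i, l i x = 0 ∧ l i y ≠ 0 := by
  simp only [FaceLE, not_forall] at h'
  obtain ⟨i, hi, hne⟩ := h'
  refine ⟨i, ?_, fun h0 => hi (signVector_eq_zero.2 h0)⟩
  by_contra h0
  exact hne (h i fun h1 => h0 (signVector_eq_zero.1 h1)).symm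

theorem FaceLE.eq_zero {x y : Vec d} (h : FaceLE l x y) {i : I} (hi : l i y = 0) : l i x = 0 := by
  by_contra h0
  have h1 : signVector l x i ≠ 0 := fun h1 => h0 (signVector_eq_zero.1 h1)
  have h2 := h i h1
  rw [signVector_eq_zero.2 hi] at h2
  exact h1 h2.symm

theorem signVector_sum {ι : Type*} {s : Finset ι} {y : ι → Vec d} {f : I → SignType}
    (hs : s.Nonempty) (hy : ∀ j ∈ s, signVector l (y j) = f) :
    signVector l (∑ j ∈ s, y j) = f := by
  funext i
  have h : ∀ j ∈ s, SignType.sign (l i (y j)) = f i := fun j hj => congrFun (hy j hj) i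
  change SignType.sign (l i (∑ j ∈ s, y j)) = f i
  rw [map_sum]
  rcases hf : f i with _ | _ | _
  · exact sign_eq_zero_iff.2 (Finset.sum_eq_zero fun j hj => sign_eq_zero_iff.1 ((h j hj).trans hf))
  · exact sign_eq_neg_one_iff.2
      (Finset.sum_neg (fun j hj => sign_eq_neg_one_iff.1 ((h j hj).trans hf)) hs)
  · exact sign_eq_one_iff.2 (Finset.sum_pos (fun j hj => sign_eq_one_iff.1 ((h j hj).trans hf)) hs)

theorem exists_greatest_of_isChain {t : Finset (Vec d)} (ht : IsChain (FaceLE l) (t : Set (Vec d)))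
    (hne : t.Nonempty) : ∃ m ∈ t, ∀ w ∈ t, FaceLE l w m := by
  classical
  induction hne using Finset.Nonempty.cons_induction with
  | singleton a => exact ⟨a, by simp, fun w hw => by
      rw [Finset.mem_singleton.1 hw]; exact .of_eq rfl⟩
  | cons a s ha hs ih =>
    obtain ⟨m, hm, hmax⟩ := ih (ht.mono (by simp))
    have hne : a ≠ m := fun h => ha (h ▸ hm)
    rcases ht (Finset.mem_coe.2 (Finset.mem_cons_self a s))
      (Finset.mem_coe.2 (Finset.mem_cons_of_mem hm)) hne with h | h
    · refine ⟨m, Finset.mem_cons_of_mem hm, fun w hw => ?_⟩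
      rcases Finset.mem_cons.1 hw with rfl | hw
      · exact h
      · exact hmax w hw
    · refine ⟨a, Finset.mem_cons_self a s, fun w hw => ?_⟩
      rcases Finset.mem_cons.1 hw with rfl | hw
      · exact .of_eq rfl
      · exact (hmax w hw).trans h

/-- Along a chain of faces the nonzero signs of each functional agree, so a positive combination
suffers no cancellation. -/
theorem faceLE_of_mem_openCone {t : Finset (Vec d)} (ht : IsChain (FaceLE l) (t : Set (Vec d)))
    {x : Vec d} (hx : x ∈ openCone t) {v : Vec d} (hv : v ∈ t) : FaceLE l v x := by
  obtain ⟨c, hc, rfl⟩ := hx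
  intro i hi
  have hsame : ∀ w ∈ t, signVector l w i ≠ 0 → signVector l w i = signVector l v i := by
    intro w hw hwi
    rcases eq_or_ne w v with rfl | hne
    · rfl
    · rcases ht hw hv hne with h | h
      · exact (h i hwi).symm
      · exact h i hi
  change SignType.sign (l i (∑ w ∈ t, c w • w)) = _
  rw [map_sum]
  simp only [map_smul, smul_eq_mul]
  rcases hf : signVector l v i with _ | _ | _
  · exact absurd hf hi
  · refine sign_eq_neg_one_iff.2 (Finset.sum_neg' (fun w hw => ?_) ⟨v, hv, ?_⟩)
    · refine mul_nonpos_of_nonneg_of_nonpos (hc w hw).le ?_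
      by_cases h0 : signVector l w i = 0
      · exact (signVector_eq_zero.1 h0).le
      · exact (sign_eq_neg_one_iff.1 ((hsame w hw h0).trans hf)).le
    · exact mul_neg_of_pos_of_neg (hc v hv) (sign_eq_neg_one_iff.1 hf)
  · refine sign_eq_one_iff.2 (Finset.sum_pos' (fun w hw => ?_) ⟨v, hv, ?_⟩)
    · refine mul_nonneg (hc w hw).le ?_
      by_cases h0 : signVector l w i = 0
      · exact (signVector_eq_zero.1 h0).ge
      · exact (sign_eq_one_iff.1 ((hsame w hw h0).trans hf)).le
    · exact mul_pos (hc v hv) (sign_eq_one_iff.1 hf)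

/-- A functional vanishing on the greatest generator vanishes on all of them. Hence the open cone
lies in the face of its greatest generator, which is thereby determined by the point. -/
theorem signVector_eq_of_mem_openCone {t : Finset (Vec d)}
    (ht : IsChain (FaceLE l) (t : Set (Vec d))) {x : Vec d} (hx : x ∈ openCone t) {m : Vec d}
    (hm : m ∈ t) (hmax : ∀ w ∈ t, FaceLE l w m) : signVector l x = signVector l m := by
  refine FaceLE.antisymm (fun i hi => ?_) (faceLE_of_mem_openCone ht hx hm)
  refine ((faceLE_of_mem_openCone ht hx hm) i fun h0 => hi ?_).symm
  obtain ⟨c, hc, rfl⟩ := hx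
  rw [signVector_eq_zero, map_sum]
  refine Finset.sum_eq_zero fun w hw => ?_
  rw [map_smul, (hmax w hw).eq_zero (signVector_eq_zero.1 h0), smul_zero]

theorem mem_openCone_erase [DecidableEq (Vec d)] {t : Finset (Vec d)} {x m : Vec d}
    (hx : x ∈ openCone t) (hm : m ∈ t) :
    ∃ c : ℝ, 0 < c ∧ x - c • m ∈ openCone (t.erase m) := by
  obtain ⟨c, hc, rfl⟩ := hx
  refine ⟨c m, hc m hm, c, fun v hv => hc v (Finset.mem_of_mem_erase hv), ?_⟩
  rw [← Finset.add_sum_erase t (fun v => c v • v) hm, add_sub_cancel_left]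

theorem mem_openCone_insert [DecidableEq (Vec d)] {t : Finset (Vec d)} {x m : Vec d} {c : ℝ}
    (hc : 0 < c) (hx : x - c • m ∈ openCone t) (hm : m ∉ t) : x ∈ openCone (insert m t) := by
  obtain ⟨c', hc', h⟩ := hx
  have hne : ∀ v ∈ t, v ≠ m := fun v hv h => hm (h ▸ hv)
  refine ⟨fun v => if v = m then c else c' v, fun v hv => ?_, ?_⟩
  · rcases Finset.mem_insert.1 hv with rfl | hv
    · simpa using hc
    · simpa [hne v hv] using hc' v hv
  · rw [Finset.sum_insert hm]
    simp only [if_true]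
    rw [Finset.sum_congr rfl (g := fun v => c' v • v)
      fun v hv => by rw [if_neg (hne v hv)], ← h]
    abel

/-- A point `b x` in the face of every point `x`. -/
structure IsBarycenter (l : I → Vec d →ₗ[ℝ] ℝ) (b : Vec d → Vec d) : Prop where
  separating : ∀ x, (∀ i, l i x = 0) → x = 0
  signVector_eq : ∀ x, signVector l (b x) = signVector l x
  congr : ∀ x y, signVector l x = signVector l y → b x = b y
  finite : (Set.range b).Finite

namespace IsBarycenter

variable {b : Vec d → Vec d} (hb : IsBarycenter l b)
include hb

theorem ext {v w : Vec d} (hv : v ∈ Set.range b) (hw : w ∈ Set.range b)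
    (h : signVector l v = signVector l w) : v = w := by
  obtain ⟨x, rfl⟩ := hv
  obtain ⟨y, rfl⟩ := hw
  rw [hb.signVector_eq, hb.signVector_eq] at h
  exact hb.congr _ _ h

theorem eq_zero {x : Vec d} (h : FaceLE l x 0) : x = 0 :=
  hb.separating x fun i => h.eq_zero (map_zero (l i))

/-- Move from `x` against the barycenter of its face until the first functional vanishes, that is,
up to the minimal ratio `l i x / l i (b x)`. The end point lies in a proper face of the closure. -/
theorem exists_smul {x : Vec d} [Finite I] (hx : x ≠ 0) :
    ∃ c : ℝ, 0 < c ∧ FaceLE l (x - c • b x) x ∧ ¬FaceLE l x (x - c • b x) := by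
  classical
  have := Fintype.ofFinite I
  let s : Finset I := Finset.univ.filter fun i => l i x ≠ 0
  have hs : s.Nonempty := by
    by_contra h
    refine hx (hb.separating x fun i => ?_)
    by_contra hi
    exact h ⟨i, by simpa [s] using hi⟩
  obtain ⟨j, hj, hmin⟩ := s.exists_min_image (fun i => l i x / l i (b x)) hs
  have hpos : ∀ i ∈ s, 0 < l i x / l i (b x) := by
    intro i hi
    have h1 : l i x ≠ 0 := by simpa [s] using hi
    have h2 := congrFun (hb.signVector_eq x) i
    simp only [signVector] at h2
    rcases h1.lt_or_gt with h | h
    · rw [sign_neg h, sign_eq_neg_one_iff] at h2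
      exact div_pos_of_neg_of_neg h h2
    · rw [sign_pos h, sign_eq_one_iff] at h2
      exact div_pos h h2
  refine ⟨_, hpos j hj, fun i hi => ?_, fun h => ?_⟩
  · simp only [signVector, map_sub, map_smul, smul_eq_mul] at hi ⊢
    have h2 := congrFun (hb.signVector_eq x) i
    simp only [signVector] at h2
    rcases lt_trichotomy (l i x) 0 with h | h | h
    · have hm := hmin i (by simp [s, h.ne])
      rw [sign_neg h, sign_eq_neg_one_iff] at h2
      rw [le_div_iff_of_neg h2] at hm
      rw [sign_neg h]
      exact (sign_neg (lt_of_le_of_ne (by linarith) fun h0 => hi (by rw [h0, sign_zero]))).symm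
    · rw [h, sign_zero, sign_eq_zero_iff] at h2
      rw [h, h2] at hi
      simp at hi
    · have hm := hmin i (by simp [s, h.ne'])
      rw [sign_pos h, sign_eq_one_iff] at h2
      rw [le_div_iff₀ h2] at hm
      rw [sign_pos h]
      exact (sign_pos (lt_of_le_of_ne (by linarith) fun h0 => hi (by rw [← h0, sign_zero]))).symm
  · have h1 : l j x ≠ 0 := by simpa [s] using hj
    refine h1 (h.eq_zero ?_)
    have h2 : l j (b x) ≠ 0 := by
      intro h0
      have := hpos j hj
      rw [h0, div_zero] at this
      exact this.false
    simp only [map_sub, map_smul, smul_eq_mul]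
    field_simp
    simp

omit hb in
-- The number of nonzero signs serves as the dimension on which the inductions run.
theorem card_lt [Fintype I] [DecidableEq I] {x y : Vec d} (h : FaceLE l x y) (h' : ¬FaceLE l y x) :
    (Finset.univ.filter fun i => signVector l x i ≠ 0).card <
      (Finset.univ.filter fun i => signVector l y i ≠ 0).card := by
  refine Finset.card_lt_card (Finset.ssubset_iff_of_subset (fun i hi => ?_) |>.2 ?_)
  · simp only [Finset.mem_filter, Finset.mem_univ, true_and] at hi ⊢
    rwa [h i hi]
  · obtain ⟨i, h1, h2⟩ := exists_of_not_faceLE h h'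
    exact ⟨i, by simpa [signVector_eq_zero] using h2, by simpa [signVector_eq_zero] using h1⟩

/-- Subtract the barycenter of the face of `x` until a smaller face is reached, decompose the rest
by induction, and put the barycenter back as the greatest generator. -/
theorem exists_openCone [Finite I] (x : Vec d) : ∃ t : Finset (Vec d), (∀ v ∈ t, v ∈ Set.range b ∧ v ≠ 0) ∧
    IsChain (FaceLE l) (t : Set (Vec d)) ∧ x ∈ openCone t := by
  classical
  have := Fintype.ofFinite I
  induction h : (Finset.univ.filter fun i => signVector l x i ≠ 0).card using Nat.strong_induction_on
    generalizing x with
  | _ n ih =>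
  by_cases hx : x = 0
  · exact ⟨∅, by simp, by simp, fun _ => 0, by simp, by simp [hx]⟩
  obtain ⟨c, hc, hle, hnle⟩ := hb.exists_smul hx
  obtain ⟨t, ht1, ht2, ht3⟩ := ih _ (h ▸ card_lt hle hnle) _ rfl
  have hbx : FaceLE l x (b x) := .of_eq (hb.signVector_eq x).symm
  have hmem : ∀ v ∈ t, FaceLE l v (b x) := fun v hv =>
    ((faceLE_of_mem_openCone ht2 ht3 hv).trans hle).trans hbx
  have hnot : b x ∉ t := fun h => hnle (hbx.trans (faceLE_of_mem_openCone ht2 ht3 h))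
  refine ⟨insert (b x) t, fun v hv => ?_, ?_, mem_openCone_insert hc ht3 hnot⟩
  · rcases Finset.mem_insert.1 hv with rfl | hv
    · refine ⟨⟨x, rfl⟩, fun h0 => hx (hb.eq_zero ?_)⟩
      rwa [h0] at hbx
    · exact ht1 v hv
  · rw [Finset.coe_insert]
    exact ht2.insert fun v hv _ => Or.inr (hmem v hv)

theorem exists_mem_of_openCone {t : Finset (Vec d)} (ht : ∀ v ∈ t, v ∈ Set.range b ∧ v ≠ 0)
    (hc : IsChain (FaceLE l) (t : Set (Vec d))) {x : Vec d} (hx : x ∈ openCone t) (h0 : x ≠ 0) :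
    b x ∈ t ∧ ∀ w ∈ t, FaceLE l w (b x) := by
  have hne : t.Nonempty := by
    by_contra h
    obtain ⟨c, _, rfl⟩ := hx
    exact h0 (by rw [Finset.not_nonempty_iff_eq_empty.1 h, Finset.sum_empty])
  obtain ⟨m, hm, hmax⟩ := exists_greatest_of_isChain hc hne
  have h := signVector_eq_of_mem_openCone hc hx hm hmax
  have : m = b x := hb.ext (ht m hm).1 ⟨x, rfl⟩ (by rw [hb.signVector_eq, h])
  exact this ▸ ⟨hm, hmax⟩

theorem faceLE_sub {t : Finset (Vec d)} [DecidableEq (Vec d)]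
    (ht : ∀ v ∈ t, v ∈ Set.range b ∧ v ≠ 0)
    (hc : IsChain (FaceLE l) (t : Set (Vec d))) {x y : Vec d} (hx : x ∈ openCone t) (h0 : x ≠ 0)
    (hy : y ∈ openCone (t.erase (b x))) : FaceLE l y x ∧ ¬FaceLE l x y := by
  have hsub : ((t.erase (b x) : Finset (Vec d)) : Set (Vec d)) ⊆ t := by simp
  by_cases hy0 : y = 0
  · subst hy0
    exact ⟨fun i hi => absurd (signVector_eq_zero.2 (map_zero _)) hi, fun h => h0 (hb.eq_zero h)⟩
  · obtain ⟨h1, _⟩ := hb.exists_mem_of_openCone (fun v hv => ht v (Finset.mem_of_mem_erase hv))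
      (hc.mono hsub) hy hy0
    obtain ⟨h2, h3⟩ := hb.exists_mem_of_openCone ht hc hx h0
    have hy' : FaceLE l y (b y) := .of_eq (hb.signVector_eq y).symm
    have hle : FaceLE l y x := (hy'.trans (h3 _ (Finset.mem_of_mem_erase h1))).trans
      (.of_eq (hb.signVector_eq x))
    exact ⟨hle, fun h => Finset.ne_of_mem_erase h1 (hb.congr _ _ (hle.antisymm h))⟩

/-- The greatest generator must be `b x`. Its coefficient is the only one for which the remainder
falls into a proper face, so induction applies to the same remainder for both cones. -/
theorem openCone_unique [Finite I] {x : Vec d} {t t' : Finset (Vec d)}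
    (ht : ∀ v ∈ t, v ∈ Set.range b ∧ v ≠ 0) (hc : IsChain (FaceLE l) (t : Set (Vec d)))
    (hx : x ∈ openCone t) (ht' : ∀ v ∈ t', v ∈ Set.range b ∧ v ≠ 0)
    (hc' : IsChain (FaceLE l) (t' : Set (Vec d))) (hx' : x ∈ openCone t') : t = t' := by
  classical
  have := Fintype.ofFinite I
  induction h : (Finset.univ.filter fun i => signVector l x i ≠ 0).card using Nat.strong_induction_on
    generalizing x t t' with
  | _ n ih =>
  by_cases h0 : x = 0
  · subst h0
    have hempty : ∀ s : Finset (Vec d), (∀ v ∈ s, v ∈ Set.range b ∧ v ≠ 0) →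
        IsChain (FaceLE l) (s : Set (Vec d)) → (0 : Vec d) ∈ openCone s → s = ∅ := by
      intro s hs hsc h0
      by_contra hne
      obtain ⟨v, hv⟩ := Finset.nonempty_iff_ne_empty.2 hne
      exact (hs v hv).2 (hb.eq_zero (faceLE_of_mem_openCone hsc h0 hv))
    rw [hempty t ht hc hx, hempty t' ht' hc' hx']
  · have hm := (hb.exists_mem_of_openCone ht hc hx h0).1
    have hm' := (hb.exists_mem_of_openCone ht' hc' hx' h0).1
    obtain ⟨c, hcpos, hy⟩ := mem_openCone_erase hx hm
    obtain ⟨c', hcpos', hy'⟩ := mem_openCone_erase hx' hm'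
    obtain ⟨h1, h2⟩ := hb.faceLE_sub ht hc hx h0 hy
    obtain ⟨h1', h2'⟩ := hb.faceLE_sub ht' hc' hx' h0 hy'
    -- Subtracting more than the amount that reaches a proper face reverses the sign of the
    -- functional that vanished there, and so leaves the closure of the face of `x`.
    have key : ∀ c c' : ℝ, FaceLE l (x - c • b x) x → ¬FaceLE l x (x - c • b x) →
        FaceLE l (x - c' • b x) x → c' ≤ c := by
      intro c c' h1 h2 h1'
      by_contra hlt
      obtain ⟨i, hi, hi'⟩ := exists_of_not_faceLE h1 h2
      have h3 := congrFun (hb.signVector_eq x) i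
      have hbi : l i (b x) ≠ 0 := fun h => hi' (signVector_eq_zero.1 (h3 ▸ signVector_eq_zero.2 h))
      rw [map_sub, map_smul, smul_eq_mul, sub_eq_zero] at hi
      have h4 : l i (x - c' • b x) = -((c' - c) * l i (b x)) := by
        rw [map_sub, map_smul, smul_eq_mul, hi]
        ring
      have h5 := h1' i fun h => by
        rw [signVector_eq_zero, h4, neg_eq_zero, mul_eq_zero] at h
        rcases h with h | h
        · linarith
        · exact hbi h
      rw [← h3] at h5
      simp only [signVector, h4] at h5
      rw [Left.sign_neg, sign_mul, sign_pos (by linarith : 0 < c' - c), one_mul] at h5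
      exact hbi (sign_eq_zero_iff.1 (SignType.self_eq_neg_iff.1 h5))
    have hcc : c = c' := le_antisymm (key c' c h1' h2' h1) (key c c' h1 h2 h1')
    subst hcc
    have hsub : ∀ s : Finset (Vec d), ((s.erase (b x) : Finset (Vec d)) : Set (Vec d)) ⊆ s := by simp
    have := ih _ (h ▸ card_lt h1 h2) (fun v hv => ht v (Finset.mem_of_mem_erase hv))
      (hc.mono (hsub t)) hy (fun v hv => ht' v (Finset.mem_of_mem_erase hv)) (hc'.mono (hsub t'))
      hy' rfl
    rw [← Finset.insert_erase hm, this, Finset.insert_erase hm']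

theorem linearIndepOn {t : Finset (Vec d)} (ht : ∀ v ∈ t, v ∈ Set.range b ∧ v ≠ 0)
    (hc : IsChain (FaceLE l) (t : Set (Vec d))) : LinearIndepOn ℝ id (t : Set (Vec d)) := by
  classical
  induction h : t.card generalizing t with
  | zero =>
    rw [Finset.card_eq_zero.1 h, Finset.coe_empty]
    exact linearIndepOn_empty ℝ id
  | succ n ih =>
    obtain ⟨m, hm, hmax⟩ := exists_greatest_of_isChain hc (Finset.card_pos.1 (by omega))
    have hsub : ((t.erase m : Finset (Vec d)) : Set (Vec d)) ⊆ t := by simp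
    have hind := ih (fun v hv => ht v (Finset.mem_of_mem_erase hv)) (hc.mono hsub)
      (by rw [Finset.card_erase_of_mem hm, h]; rfl)
    -- The faces of a chain are distinct, so some functional vanishes on the second greatest face,
    -- hence on all smaller ones, but not on the greatest. Independence is then triangular.
    have hi : ∃ i, l i m ≠ 0 ∧ ∀ w ∈ t.erase m, l i w = 0 := by
      rcases (t.erase m).eq_empty_or_nonempty with he | hne
      · by_contra hcon
        push Not at hcon
        refine (ht m hm).2 (hb.separating m fun i => ?_)
        by_contra hi
        obtain ⟨w, hw, _⟩ := hcon i hi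
        rw [he] at hw
        exact absurd hw (Finset.notMem_empty w)
      · obtain ⟨m', hm', hmax'⟩ := exists_greatest_of_isChain (hc.mono hsub) hne
        have hle := hmax m' (Finset.mem_of_mem_erase hm')
        obtain ⟨i, hi, hi'⟩ := exists_of_not_faceLE hle fun hle' => Finset.ne_of_mem_erase hm'
          (hb.ext (ht _ (Finset.mem_of_mem_erase hm')).1 (ht m hm).1 (hle.antisymm hle'))
        exact ⟨i, hi', fun w hw => (hmax' w hw).eq_zero hi⟩
    obtain ⟨i, hi, hi0⟩ := hi
    rw [← Finset.insert_erase hm, Finset.coe_insert]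
    refine hind.id_insert fun hspan => hi ?_
    have hle : Submodule.span ℝ ((t.erase m : Finset (Vec d)) : Set (Vec d)) ≤ LinearMap.ker (l i) :=
      Submodule.span_le.2 fun w hw => hi0 w hw
    exact hle hspan

open Classical in
/-- The barycentric subdivision of the hyperplane arrangement of the kernels of `l`. -/
def coneComplex [Finite I] : ConeComplex d where
  cones := (hb.finite.toFinset.erase 0).powerset.filter fun t =>
    IsChain (FaceLE l) (t : Set (Vec d))
  face_mem s hs t hts := by
    rw [Finset.mem_filter, Finset.mem_powerset] at hs ⊢
    exact ⟨hts.trans hs.1, hs.2.mono (Finset.coe_subset.2 hts)⟩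
  linearIndepOn s hs := by
    rw [Finset.mem_filter, Finset.mem_powerset] at hs
    refine hb.linearIndepOn (fun v hv => ?_) hs.2
    have := hs.1 hv
    rw [Finset.mem_erase, Set.Finite.mem_toFinset] at this
    exact ⟨this.2, this.1⟩
  existsUnique_mem x := by
    have hiff : ∀ t : Finset (Vec d), t ⊆ hb.finite.toFinset.erase 0 ↔
        ∀ v ∈ t, v ∈ Set.range b ∧ v ≠ 0 := fun t => by
      refine forall₂_congr fun v _ => ?_
      rw [Finset.mem_erase, Set.Finite.mem_toFinset, and_comm]
    simp only [Finset.mem_filter, Finset.mem_powerset, hiff]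
    obtain ⟨t, h1, h2, h3⟩ := hb.exists_openCone x
    exact ⟨t, ⟨⟨h1, h2⟩, h3⟩, fun t' h' => hb.openCone_unique h'.1.1 h'.1.2 h'.2 h1 h2 h3⟩

end IsBarycenter

end

/-! ### An invariant hyperplane arrangement for a finite group -/

section

variable {d : ℕ} {P : Type*} [Group P] (ρ : P →* O d)

/-- The coordinates with respect to all translates of the standard basis. -/
def orbitCoord (i : P × Fin d) : Vec d →ₗ[ℝ] ℝ :=
  LinearMap.proj i.2 ∘ₗ Matrix.mulVecLin (ρ i.1).1

theorem signVector_mulVec (g : P) (x : Vec d) : signVector (orbitCoord ρ) ((ρ g).1 *ᵥ x) =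
    fun i => signVector (orbitCoord ρ) x (i.1 * g, i.2) := by
  funext i
  simp [signVector, orbitCoord, Matrix.mulVec_mulVec]

/-- A point with given signs. -/
def pointOfSigns (f : P × Fin d → SignType) : Vec d := by
  classical
  exact if h : ∃ x, signVector (orbitCoord ρ) x = f then h.choose else 0

theorem signVector_pointOfSigns (x : Vec d) :
    signVector (orbitCoord ρ) (pointOfSigns ρ (signVector (orbitCoord ρ) x)) =
      signVector (orbitCoord ρ) x := by
  have h : ∃ y, signVector (orbitCoord ρ) y = signVector (orbitCoord ρ) x := ⟨x, rfl⟩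
  rw [pointOfSigns, dif_pos h]
  exact h.choose_spec

variable [Fintype P]

/-- The average of the translates of chosen points in the faces. -/
def averagePoint (x : Vec d) : Vec d :=
  ∑ g : P, (ρ g⁻¹).1 *ᵥ pointOfSigns ρ (signVector (orbitCoord ρ) ((ρ g).1 *ᵥ x))

theorem averagePoint_mulVec (h : P) (x : Vec d) :
    averagePoint ρ ((ρ h).1 *ᵥ x) = (ρ h).1 *ᵥ averagePoint ρ x := by
  rw [averagePoint, averagePoint, Matrix.mulVec_sum]
  refine Fintype.sum_equiv (Equiv.mulRight h) _ _ fun g => ?_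
  have h1 : (ρ (g * h)).1 = (ρ g).1 * (ρ h).1 := by rw [map_mul]; rfl
  have h2 : (ρ g⁻¹).1 = (ρ h).1 * (ρ (g * h)⁻¹).1 := by
    rw [← Submonoid.coe_mul, ← map_mul]
    congr 3
    group
  rw [Matrix.mulVec_mulVec, Matrix.mulVec_mulVec, Equiv.coe_mulRight, h1, h2]

/-- Each translated summand lies in the face of `x`, and faces are closed under addition. The point
depends only on the sign vector, of which there are finitely many. -/
theorem isBarycenter_averagePoint : IsBarycenter (orbitCoord ρ) (averagePoint ρ) where
  separating x h := by
    funext i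
    simpa [orbitCoord] using h (1, i)
  signVector_eq x := by
    refine signVector_sum ⟨1, Finset.mem_univ 1⟩ fun g _ => ?_
    rw [signVector_mulVec, signVector_pointOfSigns, signVector_mulVec]
    simp
  congr x y h := by
    simp only [averagePoint, signVector_mulVec, h]
  finite := by
    refine (Set.finite_range fun f : P × Fin d → SignType => ∑ g : P, (ρ g⁻¹).1 *ᵥ
      pointOfSigns ρ fun i => f (i.1 * g, i.2)).subset ?_
    rintro _ ⟨x, rfl⟩
    exact ⟨signVector (orbitCoord ρ) x, by simp only [averagePoint, signVector_mulVec]⟩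

end

/-- The group permutes the functionals, so it preserves the order of faces; summing over the group
makes the barycenters equivariant. -/
theorem exists_invariant_coneComplex {d : ℕ} {P : Type*} [Group P] [Finite P] (ρ : P →* O d) : ∃ F : ConeComplex d, F.Invariant ρ := by
  classical
  have := Fintype.ofFinite P
  refine ⟨(isBarycenter_averagePoint ρ).coneComplex, fun g s hs => ?_⟩
  simp only [IsBarycenter.coneComplex, Finset.mem_filter, Finset.mem_powerset] at hs ⊢
  constructor
  · intro v hv
    obtain ⟨w, hw, rfl⟩ := Finset.mem_image.1 hv
    have h := hs.1 hw
    rw [Finset.mem_erase, Set.Finite.mem_toFinset] at h ⊢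
    obtain ⟨h0, x, rfl⟩ := h
    refine ⟨fun h1 => h0 ?_, (ρ g).1 *ᵥ x, averagePoint_mulVec ρ g x⟩
    have h2 := congrArg ((ρ g⁻¹).1 *ᵥ ·) h1
    simpa only [Matrix.mulVec_mulVec, ← Submonoid.coe_mul, ← map_mul, inv_mul_cancel, map_one,
      Submonoid.coe_one, Matrix.one_mulVec, Matrix.mulVec_zero] using h2
  · rw [Finset.coe_image]
    rintro _ ⟨v, hv, rfl⟩ _ ⟨w, hw, rfl⟩ hne
    have key : ∀ v w, FaceLE (orbitCoord ρ) v w →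
        FaceLE (orbitCoord ρ) ((ρ g).1 *ᵥ v) ((ρ g).1 *ᵥ w) := by
      intro v w h i hi
      rw [signVector_mulVec] at hi ⊢
      rw [signVector_mulVec]
      exact h _ hi
    exact (hs.2 hv hw fun h => hne (by rw [h])).imp (key v w) (key w v)

end

end PointGroupLSM

namespace PointGroupLSM

noncomputable section

set_option linter.unusedSectionVars false

/-! ### Affine simplices all of whose faces span linearly -/

section

variable {d : ℕ}

/-- The signed volume of the simplex spanned by the origin and the `i`-th facet of `v`. -/
def facetVolume (v : Fin (d + 1) → Vec d) (i : Fin (d + 1)) : ℝ :=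
  (-1) ^ (i : ℕ) * (Matrix.of fun j => v (i.succAbove j)).det

theorem sum_facetVolume_smul (v : Fin (d + 1) → Vec d) : ∑ i, facetVolume v i • v i = 0 :=
  sum_det_smul_eq_zero v

theorem sum_facetVolume (v : Fin (d + 1) → Vec d) :
    (Matrix.of fun i : Fin d => v i.succ - v 0).det = ∑ i, facetVolume v i := by
  rw [← det_hpt, Matrix.det_succ_column_zero]
  refine Finset.sum_congr rfl fun i _ => ?_
  rw [facetVolume]
  congr 1
  exact mul_one _

theorem facetVolume_mulVec (M : Matrix (Fin d) (Fin d) ℝ) (v : Fin (d + 1) → Vec d)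
    (i : Fin (d + 1)) : facetVolume (fun i => M *ᵥ v i) i = M.det * facetVolume v i := by
  have h : (Matrix.of fun j => M *ᵥ v (i.succAbove j)) =
      (Matrix.of fun j => v (i.succAbove j)) * Mᵀ := by
    ext j k
    simp [Matrix.mul_apply, Matrix.mulVec, dotProduct, mul_comm]
  rw [facetVolume, h, Matrix.det_mul, Matrix.det_transpose, facetVolume]
  ring

/-- The vertices other than the `i`-th form a basis, so a relation is determined by its `i`-th
coefficient. -/
theorem eq_zero_of_sum_smul_eq_zero {v : Fin (d + 1) → Vec d} {i : Fin (d + 1)}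
    (hi : facetVolume v i ≠ 0) {z : Fin (d + 1) → ℝ} (hz : ∑ k, z k • v k = 0) (h : z i = 0) :
    z = 0 := by
  have hdet : IsUnit (Matrix.of fun j => v (i.succAbove j)) := by
    rw [Matrix.isUnit_iff_isUnit_det, isUnit_iff_ne_zero]
    exact right_ne_zero_of_mul hi
  have hli : LinearIndependent ℝ fun j => v (i.succAbove j) :=
    Matrix.linearIndependent_rows_iff_isUnit.2 hdet
  rw [Fin.sum_univ_succAbove _ i, h, zero_smul, zero_add] at hz
  have h0 := Fintype.linearIndependent_iff.1 hli _ hz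
  funext k
  rcases Fin.eq_self_or_eq_succAbove i k with rfl | ⟨j, rfl⟩
  · exact h
  · exact h0 j

theorem mul_facetVolume_eq {v : Fin (d + 1) → Vec d} {i : Fin (d + 1)}
    (hi : facetVolume v i ≠ 0) {z : Fin (d + 1) → ℝ} (hz : ∑ k, z k • v k = 0) (j : Fin (d + 1)) :
    z j * facetVolume v i = z i * facetVolume v j := by
  have h := eq_zero_of_sum_smul_eq_zero (z := fun k => z k * facetVolume v i - z i * facetVolume v k)
    hi ?_ (by ring)
  · exact sub_eq_zero.1 (congrFun h j)
  · have e : ∀ k, (z k * facetVolume v i - z i * facetVolume v k) • v k =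
        facetVolume v i • z k • v k - z i • facetVolume v k • v k := fun k => by
      rw [smul_smul, smul_smul, ← sub_smul, mul_comm (facetVolume v i)]
    simp only [e]
    rw [Finset.sum_sub_distrib, ← Finset.smul_sum, ← Finset.smul_sum, hz, sum_facetVolume_smul,
      smul_zero, smul_zero, sub_zero]

theorem isGeneric_of_facetVolume {v : Fin (d + 1) → Vec d} (hv : ∀ i, facetVolume v i ≠ 0) :
    IsGeneric v := by
  classical
  refine isGeneric_of_forall fun u hu a _ ha1 h0 => ?_
  obtain ⟨i, hi⟩ : ∃ i, i ∉ u := by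
    by_contra h
    push Not at h
    have := Finset.card_le_card (show Finset.univ ⊆ u from fun i _ => h i)
    rw [Finset.card_univ, Fintype.card_fin] at this
    omega
  have h := eq_zero_of_sum_smul_eq_zero (z := fun k => if k ∈ u then a k else 0) (hv i)
    (by simpa [ite_smul, Finset.sum_ite_mem] using h0) (if_neg hi)
  refine zero_ne_one (ha1 ▸ (Finset.sum_eq_zero fun k hk => ?_).symm : (0 : ℝ) = 1)
  simpa [hk] using congrFun h k

theorem zeroSign_eq_of_sum_ne_zero {v : Fin (d + 1) → Vec d} {a : Fin (d + 1) → ℝ}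
    (ha : ∀ i, 0 < a i) (ha0 : ∑ i, a i • v i = 0) :
    zeroSign v = ((SignType.sign (∑ i, facetVolume v i) : SignType) : ℤ) := by
  have hpos : 0 < ∑ i, a i := Finset.sum_pos (fun i _ => ha i) ⟨0, Finset.mem_univ _⟩
  rw [zeroSign, if_pos, sum_facetVolume]
  rw [mem_convexHull_range_iff]
  refine ⟨fun i => (∑ i, a i)⁻¹ * a i, fun i => (mul_pos (inv_pos.2 hpos) (ha i)).le, ?_, ?_⟩
  · rw [← Finset.mul_sum, inv_mul_cancel₀ hpos.ne']
  · simp only [mul_smul]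
    rw [← Finset.smul_sum, ha0, smul_zero]

theorem zeroSign_of_pos {v : Fin (d + 1) → Vec d} (hv : ∀ i, 0 < facetVolume v i) :
    zeroSign v = 1 := by
  rw [zeroSign_eq_of_sum_ne_zero hv (sum_facetVolume_smul v),
    sign_pos (Finset.sum_pos (fun i _ => hv i) ⟨0, Finset.mem_univ _⟩)]
  rfl

theorem zeroSign_of_neg {v : Fin (d + 1) → Vec d} (hv : ∀ i, facetVolume v i < 0) :
    zeroSign v = -1 := by
  rw [zeroSign_eq_of_sum_ne_zero (a := fun i => -facetVolume v i) (fun i => neg_pos.2 (hv i)),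
    sign_neg (Finset.sum_neg (fun i _ => hv i) ⟨0, Finset.mem_univ _⟩)]
  · rfl
  · simp only [neg_smul, Finset.sum_neg_distrib, sum_facetVolume_smul, neg_zero]

/-- Barycentric coordinates of the origin would be proportional to the facet volumes, which cannot
be if two of these have opposite signs. -/
theorem zeroSign_of_mul_neg {v : Fin (d + 1) → Vec d} {i j : Fin (d + 1)}
    (h : facetVolume v i * facetVolume v j < 0) : zeroSign v = 0 := by
  rw [zeroSign, if_neg]
  rw [mem_convexHull_range_iff]
  rintro ⟨a, ha, ha1, ha0⟩
  have hi : facetVolume v i ≠ 0 := left_ne_zero_of_mul h.ne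
  have h1 := mul_facetVolume_eq hi ha0 j
  have h2 : a i = 0 := by
    by_contra hne
    have hpos : 0 < a i := lt_of_le_of_ne (ha i) (Ne.symm hne)
    have h3 : a j * facetVolume v i ^ 2 = a i * (facetVolume v i * facetVolume v j) := by
      rw [pow_two, ← mul_assoc, h1]
      ring
    have h4 := mul_neg_of_pos_of_neg hpos h
    have h5 := mul_nonneg (ha j) (sq_nonneg (facetVolume v i))
    linarith
  rw [eq_zero_of_sum_smul_eq_zero hi ha0 h2] at ha1
  simp at ha1

/-- The chains of simplices all of whose facets span `ℝ^d`. -/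
abbrev regularChains (d : ℕ) : AddSubgroup (AffineChain d (d + 1)) :=
  chainsIn {v | ∀ i, facetVolume v i ≠ 0}

theorem regularChains_le : regularChains d ≤ genericChains d (d + 1) := fun _ hc v hv =>
  isGeneric_of_facetVolume (hc v hv)

theorem act_mem_regularChains (M : O d) {c : AffineChain d (d + 1)} (hc : c ∈ regularChains d) :
    act M.1 c ∈ regularChains d := by
  refine chainLift_mem hc fun v hv => single_mem_chainsIn ?_ 1
  intro i
  rw [facetVolume_mulVec]
  exact mul_ne_zero (isUnit_iff_ne_zero.1 (isUnit_det M)) (hv i)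

end

/-! ### Planar sections and suspension -/

/-- A section over the `1`-skeleton of a planar representation whose zeros, after filling loops
from an apex, are counted by `c`. -/
structure PlanarSection {P : Type*} [Group P] (ρ : P →* O 2) (c : (Fin 2 → P) → ℤ) where
  chain : (q : ℕ) → (Fin q → P) → AffineChain 2 q
  chain_mem : ∀ q ≤ 2, ∀ g, chain q g ∈ chainsIn {v | LinearIndependent ℝ v}
  equivariant : ∀ q ≤ 2, ∀ (h : P) (g : Fin q → P),
    chain q (fun i => h * g i) = act (ρ h).1 (chain q g)
  chain_zero : ∀ g : Fin 0 → P, chain 0 g = simplex Fin.elim0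
  boundary : ∀ q < 2, ∀ g : Fin (q + 1) → P, bdry (chain (q + 1) g) = faceSum (chain q) g
  apex : Vec 2
  cone_mem : ∀ g : Fin 2 → P, cone apex (faceSum (chain 2) (Fin.partialProd g)) ∈ regularChains 2
  count : ∀ g : Fin 2 → P, countZeros 2 (cone apex (faceSum (chain 2) (Fin.partialProd g))) = c g

namespace PlanarSection

variable {P : Type*} [Group P] {ρ : P →* O 2} {c : (Fin 2 → P) → ℤ} (S : PlanarSection ρ c)

theorem bdry_loop (g : Fin 3 → P) : bdry (faceSum (S.chain 2) g) = 0 := by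
  rw [map_faceSum]
  simp only [S.boundary 1 one_lt_two]
  exact faceSum_faceSum _ _

include S in
theorem represents [TopologicalSpace P] [DiscreteTopology P] : Represents (eulerClass ρ) c := by
  refine represents_eulerClass_of_filling ρ S.chain
    (fun q hq g v hv => isGeneric_of_linearIndependent (S.chain_mem q hq g v hv))
    (fun q hq h g => ?_) S.chain_zero (fun q hq g => ?_) c fun g =>
      ⟨_, regularChains_le (S.cone_mem g), ?_, S.count g⟩
  · rw [S.equivariant q hq, sub_self]
    exact zero_mem _
  · rw [S.boundary q hq, sub_self]
    exact zero_mem _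
  · rw [bdry_cone, S.bdry_loop, map_zero, sub_zero, sub_self]
    exact zero_mem _

end PlanarSection

end

end PointGroupLSM

namespace PointGroupLSM

/-! ### Suspension of planar sections to space -/

noncomputable section

set_option linter.unusedSectionVars false

theorem faceSum_vertex {α M : Type*} [AddCommGroup M] (f : (Fin 0 → α) → M) (v : Fin 1 → α) :
    faceSum f v = f Fin.elim0 := by
  rw [faceSum, Fin.sum_univ_one, Fin.val_zero, pow_zero, one_smul]
  congr 1
  funext i
  exact i.elim0

theorem faceSum_edge {α M : Type*} [AddCommGroup M] (f : (Fin 1 → α) → M) (v : Fin 2 → α) :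
    faceSum f v = f (fun _ => v 1) - f fun _ => v 0 := by
  rw [faceSum, Fin.sum_univ_two, Fin.val_zero, Fin.val_one, pow_zero, one_smul, pow_one,
    neg_one_smul, ← sub_eq_add_neg]
  congr <;> funext j <;> exact Fin.cases rfl (fun j => j.elim0) j

theorem faceSum_triangle {α M : Type*} [AddCommGroup M] (f : (Fin 2 → α) → M) (v : Fin 3 → α) :
    faceSum f v = f ![v 1, v 2] - f ![v 0, v 2] + f ![v 0, v 1] := by
  have h0 : (fun j => v ((0 : Fin 3).succAbove j)) = ![v 1, v 2] := by
    funext j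
    fin_cases j <;> rfl
  have h1 : (fun j => v ((1 : Fin 3).succAbove j)) = ![v 0, v 2] := by
    funext j
    fin_cases j <;> rfl
  have h2 : (fun j => v ((2 : Fin 3).succAbove j)) = ![v 0, v 1] := by
    funext j
    fin_cases j <;> rfl
  rw [faceSum, Fin.sum_univ_three, h0, h1, h2, Fin.val_zero, Fin.val_one, Fin.val_two]
  module

/-- The point of `ℝ³ = ℝ² ⊕ ℝ` with components `x` and `z`. -/
def lift (x : Vec 2) (z : ℝ) : Vec 3 := ![x 0, x 1, z]

theorem axial_mulVec_lift (M : Matrix (Fin 2) (Fin 2) ℝ) (ε : ℝ) (x : Vec 2) (z : ℝ) :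
    axial M ε *ᵥ lift x z = lift (M *ᵥ x) (ε * z) := by
  funext i
  fin_cases i <;> simp [axial, lift, Matrix.mulVec, dotProduct, Fin.sum_univ_succ]

theorem linearIndependent_cons_lift {q : ℕ} {v : Fin q → Vec 2} (hv : LinearIndependent ℝ v)
    {z : ℝ} (hz : z ≠ 0) :
    LinearIndependent ℝ (Fin.cons (lift 0 z) fun i => lift (v i) 0 : Fin (q + 1) → Vec 3) := by
  rw [Fintype.linearIndependent_iff] at hv ⊢
  intro a ha
  rw [Fin.sum_univ_succ] at ha
  simp only [Fin.cons_zero, Fin.cons_succ] at ha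
  have h0 : a 0 = 0 := by
    have := congrFun ha 2
    simpa [lift, hz] using this
  have h1 := hv (fun i => a i.succ) <| by
    funext k
    fin_cases k
    · simpa [lift] using congrFun ha 0
    · simpa [lift] using congrFun ha 1
  exact fun i => Fin.cases h0 h1 i

/-- The inclusion of chains in the plane into chains in space. -/
def embed {q : ℕ} : AffineChain 2 q →+ AffineChain 3 q :=
  chainLift fun v => simplex fun i => lift (v i) 0

theorem embed_simplex {q : ℕ} (v : Fin q → Vec 2) :
    embed (simplex v) = simplex fun i => lift (v i) 0 := by
  simp [embed]

theorem bdry_embed {q : ℕ} (c : AffineChain 2 (q + 1)) : bdry (embed c) = embed (bdry c) := by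
  have h : (bdry.comp embed : AffineChain 2 (q + 1) →+ _) = embed.comp bdry :=
    chain_hom_ext fun v => by
      simp only [AddMonoidHom.comp_apply, bdry_simplex, embed_simplex, map_faceSum]
      rfl
  exact DFunLike.congr_fun h c

theorem act_embed {q : ℕ} (M : Matrix (Fin 2) (Fin 2) ℝ) (ε : ℝ) (c : AffineChain 2 q) :
    act (axial M ε) (embed c) = embed (act M c) := by
  have h : ((act (axial M ε)).comp embed : AffineChain 2 q →+ _) = embed.comp (act M) :=
    chain_hom_ext fun v => by
      simp only [AddMonoidHom.comp_apply, act_simplex, embed_simplex, axial_mulVec_lift, mul_zero]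
  exact DFunLike.congr_fun h c

/-- The join of a chain in the plane with the difference of the two poles. -/
def join {q : ℕ} : AffineChain 2 q →+ AffineChain 3 (q + 1) :=
  (cone (lift 0 (-1))).comp embed - (cone (lift 0 1)).comp embed

theorem join_apply {q : ℕ} (c : AffineChain 2 q) :
    join c = cone (lift 0 (-1)) (embed c) - cone (lift 0 1) (embed c) := rfl

theorem bdry_join {q : ℕ} (c : AffineChain 2 (q + 1)) : bdry (join c) = -join (bdry c) := by
  rw [join_apply, join_apply, map_sub, bdry_cone, bdry_cone, bdry_embed]
  abel

theorem join_simplex_zero : join (simplex Fin.elim0) =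
    simplex (fun _ => lift 0 (-1)) - simplex fun _ => lift 0 1 := by
  rw [join_apply, embed_simplex, cone_simplex, cone_simplex]
  congr <;> funext i <;> exact Fin.cases rfl (fun j => j.elim0) i

/-- Reversing the axis exchanges the poles, and `join` is antisymmetric in them. -/
theorem act_join {q : ℕ} (M : Matrix (Fin 2) (Fin 2) ℝ) {t : ℤ} (ht : t = 0 ∨ t = 1)
    (c : AffineChain 2 q) :
    act (axial M (1 - 2 * t)) (join c) = (1 - 2 * t : ℤ) • join (act M c) := by
  rw [join_apply, map_sub, act_cone, act_cone, act_embed, axial_mulVec_lift, axial_mulVec_lift,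
    Matrix.mulVec_zero, join_apply]
  rcases ht with rfl | rfl
  · norm_num
  · norm_num

theorem join_mem {q : ℕ} {c : AffineChain 2 q} (hc : c ∈ chainsIn {v | LinearIndependent ℝ v}) :
    join c ∈ genericChains 3 (q + 1) := by
  refine sub_mem ?_ ?_
  all_goals
    change cone _ (embed c) ∈ _
    rw [embed, map_chainLift]
    refine chainLift_mem hc fun v hv => ?_
    rw [cone_simplex]
    exact single_mem_chainsIn (isGeneric_of_linearIndependent
      (linearIndependent_cons_lift hv (by norm_num))) 1

theorem facetVolume_lift (v : Fin 3 → Vec 2) (z : ℝ) :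
    facetVolume ![lift (v 0) (-1), lift 0 z, lift (v 1) 0, lift (v 2) 0] =
      ![z * facetVolume v 0, facetVolume v 0, z * facetVolume v 1, z * facetVolume v 2] := by
  funext i
  fin_cases i <;>
    simp [facetVolume, lift, Matrix.det_fin_three, Matrix.det_fin_two, Fin.succAbove, Fin.lt_def] <;> ring

theorem cone_join_simplex (v : Fin 3 → Vec 2) :
    -cone (lift (v 0) (-1)) (join (simplex fun i : Fin 2 => v i.succ)) =
      simplex ![lift (v 0) (-1), lift 0 1, lift (v 1) 0, lift (v 2) 0] -
        simplex ![lift (v 0) (-1), lift 0 (-1), lift (v 1) 0, lift (v 2) 0] := by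
  rw [join_apply, embed_simplex, map_sub, cone_simplex, cone_simplex, cone_simplex, cone_simplex,
    neg_sub]
  congr <;> funext i <;> fin_cases i <;> rfl

/-- Coning from a point at height -1 turns each triangle into two tetrahedra. Their facet volumes
are those of the triangle up to sign: with the south pole two of them are opposite, so the origin is
missed; with the north pole the signs are those of the triangle, so the zero is the same. -/
theorem suspension_mem_and_count {y : Vec 2} {z : AffineChain 2 2}
    (h : cone y z ∈ regularChains 2) :
    -cone (lift y (-1)) (join z) ∈ genericChains 3 4 ∧
      countZeros 3 (-cone (lift y (-1)) (join z)) = countZeros 2 (cone y z) := by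
  let f : (Fin 3 → Vec 2) → AffineChain 3 4 := fun v =>
    simplex ![lift (v 0) (-1), lift 0 1, lift (v 1) 0, lift (v 2) 0] -
      simplex ![lift (v 0) (-1), lift 0 (-1), lift (v 1) 0, lift (v 2) 0]
  have hf : -cone (lift y (-1)) (join z) = chainLift f (cone y z) := by
    have e : -((cone (lift y (-1))).comp join : AffineChain 2 2 →+ _) =
        (chainLift f).comp (cone y) := chain_hom_ext fun v => by
      simp only [AddMonoidHom.neg_apply, AddMonoidHom.comp_apply, cone_simplex]
      have h1 := cone_join_simplex (Fin.cons y v)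
      simp only [Fin.cons_zero, Fin.cons_succ] at h1
      rw [h1]
      simp [f]
    exact DFunLike.congr_fun e z
  have hN : ∀ v : Fin 3 → Vec 2, (∀ i, facetVolume v i ≠ 0) → ∀ ε : ℝ, ε = 1 ∨ ε = -1 →
      ∀ i, facetVolume ![lift (v 0) (-1), lift 0 ε, lift (v 1) 0, lift (v 2) 0] i ≠ 0 := by
    intro v hv ε hε i
    rw [facetVolume_lift]
    have hε0 : ε ≠ 0 := by rcases hε with rfl | rfl <;> norm_num
    fin_cases i <;> simp [hv, hε0]
  rw [hf]
  refine ⟨chainLift_mem h fun v hv => ?_, ?_⟩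
  · exact sub_mem (single_mem_chainsIn (isGeneric_of_facetVolume (hN v hv 1 (.inl rfl))) 1)
      (single_mem_chainsIn (isGeneric_of_facetVolume (hN v hv (-1) (.inr rfl))) 1)
  · rw [map_chainLift, countZeros]
    refine chainLift_congr h fun v hv => ?_
    have hv' : ∀ i, facetVolume v i ≠ 0 := hv
    have h2 : zeroSign ![lift (v 0) (-1), lift 0 (-1), lift (v 1) 0, lift (v 2) 0] = 0 := by
      refine zeroSign_of_mul_neg (i := 0) (j := 1) ?_
      rw [facetVolume_lift]
      simp only [Matrix.cons_val_zero, Matrix.cons_val_one]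
      have := mul_self_pos.2 (hv' 0)
      linarith
    change chainLift zeroSign (simplex _ - simplex _) = _
    rw [map_sub]
    change countZeros 3 (simplex _) - countZeros 3 (simplex _) = _
    rw [countZeros_simplex, countZeros_simplex, h2, sub_zero]
    have hlift : ∀ (p : ℝ → Prop), (∀ i, p (facetVolume v i)) → ∀ i,
        p (facetVolume ![lift (v 0) (-1), lift 0 1, lift (v 1) 0, lift (v 2) 0] i) := by
      intro p hp i
      rw [facetVolume_lift]
      fin_cases i <;> simp [hp]
    by_cases hpos : ∀ i, 0 < facetVolume v i
    · rw [zeroSign_of_pos hpos, zeroSign_of_pos (hlift (0 < ·) hpos)]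
    by_cases hneg : ∀ i, facetVolume v i < 0
    · rw [zeroSign_of_neg hneg, zeroSign_of_neg (hlift (· < 0) hneg)]
    push Not at hpos hneg
    obtain ⟨i, hi⟩ := hpos
    obtain ⟨j, hj⟩ := hneg
    have hi' := lt_of_le_of_ne hi (hv' i)
    have hj' := lt_of_le_of_ne hj (hv' j).symm
    rw [zeroSign_of_mul_neg (mul_neg_of_neg_of_pos hi' hj')]
    let e : Fin 3 → Fin 4 := ![0, 2, 3]
    have he : ∀ i, facetVolume ![lift (v 0) (-1), lift 0 1, lift (v 1) 0, lift (v 2) 0] (e i) =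
        facetVolume v i := by
      intro i
      rw [facetVolume_lift]
      fin_cases i <;> simp [e]
    exact zeroSign_of_mul_neg (i := e i) (j := e j) (by rw [he, he]; exact mul_neg_of_neg_of_pos hi' hj')

namespace PlanarSection

variable {P : Type*} [Group P] {ρ : P →* O 2} {c : (Fin 2 → P) → ℤ} (S : PlanarSection ρ c)
  (t : P → ℤ)

/-- The suspension of a planar section, where `t g = 1` if `g` exchanges the poles. -/
def suspension : (q : ℕ) → (Fin q → P) → AffineChain 3 q
  | 0 => fun _ => simplex Fin.elim0
  -- As `join` of the empty simplex is south minus north, this is the south pole for `t = 0` and the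
  -- north pole for `t = 1`.
  | 1 => fun g => simplex (fun _ => lift 0 (-1)) - t (g 0) • join (simplex Fin.elim0)
  | q + 2 => fun g => (t (g 1) - t (g 0)) • join (S.chain (q + 1) fun i => g i.succ)

theorem suspension_one (g : Fin 1 → P) : S.suspension t 1 g =
    simplex (fun _ => lift 0 (-1)) - t (g 0) • join (simplex Fin.elim0) := rfl

theorem suspension_add_two (q : ℕ) (g : Fin (q + 2) → P) : S.suspension t (q + 2) g =
    (t (g 1) - t (g 0)) • join (S.chain (q + 1) fun i => g i.succ) := rfl

/-- A Leibniz rule: the difference of `t` at consecutive vertices adds up along the first three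
vertices, so only the face sum of the planar factor is left. -/
theorem faceSum_suspension (q : ℕ) (g : Fin (q + 3) → P) : faceSum (S.suspension t (q + 2)) g =
    -((t (g 1) - t (g 0)) • join (faceSum (S.chain (q + 1)) fun i => g i.succ)) := by
  obtain ⟨x, g, rfl⟩ : ∃ x g', g = Fin.cons x g' := ⟨_, _, (Fin.cons_self_tail g).symm⟩
  obtain ⟨y, w, rfl⟩ : ∃ y w, g = Fin.cons y w := ⟨_, _, (Fin.cons_self_tail g).symm⟩
  have h1 : ∀ (x y : P) (w : Fin (q + 1) → P),
      S.suspension t (q + 3) (Fin.cons x (Fin.cons y w : Fin (q + 2) → P)) =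
        (t y - t x) • join (S.chain (q + 2) (Fin.cons y w)) := fun x y w => rfl
  have h2 : ∀ (x : P) (w : Fin (q + 1) → P), S.suspension t (q + 2) (Fin.cons x w) =
        (t (w 0) - t x) • join (S.chain (q + 1) w) := fun x w => rfl
  have h3 : ∀ (x y : P) (w : Fin q → P),
      S.suspension t (q + 2) (Fin.cons x (Fin.cons y w : Fin (q + 1) → P)) =
        (t y - t x) • join (S.chain (q + 1) (Fin.cons y w)) := fun x y w => rfl
  have h4 : faceSum (fun w : Fin q → P =>
      S.suspension t (q + 2) (Fin.cons x (Fin.cons y w : Fin (q + 1) → P))) w =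
      (t y - t x) • join (faceSum (fun w : Fin q → P => S.chain (q + 1) (Fin.cons y w)) w) := by
    simp only [h3]
    rw [map_faceSum, ← smulAddHom_apply, map_faceSum]
    rfl
  rw [faceSum_cons, faceSum_cons, h2, h2, h4]
  simp only [Fin.cons_succ, Fin.cons_zero, Fin.cons_one]
  rw [faceSum_cons, map_sub]
  module

variable {t} (ht : ∀ g, t g = 0 ∨ t g = 1) {ρ₃ : P →* O 3}
  (hρ : ∀ g, (ρ₃ g).1 = axial (ρ g).1 (1 - 2 * t g))
include ht hρ

omit ht in
-- Compare the axis entries of the matrices: `1 - 2 t` is multiplicative.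
theorem suspension_map_mul (g h : P) : t (g * h) = t g + (1 - 2 * t g) * t h := by
  have h1 : (ρ₃ (g * h)).1 = (ρ₃ g).1 * (ρ₃ h).1 := by rw [map_mul]; rfl
  rw [hρ, hρ, hρ] at h1
  have h2 := congrFun (congrFun h1 2) 2
  simp [axial, Matrix.mul_apply, Fin.sum_univ_succ] at h2
  have h3 : (t (g * h) : ℝ) = ((t g + (1 - 2 * t g) * t h : ℤ) : ℝ) := by
    push_cast
    linarith
  exact_mod_cast h3

theorem suspension_mul (q : ℕ) (hq : q ≤ 3) (h : P) (g : Fin q → P) :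
    S.suspension t q (fun i => h * g i) = act (ρ₃ h).1 (S.suspension t q g) := by
  have hmul := suspension_map_mul hρ
  match q with
  | 0 =>
    exact ((act_simplex _ _).trans (congrArg simplex (funext fun i => i.elim0))).symm
  | 1 =>
    rw [suspension_one, suspension_one, map_sub, map_zsmul, act_simplex, hρ, act_join _ (ht h),
      axial_mulVec_lift, Matrix.mulVec_zero, act_simplex, hmul, join_simplex_zero]
    have h0 : (fun i => (ρ h).1 *ᵥ (Fin.elim0 i : Vec 2)) = Fin.elim0 := funext fun i => i.elim0
    rw [h0, join_simplex_zero]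
    rcases ht h with h1 | h1 <;> rw [h1]
    · norm_num
    · norm_num
      module
  | q + 2 =>
    rw [suspension_add_two, suspension_add_two, map_zsmul, hρ, act_join _ (ht h), S.equivariant (q + 1) (by omega),
      hmul, hmul, smul_smul]
    congr 1
    ring

include S in
-- Poles are joined along the image of the planar section whenever `t` changes. Over a 3-simplex
-- starting at the identity this happens exactly if `t (g 0) = 1`, and what must be filled is then
-- the suspension of the planar loop over the last three vertices.
theorem represents_suspension [TopologicalSpace P] [DiscreteTopology P] :
    Represents (eulerClass ρ₃) (cupCochain (orientation ρ) (cochain1 t) c) := by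
  have hmul := suspension_map_mul hρ
  refine represents_eulerClass_of_filling ρ₃ (S.suspension t) (fun q hq g => ?_)
    (fun q hq h g => ?_) (fun g => rfl) (fun q hq g => ?_) _ fun g => ?_
  · match q with
    | 0 =>
      refine single_mem_chainsIn (isGeneric_of_linearIndependent ?_) 1
      exact linearIndependent_empty_type
    | 1 =>
      refine sub_mem (single_mem_chainsIn (isGeneric_of_linearIndependent ?_) 1)
        (AddSubgroup.zsmul_mem _ (join_mem (single_mem_chainsIn linearIndependent_empty_type 1)) _)
      refine linearIndependent_unique_iff.2 fun h => ?_
      have := congrFun h 2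
      simp [lift] at this
    | q + 2 => exact AddSubgroup.zsmul_mem _ (join_mem (S.chain_mem (q + 1) (by omega) _)) _
  · rw [S.suspension_mul ht hρ q hq, sub_self]
    exact zero_mem _
  · rw [sub_eq_zero.2]
    · exact zero_mem _
    match q with
    | 0 =>
      rw [suspension_one, map_sub, map_zsmul, join_simplex_zero, map_sub, bdry_simplex, bdry_simplex,
        faceSum_vertex, faceSum_vertex, faceSum_vertex, sub_self, smul_zero, sub_zero]
      rfl
    | 1 =>
      rw [suspension_add_two, map_zsmul, bdry_join, S.boundary 0 two_pos, faceSum_vertex,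
        S.chain_zero]
      refine Eq.trans ?_ (faceSum_edge _ _).symm
      rw [suspension_one, suspension_one]
      module
    | q + 2 =>
      rw [faceSum_suspension, ← S.boundary (q + 1) (by omega), ← smul_neg, ← bdry_join, ← map_zsmul]
      rfl
  -- The loop over the last three vertices is the translate by `g 0` of the loop `z` over the
  -- normalised simplex. The translated planar filling is counted with the determinant of `ρ (g 0)`,
  -- the sign in the twisted cup product.
  · set z := faceSum (S.chain 2) (Fin.partialProd fun i => g i.succ) with hz
    have hreg := act_mem_regularChains (ρ (g 0)) (S.cone_mem fun i => g i.succ)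
    rw [act_cone, ← hz] at hreg
    obtain ⟨h1, h2⟩ := suspension_mem_and_count hreg
    have hbz : bdry z = 0 := S.bdry_loop _
    refine ⟨_, AddSubgroup.zsmul_mem _ h1 (t (g 0)), ?_, ?_⟩
    · have hz' : faceSum (S.chain 2) (fun i : Fin 3 => Fin.partialProd g i.succ) =
          act (ρ (g 0)).1 z := by
        rw [hz, map_faceSum]
        simp only [← S.equivariant 2 le_rfl]
        rw [faceSum_comp (fun x => g 0 * x)]
        exact congrArg _ (funext fun i => Fin.partialProd_succ' g i)
      have hone : t 1 = 0 := by
        have := hmul 1 1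
        rcases ht 1 with h | h <;> simp [h] at this ⊢
      have hp : Fin.partialProd g 1 = g 0 := by
        have := Fin.partialProd_succ g 0
        simpa using this
      rw [faceSum_suspension, hz', hp, Fin.partialProd_zero, hone, sub_zero, map_zsmul, map_neg,
        bdry_cone, bdry_join, bdry_act, hbz, map_zero, map_zero, neg_zero, map_zero, sub_zero,
        smul_neg, sub_self]
      exact zero_mem _
    · rw [map_zsmul, h2, ← act_cone, countZeros_act, S.count, smul_eq_mul]
      change _ = t (g 0) • ((∏ i : Fin 1, orientation ρ (g (Fin.castAdd 2 i)) : ℤˣ) : ℤ) •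
        c fun j => g (Fin.natAdd 1 j)
      rw [Fin.prod_univ_one, orientation_coe, smul_eq_mul, smul_eq_mul]
      congr 3
      funext j
      congr 1
      ext
      simp [add_comm]

end PlanarSection

end

end PointGroupLSM

namespace PointGroupLSM

noncomputable section

set_option linter.unusedSectionVars false

/-! ### Sections along a regular polygon -/

section

variable (n : ℕ)

/-- The `k`-th vertex of the regular `4n`-gon. -/
def vertex (k : ℤ) : Vec 2 := ![Real.cos (k * (Real.pi / (2 * n))), Real.sin (k * (Real.pi / (2 * n)))]

/-- A point opposite to the midpoint of an edge of the regular `4n`-gon. -/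
def antipode : Vec 2 := ![-Real.cos (Real.pi / (4 * n)), -Real.sin (Real.pi / (4 * n))]

/-- The number of vertices of index divisible by `4n` up to the `k`-th one (excluding it). -/
def winding (k : ℤ) : ℤ := (k - 1) / (4 * n)

/-- The path of `m` edges along the regular `4n`-gon. -/
def polygonPath (m : ℕ) : AffineChain 2 2 :=
  ∑ j ∈ Finset.range m, simplex ![vertex n j, vertex n (j + 1)]

variable {n} [NeZero n]

theorem natCast_pos : (0 : ℝ) < n := Nat.cast_pos.2 (NeZero.pos n)

theorem vertex_add_mul (k m : ℤ) : vertex n (k + 4 * n * m) = vertex n k := by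
  have h : ((k + 4 * n * m : ℤ) : ℝ) * (Real.pi / (2 * n)) =
      k * (Real.pi / (2 * n)) + m * (2 * Real.pi) := by
    have := natCast_pos (n := n)
    push_cast
    field_simp
    ring
  rw [vertex, h, Real.cos_add_int_mul_two_pi, Real.sin_add_int_mul_two_pi, vertex]

theorem exists_of_vertex_eq {k l : ℤ} (h : vertex n k = vertex n l) : ∃ m : ℤ, k = l + 4 * n * m := by
  have hn := natCast_pos (n := n)
  have h0 : Real.cos (k * (Real.pi / (2 * n))) = Real.cos (l * (Real.pi / (2 * n))) := congrFun h 0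
  have h1 : Real.sin (k * (Real.pi / (2 * n))) = Real.sin (l * (Real.pi / (2 * n))) := congrFun h 1
  have h2 : Real.cos ((k - l) * (Real.pi / (2 * n))) = 1 := by
    rw [sub_mul, Real.cos_sub, h0, h1, ← sq, ← sq, Real.cos_sq_add_sin_sq]
  obtain ⟨m, hm⟩ := (Real.cos_eq_one_iff _).1 h2
  refine ⟨m, ?_⟩
  field_simp at hm
  have h3 : (k : ℝ) = ((l + 4 * n * m : ℤ) : ℝ) := by
    push_cast
    linarith
  exact_mod_cast h3

theorem winding_add_mul (k m : ℤ) : winding n (k + 4 * n * m) = winding n k + m := by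
  have hn : (4 * n : ℤ) ≠ 0 := by
    have := NeZero.ne n
    omega
  rw [winding, winding, add_sub_right_comm, Int.add_mul_ediv_left _ _ hn]

/-- The three volumes are sines of differences of angles. The antipode sits at half-integral
position among the vertices, hence the odd multiples of π/(4n). -/
theorem facetVolume_antipode (j k : ℤ) : facetVolume ![antipode n, vertex n j, vertex n k] =
    ![Real.sin ((k - j) * (Real.pi / (2 * n))), Real.sin ((2 * k - 1) * (Real.pi / (4 * n))),
      -Real.sin ((2 * j - 1) * (Real.pi / (4 * n)))] := by
  have hn := natCast_pos (n := n)
  have h : ∀ k : ℤ, (2 * k - 1) * (Real.pi / (4 * n)) = k * (Real.pi / (2 * n)) - Real.pi / (4 * n) := by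
    intro k
    field_simp
    ring
  rw [h, h, sub_mul, Real.sin_sub, Real.sin_sub, Real.sin_sub]
  funext i
  fin_cases i <;>
    simp [facetVolume, antipode, vertex, Matrix.det_fin_two, Fin.succAbove, Fin.lt_def] <;> ring

/-- A multiple of π would require an odd number to be divisible by 4n. So the apex is never
collinear with the origin and a vertex. -/
theorem sin_odd_ne_zero (k : ℤ) : Real.sin ((2 * k - 1) * (Real.pi / (4 * n))) ≠ 0 := by
  have hn := natCast_pos (n := n)
  rw [Real.sin_ne_zero_iff]
  intro m hm
  field_simp at hm
  have h : ((m * (4 * n) : ℤ) : ℝ) = ((2 * k - 1 : ℤ) : ℝ) := by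
    push_cast
    linarith
  have h' : m * (4 * n) = 2 * k - 1 := by exact_mod_cast h
  have : (m * (4 * n)) % 2 = 0 := by
    rw [show m * (4 * n) = 2 * (2 * n * m) by ring]
    exact Int.mul_emod_right 2 _
  omega

/-- An edge subtends the angle π/(2n), at most a right angle even for `n = 1`; polygons with `n`
vertices would degenerate for small `n`. -/
theorem sin_edge_pos : 0 < Real.sin (Real.pi / (2 * n)) := by
  have hn := natCast_pos (n := n)
  have h1 : (1 : ℝ) ≤ n := by exact_mod_cast NeZero.one_le
  refine Real.sin_pos_of_pos_of_lt_pi (by positivity) ?_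
  rw [div_lt_iff₀ (by positivity)]
  nlinarith [Real.pi_pos]

theorem facetVolume_antipode_ne_zero {k ε : ℤ} (hε : ε = 1 ∨ ε = -1) (i : Fin 3) :
    facetVolume ![antipode n, vertex n k, vertex n (k + ε)] i ≠ 0 := by
  have h := sin_edge_pos (n := n)
  rw [facetVolume_antipode]
  fin_cases i
  · rcases hε with rfl | rfl
    · simpa using h.ne'
    · simpa using h.ne'
  · exact sin_odd_ne_zero (k + ε)
  · exact neg_ne_zero.2 (sin_odd_ne_zero k)

/-- The apex is opposite to the midpoint of the edge from vertex 0 to vertex 1, so only the triangle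
over this edge contains the origin. The offset in `winding` makes it jump at exactly this edge. -/
theorem zeroSign_antipode_succ (k : ℤ) :
    zeroSign ![antipode n, vertex n k, vertex n (k + 1)] = winding n (k + 1) - winding n k := by
  have hn := natCast_pos (n := n)
  have hN : (0 : ℤ) < 4 * n := by
    have := NeZero.pos n
    omega
  -- Both sides are periodic in `k`, so a full turn is enough.
  obtain ⟨r, hr0, hrN, m, rfl⟩ : ∃ r : ℤ, 0 ≤ r ∧ r < 4 * n ∧ ∃ m, k = r + 4 * n * m :=
    ⟨k % (4 * n), Int.emod_nonneg _ hN.ne', Int.emod_lt_of_pos _ hN, k / (4 * n),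
      (Int.emod_add_mul_ediv k (4 * n)).symm⟩
  rw [add_right_comm, vertex_add_mul, vertex_add_mul, winding_add_mul, winding_add_mul,
    add_sub_add_right_eq_sub]
  have hv := facetVolume_antipode (n := n) r (r + 1)
  have hsin := sin_edge_pos (n := n)
  have hpos : ∀ x : ℝ, 0 < x → x < 4 * n → 0 < Real.sin (x * (Real.pi / (4 * n))) := by
    intro x h0 h1
    refine Real.sin_pos_of_pos_of_lt_pi (by positivity) ?_
    rw [mul_div_assoc', div_lt_iff₀ (by positivity)]
    nlinarith [Real.pi_pos]
  have hneg : ∀ x : ℝ, 4 * n < x → x < 8 * n → Real.sin (x * (Real.pi / (4 * n))) < 0 := by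
    intro x h0 h1
    have := hpos (x - 4 * n) (by linarith) (by linarith)
    rw [sub_mul, mul_div_cancel₀ _ (by positivity), Real.sin_sub_pi] at this
    linarith
  have h0 : facetVolume ![antipode n, vertex n r, vertex n (r + 1)] 0 = Real.sin (Real.pi / (2 * n)) := by
    rw [hv]
    simp
  have h1 : facetVolume ![antipode n, vertex n r, vertex n (r + 1)] 1 =
      Real.sin ((2 * r + 1) * (Real.pi / (4 * n))) := by
    rw [hv]
    simp only [Matrix.cons_val_one, Matrix.cons_val_zero]
    congr 2
    push_cast
    ring
  have h2 : facetVolume ![antipode n, vertex n r, vertex n (r + 1)] 2 =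
      -Real.sin ((2 * r - 1) * (Real.pi / (4 * n))) := by
    rw [hv]
    rfl
  rcases hr0.eq_or_lt with rfl | hr
  · have hw : winding n (0 + 1) - winding n 0 = 1 := by
      rw [winding, winding, zero_add, sub_self, Int.zero_ediv, zero_sub, zero_sub,
        Int.ediv_eq_neg_one_of_neg_of_le (by omega) (by omega)]
      rfl
    rw [hw]
    refine zeroSign_of_pos fun i => ?_
    have h1n : (1 : ℝ) ≤ n := by exact_mod_cast NeZero.one_le
    have := hpos 1 one_pos (by linarith)
    fin_cases i
    · exact h0 ▸ hsin
    · refine h1.symm ▸ ?_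
      simpa using this
    · refine h2.symm ▸ ?_
      simpa using this
  · have hw : winding n (r + 1) - winding n r = 0 := by
      rw [winding, winding, add_sub_cancel_right, Int.ediv_eq_zero_of_lt hr0 hrN,
        Int.ediv_eq_zero_of_lt (by omega) (by omega), sub_self]
    rw [hw]
    have hrR : (1 : ℝ) ≤ r := by exact_mod_cast hr
    -- On the first half of the turn the starting vertex gives a facet volume of the wrong sign, on
    -- the second half the end vertex does.
    rcases le_or_gt r (2 * n) with h | h
    · have hR : (r : ℝ) ≤ 2 * n := by exact_mod_cast h
      refine zeroSign_of_mul_neg (i := 0) (j := 2) ?_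
      rw [h0, h2]
      exact mul_neg_of_pos_of_neg hsin (neg_neg_of_pos (hpos _ (by linarith) (by linarith)))
    · have hR : (2 * n + 1 : ℝ) ≤ r := by exact_mod_cast h
      have hR' : (r + 1 : ℝ) ≤ 4 * n := by exact_mod_cast hrN
      refine zeroSign_of_mul_neg (i := 0) (j := 1) ?_
      rw [h0, h1]
      exact mul_neg_of_pos_of_neg hsin (hneg _ (by linarith) (by linarith))

theorem zeroSign_antipode {ε : ℤ} (hε : ε = 1 ∨ ε = -1) (k : ℤ) :
    zeroSign ![antipode n, vertex n k, vertex n (k + ε)] = winding n (k + ε) - winding n k := by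
  rcases hε with rfl | rfl
  · exact zeroSign_antipode_succ k
  · have h := zeroSign_antipode_succ (n := n) (k + -1)
    rw [neg_add_cancel_right] at h
    have h2 := zeroSign_perm ![antipode n, vertex n (k + -1), vertex n k] (Equiv.swap 1 2)
    have e : (![antipode n, vertex n (k + -1), vertex n k] ∘ Equiv.swap 1 2 : Fin 3 → Vec 2) =
        ![antipode n, vertex n k, vertex n (k + -1)] := by
      funext i
      fin_cases i <;> rfl
    rw [e, h, Equiv.Perm.sign_swap (by decide)] at h2
    rw [h2]
    simp

theorem linearIndependent_edge (k : ℤ) :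
    LinearIndependent ℝ ![vertex n k, vertex n (k + 1)] := by
  have h := facetVolume_antipode_ne_zero (n := n) (k := k) (.inl rfl) 0
  have hdet : (Matrix.of ![vertex n k, vertex n (k + 1)]).det ≠ 0 := by
    refine fun h0 => h ?_
    rw [facetVolume]
    refine mul_eq_zero_of_right _ (Eq.trans ?_ h0)
    congr 2
  exact Matrix.linearIndependent_rows_iff_isUnit.2
    ((Matrix.isUnit_iff_isUnit_det _).2 (isUnit_iff_ne_zero.2 hdet))

theorem polygonPath_mem (m : ℕ) : polygonPath n m ∈ chainsIn {v | LinearIndependent ℝ v} :=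
  sum_mem fun j _ => single_mem_chainsIn (by exact_mod_cast linearIndependent_edge (n := n) j) 1

omit [NeZero n] in
theorem bdry_polygonPath (m : ℕ) :
    bdry (polygonPath n m) = simplex (fun _ => vertex n m) - simplex fun _ => vertex n 0 := by
  have h := Finset.sum_range_sub (fun j : ℕ => simplex fun _ : Fin 1 => vertex n j) m
  rw [polygonPath, map_sum]
  refine Eq.trans (Finset.sum_congr rfl fun j _ => ?_) h
  rw [bdry_simplex, faceSum_edge]
  simp

end

section

variable {P : Type*} [Group P] {n : ℕ} [NeZero n] (ρ : P →* O 2) {r a : P → ℤ}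

/-- The chains of a section with values in the regular `4n`-gon. -/
def polygonChain (n : ℕ) (ρ : P →* O 2) (a : P → ℤ) : (q : ℕ) → (Fin q → P) → AffineChain 2 q
  | 0 => fun _ => simplex Fin.elim0
  | 1 => fun g => act (ρ (g 0)).1 (simplex fun _ => vertex n 0)
  | 2 => fun g => act (ρ (g 0)).1 (polygonPath n (4 * a ((g 0)⁻¹ * g 1)).toNat)
  | _ + 3 => 0

variable {ρ} (hr : ∀ g, r g = 0 ∨ r g = 1) (ha : ∀ g, 0 ≤ a g)
  (hρ : ∀ g k, (ρ g).1 *ᵥ vertex n k = vertex n (4 * a g + (1 - 2 * r g) * k))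

include hr ha hρ

omit hr in
theorem act_bdry_polygonPath (g h : P) :
    bdry (act (ρ g).1 (polygonPath n (4 * a h).toNat)) =
      act (ρ (g * h)).1 (simplex fun _ => vertex n 0) - act (ρ g).1 (simplex fun _ => vertex n 0) := by
  have h1 : ((4 * a h).toNat : ℤ) = 4 * a h := Int.toNat_of_nonneg (by have := ha h; omega)
  have h2 : (ρ h).1 *ᵥ vertex n 0 = vertex n (4 * a h) := by rw [hρ, mul_zero, add_zero]
  rw [bdry_act, bdry_polygonPath, h1, map_sub, map_mul, Submonoid.coe_mul, act_mul,
    act_simplex (ρ h).1, h2]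

omit ha in
theorem cone_act_polygonPath (g : P) (m : ℕ) : cone (antipode n) (act (ρ g).1 (polygonPath n m)) =
    ∑ j ∈ Finset.range m, simplex ![antipode n, vertex n (4 * a g + (1 - 2 * r g) * j),
      vertex n (4 * a g + (1 - 2 * r g) * j + (1 - 2 * r g))] := by
  rw [polygonPath, map_sum, map_sum]
  refine Finset.sum_congr rfl fun j _ => ?_
  rw [act_simplex, cone_simplex]
  congr 1
  funext i
  fin_cases i
  · rfl
  · exact hρ g j
  · refine (hρ g (j + 1)).trans (congrArg _ ?_)
    ring

omit ha in
theorem cone_act_polygonPath_mem (g : P) (m : ℕ) :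
    cone (antipode n) (act (ρ g).1 (polygonPath n m)) ∈ regularChains 2 := by
  rw [cone_act_polygonPath hr hρ]
  have hε : 1 - 2 * r g = 1 ∨ 1 - 2 * r g = -1 := by
    rcases hr g with h | h <;> simp [h]
  exact sum_mem fun j _ => single_mem_chainsIn
    (S := {v : Fin 3 → Vec 2 | ∀ i, facetVolume v i ≠ 0})
    (fun i => facetVolume_antipode_ne_zero hε i) 1

omit ha in
theorem countZeros_cone_act_polygonPath (g : P) (m : ℕ) :
    countZeros 2 (cone (antipode n) (act (ρ g).1 (polygonPath n m))) =
      winding n (4 * a g + (1 - 2 * r g) * m) - winding n (4 * a g) := by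
  have h := Finset.sum_range_sub (fun j : ℕ => winding n (4 * a g + (1 - 2 * r g) * j)) m
  rw [Nat.cast_zero, mul_zero, add_zero] at h
  rw [cone_act_polygonPath hr hρ, map_sum, ← h]
  refine Finset.sum_congr rfl fun j _ => ?_
  rw [countZeros_simplex, zeroSign_antipode (by rcases hr g with h | h <;> simp [h]), Nat.cast_add_one,
    mul_add, mul_one, add_assoc]

omit hr ha in
-- Follow vertex 0 under `g * h` in two ways: its indices agree modulo 4n. The integer `m` is the
-- value of `twistedBockstein`.
theorem exists_mul_eq (g h : P) : ∃ m : ℤ, a g + (1 - 2 * r g) * a h = a (g * h) + n * m := by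
  have h1 : (ρ (g * h)).1 *ᵥ vertex n 0 = (ρ g).1 *ᵥ (ρ h).1 *ᵥ vertex n 0 := by
    rw [map_mul, Submonoid.coe_mul, Matrix.mulVec_mulVec]
  rw [hρ, hρ, hρ, mul_zero, add_zero, mul_zero, add_zero] at h1
  obtain ⟨m, hm⟩ := exists_of_vertex_eq h1.symm
  refine ⟨m, ?_⟩
  linarith

/-- The section with values in the regular `4n`-gon. -/
def polygonSection : PlanarSection ρ (twistedBockstein n r a) where
  chain := polygonChain n ρ a
  chain_mem q hq g := by
    have key : ∀ {q : ℕ} {c : AffineChain 2 q} (g : P), c ∈ chainsIn {v | LinearIndependent ℝ v} →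
        act (ρ g).1 c ∈ chainsIn {v | LinearIndependent ℝ v} := fun g hc =>
      chainLift_mem hc fun v hv => single_mem_chainsIn
        (hv.map' (Matrix.mulVecLin (ρ g).1) (LinearMap.ker_eq_bot.2 (Matrix.mulVec_injective_iff_isUnit.2
          ((Matrix.isUnit_iff_isUnit_det _).2 (isUnit_det (ρ g)))))) 1
    match q with
    | 0 => exact single_mem_chainsIn linearIndependent_empty_type 1
    | 1 =>
      refine key _ (single_mem_chainsIn (linearIndependent_unique_iff.2 fun h => ?_) 1)
      have := congrFun h 0
      simp [vertex] at this
    | 2 => exact key _ (polygonPath_mem _)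
    | q + 3 => omega
  equivariant q hq h g := by
    match q with
    | 0 => exact ((act_simplex _ _).trans (congrArg simplex (funext fun i => i.elim0))).symm
    | 1 => exact act_hom_mul ρ h (g 0) _
    | 2 =>
      refine Eq.trans ?_ (act_hom_mul ρ h (g 0) _)
      change act (ρ (h * g 0)).1 (polygonPath n (4 * a ((h * g 0)⁻¹ * (h * g 1))).toNat) = _
      rw [mul_inv_rev, mul_assoc, inv_mul_cancel_left]
    | q + 3 => omega
  chain_zero g := rfl
  boundary q hq g := by
    match q with
    | 0 =>
      refine Eq.trans ?_ (faceSum_vertex _ _).symm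
      change bdry (act _ (simplex _)) = _
      rw [act_simplex, bdry_simplex, faceSum_vertex]
      rfl
    | 1 =>
      refine Eq.trans ?_ (faceSum_edge _ _).symm
      change bdry (act _ (polygonPath n _)) = _
      rw [act_bdry_polygonPath ha hρ, mul_inv_cancel_left]
      rfl
    | q + 2 => omega
  apex := antipode n
  cone_mem g := by
    rw [map_faceSum]
    exact faceSum_mem fun i => cone_act_polygonPath_mem hr hρ _ _
  count g := by
    have h1 : Fin.partialProd g 1 = g 0 := by
      have := Fin.partialProd_succ g 0
      simpa using this
    have h2 : Fin.partialProd g 2 = g 0 * g 1 := by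
      have := Fin.partialProd_succ g 1
      simpa [h1] using this
    have h0 : Fin.partialProd g 0 = 1 := Fin.partialProd_zero g
    have hnat : ∀ h : P, ((4 * a h).toNat : ℤ) = 4 * a h := fun h =>
      Int.toNat_of_nonneg (by have := ha h; omega)
    have hcount : ∀ x y : P, countZeros 2 (cone (antipode n) (polygonChain n ρ a 2 ![x, y])) =
        winding n (4 * a x + (1 - 2 * r x) * (4 * a (x⁻¹ * y))) - winding n (4 * a x) := fun x y => by
      rw [← hnat (x⁻¹ * y)]
      exact countZeros_cone_act_polygonPath hr hρ x _
    obtain ⟨m, hm⟩ := exists_mul_eq hρ (g 0) (g 1)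
    -- The identity fixes vertex 1. Modulo 4 this excludes `r 1 = 1`, and it leaves `a 1` as a
    -- multiple of `n`, which is not assumed to be zero.
    obtain ⟨hr1, m', hm'⟩ : r 1 = 0 ∧ ∃ m' : ℤ, a 1 = n * m' := by
      have h : vertex n 1 = vertex n (4 * a 1 + (1 - 2 * r 1) * 1) := by
        rw [← hρ, map_one, Submonoid.coe_one, Matrix.one_mulVec]
      obtain ⟨l, hl⟩ := exists_of_vertex_eq h
      rw [mul_assoc] at hl
      have hr1 : r 1 = 0 := by rcases hr 1 with h | h <;> omega
      exact ⟨hr1, -l, by rw [hr1] at hl; linarith⟩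
    have hw : ∀ k : ℤ, winding n (4 * a 1 + k) = winding n k + m' := fun k => by
      rw [hm', ← winding_add_mul]
      congr 1
      ring
    have hw0 := hw 0
    rw [add_zero] at hw0
    have hw1 : winding n (4 * a (g 0) + (1 - 2 * r (g 0)) * (4 * a (g 1))) =
        winding n (4 * a (g 0 * g 1)) + m := by
      rw [← winding_add_mul]
      congr 1
      linarith
    have hm2 : (a (g 1) - a (g 0 * g 1) + a (g 0)) - 2 * (r (g 0) * a (g 1)) = n * m := by linarith
    -- The winding numbers of the three edges telescope: the shifts by `m'` cancel, and the jump `m`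
    -- at the end of the middle edge is what remains.
    rw [faceSum_triangle, h0, h1, h2, map_add, map_sub, map_add, map_sub, hcount, hcount, hcount,
      inv_mul_cancel_left, inv_one, one_mul, one_mul, hr1, mul_zero, sub_zero, one_mul, one_mul, hw,
      hw, hw0, hw1, twistedBockstein, hm2,
      Int.mul_ediv_cancel_left _ (Int.natCast_ne_zero.2 (NeZero.ne n))]
    ring

end

end

end PointGroupLSM

namespace PointGroupLSM

noncomputable section

set_option linter.unusedSectionVars false

/-! ### Point groups -/

section

variable {n : ℕ} [NeZero n]

theorem rotationMatrix_mulVec_vertex (k : ℤ) : rotationMatrix n *ᵥ vertex n k = vertex n (4 + k) := by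
  have hn := natCast_pos (n := n)
  have h : ((4 + k : ℤ) : ℝ) * (Real.pi / (2 * n)) = 2 * Real.pi / n + k * (Real.pi / (2 * n)) := by
    push_cast
    field_simp
    ring
  rw [vertex, vertex, h, Real.cos_add, Real.sin_add]
  funext i
  fin_cases i <;> simp [rotationMatrix, Matrix.mulVec, dotProduct]; ring

omit [NeZero n] in
theorem mirrorMatrix_mulVec_vertex (k : ℤ) : mirrorMatrix *ᵥ vertex n k = vertex n (-k) := by
  funext i
  fin_cases i <;> simp [mirrorMatrix, Matrix.mulVec, dotProduct, vertex]

theorem pow_mulVec_vertex {P : Type*} [Group P] (ρ : P →* O 2) {x : P}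
    (hx : (ρ x).1 = rotationMatrix n) (m : ℕ) (k : ℤ) :
    (ρ (x ^ m)).1 *ᵥ vertex n k = vertex n (4 * m + k) := by
  induction m with
  | zero => simp
  | succ m ih =>
    rw [pow_succ', map_mul, Submonoid.coe_mul, ← Matrix.mulVec_mulVec, ih, hx,
      rotationMatrix_mulVec_vertex]
    congr 1
    push_cast
    ring

theorem gen_pow_val (g : Cyc n) : gen n ^ (Multiplicative.toAdd g).val = g := by
  rw [gen, ← ofAdd_nsmul, nsmul_eq_mul, mul_one, ZMod.natCast_zmod_val]
  rfl

theorem cyc_mulVec_vertex {ρ : Cyc n →* O 2} (h : (ρ (gen n)).1 = rotationMatrix n) (g : Cyc n)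
    (k : ℤ) : (ρ g).1 *ᵥ vertex n k = vertex n (4 * cycLift n g + k) := by
  conv_lhs => rw [← gen_pow_val g]
  rw [pow_mulVec_vertex ρ h]
  rfl

theorem cyc_eq_one {ρ : Cyc n →* O 2} (h : (ρ (gen n)).1 = 1) (g : Cyc n) : ρ g = 1 := by
  have h' : ρ (gen n) = 1 := Subtype.ext h
  rw [← gen_pow_val g, map_pow, h', one_pow]

/-- A reflection `sr i` acts by first rotating by `i` and then changing the sign of the index. -/
theorem dihedral_mulVec_vertex {ρ : DihedralGroup n →* O 2}
    (h : (ρ (.r 1)).1 = rotationMatrix n) (h' : (ρ (.sr 0)).1 = mirrorMatrix) (g : DihedralGroup n)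
    (k : ℤ) : (ρ g).1 *ᵥ vertex n k = vertex n (4 * dihLift n g + (1 - 2 * dihRefl n g) * k) := by
  have hrot : ∀ (i : ZMod n) (k : ℤ), (ρ (.r i)).1 *ᵥ vertex n k = vertex n (4 * i.val + k) := by
    intro i k
    have := pow_mulVec_vertex ρ h i.val k
    rwa [DihedralGroup.r_one_pow, ZMod.natCast_zmod_val] at this
  cases g with
  | r i =>
    rw [hrot]
    simp [dihLift, dihRefl]
  | sr i =>
    have e : (DihedralGroup.sr i : DihedralGroup n) = .sr 0 * .r i := by
      rw [DihedralGroup.sr_mul_r, zero_add]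
    rw [e, map_mul, Submonoid.coe_mul, ← Matrix.mulVec_mulVec, hrot, h', mirrorMatrix_mulVec_vertex, ← e]
    -- The lift uses the representative of `-i` in `[0, n)`, which differs from minus the
    -- representative of `i` by a multiple of `n`, that is, by full turns.
    have hdvd : ((n : ℕ) : ℤ) ∣ ((-i).val + i.val : ℕ) := by
      rw [Int.natCast_dvd_natCast, ← ZMod.natCast_eq_zero_iff]
      simp
    obtain ⟨m, hm⟩ := hdvd
    rw [← vertex_add_mul (n := n) (-(4 * (i.val : ℤ) + k)) m]
    congr 1
    push_cast at hm
    simp only [dihLift, dihRefl]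
    linarith

omit [NeZero n] in
theorem cycLift_nonneg (g : Cyc n) : 0 ≤ cycLift n g := Int.natCast_nonneg _

omit [NeZero n] in
theorem dihLift_nonneg (g : DihedralGroup n) : 0 ≤ dihLift n g := by
  cases g <;> exact Int.natCast_nonneg _

omit [NeZero n] in
theorem dihRefl_cases (g : DihedralGroup n) : dihRefl n g = 0 ∨ dihRefl n g = 1 := by
  cases g
  · exact .inl rfl
  · exact .inr rfl

theorem cycLift_two_cases (g : Cyc 2) : cycLift 2 g = 0 ∨ cycLift 2 g = 1 := by
  have h := ZMod.val_lt (Multiplicative.toAdd g)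
  have h' : cycLift 2 g = ((Multiplicative.toAdd g).val : ℤ) := rfl
  omega

theorem neg_one_zpow_eq {t : ℤ} (ht : t = 0 ∨ t = 1) : (-1 : ℝ) ^ t = 1 - 2 * t := by
  rcases ht with rfl | rfl <;> norm_num

theorem neg_one_zpow_eq_emod (a : ℤ) : (-1 : ℝ) ^ a = 1 - 2 * ((a % 2 : ℤ) : ℝ) := by
  rcases Int.even_or_odd a with h | h
  · rw [h.neg_one_zpow, Int.even_iff.1 h]
    norm_num
  · rw [h.neg_one_zpow, Int.odd_iff.1 h]
    norm_num

end

theorem eulerClass_axial_eq_zero {P : Type*} [Group P] [TopologicalSpace P] [DiscreteTopology P]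
    {M : P → Matrix (Fin 2) (Fin 2) ℝ} {ρ₃ : P →* O 3} (h : ∀ g, (ρ₃ g).1 = axial (M g) 1) :
    eulerClass ρ₃ = 0 := by
  refine eulerClass_eq_zero ρ₃ (x := lift 0 1) (fun h0 => ?_) fun g => ?_
  · have := congrFun h0 2
    simp [lift] at this
  · rw [h, axial_mulVec_lift, Matrix.mulVec_zero, one_mul]

/-- The section is -1 at the identity and +1 at the reflection. An edge from the identity has a zero
only if it ends at the reflection, and it then passes from -1 to 1, which counts positively. -/
theorem represents_eulerClass_reflection {ρ : Cyc 2 →* O 1} (h : (ρ (gen 2)).1 = -1) :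
    Represents (eulerClass ρ) (cochain1 (cycLift 2)) := by
  let chain : (q : ℕ) → (Fin q → Cyc 2) → AffineChain 1 q
    | 0 => fun _ => simplex Fin.elim0
    | 1 => fun g => act (ρ (g 0)).1 (simplex fun _ _ => -1)
    | _ + 2 => 0
  refine represents_eulerClass_of_filling ρ chain (fun q hq g => ?_) (fun q hq x g => ?_)
    (fun g => rfl) (fun q hq g => ?_) _ fun g => ?_
  · match q with
    | 0 => exact single_mem_chainsIn (isGeneric_of_linearIndependent linearIndependent_empty_type) 1
    | 1 =>
      refine act_mem_generic _ (single_mem_chainsIn (isGeneric_of_linearIndependent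
        (linearIndependent_unique_iff.2 fun h => ?_)) 1)
      have := congrFun h 0
      simp at this
    | q + 2 => omega
  · rw [sub_eq_zero.2]
    · exact zero_mem _
    match q with
    | 0 => exact ((act_simplex _ _).trans (congrArg simplex (funext fun i => i.elim0))).symm
    | 1 => exact act_hom_mul ρ x (g 0) _
    | q + 2 => omega
  · rw [sub_eq_zero.2]
    · exact zero_mem _
    match q with
    | 0 =>
      refine Eq.trans ?_ (faceSum_vertex _ _).symm
      change bdry (act _ (simplex _)) = _
      rw [act_simplex, bdry_simplex, faceSum_vertex]
    | q + 1 => omega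
  · have h1 : Fin.partialProd g 1 = g 0 := by
      have := Fin.partialProd_succ g 0
      simpa using this
    have h2 : faceSum (chain 1) (Fin.partialProd g) =
        act (ρ (g 0)).1 (simplex fun _ _ => -1) - simplex fun _ _ => -1 := by
      rw [faceSum_edge]
      change act (ρ (Fin.partialProd g 1)).1 _ - act (ρ (Fin.partialProd g 0)).1 _ = _
      rw [h1, Fin.partialProd_zero, act_hom_one]
    have hg : ∃ s : ℝ, (ρ (g 0)).1 *ᵥ (fun _ => -1 : Vec 1) = (fun _ => s) ∧
        (s = -1 ∧ cycLift 2 (g 0) = 0 ∨ s = 1 ∧ cycLift 2 (g 0) = 1) := by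
      have hpow := gen_pow_val (g 0)
      rcases cycLift_two_cases (g 0) with h0 | h0
      · have h0' : (Multiplicative.toAdd (g 0)).val = 0 := Int.natCast_eq_zero.1 h0
        rw [h0', pow_zero] at hpow
        exact ⟨-1, by rw [← hpow, map_one, Submonoid.coe_one, Matrix.one_mulVec], .inl ⟨rfl, h0⟩⟩
      · have h0' : (Multiplicative.toAdd (g 0)).val = 1 := by
          have h1 : ((Multiplicative.toAdd (g 0)).val : ℤ) = 1 := h0
          exact_mod_cast h1
        rw [h0', pow_one] at hpow
        refine ⟨1, ?_, .inr ⟨rfl, h0⟩⟩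
        rw [← hpow, h, Matrix.neg_mulVec, Matrix.one_mulVec]
        funext i
        simp
    obtain ⟨s, hs, hs'⟩ := hg
    -- In dimension one the facet volumes of an edge are its end value and minus its initial value;
    -- the origin lies inside iff they have the same sign.
    have hvol : ∀ i, facetVolume ![fun _ => -1, fun _ => s] i = (![s, 1] i : ℝ) := by
      intro i
      fin_cases i <;> simp [facetVolume]
    refine ⟨simplex ![fun _ => -1, fun _ => s], single_mem_chainsIn ?_ 1, ?_, ?_⟩
    · refine isGeneric_of_facetVolume fun i => ?_
      rw [hvol]
      rcases hs' with ⟨rfl, _⟩ | ⟨rfl, _⟩ <;> fin_cases i <;> simp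
    · rw [h2, act_simplex, hs, bdry_simplex, faceSum_edge, sub_eq_zero.2]
      · exact zero_mem _
      rfl
    · rw [countZeros_simplex]
      change _ = cycLift 2 (g 0)
      rcases hs' with ⟨rfl, h0⟩ | ⟨rfl, h0⟩
      · rw [h0]
        refine zeroSign_of_mul_neg (i := 0) (j := 1) ?_
        rw [hvol, hvol]
        norm_num
      · rw [h0]
        refine zeroSign_of_pos fun i => ?_
        rw [hvol]
        fin_cases i <;> simp

section

variable {n : ℕ} [NeZero n]

/-- The section for the cyclic group. -/
def cyclicSection {ρ : Cyc n →* O 2} (h : (ρ (gen n)).1 = rotationMatrix n) :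
    PlanarSection ρ (twistedBockstein n 0 (cycLift n)) :=
  polygonSection (fun _ => .inl rfl) cycLift_nonneg fun g k => by
    rw [cyc_mulVec_vertex h]
    simp

/-- The section for the dihedral group. -/
def dihedralSection {ρ : DihedralGroup n →* O 2} (h : (ρ (.r 1)).1 = rotationMatrix n)
    (h' : (ρ (.sr 0)).1 = mirrorMatrix) :
    PlanarSection ρ (twistedBockstein n (dihRefl n) (dihLift n)) :=
  polygonSection dihRefl_cases dihLift_nonneg (dihedral_mulVec_vertex h h')

/-- The section for the product of the cyclic group with a group acting trivially. -/
def cyclicProdSection {ρ : Cyc n × Cyc 2 →* O 2} (h : (ρ (gen n, 1)).1 = rotationMatrix n)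
    (h' : (ρ (1, gen 2)).1 = 1) :
    PlanarSection ρ (twistedBockstein n 0 fun g => cycLift n g.1) :=
  polygonSection (fun _ => .inl rfl) (fun g => cycLift_nonneg g.1) fun g k => by
    have h1 : ρ g = ρ.comp (MonoidHom.inl _ _) g.1 * ρ.comp (MonoidHom.inr _ _) g.2 := by
      simp [← map_mul]
    rw [h1, cyc_eq_one (ρ := ρ.comp (MonoidHom.inr _ _)) h', mul_one,
      cyc_mulVec_vertex (ρ := ρ.comp (MonoidHom.inl _ _)) h]
    simp

/-- The section for the product of the dihedral group with a group acting trivially. -/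
def dihedralProdSection {ρ : Cyc 2 × DihedralGroup n →* O 2}
    (h : (ρ (1, .r 1)).1 = rotationMatrix n) (h' : (ρ (1, .sr 0)).1 = mirrorMatrix)
    (h'' : (ρ (gen 2, 1)).1 = 1) :
    PlanarSection ρ (twistedBockstein n (fun g => dihRefl n g.2) fun g => dihLift n g.2) :=
  polygonSection (fun g => dihRefl_cases g.2) (fun g => dihLift_nonneg g.2) fun g k => by
    have h1 : ρ g = ρ.comp (MonoidHom.inl _ _) g.1 * ρ.comp (MonoidHom.inr _ _) g.2 := by
      simp [← map_mul]
    rw [h1, cyc_eq_one (ρ := ρ.comp (MonoidHom.inl _ _)) h'', one_mul,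
      dihedral_mulVec_vertex (ρ := ρ.comp (MonoidHom.inr _ _)) h h']

end

end

end PointGroupLSM

/-! ### The main theorem -/

theorem mainTheorem6 {d : ℕ} {P : Type u} [Group P] [TopologicalSpace P] [DiscreteTopology P]
    (ρ : P →* O d) :
    -- the Euler class is well defined
    (Nonempty (GenericSection ρ) ∧
      ∀ S : GenericSection ρ, Represents (eulerClass ρ) S.zeroCount) ∧
    -- invariant cell decompositions into open cones exist
    (Finite P → ∃ F : ConeComplex d, F.Invariant ρ) ∧
    -- the LSM anomaly is `e ∪ ω`, for every symmetry group `G` acting on `ℝ^d` through `P`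
    (∀ F : ConeComplex d, F.Invariant ρ →
      ∀ (G : Type v) [Group G] [TopologicalSpace G] [IsTopologicalGroup G]
        (π : G →ₜ* P) (σ : G →ₜ* ℤˣ),
        (∃ Φ : Cohomology U1 (orTwist ρ π σ) (d + 2) ≃+
            EquivariantHomology U1 F (ρ.comp π.toMonoidHom) σ 1,
          ∀ y c, Represents y c → HomologyRepresents (Φ y) (timesFundamentalChain F c)) ∧
        ∀ ω y, IsLSMAnomaly F ρ π σ ω y ↔ y = cup (pullback π (eulerClass ρ)) ω) ∧
    -- the case `G = G_int × P` with only `G_int` acting projectively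
    (∀ F : ConeComplex d, F.Invariant ρ →
      ∀ (Gint : Type v) [Group Gint] [TopologicalSpace Gint] [IsTopologicalGroup Gint]
        (σ : Gint →ₜ* ℤˣ) (α : Cohomology U1 σ 2) (y),
        IsLSMAnomaly F ρ (ContinuousMonoidHom.snd Gint P)
          (σ.comp (ContinuousMonoidHom.fst Gint P))
          (pullback (ContinuousMonoidHom.fst Gint P) α) y ↔ y = eulerCup ρ α) ∧
    -- the anomaly vanishes if `P` fixes an axis
    ((∃ x : Vec d, x ≠ 0 ∧ ∀ g, (ρ g).1 *ᵥ x = x) →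
      eulerClass ρ = 0 ∧
      ∀ (Gint : Type v) [Group Gint] [TopologicalSpace Gint] [IsTopologicalGroup Gint]
        (σ : Gint →ₜ* ℤˣ) (α : Cohomology U1 σ 2), eulerCup ρ α = 0) ∧
    -- the anomaly is 2-torsion in odd dimensions
    (Odd d →
      2 • eulerClass ρ = 0 ∧
      ∀ (Gint : Type v) [Group Gint] [TopologicalSpace Gint] [IsTopologicalGroup Gint]
        (σ : Gint →ₜ* ℤˣ) (α : Cohomology U1 σ 2),
        2 • eulerCup ρ α = 0 ∧ eulerCup ρ (2 • α) = 0) ∧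
    -- `d = 1`: the reflection group `D_1`
    (∀ ρ₁ : Cyc 2 →* O 1, (ρ₁ (gen 2)).1 = -1 →
      Represents (eulerClass ρ₁) (cochain1 (cycLift 2))) ∧
    -- `d = 2`: the cyclic groups `C_n`
    (∀ (n : ℕ) [NeZero n] (ρ₂ : Cyc n →* O 2), (ρ₂ (gen n)).1 = rotationMatrix n →
      Represents (eulerClass ρ₂) (twistedBockstein n 0 (cycLift n))) ∧
    -- `d = 2`: the dihedral groups `D_n`
    (∀ (n : ℕ) [NeZero n] (ρ₂ : DihedralGroup n →* O 2),
      (ρ₂ (.r 1)).1 = rotationMatrix n → (ρ₂ (.sr 0)).1 = mirrorMatrix →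
      Represents (eulerClass ρ₂) (twistedBockstein n (dihRefl n) (dihLift n))) ∧
    -- `d = 3`, `p1`: rotations about the axis
    (∀ (n : ℕ) [NeZero n] (ρ₂ : Cyc n →* O 2) (ρ₃ : Cyc n →* O 3),
      (ρ₂ (gen n)).1 = rotationMatrix n → (∀ g, (ρ₃ g).1 = axial (ρ₂ g).1 1) →
      eulerClass ρ₃ = 0) ∧
    -- `d = 3`, `p11g`: generated by a rotoreflection of order `2n`
    (∀ (n : ℕ) [NeZero n] (ρ₂ : Cyc (2 * n) →* O 2) (ρ₃ : Cyc (2 * n) →* O 3),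
      (ρ₂ (gen (2 * n))).1 = rotationMatrix (2 * n) →
      (∀ g, (ρ₃ g).1 = axial (ρ₂ g).1 ((-1) ^ cycLift (2 * n) g)) →
      Represents (eulerClass ρ₃) (cupCochain (orientation ρ₂)
        (cochain1 fun g => cycLift (2 * n) g % 2)
        (twistedBockstein (2 * n) 0 (cycLift (2 * n))))) ∧
    -- `d = 3`, `p11m`: rotations about the axis and the horizontal mirror
    (∀ (n : ℕ) [NeZero n] (ρ₂ : Cyc n × Cyc 2 →* O 2) (ρ₃ : Cyc n × Cyc 2 →* O 3),
      (ρ₂ (gen n, 1)).1 = rotationMatrix n → (ρ₂ (1, gen 2)).1 = 1 →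
      (∀ g, (ρ₃ g).1 = axial (ρ₂ g).1 ((-1) ^ cycLift 2 g.2)) →
      Represents (eulerClass ρ₃) (cupCochain (orientation ρ₂)
        (cochain1 fun g => cycLift 2 g.2)
        (twistedBockstein n 0 fun g => cycLift n g.1))) ∧
    -- `d = 3`, `p1m1`: rotations about the axis and mirrors which contain it
    (∀ (n : ℕ) [NeZero n] (ρ₂ : DihedralGroup n →* O 2) (ρ₃ : DihedralGroup n →* O 3),
      (ρ₂ (.r 1)).1 = rotationMatrix n → (ρ₂ (.sr 0)).1 = mirrorMatrix →
      (∀ g, (ρ₃ g).1 = axial (ρ₂ g).1 1) →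
      eulerClass ρ₃ = 0) ∧
    -- `d = 3`, `p211`: rotations about the axis and half-turns which reverse it
    (∀ (n : ℕ) [NeZero n] (ρ₂ : DihedralGroup n →* O 2) (ρ₃ : DihedralGroup n →* O 3),
      (ρ₂ (.r 1)).1 = rotationMatrix n → (ρ₂ (.sr 0)).1 = mirrorMatrix →
      (∀ g, (ρ₃ g).1 = axial (ρ₂ g).1 ((-1) ^ dihRefl n g)) →
      Represents (eulerClass ρ₃) (cupCochain (orientation ρ₂)
        (cochain1 (dihRefl n))
        (twistedBockstein n (dihRefl n) (dihLift n)))) ∧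
    -- `d = 3`, `p2mg`: generated by a rotoreflection of order `2n` and a mirror containing the axis
    (∀ (n : ℕ) [NeZero n] (ρ₂ : DihedralGroup (2 * n) →* O 2)
      (ρ₃ : DihedralGroup (2 * n) →* O 3),
      (ρ₂ (.r 1)).1 = rotationMatrix (2 * n) → (ρ₂ (.sr 0)).1 = mirrorMatrix →
      (∀ g, (ρ₃ g).1 = axial (ρ₂ g).1 ((-1) ^ dihLift (2 * n) g)) →
      Represents (eulerClass ρ₃) (cupCochain (orientation ρ₂)
        (cochain1 fun g => dihLift (2 * n) g % 2)
        (twistedBockstein (2 * n) (dihRefl (2 * n)) (dihLift (2 * n))))) ∧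
    -- `d = 3`, `p2mm`: `D_n` acting on the plane, and the horizontal mirror
    (∀ (n : ℕ) [NeZero n] (ρ₂ : Cyc 2 × DihedralGroup n →* O 2)
      (ρ₃ : Cyc 2 × DihedralGroup n →* O 3),
      (ρ₂ (1, .r 1)).1 = rotationMatrix n → (ρ₂ (1, .sr 0)).1 = mirrorMatrix → (ρ₂ (gen 2, 1)).1 = 1 →
      (∀ g, (ρ₃ g).1 = axial (ρ₂ g).1 ((-1) ^ cycLift 2 g.1)) →
      Represents (eulerClass ρ₃) (cupCochain (orientation ρ₂)
        (cochain1 fun g => cycLift 2 g.1)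
        (twistedBockstein n (fun g => dihRefl n g.2) fun g => dihLift n g.2))) := by
  refine ⟨⟨nonempty_genericSection ρ, fun S => S.represents⟩, fun _ => exists_invariant_coneComplex ρ,
    fun F hF G _ _ _ π σ => ⟨exists_fundamental_addEquiv hF, isLSMAnomaly_iff hF⟩,
    fun F hF Gint _ _ _ σ α y => isLSMAnomaly_iff hF _ y,
    fun ⟨x, hx, hρ⟩ => ⟨eulerClass_eq_zero ρ hx hρ, fun Gint _ _ _ σ α =>
      eulerCup_eq_zero α (eulerClass_eq_zero ρ hx hρ)⟩,
    fun hd => ⟨two_nsmul_eulerClass ρ hd, fun Gint _ _ _ σ α => ⟨two_nsmul_eulerCup α hd, ?_⟩⟩,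
    fun ρ₁ h => represents_eulerClass_reflection h,
    fun n _ ρ₂ h => (cyclicSection h).represents,
    fun n _ ρ₂ h h' => (dihedralSection h h').represents,
    fun n _ ρ₂ ρ₃ _ h => eulerClass_axial_eq_zero h,
    fun n _ ρ₂ ρ₃ h h₃ => (cyclicSection h).represents_suspension
      (fun g => Int.emod_two_eq_zero_or_one _) fun g => ?_,
    fun n _ ρ₂ ρ₃ h h' h₃ => (cyclicProdSection h h').represents_suspension
      (fun g => cycLift_two_cases g.2) fun g => ?_,
    fun n _ ρ₂ ρ₃ _ _ h => eulerClass_axial_eq_zero h,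
    fun n _ ρ₂ ρ₃ h h' h₃ => (dihedralSection h h').represents_suspension dihRefl_cases fun g => ?_,
    fun n _ ρ₂ ρ₃ h h' h₃ => (dihedralSection h h').represents_suspension
      (fun g => Int.emod_two_eq_zero_or_one _) fun g => ?_,
    fun n _ ρ₂ ρ₃ h h' h'' h₃ => (dihedralProdSection h h' h'').represents_suspension
      (fun g => cycLift_two_cases g.1) fun g => ?_⟩
  · rw [eulerCup_two_nsmul, two_nsmul_eulerCup α hd]
  · rw [h₃, neg_one_zpow_eq_emod]
  · rw [h₃, neg_one_zpow_eq (cycLift_two_cases g.2)]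
  · rw [h₃, neg_one_zpow_eq (dihRefl_cases g)]
  · rw [h₃, neg_one_zpow_eq_emod]
  · rw [h₃, neg_one_zpow_eq (cycLift_two_cases g.1)]
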